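/- Consider an ISI channel with complex taps $h_0,\dots,h_{L-1}$, transfer function $H(\theta)=\sum_{k=0}^{L-1}h_ke^{-jk\theta}$, and standard complex Gaussian noise $n=n^I+jn^Q$, where $n^I,n^Q\sim\mathcal N(0,1/2)$ are independent. Let $M\ge 16$ and let $x$ be uniformly distributed on the unit-power square $M^2$-QAM constellation, that is, on the points $\frac{d}{2}(2a-M+1)+j\frac{d}{2}(2b-M+1)$, $0\le a,b\le M-1$, with $d=\sqrt{6/(M^2-1)}$. For $\gamma\ge 0$ put $I_x(\gamma)=I(x;\sqrt{\gamma}\,x+n)$ with $n$ independent of $x$, and let $P_{\mathrm{err}}(\gamma)$ be the uncoded symbol error rate at SNR $\gamma$: the probability that $x$ is not the unique constellation point $x'$ minimizing $|\sqrt\gamma\,x+n-\sqrt\gamma\,x'|$. For OFDM with block size $N$ and a cyclic prefix of length $N_{CP}=N_{CP}(N)=o(N)$, the $k$-th subcarrier ($0\le k<N$) has SNR $|H(2\pi k/N)|^2$ and the achievable rate is $$I_{\mathrm{OFDM}}^{(N)}=\frac{1}{N+N_{CP}}\sum_{k=0}^{N-1}I_x\big(|H(2\pi k/N)|^2\big).$$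 Suppose that there are arbitrarily large $N$ for which the uncoded symbol error rate is below $50\%$ on every subcarrier, i.e. $P_{\mathrm{err}}(|H(2\pi k/N)|^2)<\frac12$ for all $0\le k<N$. Then $I_{\mathrm{OFDM}}:=\lim_{N\to\infty}I_{\mathrm{OFDM}}^{(N)}$ exists, equals $\frac1{2\pi}\int_{-\pi}^{\pi}I_x(|H(\theta)|^2)\,d\theta$, and satisfies $$I_{\mathrm{OFDM}}\le I_{\mathrm{SL}}:=I_x\!\left(\exp\Big\{\frac1{2\pi}\int_{-\pi}^{\pi}\log\big(1+|H(\theta)|^2\big)\,d\theta\Big\}-1\right).$$ -/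

import Mathlib

open MeasureTheory ProbabilityTheory Filter Topology Asymptotics

noncomputable section

/-- The law of the standard complex Gaussian noise `n = n^I + j n^Q`, with `n^I, n^Q` independent
real Gaussians of mean `0` and variance `1/2`. -/
def stdComplexGaussian : Measure ℂ :=
  ((gaussianReal 0 (1 / 2)).prod (gaussianReal 0 (1 / 2))).map
    (fun p : ℝ × ℝ => (⟨p.1, p.2⟩ : ℂ))

/-- Joint law of `(x, √γ x + n)`, where `x` is uniform on the constellation `S` and `n` is standard
complex Gaussian noise independent of `x`. -/
def gaussianChannelLaw (S : Finset ℂ) (γ : ℝ) : Measure (ℂ × ℂ) :=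
  ((uniformOn (S : Set ℂ)).prod stdComplexGaussian).map
    (fun p : ℂ × ℂ => (p.1, (√γ : ℂ) * p.1 + p.2))

/-- Mutual information (in nats) of a pair with joint law `ρ`: the Kullback-Leibler divergence of
the joint law from the product of its marginals. -/
def mutualInformation (ρ : Measure (ℂ × ℂ)) : ℝ :=
  (InformationTheory.klDiv ρ (ρ.fst.prod ρ.snd)).toReal

/-- `I_x(γ) = I(x ; √γ x + n)` for `x` uniform on the constellation `S`. -/
def scalarInformation (S : Finset ℂ) (γ : ℝ) : ℝ :=
  mutualInformation (gaussianChannelLaw S γ)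

/-- Uncoded symbol error rate at SNR `γ`: the probability, for a uniformly chosen transmitted
symbol `x ∈ S`, that minimum-distance detection from `y = √γ x + n` fails, i.e. that `x` is not the
unique symbol whose scaled version is nearest to `y`. -/
def symbolErrorRate (S : Finset ℂ) (γ : ℝ) : ℝ :=
  (∑ x ∈ S, stdComplexGaussian.real
    {n : ℂ | ∃ x' ∈ S, x' ≠ x ∧
      ‖((√γ : ℂ) * x + n) - (√γ : ℂ) * x'‖ ≤ ‖((√γ : ℂ) * x + n) - (√γ : ℂ) * x‖}) / S.card

/-- Distance between adjacent symbols of the unit-power square `M²`-QAM constellation. -/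
def qamMinDist (M : ℕ) : ℝ := √(6 / ((M : ℝ) ^ 2 - 1))

/-- The `a`-th level (`a = 0, …, M - 1`) of the centred `M`-PAM grid with spacing
`qamMinDist M`. -/
def pamLevel (M a : ℕ) : ℝ := qamMinDist M / 2 * (2 * (a : ℝ) - ((M : ℝ) - 1))

/-- The unit-power square `M²`-QAM constellation: two `M`-PAM constellations in quadrature. -/
def squareQAM (M : ℕ) : Finset ℂ :=
  (Finset.range M ×ˢ Finset.range M).image
    (fun p : ℕ × ℕ => (⟨pamLevel M p.1, pamLevel M p.2⟩ : ℂ))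

/-- Transfer function `H(θ) = ∑ₖ hₖ e^{-jkθ}` of the ISI channel with taps `h₀, …, h_{L-1}`. -/
def transferFunction {L : ℕ} (h : Fin L → ℂ) (θ : ℝ) : ℂ :=
  ∑ k : Fin L, h k * Complex.exp (-(Complex.I * (k : ℕ) * θ))

/-- SNR `|H(2πk/N)|²` of the `k`-th of the `N` OFDM subcarriers. -/
def subcarrierSNR {L : ℕ} (h : Fin L → ℂ) (N k : ℕ) : ℝ :=
  ‖transferFunction h (2 * Real.pi * k / N)‖ ^ 2

/-- Achievable rate per channel input of OFDM with block size `N` and cyclic prefix length `Ncp`,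
with inputs that are i.i.d. uniform on `S` over the `N` parallel subcarriers. -/
def ofdmBlockRate (S : Finset ℂ) {L : ℕ} (h : Fin L → ℂ) (N Ncp : ℕ) : ℝ :=
  1 / ((N : ℝ) + Ncp) * ∑ k ∈ Finset.range N, scalarInformation S (subcarrierSNR h N k)

/-- `I_OFDM = (1/2π) ∫_{-π}^{π} I_x(|H(θ)|²) dθ`. -/
def ofdmRate (S : Finset ℂ) {L : ℕ} (h : Fin L → ℂ) : ℝ :=
  1 / (2 * Real.pi) *
    ∫ θ in (-Real.pi)..Real.pi, scalarInformation S (‖transferFunction h θ‖ ^ 2)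

/-- Output SNR of the unbiased MMSE decision-feedback equalizer,
`exp((1/2π) ∫_{-π}^{π} log(1 + |H(θ)|²) dθ) - 1`. -/
def snrDFE {L : ℕ} (h : Fin L → ℂ) : ℝ :=
  Real.exp (1 / (2 * Real.pi) *
    ∫ θ in (-Real.pi)..Real.pi, Real.log (1 + ‖transferFunction h θ‖ ^ 2)) - 1

/-- The Shamai-Laroia approximation `I_SL = I_x(SNR_{MMSE-DFE-U})`. -/
def shamaiLaroiaRate (S : Finset ℂ) {L : ℕ} (h : Fin L → ℂ) : ℝ :=
  scalarInformation S (snrDFE h)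

end

/-! Put t = log(1 + γ) and g(t) = I_x(e^t - 1). The OFDM rate is the mean over θ of g(log(1 +
|H(θ)|²)), while the Shamai-Laroia rate is g of the mean. The inequality is therefore Jensen's, once
g is concave on an interval containing all values log(1 + |H(θ)|²). The limit of the block rates is
a Riemann sum of a continuous periodic function, and a prefix of length o(N) does not change it.

Square QAM is two M-PAM constellations in quadrature (`scalarInformation_squareQAM`). With noise
rescaled to variance 1 the spacing Δ satisfies Δ² = a(e^t - 1), a = 12/(M² - 1). An error rate below
1/2 forces Δ ≥ 2.017 (`le_qamSpacing_of_symbolErrorRate_lt`). This is a closed condition, so it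
passes from the subcarrier grids to every θ by continuity.

Let P(y) be the sum of the M Gaussian bumps, u(y) the conditional variance of the index given y, and
V_n = ∫ P uⁿ. The I-MMSE relation gives (∫ P log P)' = -Δ V_1, and a second differentiation gives
V_1' = -2Δ V_2. Hence g'' has the sign of V_1 - (Δ² + a) V_2, and everything reduces to V_1 ≤ (Δ² +
a) V_2 for Δ ≥ 2.017 and M ≥ 16 (`pamVarIntegral_one_le`).

For Δ ≥ 3 only adjacent levels interact. Each gap contributes integrals of Gaussian times powers of
sech, and an exact derivative compares the first power with the third (`integral_gaussSech_le`).

For 2.017 ≤ Δ ≤ 3 the difficulty is that P u² has P in its denominator. It is removed by a tangent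
inequality: for any function f, the square of 2aΔ²u - (1 + αPf), now with a the ratio of the claimed
coefficient to Δ², is nonnegative. This bounds P u² below by terms in P²uf, P²f and P³f², which are
polynomial in the bumps and have explicit Gaussian integrals
(`pamVarIntegral_one_le_of_multiplier`). The multiplier is f = 1 - b cos(2πy/Δ) in the bulk, minus
an exponential tilt of amplitude c at each end. Poisson summation evaluates the bulk: without the
cosine the leading terms cancel exactly, and the cosine yields a gain of order ρ² per symbol, where
ρ = exp(-2π²/Δ²). The two ends cost a bounded amount, which the tilt reduces. The outcome is an
explicit inequality in Δ and M (`pamVarIntegral_one_le_of_balance`), checked on ten subintervals of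
[2.017, 3] by rational interval arithmetic, with M = 16 the worst case. -/

/-! ### Moment sums of the PAM output: derivatives and Gaussian domination. -/

/-- The Gaussian bump `exp (-(y - x)² / 2)` centred at `x`. -/
noncomputable def bump (x y : ℝ) : ℝ := Real.exp (-(y - x) ^ 2 / 2)

/-- `n`-th moment sum `∑ₖ kⁿ exp (-(y - kΔ)² / 2)` of the `M`-PAM grid with spacing `Δ`. -/
noncomputable def pamMoment (M n : ℕ) (Δ y : ℝ) : ℝ :=
  ∑ k ∈ Finset.range M, (k : ℝ) ^ n * bump (k * Δ) y

/-- Conditional variance of the PAM index given the output `y`. -/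
noncomputable def pamVar (M : ℕ) (Δ y : ℝ) : ℝ :=
  pamMoment M 2 Δ y / pamMoment M 0 Δ y - (pamMoment M 1 Δ y / pamMoment M 0 Δ y) ^ 2

lemma bump_pos (x y : ℝ) : 0 < bump x y := Real.exp_pos _

@[fun_prop]
lemma continuous_bump (x : ℝ) : Continuous (bump x) := by unfold bump; fun_prop

@[fun_prop]
lemma continuous_pamMoment (M n : ℕ) (Δ : ℝ) : Continuous (pamMoment M n Δ) := by
  unfold pamMoment; fun_prop

lemma pamMoment_nonneg (M n : ℕ) (Δ y : ℝ) : 0 ≤ pamMoment M n Δ y :=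
  Finset.sum_nonneg fun k _ => mul_nonneg (by positivity) (bump_pos _ _).le

lemma bump_zero_le_pamMoment {M : ℕ} (hM : 1 ≤ M) (Δ y : ℝ) :
    bump 0 y ≤ pamMoment M 0 Δ y := by
  have := Finset.single_le_sum (f := fun k : ℕ => (k : ℝ) ^ 0 * bump (k * Δ) y)
    (s := Finset.range M) (fun k _ => mul_nonneg (by positivity) (bump_pos _ _).le)
    (Finset.mem_range.2 hM)
  simpa [pamMoment] using this

lemma pamMoment_zero_pos {M : ℕ} (hM : 1 ≤ M) (Δ y : ℝ) : 0 < pamMoment M 0 Δ y :=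
  (bump_pos 0 y).trans_le (bump_zero_le_pamMoment hM Δ y)

lemma pamMoment_zero_le (M : ℕ) (Δ y : ℝ) : pamMoment M 0 Δ y ≤ M := by
  unfold pamMoment
  calc _ ≤ ∑ k ∈ Finset.range M, (1 : ℝ) := Finset.sum_le_sum fun k _ => by
        simp only [pow_zero, one_mul, bump]
        exact Real.exp_le_one_iff.2 (by nlinarith [sq_nonneg (y - k * Δ)])
    _ = M := by simp

lemma pamMoment_succ_le (M n : ℕ) (Δ y : ℝ) :
    pamMoment M (n + 1) Δ y ≤ M * pamMoment M n Δ y := by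
  unfold pamMoment
  rw [Finset.mul_sum]
  refine Finset.sum_le_sum fun k hk => ?_
  have hk' : (k : ℝ) ≤ M := by exact_mod_cast (Finset.mem_range.1 hk).le
  rw [pow_succ, mul_comm ((k : ℝ) ^ n), mul_assoc]
  exact mul_le_mul_of_nonneg_right hk' (mul_nonneg (by positivity) (bump_pos _ _).le)

lemma hasDerivAt_bump (x y : ℝ) : HasDerivAt (bump x) (-(y - x) * bump x y) y := by
  have := (((hasDerivAt_id y).sub_const x).pow 2).neg.div_const 2 |>.exp
  refine this.congr_deriv ?_
  simp [bump]; ring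

lemma hasDerivAt_bump_left (k Δ y : ℝ) :
    HasDerivAt (fun Δ => bump (k * Δ) y) (k * (y - k * Δ) * bump (k * Δ) y) Δ := by
  have := ((((hasDerivAt_id Δ).const_mul k).const_sub y).pow 2).neg.div_const 2 |>.exp
  refine this.congr_deriv ?_
  simp [bump]; ring

lemma hasDerivAt_pamMoment (M n : ℕ) (Δ y : ℝ) :
    HasDerivAt (pamMoment M n Δ)
      (-y * pamMoment M n Δ y + Δ * pamMoment M (n + 1) Δ y) y := by
  have : HasDerivAt (fun y => ∑ k ∈ Finset.range M, (k : ℝ) ^ n * bump (k * Δ) y)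
      (∑ k ∈ Finset.range M, (k : ℝ) ^ n * (-(y - k * Δ) * bump (k * Δ) y)) y :=
    HasDerivAt.fun_sum fun k _ => (hasDerivAt_bump _ y).const_mul _
  refine this.congr_deriv ?_
  simp only [pamMoment, Finset.mul_sum, ← Finset.sum_add_distrib]
  exact Finset.sum_congr rfl fun k _ => by ring

/-- The value is minus the y-derivative of the moment of order n + 1. This is what allows every
Δ-derivative below to be integrated by parts in y. -/
lemma hasDerivAt_pamMoment_left (M n : ℕ) (Δ y : ℝ) :
    HasDerivAt (fun Δ => pamMoment M n Δ y)
      (y * pamMoment M (n + 1) Δ y - Δ * pamMoment M (n + 2) Δ y) Δ := by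
  have : HasDerivAt (fun Δ => ∑ k ∈ Finset.range M, (k : ℝ) ^ n * bump (k * Δ) y)
      (∑ k ∈ Finset.range M, (k : ℝ) ^ n * (k * (y - k * Δ) * bump (k * Δ) y)) Δ :=
    HasDerivAt.fun_sum fun k _ => (hasDerivAt_bump_left _ _ y).const_mul _
  refine this.congr_deriv ?_
  simp only [pamMoment, Finset.mul_sum, ← Finset.sum_sub_distrib]
  exact Finset.sum_congr rfl fun k _ => by ring

/-- The exponents differ by (y - 2x)²/4. Halving the Gaussian rate makes the bound uniform for
centres in a bounded set. -/
lemma bump_le_exp (x y : ℝ) : bump x y ≤ Real.exp (x ^ 2 / 2) * Real.exp (-y ^ 2 / 4) := by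
  rw [bump, ← Real.exp_add]
  exact Real.exp_le_exp.2 (by nlinarith [sq_nonneg (y - 2 * x)])

/-- Uniform Gaussian domination of the moment sums for `Δ` in a bounded set. -/
lemma exists_pamMoment_le (M : ℕ) (R : ℝ) : ∃ C : ℝ, 0 ≤ C ∧ ∀ n ≤ 4, ∀ Δ, |Δ| ≤ R → ∀ y,
    pamMoment M n Δ y ≤ C * Real.exp (-y ^ 2 / 4) := by
  -- Adding up the constants for all n < 5 gives one C. Order 4 is the highest needed: the
  -- Δ-derivative raises the order by two, and it is applied to orders at most 2.
  refine ⟨∑ n ∈ Finset.range 5, ∑ k ∈ Finset.range M, (k : ℝ) ^ n * Real.exp ((k * R) ^ 2 / 2),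
    by positivity, fun n hn Δ hΔ y => ?_⟩
  have h1 : pamMoment M n Δ y ≤
      (∑ k ∈ Finset.range M, (k : ℝ) ^ n * Real.exp ((k * R) ^ 2 / 2)) * Real.exp (-y ^ 2 / 4) := by
    rw [Finset.sum_mul]
    refine Finset.sum_le_sum fun k _ => ?_
    rw [mul_assoc]
    refine mul_le_mul_of_nonneg_left ((bump_le_exp _ _).trans ?_) (by positivity)
    refine mul_le_mul_of_nonneg_right (Real.exp_le_exp.2 ?_) (Real.exp_pos _).le
    have : Δ ^ 2 ≤ R ^ 2 := sq_le_sq' (by linarith [abs_le.1 hΔ]) (abs_le.1 hΔ).2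
    rw [mul_pow, mul_pow]
    nlinarith [sq_nonneg (k : ℝ)]
  refine h1.trans (mul_le_mul_of_nonneg_right ?_ (Real.exp_pos _).le)
  exact Finset.single_le_sum
    (f := fun n => ∑ k ∈ Finset.range M, (k : ℝ) ^ n * Real.exp ((k * R) ^ 2 / 2))
    (fun n _ => by positivity) (Finset.mem_range.2 (by omega))

lemma integrable_gaussian_bound (C : ℝ) :
    Integrable fun y : ℝ => C * (1 + y ^ 2) ^ 2 * Real.exp (-y ^ 2 / 4) := by
  have h0 : Integrable fun y : ℝ => (|C| * 256) * Real.exp (-(1 / 8) * y ^ 2) :=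
    (integrable_exp_neg_mul_sq (by norm_num)).const_mul _
  refine h0.mono' (by fun_prop) (Eventually.of_forall fun y => ?_)
  rw [Real.norm_eq_abs, abs_mul, abs_mul, abs_of_pos (Real.exp_pos _),
    abs_of_nonneg (a := (1 + y ^ 2) ^ 2) (by positivity),
    mul_assoc, mul_assoc]
  refine mul_le_mul_of_nonneg_left ?_ (abs_nonneg _)
  have h1 : 1 + y ^ 2 ≤ 16 * Real.exp (y ^ 2 / 16) := by
    nlinarith [Real.add_one_le_exp (y ^ 2 / 16), sq_nonneg y]
  have h2 : (1 + y ^ 2) ^ 2 ≤ 256 * Real.exp (y ^ 2 / 8) := by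
    have := pow_le_pow_left₀ (by positivity) h1 2
    rw [mul_pow, ← Real.exp_nat_mul] at this
    have e : ((2 : ℕ) : ℝ) * (y ^ 2 / 16) = y ^ 2 / 8 := by push_cast; ring
    rw [e] at this
    linarith
  calc _ ≤ 256 * Real.exp (y ^ 2 / 8) * Real.exp (-y ^ 2 / 4) :=
        mul_le_mul_of_nonneg_right h2 (Real.exp_pos _).le
    _ = _ := by rw [mul_assoc, ← Real.exp_add]; ring_nf

lemma integrable_of_gaussian_bound {f : ℝ → ℝ} (hf : Continuous f) (C : ℝ)
    (h : ∀ y, |f y| ≤ C * (1 + y ^ 2) ^ 2 * Real.exp (-y ^ 2 / 4)) : Integrable f :=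
  (integrable_gaussian_bound C).mono' hf.aestronglyMeasurable (Eventually.of_forall h)

lemma abs_log_pamMoment_le {M : ℕ} (hM : 1 ≤ M) (Δ y : ℝ) :
    |Real.log (pamMoment M 0 Δ y)| ≤ y ^ 2 / 2 + M := by
  have h1 := Real.log_le_log (bump_pos 0 y) (bump_zero_le_pamMoment hM Δ y)
  have h2 := Real.log_le_sub_one_of_pos (pamMoment_zero_pos hM Δ y)
  have h3 := pamMoment_zero_le M Δ y
  have hM0 : (0 : ℝ) ≤ M := by positivity
  rw [bump, Real.log_exp] at h1
  rw [abs_le]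
  constructor <;> nlinarith [sq_nonneg y]

/-- A weight of at most quadratic growth times the Gaussian domination. -/
lemma mul_gaussian_bound {a b A C y : ℝ} (ha : |a| ≤ A * (1 + y ^ 2))
    (hb : |b| ≤ C * (1 + y ^ 2) * Real.exp (-y ^ 2 / 4)) :
    |a * b| ≤ A * C * (1 + y ^ 2) ^ 2 * Real.exp (-y ^ 2 / 4) := by
  rw [abs_mul]
  calc _ ≤ A * (1 + y ^ 2) * (C * (1 + y ^ 2) * Real.exp (-y ^ 2 / 4)) := by
        exact mul_le_mul ha hb (abs_nonneg _) ((abs_nonneg _).trans ha)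
    _ = _ := by ring

lemma abs_pamMoment_deriv_le {M : ℕ} {R C : ℝ} (hC : 0 ≤ C) (hR : 0 ≤ R)
    (h : ∀ n ≤ 4, ∀ Δ, |Δ| ≤ R → ∀ y, pamMoment M n Δ y ≤ C * Real.exp (-y ^ 2 / 4))
    {n : ℕ} (hn : n ≤ 2) {Δ : ℝ} (hΔ : |Δ| ≤ R) (y : ℝ) :
    |y * pamMoment M (n + 1) Δ y - Δ * pamMoment M (n + 2) Δ y| ≤
      (C * (1 + R)) * (1 + y ^ 2) * Real.exp (-y ^ 2 / 4) := by
  have h1 := h (n + 1) (by omega) Δ hΔ y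
  have h2 := h (n + 2) (by omega) Δ hΔ y
  have hy : |y| ≤ 1 + y ^ 2 := by nlinarith [sq_abs y, sq_nonneg (|y| - 1), abs_nonneg y]
  have hE : 0 ≤ C * Real.exp (-y ^ 2 / 4) := by positivity
  refine (abs_sub _ _).trans ?_
  rw [abs_mul, abs_mul, abs_of_nonneg (pamMoment_nonneg _ _ _ _),
    abs_of_nonneg (pamMoment_nonneg _ _ _ _)]
  calc _ ≤ (1 + y ^ 2) * (C * Real.exp (-y ^ 2 / 4)) + R * (C * Real.exp (-y ^ 2 / 4)) :=
        add_le_add (mul_le_mul hy h1 (pamMoment_nonneg _ _ _ _) (by positivity))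
          (mul_le_mul hΔ h2 (pamMoment_nonneg _ _ _ _) hR)
    _ ≤ _ := by nlinarith [mul_nonneg hE hR, mul_nonneg (mul_nonneg hE hR) (sq_nonneg y)]

lemma pamMean_nonneg (M : ℕ) (Δ y : ℝ) : 0 ≤ pamMoment M 1 Δ y / pamMoment M 0 Δ y :=
  div_nonneg (pamMoment_nonneg _ _ _ _) (pamMoment_nonneg _ _ _ _)

lemma pamMean_le {M : ℕ} (hM : 1 ≤ M) (Δ y : ℝ) :
    pamMoment M 1 Δ y / pamMoment M 0 Δ y ≤ M :=
  (div_le_iff₀ (pamMoment_zero_pos hM Δ y)).2 (pamMoment_succ_le M 0 Δ y)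

@[fun_prop]
lemma continuous_pamMean {M : ℕ} (hM : 1 ≤ M) (Δ : ℝ) :
    Continuous fun y => pamMoment M 1 Δ y / pamMoment M 0 Δ y :=
  (continuous_pamMoment M 1 Δ).div (continuous_pamMoment M 0 Δ)
    fun y => (pamMoment_zero_pos hM Δ y).ne'

lemma continuous_pamVar {M : ℕ} (hM : 1 ≤ M) (Δ : ℝ) : Continuous (pamVar M Δ) :=
  ((continuous_pamMoment M 2 Δ).div (continuous_pamMoment M 0 Δ)
    fun y => (pamMoment_zero_pos hM Δ y).ne').sub ((continuous_pamMean hM Δ).pow 2)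

/-- For Gaussian noise the derivative of the posterior mean in the output is the posterior variance,
here with a factor Δ because indices rather than levels are averaged. -/
lemma hasDerivAt_pamMean {M : ℕ} (hM : 1 ≤ M) (Δ y : ℝ) :
    HasDerivAt (fun y => pamMoment M 1 Δ y / pamMoment M 0 Δ y) (Δ * pamVar M Δ y) y := by
  have hp := (pamMoment_zero_pos hM Δ y).ne'
  refine ((hasDerivAt_pamMoment M 1 Δ y).div (hasDerivAt_pamMoment M 0 Δ y) hp).congr_deriv ?_
  unfold pamVar
  field_simp
  ring

lemma pamVar_abs_le {M : ℕ} (hM : 1 ≤ M) (Δ y : ℝ) : |pamVar M Δ y| ≤ M ^ 2 := by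
  have hp := pamMoment_zero_pos hM Δ y
  have h1 := pamMean_nonneg M Δ y
  have h2 := pamMean_le hM Δ y
  have h3 : pamMoment M 2 Δ y / pamMoment M 0 Δ y ≤ M ^ 2 := by
    rw [div_le_iff₀ hp]
    have := pamMoment_succ_le M 1 Δ y
    have := pamMoment_succ_le M 0 Δ y
    have hM0 : (0 : ℝ) ≤ M := by positivity
    nlinarith
  have h4 : 0 ≤ pamMoment M 2 Δ y / pamMoment M 0 Δ y :=
    div_nonneg (pamMoment_nonneg _ _ _ _) hp.le
  unfold pamVar
  rw [abs_le]
  constructor <;> nlinarith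

/-! ### Integration by parts and the two I-MMSE derivatives. -/

/-- The bracket on the left is minus the y-derivative of the moment of order n + 1, so this is one
integration by parts. The boundary terms vanish since the weight grows at most quadratically against
Gaussian decay. -/
lemma integral_deriv_pamMoment_mul {M : ℕ} (Δ : ℝ) {n : ℕ} (hn : n ≤ 2)
    {u u' : ℝ → ℝ} (hu : ∀ y, HasDerivAt u (u' y) y) (hu' : Continuous u') {A : ℝ}
    (hA : ∀ y, |u y| ≤ A * (1 + y ^ 2)) (hA' : ∀ y, |u' y| ≤ A * (1 + y ^ 2)) :
    ∫ y, u y * (y * pamMoment M (n + 1) Δ y - Δ * pamMoment M (n + 2) Δ y) =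
      ∫ y, u' y * pamMoment M (n + 1) Δ y := by
  obtain ⟨C, hC, h⟩ := exists_pamMoment_le M |Δ|
  have hcu : Continuous u := continuous_iff_continuousAt.2 fun y => (hu y).continuousAt
  have hv : ∀ y, HasDerivAt (fun y => - pamMoment M (n + 1) Δ y)
      (y * pamMoment M (n + 1) Δ y - Δ * pamMoment M (n + 2) Δ y) y := fun y =>
    (hasDerivAt_pamMoment M (n + 1) Δ y).neg.congr_deriv (by ring)
  have hb : ∀ y, |-pamMoment M (n + 1) Δ y| ≤ C * (1 + y ^ 2) * Real.exp (-y ^ 2 / 4) := fun y => by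
    rw [abs_neg, abs_of_nonneg (pamMoment_nonneg _ _ _ _)]
    refine (h (n + 1) (by omega) Δ le_rfl y).trans ?_
    have : 0 ≤ C * Real.exp (-y ^ 2 / 4) := by positivity
    nlinarith [mul_nonneg this (sq_nonneg y)]
  rw [integral_mul_deriv_eq_deriv_mul_of_integrable (u := u) (u' := u')
    (v := fun y => -pamMoment M (n + 1) Δ y) (fun y _ => hu y) (fun y _ => hv y)
    (integrable_of_gaussian_bound (hcu.mul (by fun_prop)) _ fun y => mul_gaussian_bound (hA y)
      (abs_pamMoment_deriv_le hC (abs_nonneg _) h hn le_rfl y))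
    (integrable_of_gaussian_bound (hu'.mul (by fun_prop)) _ fun y =>
      mul_gaussian_bound (hA' y) (hb y))
    (integrable_of_gaussian_bound (hcu.mul (by fun_prop)) _ fun y =>
      mul_gaussian_bound (hA y) (hb y)), ← integral_neg]
  simp

/-- `∫ P log P` for the unnormalised output density `P` of an `M`-PAM input with spacing `Δ`. -/
noncomputable def pamLogIntegral (M : ℕ) (Δ : ℝ) : ℝ :=
  ∫ y, pamMoment M 0 Δ y * Real.log (pamMoment M 0 Δ y)

/-- `∫ P uⁿ` with `u` the conditional variance of the index. -/
noncomputable def pamVarIntegral (M n : ℕ) (Δ : ℝ) : ℝ :=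
  ∫ y, pamMoment M 0 Δ y * pamVar M Δ y ^ n

lemma pamMoment_mul_pamVar {M : ℕ} (hM : 1 ≤ M) (Δ y : ℝ) :
    pamMoment M 0 Δ y * pamVar M Δ y =
      pamMoment M 2 Δ y - pamMoment M 1 Δ y / pamMoment M 0 Δ y * pamMoment M 1 Δ y := by
  have := (pamMoment_zero_pos hM Δ y).ne'
  unfold pamVar
  field_simp

lemma one_le_one_add_sq (y : ℝ) : 1 ≤ 1 + y ^ 2 := by nlinarith [sq_nonneg y]

lemma integrable_mul_pamMoment {M : ℕ} (Δ : ℝ) {n : ℕ} (hn : n ≤ 4) {u : ℝ → ℝ}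
    (hu : Continuous u) {A : ℝ} (hA : ∀ y, |u y| ≤ A * (1 + y ^ 2)) :
    Integrable fun y => u y * pamMoment M n Δ y := by
  obtain ⟨C, hC, h⟩ := exists_pamMoment_le M |Δ|
  refine integrable_of_gaussian_bound (hu.mul (by fun_prop)) (A * C) fun y =>
    mul_gaussian_bound (hA y) ?_
  rw [abs_of_nonneg (pamMoment_nonneg _ _ _ _)]
  refine (h n hn Δ le_rfl y).trans ?_
  have : 0 ≤ C * Real.exp (-y ^ 2 / 4) := by positivity
  nlinarith [mul_nonneg this (sq_nonneg y)]

lemma abs_id_le_sq (y : ℝ) : |y| ≤ 1 + y ^ 2 := by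
  nlinarith [sq_abs y, sq_nonneg (|y| - 1), abs_nonneg y]

lemma integrable_pamLog {M : ℕ} (hM : 1 ≤ M) (Δ : ℝ) :
    Integrable fun y => pamMoment M 0 Δ y * Real.log (pamMoment M 0 Δ y) := by
  have := integrable_mul_pamMoment (M := M) Δ (n := 0) (by norm_num)
    (u := fun y => Real.log (pamMoment M 0 Δ y)) (A := M + 1)
    ((continuous_pamMoment M 0 Δ).log fun y => (pamMoment_zero_pos hM Δ y).ne')
    fun y => (abs_log_pamMoment_le hM Δ y).trans (by
      have : (0 : ℝ) ≤ M := by positivity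
      nlinarith [sq_nonneg y, mul_nonneg this (sq_nonneg y)])
  exact this.congr (Eventually.of_forall fun y => mul_comm _ _)

/-- I-MMSE: derivative of the (negative, unnormalised) output entropy in the spacing. -/
lemma hasDerivAt_pamLogIntegral {M : ℕ} (hM : 1 ≤ M) (Δ : ℝ) :
    HasDerivAt (pamLogIntegral M) (-Δ * pamVarIntegral M 1 Δ) Δ := by
  have hM0 : (0 : ℝ) ≤ M := by positivity
  obtain ⟨C, hC, h⟩ := exists_pamMoment_le M (|Δ| + 1)
  have key := hasDerivAt_integral_of_dominated_loc_of_deriv_le (μ := volume) (x₀ := Δ)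
    (s := Metric.ball Δ 1)
    (F := fun Δ y => pamMoment M 0 Δ y * Real.log (pamMoment M 0 Δ y))
    (F' := fun Δ y => (Real.log (pamMoment M 0 Δ y) + 1) *
      (y * pamMoment M 1 Δ y - Δ * pamMoment M 2 Δ y))
    (bound := fun y => (M + 2) * (C * (1 + (|Δ| + 1))) * (1 + y ^ 2) ^ 2 *
    Real.exp (-y ^ 2 / 4))
  have hlog : ∀ Δ y, |Real.log (pamMoment M 0 Δ y) + 1| ≤ (M + 2) * (1 + y ^ 2) := fun Δ y => by
    refine (abs_add_le _ _).trans ?_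
    have := abs_log_pamMoment_le hM Δ y
    rw [abs_one]
    nlinarith [sq_nonneg y, mul_nonneg hM0 (sq_nonneg y)]
  have hcl : ∀ Δ, Continuous fun y => Real.log (pamMoment M 0 Δ y) := fun Δ =>
    (continuous_pamMoment M 0 Δ).log fun y => (pamMoment_zero_pos hM Δ y).ne'
  specialize key (Metric.ball_mem_nhds _ one_pos)
    (Eventually.of_forall fun Δ => ((continuous_pamMoment M 0 Δ).mul (hcl Δ)).aestronglyMeasurable)
    (integrable_pamLog hM Δ)
    (((hcl Δ).add continuous_const).mul (by fun_prop)).aestronglyMeasurable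
    (Eventually.of_forall fun y x hx => by
      have hx' : |x| ≤ |Δ| + 1 := by
        have := Metric.mem_ball.1 hx
        rw [Real.dist_eq] at this
        linarith [abs_sub_abs_le_abs_sub x Δ]
      exact mul_gaussian_bound (hlog x y)
        (abs_pamMoment_deriv_le hC (by positivity) h (n := 0) (by norm_num) hx' y))
    (integrable_gaussian_bound _)
    (Eventually.of_forall fun y x _ => by
      have hp := (pamMoment_zero_pos hM x y).ne'
      have h1 := hasDerivAt_pamMoment_left M 0 x y
      exact (h1.mul (h1.log hp)).congr_deriv (by field_simp))
  refine key.2.congr_deriv ?_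
  -- Write p_n for the moments. The weight log P + 1 turns the derivative into ∫ (-y + Δ p_1/P) p_1,
  -- and the weight 1 gives ∫ y p_1 = Δ ∫ p_2. Together they leave -Δ ∫ (p_2 - p_1²/P) = -Δ ∫ P u.
  have e1 := integral_deriv_pamMoment_mul (M := M) Δ (n := 0) (by norm_num)
    (u := fun y => Real.log (pamMoment M 0 Δ y) + 1)
    (u' := fun y => -y + Δ * (pamMoment M 1 Δ y / pamMoment M 0 Δ y)) (A := M + 2 + |Δ| * M)
    (fun y => by
      have hp := (pamMoment_zero_pos hM Δ y).ne'
      exact (((hasDerivAt_pamMoment M 0 Δ y).log hp).add_const 1).congr_deriv (by field_simp))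
    (by have := continuous_pamMean hM Δ; fun_prop)
    (fun y => (hlog Δ y).trans (by
      have := one_le_one_add_sq y
      have h3 : 0 ≤ |Δ| * M := by positivity
      nlinarith))
    (fun y => by
      refine (abs_add_le _ _).trans ?_
      rw [abs_neg, abs_mul, abs_of_nonneg (pamMean_nonneg _ _ _)]
      have h1 := abs_id_le_sq y
      have h2 := mul_le_mul_of_nonneg_left (pamMean_le hM Δ y) (abs_nonneg Δ)
      have h3 : 0 ≤ |Δ| * M := by positivity
      have := one_le_one_add_sq y
      nlinarith)
  have e2 := integral_deriv_pamMoment_mul (M := M) Δ (n := 0) (by norm_num)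
    (u := fun y => y) (u' := fun _ => 1) (A := 1) (fun y => hasDerivAt_id y)
    continuous_const (fun y => by simpa using abs_id_le_sq y)
    (fun y => by simpa using one_le_one_add_sq y)
  have e3 := integral_deriv_pamMoment_mul (M := M) Δ (n := 0) (by norm_num)
    (u := fun y => 1) (u' := fun _ => 0) (A := 1) (fun y => hasDerivAt_const _ _)
    continuous_const (fun y => by simpa using one_le_one_add_sq y)
    (fun y => by simpa using (zero_le_one.trans (one_le_one_add_sq y)))
  simp only [zero_add, zero_mul, integral_zero, one_mul] at e1 e2 e3
  have i1 : Integrable fun y => y * pamMoment M 1 Δ y :=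
    integrable_mul_pamMoment Δ (by norm_num) continuous_id (A := 1)
      (fun y => by simpa using abs_id_le_sq y)
  have i0 : ∀ n ≤ 4, Integrable fun y => pamMoment M n Δ y := fun n hn => by
    simpa using integrable_mul_pamMoment Δ hn (u := fun _ => 1) continuous_const (A := 1)
      (fun y => by simpa using one_le_one_add_sq y)
  have i3 : Integrable fun y =>
      pamMoment M 1 Δ y / pamMoment M 0 Δ y * pamMoment M 1 Δ y :=
    integrable_mul_pamMoment Δ (by norm_num) (continuous_pamMean hM Δ) (A := M)
      (fun y => by
        rw [abs_of_nonneg (pamMean_nonneg _ _ _)]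
        nlinarith [pamMean_le hM Δ y, mul_nonneg hM0 (sq_nonneg y)])
  rw [e1]
  simp only [pamVarIntegral, pow_one, pamMoment_mul_pamVar hM]
  rw [integral_sub (i0 2 (by norm_num)) i3]
  have e4 : ∫ y, y * pamMoment M 1 Δ y = Δ * ∫ y, pamMoment M 2 Δ y := by
    rw [integral_sub i1 ((i0 2 (by norm_num)).const_mul _), integral_const_mul] at e3
    linarith
  have e5 : ∫ y, (-y + Δ * (pamMoment M 1 Δ y / pamMoment M 0 Δ y)) * pamMoment M 1 Δ y =
      Δ * (∫ y, pamMoment M 1 Δ y / pamMoment M 0 Δ y * pamMoment M 1 Δ y) -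
      ∫ y, y * pamMoment M 1 Δ y := by
    rw [← integral_const_mul, ← integral_sub (i3.const_mul _) i1]
    exact integral_congr_ae (Eventually.of_forall fun y => by ring)
  rw [e5, e4]
  ring

/-- Derivative of the (unnormalised) minimum mean-square error in the spacing. -/
lemma hasDerivAt_pamVarIntegral_one {M : ℕ} (hM : 1 ≤ M) (Δ : ℝ) :
    HasDerivAt (pamVarIntegral M 1) (-(2 * Δ) * pamVarIntegral M 2 Δ) Δ := by
  have hM0 : (0 : ℝ) ≤ M := by positivity
  obtain ⟨C, hC, h⟩ := exists_pamMoment_le M (|Δ| + 1)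
  have key := hasDerivAt_integral_of_dominated_loc_of_deriv_le (μ := volume) (x₀ := Δ)
    (s := Metric.ball Δ 1)
    (F := fun Δ y => pamMoment M 0 Δ y * pamVar M Δ y ^ 1)
    -- Since P u = p_2 - p_1²/P, its Δ-derivative is p_2' - 2m p_1' + m² p_0' with m = p_1/P the
    -- posterior mean.
    (F' := fun Δ y => (y * pamMoment M 3 Δ y - Δ * pamMoment M 4 Δ y) -
      (2 * (pamMoment M 1 Δ y / pamMoment M 0 Δ y)) *
        (y * pamMoment M 2 Δ y - Δ * pamMoment M 3 Δ y) +
      (pamMoment M 1 Δ y / pamMoment M 0 Δ y) ^ 2 *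
        (y * pamMoment M 1 Δ y - Δ * pamMoment M 2 Δ y))
    (bound := fun y => ((1 + 2 * M + M ^ 2) * (C * (1 + (|Δ| + 1)))) *
    (1 + y ^ 2) ^ 2 * Real.exp (-y ^ 2 / 4))
  have hm : ∀ Δ y, |2 * (pamMoment M 1 Δ y / pamMoment M 0 Δ y)| ≤ (2 * M) * (1 + y ^ 2) :=
    fun Δ y => by
      rw [abs_of_nonneg (mul_nonneg two_pos.le (pamMean_nonneg _ _ _))]
      nlinarith [pamMean_le hM Δ y, mul_nonneg hM0 (sq_nonneg y)]
  have hm2 : ∀ Δ y, |(pamMoment M 1 Δ y / pamMoment M 0 Δ y) ^ 2| ≤ M ^ 2 * (1 + y ^ 2) :=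
    fun Δ y => by
      rw [abs_of_nonneg (sq_nonneg _)]
      have := pow_le_pow_left₀ (pamMean_nonneg M Δ y) (pamMean_le hM Δ y) 2
      nlinarith [mul_nonneg (sq_nonneg (M : ℝ)) (sq_nonneg y)]
  have hcont : ∀ Δ, Continuous fun y => pamMoment M 1 Δ y / pamMoment M 0 Δ y :=
    fun Δ => continuous_pamMean hM Δ
  have hint : Integrable fun y => pamMoment M 0 Δ y * pamVar M Δ y ^ 1 := by
    have := integrable_mul_pamMoment (M := M) Δ (n := 0) (by norm_num)
      (continuous_pamVar hM Δ) (A := M ^ 2) (fun y => (pamVar_abs_le hM Δ y).trans (by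
        nlinarith [mul_nonneg (sq_nonneg (M : ℝ)) (sq_nonneg y)]))
    exact this.congr (Eventually.of_forall fun y => by simp [mul_comm])
  have hd : ∀ x, |x| ≤ |Δ| + 1 → ∀ n ≤ 2, ∀ y,
      |y * pamMoment M (n + 1) x y - x * pamMoment M (n + 2) x y| ≤
      (C * (1 + (|Δ| + 1))) * (1 + y ^ 2) * Real.exp (-y ^ 2 / 4) := fun x hx n hn y =>
    abs_pamMoment_deriv_le hC (by positivity) h hn hx y
  specialize key (Metric.ball_mem_nhds _ one_pos)
    (Eventually.of_forall fun Δ => (((continuous_pamMoment M 0 Δ).mul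
      ((continuous_pamVar hM Δ).pow 1))).aestronglyMeasurable) hint
    (by
      have := hcont Δ
      exact Continuous.aestronglyMeasurable (by fun_prop))
    (Eventually.of_forall fun y x hx => by
      have hx' : |x| ≤ |Δ| + 1 := by
        have := Metric.mem_ball.1 hx
        rw [Real.dist_eq] at this
        linarith [abs_sub_abs_le_abs_sub x Δ]
      have b1 := mul_gaussian_bound (a := 1) (A := 1) (by simpa using one_le_one_add_sq y)
        (hd x hx' 2 le_rfl y)
      have b2 := mul_gaussian_bound (hm x y) (hd x hx' 1 (by norm_num) y)
      have b3 := mul_gaussian_bound (hm2 x y) (hd x hx' 0 (by norm_num) y)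
      rw [one_mul] at b1
      refine (abs_add_le _ _).trans ((add_le_add ((abs_sub _ _).trans (add_le_add b1 b2))
        b3).trans (le_of_eq (by ring))))
    (integrable_gaussian_bound _)
    (Eventually.of_forall fun y x _ => by
      have hp := (pamMoment_zero_pos hM x y).ne'
      have h0 := hasDerivAt_pamMoment_left M 0 x y
      have h1 := hasDerivAt_pamMoment_left M 1 x y
      have h2 := hasDerivAt_pamMoment_left M 2 x y
      simp only [pow_one, pamMoment_mul_pamVar hM]
      exact (h2.fun_sub ((h1.fun_div h0 hp).fun_mul h1)).congr_deriv (by field_simp; ring))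
  refine key.2.congr_deriv ?_
  obtain ⟨C', hC', h'⟩ := exists_pamMoment_le M |Δ|
  have hd' := fun n hn => abs_pamMoment_deriv_le (M := M) hC' (abs_nonneg Δ) h' (n := n) hn le_rfl
  have hm' := fun y => (hasDerivAt_pamMean hM Δ y).const_mul 2
  have hm2' := fun y => (hasDerivAt_pamMean hM Δ y).fun_pow 2
  have hV : ∀ y, |Δ * pamVar M Δ y| ≤ |Δ| * M ^ 2 * (1 + y ^ 2) := fun y => by
    rw [abs_mul]
    have := mul_le_mul_of_nonneg_left (pamVar_abs_le hM Δ y) (abs_nonneg Δ)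
    nlinarith [mul_nonneg (mul_nonneg (abs_nonneg Δ) (sq_nonneg (M : ℝ))) (sq_nonneg y)]
  have hcV := continuous_pamVar hM Δ
  have hcm := hcont Δ
  have hposA : 0 ≤ |Δ| * M ^ 2 := by positivity
  -- The weights 1, 2m and m² have y-derivatives 0, 2Δu and 2mΔu. Integrating by parts leaves ∫ 2Δu
  -- (m p_1 - p_2) = -2Δ ∫ P u².
  have e1 := integral_deriv_pamMoment_mul (M := M) Δ (n := 2) le_rfl
    (u := fun y => 1) (u' := fun _ => 0) (A := 1) (fun y => hasDerivAt_const _ _)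
    continuous_const (fun y => by simpa using one_le_one_add_sq y)
    (fun y => by simpa using (zero_le_one.trans (one_le_one_add_sq y)))
  have e2 := integral_deriv_pamMoment_mul (M := M) Δ (n := 1) (by norm_num)
    (A := 2 * M + 2 * (|Δ| * M ^ 2)) hm' (by fun_prop)
    (fun y => (hm Δ y).trans (by nlinarith [mul_nonneg hposA (one_le_one_add_sq y |>.trans' zero_le_one)]))
    (fun y => by
      rw [abs_mul, abs_two]
      nlinarith [hV y, mul_nonneg hM0 (one_le_one_add_sq y |>.trans' zero_le_one)])
  have e3 := integral_deriv_pamMoment_mul (M := M) Δ (n := 0) (by norm_num)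
    (A := M ^ 2 + 2 * M * (|Δ| * M ^ 2)) hm2' (by fun_prop)
    (fun y => (hm2 Δ y).trans (by
      nlinarith [mul_nonneg (mul_nonneg hM0 hposA) (one_le_one_add_sq y |>.trans' zero_le_one)]))
    (fun y => by
      have a1 : |pamMoment M 1 Δ y / pamMoment M 0 Δ y| ≤ M := by
        rw [abs_of_nonneg (pamMean_nonneg _ _ _)]; exact pamMean_le hM Δ y
      have a2 := mul_le_mul a1 (hV y) (abs_nonneg _) hM0
      simp only [Nat.cast_ofNat, Nat.add_one_sub_one, pow_one]
      rw [abs_mul, abs_mul, abs_two]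
      have := one_le_one_add_sq y
      nlinarith [sq_nonneg (M : ℝ), mul_nonneg (sq_nonneg (M : ℝ)) (zero_le_one.trans this)])
  simp only [zero_mul, integral_zero, one_mul, Nat.reduceAdd, zero_add] at e1 e2 e3
  have j : ∀ n ≤ 2, ∀ {u : ℝ → ℝ} {A : ℝ}, Continuous u → (∀ y, |u y| ≤ A * (1 + y ^ 2)) →
      Integrable fun y => u y * (y * pamMoment M (n + 1) Δ y - Δ * pamMoment M (n + 2) Δ y) :=
    fun n hn u A hu hA => integrable_of_gaussian_bound (hu.mul (by fun_prop)) _ fun y =>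
      mul_gaussian_bound (hA y) (hd' n hn y)
  have j1 : Integrable fun y => y * pamMoment M 3 Δ y - Δ * pamMoment M 4 Δ y := by
    simpa using j 2 le_rfl (u := fun _ => 1) (A := 1) continuous_const
      (fun y => by simpa using one_le_one_add_sq y)
  have j2 := j 1 (by norm_num) (u := fun y => 2 * (pamMoment M 1 Δ y / pamMoment M 0 Δ y))
    (by fun_prop) (hm Δ)
  have j3 := j 0 (by norm_num) (u := fun y => (pamMoment M 1 Δ y / pamMoment M 0 Δ y) ^ 2)
    (by fun_prop) (hm2 Δ)
  simp only [zero_add, Nat.reduceAdd] at j2 j3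
  have k2 : Integrable fun y => 2 * (Δ * pamVar M Δ y) * pamMoment M 2 Δ y :=
    integrable_mul_pamMoment Δ (by norm_num) (by fun_prop) (A := 2 * (|Δ| * M ^ 2))
      (fun y => by rw [abs_mul, abs_two]; nlinarith [hV y])
  have k3 : Integrable fun y => 2 * (pamMoment M 1 Δ y / pamMoment M 0 Δ y) *
      (Δ * pamVar M Δ y) * pamMoment M 1 Δ y :=
    integrable_mul_pamMoment Δ (by norm_num) (by fun_prop) (A := 2 * M * (|Δ| * M ^ 2))
      (fun y => by
        have a1 : |pamMoment M 1 Δ y / pamMoment M 0 Δ y| ≤ M := by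
          rw [abs_of_nonneg (pamMean_nonneg _ _ _)]; exact pamMean_le hM Δ y
        have a2 := mul_le_mul a1 (hV y) (abs_nonneg _) hM0
        rw [abs_mul, abs_mul, abs_two]
        nlinarith)
  have e0 := integral_add (j1.sub j2) j3
  simp only [Pi.sub_apply] at e0
  rw [e0, integral_sub j1 j2, e1, e2, e3]
  have e4 : (∫ y, (↑2 * (pamMoment M 1 Δ y / pamMoment M 0 Δ y) ^ (2 - 1) * (Δ * pamVar M Δ y)) *
      pamMoment M 1 Δ y) = ∫ y, 2 * (pamMoment M 1 Δ y / pamMoment M 0 Δ y) *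
      (Δ * pamVar M Δ y) * pamMoment M 1 Δ y := by norm_num
  simp only [Nat.cast_ofNat, Nat.add_one_sub_one, pow_one] at e4 ⊢
  rw [zero_sub, neg_add_eq_sub, ← integral_sub k3 k2, pamVarIntegral, ← integral_const_mul]
  refine integral_congr_ae (Eventually.of_forall fun y => ?_)
  have := pamMoment_mul_pamVar hM Δ y
  simp only
  linear_combination (2 * Δ * pamVar M Δ y) * this

/-! ### Gaussian integrals of one, two and three bumps against exponentials and cosines. -/

/-- Gaussian integral against `exp (c y) cos (θ y)`, together with integrability. -/
lemma integral_gaussian_exp_cos {n : ℝ} (hn : 0 < n) (m c θ : ℝ) :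
    Integrable (fun y : ℝ => Real.exp (-(n / 2) * (y - m) ^ 2) * (Real.exp (c * y) *
      Real.cos (θ * y))) ∧
    ∫ y : ℝ, Real.exp (-(n / 2) * (y - m) ^ 2) * (Real.exp (c * y) * Real.cos (θ * y)) =
      √(2 * Real.pi / n) * (Real.exp (c * m + (c ^ 2 - θ ^ 2) / (2 * n)) *
        Real.cos (θ * m + c * θ / n)) := by
  have hb : (-(n / 2 : ℝ) : ℂ).re < 0 := by
    rw [← Complex.ofReal_neg, Complex.ofReal_re]; linarith
  have hn0 : (n : ℂ) ≠ 0 := by exact_mod_cast hn.ne'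
  -- The integrand is the real part of the exponential of a complex quadratic whose linear
  -- coefficient is nm + c + iθ.
  have hi := integrable_cexp_quadratic' hb (n * m + c + θ * Complex.I : ℂ) (-(n / 2) * m ^ 2 : ℂ)
  have h := integral_cexp_quadratic hb (n * m + c + θ * Complex.I : ℂ) (-(n / 2) * m ^ 2 : ℂ)
  have e : ∀ y : ℝ, (Complex.exp (-(n / 2 : ℝ) * (y : ℂ) ^ 2 + (n * m + c + θ * Complex.I) * y +
      -(n / 2) * m ^ 2)).re =
      Real.exp (-(n / 2) * (y - m) ^ 2) * (Real.exp (c * y) * Real.cos (θ * y)) := fun y => by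
    have : (-(n / 2 : ℝ) * (y : ℂ) ^ 2 + (n * m + c + θ * Complex.I) * y + -(n / 2) * m ^ 2 : ℂ) =
      ((-(n / 2) * (y - m) ^ 2 + c * y : ℝ) : ℂ) + ((θ * y : ℝ) : ℂ) * Complex.I := by
      push_cast; ring
    rw [this, Complex.exp_add, ← Complex.ofReal_exp, Complex.re_ofReal_mul,
      Complex.exp_ofReal_mul_I_re, Real.exp_add, mul_assoc]
  refine ⟨(hi.re).congr (Eventually.of_forall e), ?_⟩
  have h2 := congrArg Complex.re h
  have h3 := integral_re (𝕜 := ℂ) hi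
  simp only [RCLike.re_eq_complex_re] at h3
  rw [← h3] at h2
  simp only [e] at h2
  rw [h2]
  have e2 : (Real.pi / - -(n / 2 : ℝ) : ℂ) ^ (1 / 2 : ℂ) = ((√(2 * Real.pi / n) : ℝ) : ℂ) := by
    rw [Real.sqrt_eq_rpow, Complex.ofReal_cpow (by positivity)]
    congr 1
    · push_cast; field_simp
    · push_cast; rfl
  have e3 : (-(n / 2) * m ^ 2 - (n * m + c + θ * Complex.I) ^ 2 / (4 * -(n / 2 : ℝ)) : ℂ) =
      ((c * m + (c ^ 2 - θ ^ 2) / (2 * n) : ℝ) : ℂ) + ((θ * m + c * θ / n : ℝ) : ℂ) * Complex.I := by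
    push_cast
    field_simp
    ring_nf
    rw [Complex.I_sq]
    ring
  rw [e2, e3, Complex.exp_add, ← Complex.ofReal_exp, Complex.re_ofReal_mul, Complex.re_ofReal_mul,
    Complex.exp_ofReal_mul_I_re]

lemma integral_bump_mul (x c θ : ℝ) :
    Integrable (fun y => bump x y * (Real.exp (c * y) * Real.cos (θ * y))) ∧
    ∫ y, bump x y * (Real.exp (c * y) * Real.cos (θ * y)) =
      √(2 * Real.pi) * (Real.exp (c * x + (c ^ 2 - θ ^ 2) / 2) * Real.cos (θ * x + c * θ)) := by
  have := integral_gaussian_exp_cos one_pos x c θ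
  simp only [div_one, mul_one] at this
  convert this using 5
  all_goals (unfold bump; congr 1; ring)

lemma bump_mul_bump (x x' y : ℝ) : bump x y * bump x' y =
    Real.exp (-(x - x') ^ 2 / 4) * Real.exp (-(2 / 2) * (y - (x + x') / 2) ^ 2) := by
  rw [bump, bump, ← Real.exp_add, ← Real.exp_add]
  congr 1; ring

lemma bump_mul_bump_mul_bump (x x' x'' y : ℝ) : bump x y * bump x' y * bump x'' y =
    Real.exp (-(x ^ 2 + x' ^ 2 + x'' ^ 2 - (x + x' + x'') ^ 2 / 3) / 2) *
      Real.exp (-(3 / 2) * (y - (x + x' + x'') / 3) ^ 2) := by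
  rw [bump, bump, bump, ← Real.exp_add, ← Real.exp_add, ← Real.exp_add]
  congr 1; ring

lemma integral_bump_pair (x x' c θ : ℝ) :
    Integrable (fun y => bump x y * bump x' y * (Real.exp (c * y) * Real.cos (θ * y))) ∧
    ∫ y, bump x y * bump x' y * (Real.exp (c * y) * Real.cos (θ * y)) =
      √Real.pi * (Real.exp (-(x - x') ^ 2 / 4 + (c * ((x + x') / 2) + (c ^ 2 - θ ^ 2) / 4)) *
        Real.cos (θ * ((x + x') / 2) + c * θ / 2)) := by
  have := integral_gaussian_exp_cos two_pos ((x + x') / 2) c θ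
  simp only [bump_mul_bump, mul_assoc]
  refine ⟨this.1.const_mul _, ?_⟩
  rw [integral_const_mul, this.2, mul_div_cancel_left₀ _ two_ne_zero,
    Real.exp_add (-(x - x') ^ 2 / 4)]
  norm_num
  ring

lemma integral_bump_triple (x x' x'' c θ : ℝ) :
    Integrable (fun y => bump x y * bump x' y * bump x'' y *
      (Real.exp (c * y) * Real.cos (θ * y))) ∧
    ∫ y, bump x y * bump x' y * bump x'' y * (Real.exp (c * y) * Real.cos (θ * y)) =
      √(2 * Real.pi / 3) * (Real.exp (-(x ^ 2 + x' ^ 2 + x'' ^ 2 - (x + x' + x'') ^ 2 / 3) / 2 +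
        (c * ((x + x' + x'') / 3) + (c ^ 2 - θ ^ 2) / 6)) *
        Real.cos (θ * ((x + x' + x'') / 3) + c * θ / 3)) := by
  have := integral_gaussian_exp_cos three_pos ((x + x' + x'') / 3) c θ
  simp only [bump_mul_bump_mul_bump]
  simp only [mul_assoc (Real.exp (-(x ^ 2 + x' ^ 2 + x'' ^ 2 - (x + x' + x'') ^ 2 / 3) / 2))]
  refine ⟨this.1.const_mul _, ?_⟩
  rw [integral_const_mul, this.2,
    Real.exp_add (-(x ^ 2 + x' ^ 2 + x'' ^ 2 - (x + x' + x'') ^ 2 / 3) / 2)]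
  norm_num
  ring

/-! ### The theta transformation and its derivative. -/

lemma summable_pow_mul_exp_neg_mul_sq {τ : ℝ} (hτ : 0 < τ) (a : ℝ) (k : ℕ) :
    Summable fun n : ℤ => (|n| ^ k : ℝ) * Real.exp (-τ * (n + a) ^ 2) := by
  have hpi := Real.pi_pos
  have := summable_pow_mul_jacobiTheta₂_term_bound (τ * |a| / Real.pi)
    (T := τ / Real.pi) (by positivity) k
  refine this.of_nonneg_of_le (fun n => by positivity) fun n => ?_
  push_cast
  refine mul_le_mul_of_nonneg_left (Real.exp_le_exp.2 ?_) (by positivity)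
  have e : -Real.pi * (τ / Real.pi * n ^ 2 - 2 * (τ * |a| / Real.pi) * |(n : ℝ)|) =
      -τ * (n ^ 2 - 2 * (|a| * |(n : ℝ)|)) := by field_simp
  rw [e, ← abs_mul]
  have h1 := neg_abs_le (a * n)
  nlinarith [mul_nonneg hτ.le (sq_nonneg a), mul_nonneg hτ.le (by linarith : 0 ≤ a * n + |a * n|)]

lemma summable_exp_neg_mul_sq {τ : ℝ} (hτ : 0 < τ) (a : ℝ) :
    Summable fun n : ℤ => Real.exp (-τ * (n + a) ^ 2) := by
  simpa using summable_pow_mul_exp_neg_mul_sq hτ a 0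

lemma summable_sq_mul_exp_neg_mul_sq {τ : ℝ} (hτ : 0 < τ) (a : ℝ) :
    Summable fun n : ℤ => (n + a) ^ 2 * Real.exp (-τ * (n + a) ^ 2) := by
  have h0 := (summable_exp_neg_mul_sq hτ a).mul_left (2 * a ^ 2)
  have h2 := (summable_pow_mul_exp_neg_mul_sq hτ a 2).mul_left 2
  refine (h2.add h0).of_nonneg_of_le (fun n => by positivity) fun n => ?_
  rw [← mul_assoc, ← add_mul, Int.cast_abs, sq_abs]
  refine mul_le_mul_of_nonneg_right ?_ (Real.exp_pos _).le
  nlinarith [sq_nonneg ((n : ℝ) - a)]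

lemma hasDerivAt_tsum_exp_neg_mul_sq {τ : ℝ} (hτ : 0 < τ) (a : ℝ) {c : ℤ → ℝ}
    (hc : ∀ n, |c n| ≤ 1) :
    HasDerivAt (fun τ => ∑' n : ℤ, c n * Real.exp (-τ * (n + a) ^ 2))
      (∑' n : ℤ, c n * (-(n + a) ^ 2 * Real.exp (-τ * (n + a) ^ 2))) τ := by
  have hb : ∀ n : ℤ, ∀ x : ℝ, 0 ≤ x → ‖c n * x‖ ≤ x := fun n x hx => by
    rw [norm_mul, Real.norm_of_nonneg hx, Real.norm_eq_abs]
    exact mul_le_of_le_one_left hx (hc n)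
  refine hasDerivAt_tsum_of_isPreconnected (F := ℝ)
    (g := fun n τ => c n * Real.exp (-τ * ((n : ℝ) + a) ^ 2))
    (g' := fun n τ => c n * (-((n : ℝ) + a) ^ 2 * Real.exp (-τ * ((n : ℝ) + a) ^ 2)))
    (t := Set.Ioi (τ / 2)) (y₀ := τ)
    (summable_sq_mul_exp_neg_mul_sq (half_pos hτ) a) isOpen_Ioi isPreconnected_Ioi
    (fun n y _ => ?_) (fun n y hy => ?_) (Set.mem_Ioi.2 (half_lt_self hτ)) ?_
    (Set.mem_Ioi.2 (half_lt_self hτ))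
  · have : HasDerivAt (fun y : ℝ => -y * (n + a) ^ 2) (-1 * (n + a) ^ 2) y :=
      (hasDerivAt_id y).neg.mul_const _
    exact (this.exp.const_mul (c n)).congr_deriv (by ring)
  · rw [neg_mul, mul_neg, norm_neg]
    refine (hb n _ (by positivity)).trans ?_
    refine mul_le_mul_of_nonneg_left (Real.exp_le_exp.2 ?_) (sq_nonneg _)
    have := Set.mem_Ioi.1 hy
    nlinarith [sq_nonneg ((n : ℝ) + a)]
  · exact Summable.of_norm_bounded (summable_exp_neg_mul_sq hτ a)
      fun n => hb n _ (Real.exp_pos _).le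

/-- Real form of the theta transformation. -/
lemma tsum_theta {τ : ℝ} (hτ : 0 < τ) (a : ℝ) :
    ∑' n : ℤ, Real.exp (-τ * n ^ 2) * Real.cos (2 * Real.pi * a * n) =
      √(Real.pi / τ) * ∑' n : ℤ, Real.exp (-(Real.pi ^ 2 / τ) * (n + a) ^ 2) := by
  have hpi := Real.pi_pos
  have hp0 : (Real.pi : ℂ) ≠ 0 := by exact_mod_cast hpi.ne'
  have ht0 : (τ : ℂ) ≠ 0 := by exact_mod_cast hτ.ne'
  -- The purely imaginary linear term -ia produces the character exp(-2πi a n) on one side and the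
  -- real shift by a on the other. Real parts then give the cosine.
  have h := Complex.tsum_exp_neg_quadratic (a := ((τ / Real.pi : ℝ) : ℂ))
    (by rw [Complex.ofReal_re]; positivity) (-Complex.I * a)
  have e1 : ∀ n : ℤ, Complex.exp (-Real.pi * ((τ / Real.pi : ℝ) : ℂ) * n ^ 2 +
      2 * Real.pi * (-Complex.I * a) * n) =
      ((Real.exp (-τ * n ^ 2) : ℝ) : ℂ) * Complex.exp (((-(2 * Real.pi * a * n) : ℝ) : ℂ) *
        Complex.I) := fun n => by
    rw [Complex.ofReal_exp, ← Complex.exp_add]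
    congr 1; push_cast; field_simp
  have e2 : ∀ n : ℤ, Complex.exp (-Real.pi / ((τ / Real.pi : ℝ) : ℂ) *
      (n + Complex.I * (-Complex.I * a)) ^ 2) =
      ((Real.exp (-(Real.pi ^ 2 / τ) * (n + a) ^ 2) : ℝ) : ℂ) := fun n => by
    have : Complex.I * (-Complex.I * a) = a := by
      rw [← mul_assoc, mul_neg, Complex.I_mul_I, neg_neg, one_mul]
    rw [Complex.ofReal_exp, this]
    congr 1; push_cast; field_simp
  have e3 : (1 / ((τ / Real.pi : ℝ) : ℂ) ^ (1 / 2 : ℂ)) = ((√(Real.pi / τ) : ℝ) : ℂ) := by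
    have : ((1 / 2 : ℂ)) = (((1 / 2 : ℝ)) : ℂ) := by push_cast; rfl
    rw [this, ← Complex.ofReal_cpow (by positivity), ← Real.sqrt_eq_rpow, one_div,
      ← Complex.ofReal_inv, ← Real.sqrt_inv, inv_div]
  simp only [e1, e2] at h
  rw [e3, ← Complex.ofReal_tsum, ← Complex.ofReal_mul] at h
  have h2 := congrArg Complex.re h
  rw [Complex.ofReal_re, Complex.re_tsum] at h2
  · rw [← h2]
    refine tsum_congr fun n => ?_
    rw [Complex.re_ofReal_mul, Complex.exp_ofReal_mul_I_re, Real.cos_neg]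
  · have hs : Summable fun n : ℤ => Real.exp (-τ * n ^ 2) := by
      simpa using summable_exp_neg_mul_sq hτ 0
    refine Summable.of_norm (hs.congr fun n => ?_)
    rw [norm_mul, Complex.norm_exp_ofReal_mul_I, mul_one, Complex.norm_real,
      Real.norm_of_nonneg (Real.exp_pos _).le]

/-- The derivative of the theta transformation in the parameter. -/
lemma tsum_sq_theta {τ : ℝ} (hτ : 0 < τ) (a : ℝ) :
    ∑' n : ℤ, (n : ℝ) ^ 2 * Real.exp (-τ * n ^ 2) * Real.cos (2 * Real.pi * a * n) =
      √(Real.pi / τ) *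
        (1 / (2 * τ) * ∑' n : ℤ, Real.exp (-(Real.pi ^ 2 / τ) * (n + a) ^ 2) -
        Real.pi ^ 2 / τ ^ 2 *
          ∑' n : ℤ, (n + a) ^ 2 * Real.exp (-(Real.pi ^ 2 / τ) * (n + a) ^ 2)) := by
  have hpi := Real.pi_pos
  have h1 := hasDerivAt_tsum_exp_neg_mul_sq hτ 0 (c := fun n => Real.cos (2 * Real.pi * a * n))
    fun n => Real.abs_cos_le_one _
  have h2 := hasDerivAt_tsum_exp_neg_mul_sq (τ := Real.pi ^ 2 / τ) (by positivity) a
    (c := fun n => 1) (fun n => by simp)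
  have h3 : HasDerivAt (fun τ : ℝ => Real.pi ^ 2 / τ) (-(Real.pi ^ 2 / τ ^ 2)) τ := by
    simpa [div_eq_mul_inv] using (hasDerivAt_inv hτ.ne').const_mul (Real.pi ^ 2)
  have h4 : HasDerivAt (fun τ : ℝ => √(Real.pi / τ)) (-(√(Real.pi / τ) / (2 * τ))) τ := by
    have h5 : HasDerivAt (fun τ : ℝ => Real.pi / τ) (-(Real.pi / τ ^ 2)) τ := by
      simpa [div_eq_mul_inv] using (hasDerivAt_inv hτ.ne').const_mul Real.pi
    refine (h5.sqrt (by positivity)).congr_deriv ?_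
    have h6 : √(Real.pi / τ) ^ 2 = Real.pi / τ := Real.sq_sqrt (by positivity)
    have h7 : 0 < √(Real.pi / τ) := Real.sqrt_pos.2 (by positivity)
    rw [neg_div, neg_inj, div_eq_div_iff (by positivity) (by positivity)]
    have : Real.pi / τ ^ 2 = √(Real.pi / τ) ^ 2 / τ := by rw [h6]; field_simp
    rw [this]
    field_simp
  have h5 := h4.mul (h2.comp τ h3)
  -- The theta transformation holds for all parameters near τ, so both sides have the same
  -- derivative there. Termwise differentiation of each side gives the identity.
  have h6 : (fun τ : ℝ => ∑' n : ℤ, Real.cos (2 * Real.pi * a * n) *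
      Real.exp (-τ * ((n : ℝ) + 0) ^ 2)) =ᶠ[𝓝 τ]
      ((fun τ : ℝ => √(Real.pi / τ)) * ((fun τ => ∑' n : ℤ, 1 * Real.exp (-τ * (n + a) ^ 2)) ∘
        fun τ : ℝ => Real.pi ^ 2 / τ)) := by
    filter_upwards [lt_mem_nhds hτ] with t ht
    simp only [Pi.mul_apply, Function.comp, one_mul, add_zero, ← tsum_theta ht a]
    exact tsum_congr fun n => mul_comm _ _
  have h7 := (h1.congr_of_eventuallyEq h6.symm).unique h5
  simp only [Function.comp, one_mul, add_zero] at h7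
  have e1 : ∀ n : ℤ, (n : ℝ) ^ 2 * Real.exp (-τ * n ^ 2) * Real.cos (2 * Real.pi * a * n) =
      -(Real.cos (2 * Real.pi * a * n) * (-(n : ℝ) ^ 2 * Real.exp (-τ * n ^ 2))) := fun n => by ring
  have e2 : ∀ n : ℤ, -((n : ℝ) + a) ^ 2 * Real.exp (-(Real.pi ^ 2 / τ) * (n + a) ^ 2) =
      -(((n : ℝ) + a) ^ 2 * Real.exp (-(Real.pi ^ 2 / τ) * (n + a) ^ 2)) := fun n => by ring
  simp only [e1, tsum_neg, h7, e2]
  ring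

/-! ### Double sums over a finite grid compared with full lattice sums. -/

/-- Recursion for double sums of a symmetric kernel that is covariant under the diagonal shift. -/
lemma sum_range_pair_succ {G : ℕ → ℕ → ℝ} {μ : ℝ} (hs : ∀ i j, G i j = G j i)
    (hc : ∀ i j, G (i + 1) (j + 1) = μ * G i j) (M : ℕ) :
    ∑ i ∈ Finset.range (M + 1), ∑ j ∈ Finset.range (M + 1), G i j =
      G 0 0 + 2 * ∑ j ∈ Finset.range M, G 0 (j + 1) +
        μ * ∑ i ∈ Finset.range M, ∑ j ∈ Finset.range M, G i j := by
  have h1 : ∀ i, ∑ j ∈ Finset.range (M + 1), G i j =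
      ∑ j ∈ Finset.range M, G i (j + 1) + G i 0 := fun i => Finset.sum_range_succ' _ _
  rw [Finset.sum_range_succ', h1 0]
  simp only [h1, hc, Finset.sum_add_distrib, ← Finset.mul_sum]
  have h2 : ∑ x ∈ Finset.range M, G (x + 1) 0 = ∑ j ∈ Finset.range M, G 0 (j + 1) :=
    Finset.sum_congr rfl fun j _ => hs _ _
  rw [h2]
  ring

section DistanceSums
variable {g : ℕ → ℝ}

/-- Counting occurrences of g(e) for e ≥ 1: the tails with m < M contain it min(e, M) times, and the
remaining sum adds e - M when e > M. The total is e on both sides. -/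
lemma sum_tail_add (hg' : Summable fun d : ℕ => (d : ℝ) * g d) (hg : Summable g) (M : ℕ) :
    ∑ m ∈ Finset.range M, ∑' d, g (m + d + 1) + ∑' d : ℕ, ((d : ℝ) + 1) * g (M + d + 1) =
      ∑' d : ℕ, ((d : ℝ) + 1) * g (d + 1) := by
  induction M with
  | zero => simp
  | succ M ih =>
    have hsh : ∀ k, Summable fun d => g (k + d + 1) := fun k => by
      have := (summable_nat_add_iff (k + 1)).2 hg
      exact this.congr fun d => by congr 1; ring
    have hsh' : ∀ k : ℕ, Summable fun d : ℕ => ((d : ℝ) + 1) * g (k + d + 1) := fun k => by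
      have h1 := (summable_nat_add_iff (k + 1)).2 hg'
      have h2 := (hsh k).mul_left (k : ℝ)
      refine (h1.sub h2).congr fun d => ?_
      have : d + (k + 1) = k + d + 1 := by ring
      rw [this]; push_cast; ring
    rw [Finset.sum_range_succ, ← ih, add_assoc]
    congr 1
    rw [(hsh' M).tsum_eq_zero_add, (hsh M).tsum_eq_zero_add, add_assoc]
    simp only [Nat.cast_zero, zero_add, one_mul, add_zero]
    congr 1
    have e1 : ∀ d, g (M + (d + 1) + 1) = g (M + 1 + d + 1) := fun d => by congr 1; ring
    simp only [e1]
    rw [← (hsh (M + 1)).tsum_add (hsh' (M + 1))]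
    exact tsum_congr fun d => by push_cast; ring

/-- Each of the M rows would see the full two-sided lattice sum. A row at distance m from an end
misses the tail beyond that end, and the two ends contribute equally. -/
lemma sum_range_pair_eq {G : ℕ → ℕ → ℝ} (hs : ∀ i j, G i j = G j i)
    (hc : ∀ i j, G (i + 1) (j + 1) = G i j) (hG : ∀ d, G 0 d = g d) (hg : Summable g) (M : ℕ) :
    ∑ i ∈ Finset.range M, ∑ j ∈ Finset.range M, G i j =
      M * (g 0 + 2 * ∑' d, g (d + 1)) - 2 * ∑ m ∈ Finset.range M, ∑' d, g (m + d + 1) := by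
  induction M with
  | zero => simp
  | succ M ih =>
    rw [sum_range_pair_succ (μ := 1) hs (by simpa using hc), ih, Finset.sum_range_succ _ M]
    have h1 := ((summable_nat_add_iff 1).2 hg).sum_add_tsum_nat_add M
    have h2 : ∀ d, g (d + M + 1) = g (M + d + 1) := fun d => by congr 1; ring
    simp only [h2] at h1
    simp only [hG, ← h1]
    push_cast
    ring

lemma sum_range_pair_ge {G : ℕ → ℕ → ℝ} (hs : ∀ i j, G i j = G j i)
    (hc : ∀ i j, G (i + 1) (j + 1) = G i j) (hG : ∀ d, G 0 d = g d) (hg : Summable g)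
    (hg' : Summable fun d : ℕ => (d : ℝ) * g d) (h0 : ∀ d, 0 ≤ g d) (M : ℕ) :
    M * (g 0 + 2 * ∑' d, g (d + 1)) - 2 * ∑' d : ℕ, ((d : ℝ) + 1) * g (d + 1) ≤
      ∑ i ∈ Finset.range M, ∑ j ∈ Finset.range M, G i j := by
  rw [sum_range_pair_eq hs hc hG hg]
  have h1 := sum_tail_add hg' hg M
  have h2 : 0 ≤ ∑' d : ℕ, ((d : ℝ) + 1) * g (M + d + 1) :=
    tsum_nonneg fun d => mul_nonneg (by positivity) (h0 _)
  linarith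

/-- Of the missing tails only distances 1 and 2 are subtracted: the outermost row of each end misses
both g 1 and g 2, the next row misses g 2. -/
lemma sum_range_pair_le {G : ℕ → ℕ → ℝ} (hs : ∀ i j, G i j = G j i)
    (hc : ∀ i j, G (i + 1) (j + 1) = G i j) (hG : ∀ d, G 0 d = g d) (hg : Summable g)
    (h0 : ∀ d, 0 ≤ g d) {M : ℕ} (hM : 2 ≤ M) :
    ∑ i ∈ Finset.range M, ∑ j ∈ Finset.range M, G i j ≤
      M * (g 0 + 2 * ∑' d, g (d + 1)) - 2 * (g 1 + 2 * g 2) := by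
  rw [sum_range_pair_eq hs hc hG hg]
  have hsh : ∀ k, Summable fun d => g (k + d + 1) := fun k => by
    have := (summable_nat_add_iff (k + 1)).2 hg
    exact this.congr fun d => by congr 1; ring
  have h1 : g 1 + g 2 ≤ ∑' d, g (0 + d + 1) := by
    have := (hsh 0).sum_le_tsum (Finset.range 2) fun d _ => h0 _
    simpa [Finset.sum_range_succ] using this
  have h2 : g 2 ≤ ∑' d, g (1 + d + 1) := by
    have := (hsh 1).sum_le_tsum (Finset.range 1) fun d _ => h0 _
    simpa [Finset.sum_range_succ] using this
  have h3 : ∑ m ∈ Finset.range 2, ∑' d, g (m + d + 1) ≤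
      ∑ m ∈ Finset.range M, ∑' d, g (m + d + 1) :=
    Finset.sum_le_sum_of_subset_of_nonneg (Finset.range_subset_range.2 hM)
      fun m _ _ => tsum_nonneg fun d => h0 _
  rw [Finset.sum_range_succ, Finset.sum_range_one] at h3
  linarith

end DistanceSums

lemma tsum_int_eq_of_even {f : ℤ → ℝ} {g : ℕ → ℝ} (hf : ∀ n : ℕ, f n = g n)
    (hf' : ∀ n : ℕ, f (-(n + 1)) = g (n + 1)) (hg : Summable g) :
    ∑' n, f n = g 0 + 2 * ∑' d, g (d + 1) := by
  have h1 : HasSum (fun n : ℕ => f n) (∑' n, g n) := by simpa only [hf] using hg.hasSum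
  have h2 : HasSum (fun n : ℕ => f (-(n + 1))) (∑' n, g (n + 1)) := by
    simpa only [hf'] using ((summable_nat_add_iff 1).2 hg).hasSum
  rw [(h1.of_nat_of_neg_add_one h2).tsum_eq, hg.tsum_eq_zero_add]
  ring

lemma tsum_int_eq_of_shift_even {f : ℤ → ℝ} {g : ℕ → ℝ} (hf : ∀ n : ℕ, f n = g n)
    (hf' : ∀ n : ℕ, f (-(n + 1)) = g n) (hg : Summable g) :
    ∑' n, f n = 2 * ∑' d, g d := by
  have h1 : HasSum (fun n : ℕ => f n) (∑' n, g n) := by simpa only [hf] using hg.hasSum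
  have h2 : HasSum (fun n : ℕ => f (-(n + 1))) (∑' n, g n) := by simpa only [hf'] using hg.hasSum
  rw [(h1.of_nat_of_neg_add_one h2).tsum_eq]
  ring

/-! ### Tails of series in q to the power n². -/

section Lacunary
variable {q : ℝ}

lemma exp_neg_mul_natCast_sq (t : ℝ) (n : ℕ) :
    Real.exp (-t * (n : ℝ) ^ 2) = Real.exp (-t) ^ (n ^ 2) := by
  rw [← Real.exp_nat_mul]; push_cast; ring_nf

lemma summable_sq_mul_pow_sq (h0 : 0 ≤ q) (h1 : q < 1) :
    Summable fun n : ℕ => (n : ℝ) ^ 2 * q ^ (n ^ 2) := by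
  refine (summable_pow_mul_geometric_of_norm_lt_one 2
    (by rwa [Real.norm_of_nonneg h0] : ‖q‖ < 1)).of_nonneg_of_le (fun n => by positivity)
    fun n => mul_le_mul_of_nonneg_left ?_ (by positivity)
  exact pow_le_pow_of_le_one h0 h1.le (Nat.le_self_pow two_ne_zero n)

lemma summable_pow_sq (h0 : 0 ≤ q) (h1 : q < 1) : Summable fun n : ℕ => q ^ (n ^ 2) :=
  (summable_geometric_of_lt_one h0 h1).of_nonneg_of_le (fun n => by positivity)
    fun n => pow_le_pow_of_le_one h0 h1.le (Nat.le_self_pow two_ne_zero n)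

/-- Since (n + 2)² ≥ 4 + 5n, the tail is dominated by a geometric series of ratio q⁵ ≤ 8⁻⁵ that
starts at q⁴. -/
lemma tsum_pow_sq_tail_le (h0 : 0 ≤ q) (h1 : q ≤ 1 / 8) :
    ∑' n : ℕ, q ^ ((n + 2) ^ 2) ≤ 1.01 * q ^ 4 := by
  have hq5 : q ^ 5 ≤ 1 / 8 ^ 5 := by
    have := pow_le_pow_left₀ h0 h1 5; norm_num at this ⊢; exact this
  have hq1 : q ^ 5 < 1 := by norm_num at hq5; linarith
  have hgeo := (hasSum_geometric_of_lt_one (by positivity) hq1).mul_left (q ^ 4)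
  have hle : ∀ n : ℕ, q ^ ((n + 2) ^ 2) ≤ q ^ 4 * (q ^ 5) ^ n := fun n => by
    rw [← pow_mul, ← pow_add]
    exact pow_le_pow_of_le_one h0 (by linarith) (by nlinarith [Nat.zero_le n, Nat.le_self_pow two_ne_zero n])
  have hs := hgeo.summable.of_nonneg_of_le (fun n => by positivity) hle
  refine (hs.tsum_le_tsum hle hgeo.summable).trans ?_
  rw [hgeo.tsum_eq, mul_comm]
  refine mul_le_mul_of_nonneg_right ?_ (by positivity)
  rw [inv_le_comm₀ (by linarith) (by norm_num)]
  norm_num at hq5 ⊢; linarith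

lemma tsum_sq_mul_pow_sq_tail_le (h0 : 0 ≤ q) (h1 : q ≤ 1 / 8) :
    ∑' n : ℕ, ((n : ℝ) + 2) ^ 2 * q ^ ((n + 2) ^ 2) ≤ 4.1 * q ^ 4 := by
  have hq5 : q ^ 5 ≤ 1 / 8 ^ 5 := by
    have := pow_le_pow_left₀ h0 h1 5; norm_num at this ⊢; exact this
  have hq1 : 4 * q ^ 5 < 1 := by norm_num at hq5; linarith
  have hgeo := (hasSum_geometric_of_lt_one (by positivity) hq1).mul_left (4 * q ^ 4)
  have hle : ∀ n : ℕ, ((n : ℝ) + 2) ^ 2 * q ^ ((n + 2) ^ 2) ≤ 4 * q ^ 4 * (4 * q ^ 5) ^ n :=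
    fun n => by
      have e : 4 * q ^ 4 * (4 * q ^ 5) ^ n = (4 * 4 ^ n) * (q ^ (4 + 5 * n)) := by
        rw [mul_pow, ← pow_mul, pow_add]; ring
      rw [e]
      refine mul_le_mul ?_ (pow_le_pow_of_le_one h0 (by linarith)
        (by nlinarith [Nat.zero_le n, Nat.le_self_pow two_ne_zero n])) (by positivity) (by positivity)
      have h2 : (n : ℝ) + 1 ≤ 2 ^ n := by
        exact_mod_cast Nat.succ_le_of_lt n.lt_two_pow_self
      have h3 : (4 : ℝ) ^ n = 2 ^ n * 2 ^ n := by rw [← mul_pow]; norm_num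
      rw [h3]
      have hn : (0 : ℝ) ≤ n := by positivity
      nlinarith
  have hs := hgeo.summable.of_nonneg_of_le (fun n => by positivity) hle
  refine (hs.tsum_le_tsum hle hgeo.summable).trans ?_
  rw [hgeo.tsum_eq, mul_right_comm]
  refine mul_le_mul_of_nonneg_right ?_ (by positivity)
  rw [← div_eq_mul_inv, div_le_iff₀ (by linarith)]
  norm_num at hq5 ⊢; linarith

end Lacunary

/-! ### Poisson summation: lattice constants and the bulk values of the pair sums. -/

/-- First Fourier weight `exp (-2π²/Δ²)` of the periodised unit Gaussian of period `Δ`. -/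
noncomputable def latticeRho (Δ : ℝ) : ℝ := Real.exp (-(2 * Real.pi ^ 2 / Δ ^ 2))

/-- Square root of `latticeRho`. -/
noncomputable def latticeEta (Δ : ℝ) : ℝ := Real.exp (-(Real.pi ^ 2 / Δ ^ 2))

/-- Angular frequency `2π/Δ` of the lattice. -/
noncomputable def latticeFreq (Δ : ℝ) : ℝ := 2 * Real.pi / Δ

/-- Normalised pair integral of two bumps at distance `d Δ` against `1 - b cos (ω y)`. -/
noncomputable def pairWeight (Δ b : ℝ) (d : ℕ) : ℝ :=
  Δ / (2 * √Real.pi) * (Real.exp (-(Δ ^ 2 / 4) * (d : ℝ) ^ 2) *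
    (1 - b * latticeEta Δ * Real.cos (Real.pi * d)))

lemma latticeEta_sq (Δ : ℝ) : latticeEta Δ ^ 2 = latticeRho Δ := by
  rw [latticeEta, latticeRho, ← Real.exp_nat_mul]; congr 1; push_cast; ring

lemma latticeRho_pos (Δ : ℝ) : 0 < latticeRho Δ := Real.exp_pos _
lemma latticeEta_pos (Δ : ℝ) : 0 < latticeEta Δ := Real.exp_pos _

lemma latticeRho_le {Δ : ℝ} (h0 : 0 < Δ) (h3 : Δ ≤ 3) : latticeRho Δ ≤ 1 / 8 := by
  have hpi := Real.pi_gt_d2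
  have h1 : (2.19 : ℝ) ≤ 2 * Real.pi ^ 2 / Δ ^ 2 := by
    rw [le_div_iff₀ (by positivity)]
    nlinarith
  have h2 : (8 : ℝ) ≤ Real.exp 2.19 := by
    have h3 : Real.exp 2.19 = Real.exp 1 ^ 2 * Real.exp 0.19 := by
      rw [← Real.exp_nat_mul, ← Real.exp_add]; norm_num
    have h4 := Real.exp_one_gt_d9
    have h5 := Real.add_one_le_exp (0.19 : ℝ)
    rw [h3]
    nlinarith [Real.exp_pos 1]
  rw [latticeRho, Real.exp_neg, one_div]
  exact inv_anti₀ (by norm_num) (h2.trans (Real.exp_le_exp.2 h1))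

lemma latticeEta_le {Δ : ℝ} (h0 : 0 < Δ) (h3 : Δ ≤ 3) : latticeEta Δ ≤ 1 / 2 := by
  have h1 := latticeRho_le h0 h3
  rw [← latticeEta_sq] at h1
  nlinarith [latticeEta_pos Δ]

/-- At τ = Δ²/4, the rate of a pair of bumps as a function of their distance, the dual Gaussian has
rate 4π²/Δ². The unshifted dual sum is therefore lacunary in ρ², and the one shifted by 1/2 has the
odd squares of η as its terms. -/
lemma exp_dual_zero (Δ : ℝ) (hΔ : Δ ≠ 0) (n : ℤ) :
    Real.exp (-(Real.pi ^ 2 / (Δ ^ 2 / 4)) * ((n : ℝ) + 0) ^ 2) =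
      (latticeRho Δ ^ 2) ^ (n.natAbs ^ 2) := by
  rw [latticeRho, ← Real.exp_nat_mul, ← Real.exp_nat_mul]
  congr 1
  have : ((n.natAbs ^ 2 : ℕ) : ℝ) = (n : ℝ) ^ 2 := by
    rw [Nat.cast_pow, Nat.cast_natAbs, Int.cast_abs, sq_abs]
  rw [this, add_zero]; push_cast; field_simp; norm_num; try ring

lemma exp_dual_half (Δ : ℝ) (hΔ : Δ ≠ 0) (n : ℕ) :
    Real.exp (-(Real.pi ^ 2 / (Δ ^ 2 / 4)) * ((n : ℝ) + 1 / 2) ^ 2) =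
      latticeEta Δ ^ ((2 * n + 1) ^ 2) := by
  rw [latticeEta, ← Real.exp_nat_mul]
  congr 1
  push_cast; field_simp; ring

section Dual
variable {Δ : ℝ}

lemma tsum_dual_zero (h0 : 0 < Δ) (h3 : Δ ≤ 3) :
    1 + 2 * latticeRho Δ ^ 2 ≤
      ∑' n : ℤ, Real.exp (-(Real.pi ^ 2 / (Δ ^ 2 / 4)) * ((n : ℝ) + 0) ^ 2) ∧
    ∑' n : ℤ, Real.exp (-(Real.pi ^ 2 / (Δ ^ 2 / 4)) * ((n : ℝ) + 0) ^ 2) ≤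
      1 + 2 * latticeRho Δ ^ 2 + 3 * latticeRho Δ ^ 8 := by
  have hr := latticeRho_le h0 h3
  have hr0 := latticeRho_pos Δ
  set q := latticeRho Δ ^ 2 with hq
  have hq0 : 0 ≤ q := by positivity
  have hq1 : q ≤ 1 / 8 := by nlinarith
  have hs := summable_pow_sq hq0 (by linarith)
  have e : ∑' n : ℤ, Real.exp (-(Real.pi ^ 2 / (Δ ^ 2 / 4)) * ((n : ℝ) + 0) ^ 2) =
      1 + 2 * (q + ∑' n : ℕ, q ^ ((n + 2) ^ 2)) := by
    simp only [exp_dual_zero Δ h0.ne', ← hq]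
    rw [tsum_int_eq_of_even (g := fun n : ℕ => q ^ (n ^ 2)) (fun n => by simp)
      (fun n => by congr 2) hs, ((summable_nat_add_iff 1).2 hs).tsum_eq_zero_add]
    norm_num [add_assoc]
  have h1 := tsum_pow_sq_tail_le hq0 hq1
  have h2 : 0 ≤ ∑' n : ℕ, q ^ ((n + 2) ^ 2) := tsum_nonneg fun n => by positivity
  have h8 : latticeRho Δ ^ 8 = q ^ 4 := by rw [hq]; ring
  have hq4 : 0 ≤ q ^ 4 := by positivity
  rw [e, h8]
  constructor <;> linarith

lemma tsum_dual_zero_sq_le (h0 : 0 < Δ) (h3 : Δ ≤ 3) :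
    ∑' n : ℤ, ((n : ℝ) + 0) ^ 2 * Real.exp (-(Real.pi ^ 2 / (Δ ^ 2 / 4)) * ((n : ℝ) + 0) ^ 2) ≤
      2 * latticeRho Δ ^ 2 + 9 * latticeRho Δ ^ 8 := by
  have hr := latticeRho_le h0 h3
  have hr0 := latticeRho_pos Δ
  set q := latticeRho Δ ^ 2 with hq
  have hq0 : 0 ≤ q := by positivity
  have hq1 : q ≤ 1 / 8 := by nlinarith
  have hs := summable_sq_mul_pow_sq hq0 (by linarith)
  have e : ∑' n : ℤ, ((n : ℝ) + 0) ^ 2 *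
      Real.exp (-(Real.pi ^ 2 / (Δ ^ 2 / 4)) * ((n : ℝ) + 0) ^ 2) =
      2 * (q + ∑' n : ℕ, ((n : ℝ) + 2) ^ 2 * q ^ ((n + 2) ^ 2)) := by
    simp only [exp_dual_zero Δ h0.ne', ← hq]
    rw [tsum_int_eq_of_even (g := fun n : ℕ => (n : ℝ) ^ 2 * q ^ (n ^ 2)) (fun n => by simp)
      (fun n => by
        have : (-((n : ℤ) + 1)).natAbs = n + 1 := by omega
        rw [this]; push_cast; ring) hs, ((summable_nat_add_iff 1).2 hs).tsum_eq_zero_add]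
    norm_num [add_assoc]
  have h1 := tsum_sq_mul_pow_sq_tail_le hq0 hq1
  have h8 : latticeRho Δ ^ 8 = q ^ 4 := by rw [hq]; ring
  have hq4 : 0 ≤ q ^ 4 := by positivity
  rw [e, h8]
  linarith

lemma summable_dual_half (h0 : 0 < Δ) (h3 : Δ ≤ 3) :
    Summable fun n : ℕ => latticeEta Δ ^ ((2 * n + 1) ^ 2) := by
  have hr := latticeEta_le h0 h3
  have hr0 := latticeEta_pos Δ
  exact (summable_geometric_of_lt_one hr0.le (by linarith)).of_nonneg_of_le
    (fun n => by positivity) fun n => pow_le_pow_of_le_one hr0.le (by linarith) (by nlinarith)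

lemma tsum_dual_half (h0 : 0 < Δ) (h3 : Δ ≤ 3) :
    2 * latticeEta Δ ≤
      ∑' n : ℤ, Real.exp (-(Real.pi ^ 2 / (Δ ^ 2 / 4)) * ((n : ℝ) + 1 / 2) ^ 2) ∧
    ∑' n : ℤ, Real.exp (-(Real.pi ^ 2 / (Δ ^ 2 / 4)) * ((n : ℝ) + 1 / 2) ^ 2) ≤
      2 * latticeEta Δ + 2.2 * latticeEta Δ ^ 9 := by
  have hr := latticeEta_le h0 h3
  have hr0 := latticeEta_pos Δ
  set r := latticeEta Δ with hrdef
  have hs := summable_dual_half h0 h3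
  rw [← hrdef] at hs
  have e : ∑' n : ℤ, Real.exp (-(Real.pi ^ 2 / (Δ ^ 2 / 4)) * ((n : ℝ) + 1 / 2) ^ 2) =
      2 * (r + ∑' n : ℕ, r ^ ((2 * (n + 1) + 1) ^ 2)) := by
    rw [tsum_int_eq_of_shift_even (g := fun n : ℕ => r ^ ((2 * n + 1) ^ 2))
      (fun n => by simpa using exp_dual_half Δ h0.ne' n)
      (fun n => by
        rw [← exp_dual_half Δ h0.ne' n]; congr 2; push_cast; ring) hs, hs.tsum_eq_zero_add]
    norm_num
  have h2 : 0 ≤ ∑' n : ℕ, r ^ ((2 * (n + 1) + 1) ^ 2) := tsum_nonneg fun n => by positivity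
  have hr12 : r ^ 12 ≤ 1 / 2 ^ 12 := by
    have := pow_le_pow_left₀ hr0.le hr 12; norm_num at this ⊢; exact this
  have hgeo := (hasSum_geometric_of_lt_one (r := r ^ 12) (by positivity)
    (by norm_num at hr12; linarith)).mul_left (r ^ 9)
  have hle : ∀ n : ℕ, r ^ ((2 * (n + 1) + 1) ^ 2) ≤ r ^ 9 * (r ^ 12) ^ n := fun n => by
    rw [← pow_mul, ← pow_add]
    exact pow_le_pow_of_le_one hr0.le (by linarith) (by nlinarith)
  have h1 : ∑' n : ℕ, r ^ ((2 * (n + 1) + 1) ^ 2) ≤ 1.1 * r ^ 9 := by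
    refine (((summable_nat_add_iff 1).2 hs).tsum_le_tsum hle hgeo.summable).trans ?_
    rw [hgeo.tsum_eq, mul_comm]
    refine mul_le_mul_of_nonneg_right ?_ (by positivity)
    norm_num at hr12
    rw [inv_le_comm₀ (by linarith) (by norm_num)]
    norm_num; linarith
  rw [e]
  constructor <;> linarith

/-- The two terms n = 0 and n = -1 alone contribute η/4 each. -/
lemma tsum_dual_half_sq_ge (h0 : 0 < Δ) :
    latticeEta Δ / 2 ≤ ∑' n : ℤ, ((n : ℝ) + 1 / 2) ^ 2 *
      Real.exp (-(Real.pi ^ 2 / (Δ ^ 2 / 4)) * ((n : ℝ) + 1 / 2) ^ 2) := by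
  have hs := summable_sq_mul_exp_neg_mul_sq (τ := Real.pi ^ 2 / (Δ ^ 2 / 4)) (by positivity) (1 / 2)
  have := hs.sum_le_tsum {0, -1} fun n _ => by positivity
  refine le_trans (le_of_eq ?_) this
  have e0 := exp_dual_half Δ h0.ne' 0
  have e1 : Real.exp (-(Real.pi ^ 2 / (Δ ^ 2 / 4)) * (((-1 : ℤ) : ℝ) + 1 / 2) ^ 2) =
      latticeEta Δ := by
    rw [← (show latticeEta Δ ^ ((2 * 0 + 1) ^ 2) = latticeEta Δ by simp), ← e0]
    congr 2; push_cast; ring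
  rw [Finset.sum_pair (by norm_num), e1]
  simp only [Nat.cast_zero, mul_zero, zero_add, one_pow, pow_one] at e0
  rw [Int.cast_zero, zero_add, e0]
  norm_num; ring

lemma summable_pair_aux (h0 : 0 < Δ) (b : ℝ) (k : ℕ) :
    Summable fun d : ℕ => (d : ℝ) ^ k * pairWeight Δ b d := by
  have h1 := (summable_pow_mul_exp_neg_mul_sq (τ := Δ ^ 2 / 4) (by positivity) 0 k).comp_injective
    Nat.cast_injective
  have h2 := h1.mul_left (Δ / (2 * √Real.pi) * (1 + |b| * latticeEta Δ))
  refine Summable.of_norm_bounded h2 fun d => ?_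
  rw [pairWeight, Real.norm_eq_abs, abs_mul, abs_mul, abs_mul, abs_of_nonneg (by positivity),
    abs_of_nonneg (by positivity), abs_of_pos (Real.exp_pos _)]
  have h3 : |1 - b * latticeEta Δ * Real.cos (Real.pi * d)| ≤ 1 + |b| * latticeEta Δ := by
    refine (abs_sub _ _).trans ?_
    rw [abs_one, abs_mul, abs_mul, abs_of_pos (latticeEta_pos Δ)]
    have := mul_le_mul_of_nonneg_left (Real.abs_cos_le_one (Real.pi * d))
      (mul_nonneg (abs_nonneg b) (latticeEta_pos Δ).le)
    linarith
  simp only [Function.comp, Int.cast_natCast, Nat.abs_cast, add_zero]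
  calc _ = (d : ℝ) ^ k * (Δ / (2 * √Real.pi)) * Real.exp (-(Δ ^ 2 / 4) * (d : ℝ) ^ 2) *
        |1 - b * latticeEta Δ * Real.cos (Real.pi * d)| := by ring
    _ ≤ (d : ℝ) ^ k * (Δ / (2 * √Real.pi)) * Real.exp (-(Δ ^ 2 / 4) * (d : ℝ) ^ 2) *
        (1 + |b| * latticeEta Δ) := mul_le_mul_of_nonneg_left h3 (by positivity)
    _ = _ := by ring

/-- For even k the summand is even, so the distances d ≥ 1 counted twice make a sum over all
integers. The factor cos(πd) becomes the theta shift 1/2. -/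
lemma pairWeight_tsum_int (h0 : 0 < Δ) (b : ℝ) (k : ℕ) (hk : Even k) :
    (0 : ℝ) ^ k * pairWeight Δ b 0 +
      2 * ∑' d : ℕ, ((d + 1 : ℕ) : ℝ) ^ k * pairWeight Δ b (d + 1) =
    Δ / (2 * √Real.pi) *
      (∑' n : ℤ, (n : ℝ) ^ k * Real.exp (-(Δ ^ 2 / 4) * (n : ℝ) ^ 2) *
        Real.cos (2 * Real.pi * 0 * n) -
      b * latticeEta Δ * ∑' n : ℤ, (n : ℝ) ^ k * Real.exp (-(Δ ^ 2 / 4) * (n : ℝ) ^ 2) *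
        Real.cos (2 * Real.pi * (1 / 2) * n)) := by
  have hpw := summable_pow_mul_exp_neg_mul_sq (τ := Δ ^ 2 / 4) (by positivity) 0 k
  have hs : ∀ a : ℝ, Summable fun n : ℤ => (n : ℝ) ^ k * Real.exp (-(Δ ^ 2 / 4) * (n : ℝ) ^ 2) *
      Real.cos (2 * Real.pi * a * n) := fun a => by
    refine Summable.of_norm_bounded hpw fun n => ?_
    rw [norm_mul, norm_mul, norm_pow, Real.norm_of_nonneg (Real.exp_pos _).le, add_zero,
      Real.norm_eq_abs, Int.cast_abs]
    exact mul_le_of_le_one_right (by positivity) (Real.abs_cos_le_one _)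
  rw [← tsum_mul_left (a := b * latticeEta Δ), ← (hs 0).tsum_sub ((hs (1 / 2)).mul_left _),
    ← tsum_mul_left (a := Δ / (2 * √Real.pi))]
  have h1 := tsum_int_eq_of_even (g := fun d : ℕ => (d : ℝ) ^ k * pairWeight Δ b d)
    (f := fun n : ℤ => Δ / (2 * √Real.pi) * ((n : ℝ) ^ k * Real.exp (-(Δ ^ 2 / 4) * (n : ℝ) ^ 2) *
        Real.cos (2 * Real.pi * 0 * n) - b * latticeEta Δ * ((n : ℝ) ^ k *
        Real.exp (-(Δ ^ 2 / 4) * (n : ℝ) ^ 2) * Real.cos (2 * Real.pi * (1 / 2) * n))))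
    (fun n => by
      simp only [pairWeight, Int.cast_natCast, mul_zero, zero_mul, Real.cos_zero]
      rw [show 2 * Real.pi * (1 / 2) * (n : ℝ) = Real.pi * n by ring]; ring)
    (fun n => by
      have e1 : (((-((n : ℤ) + 1) : ℤ)) : ℝ) = -((n : ℝ) + 1) := by push_cast; ring
      have e2 : Real.cos (2 * Real.pi * (1 / 2) * -((n : ℝ) + 1)) =
          Real.cos (Real.pi * ((n : ℝ) + 1)) := by
        rw [← Real.cos_neg]; congr 1; ring
      simp only [pairWeight, e1, e2, hk.neg_pow, neg_sq, mul_zero, zero_mul, Real.cos_zero]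
      push_cast; ring) (summable_pair_aux h0 b k)
  rw [h1]
  simp

lemma sqrt_pi_div (h0 : 0 < Δ) : Δ / (2 * √Real.pi) * √(Real.pi / (Δ ^ 2 / 4)) = 1 := by
  have hpi := Real.pi_pos
  have e : Real.pi / (Δ ^ 2 / 4) = (2 * √Real.pi / Δ) ^ 2 := by
    rw [div_pow, mul_pow, Real.sq_sqrt hpi.le]; field_simp; norm_num
  rw [e, Real.sqrt_sq (by positivity)]
  have : 0 < √Real.pi := Real.sqrt_pos.2 hpi
  field_simp

/-- After the theta transformation the constant part of the multiplier contributes the unshifted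
dual sum, near 1 + 2ρ². The cosine part contributes -bη times the half-shifted sum, which is at
least 2η, and η² = ρ. -/
lemma bulk_pair_le (h0 : 0 < Δ) (h3 : Δ ≤ 3) {b : ℝ} (hb : 0 ≤ b) :
    pairWeight Δ b 0 + 2 * ∑' d : ℕ, pairWeight Δ b (d + 1) ≤
      1 + 2 * latticeRho Δ ^ 2 + 3 * latticeRho Δ ^ 8 - 2 * b * latticeRho Δ := by
  have h1 := pairWeight_tsum_int h0 b 0 Even.zero
  have t0 := tsum_theta (τ := Δ ^ 2 / 4) (by positivity) 0
  have t1 := tsum_theta (τ := Δ ^ 2 / 4) (by positivity) (1 / 2)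
  simp only [pow_zero, one_mul] at h1
  rw [h1, t0, t1]
  have d0 := (tsum_dual_zero h0 h3).2
  have d1 := (tsum_dual_half h0 h3).1
  have hs := sqrt_pi_div h0
  have hbe : 0 ≤ b * latticeEta Δ := mul_nonneg hb (latticeEta_pos Δ).le
  have h4 := mul_le_mul_of_nonneg_left d1 hbe
  have h5 : b * latticeEta Δ * (2 * latticeEta Δ) = 2 * b * latticeRho Δ := by
    rw [← latticeEta_sq]; ring
  rw [h5] at h4
  calc _ = (Δ / (2 * √Real.pi) * √(Real.pi / (Δ ^ 2 / 4))) *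
      (∑' n : ℤ, Real.exp (-(Real.pi ^ 2 / (Δ ^ 2 / 4)) * ((n : ℝ) + 0) ^ 2) -
        b * latticeEta Δ *
        ∑' n : ℤ, Real.exp (-(Real.pi ^ 2 / (Δ ^ 2 / 4)) * ((n : ℝ) + 1 / 2) ^ 2)) := by ring
    _ ≤ _ := by rw [hs]; linarith

/-- The squared distance calls for the differentiated theta transformation. The factor Δ²/2
normalises the leading term to 1, and the main gain b ρ ω² comes from the half-shifted dual sum
weighted by squares. -/
lemma bulk_pair_sq_ge (h0 : 0 < Δ) (h3 : Δ ≤ 3) {b : ℝ} (hb : 0 ≤ b) :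
    1 + 2 * latticeRho Δ ^ 2 -
        2 * latticeFreq Δ ^ 2 * (2 * latticeRho Δ ^ 2 + 9 * latticeRho Δ ^ 8) +
        b * latticeRho Δ * (latticeFreq Δ ^ 2 - 2) - 2.2 * b * latticeRho Δ ^ 5 ≤
      2 * ∑' d : ℕ, Δ ^ 2 / 2 * ((d + 1 : ℕ) : ℝ) ^ 2 * pairWeight Δ b (d + 1) := by
  have h1 := pairWeight_tsum_int h0 b 2 even_two
  have t0 := tsum_sq_theta (τ := Δ ^ 2 / 4) (by positivity) 0
  have t1 := tsum_sq_theta (τ := Δ ^ 2 / 4) (by positivity) (1 / 2)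
  rw [t0, t1] at h1
  have d0 := (tsum_dual_zero h0 h3).1
  have d0' := tsum_dual_zero_sq_le h0 h3
  have d1 := (tsum_dual_half h0 h3).2
  have d1' := tsum_dual_half_sq_ge h0
  have hs := sqrt_pi_div h0
  set S0 := ∑' n : ℤ, Real.exp (-(Real.pi ^ 2 / (Δ ^ 2 / 4)) * ((n : ℝ) + 0) ^ 2)
  set S0' := ∑' n : ℤ, ((n : ℝ) + 0) ^ 2 *
    Real.exp (-(Real.pi ^ 2 / (Δ ^ 2 / 4)) * ((n : ℝ) + 0) ^ 2)
  set S1 := ∑' n : ℤ, Real.exp (-(Real.pi ^ 2 / (Δ ^ 2 / 4)) * ((n : ℝ) + 1 / 2) ^ 2)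
  set S1' := ∑' n : ℤ, ((n : ℝ) + 1 / 2) ^ 2 *
    Real.exp (-(Real.pi ^ 2 / (Δ ^ 2 / 4)) * ((n : ℝ) + 1 / 2) ^ 2)
  have e1 : 2 * ∑' d : ℕ, Δ ^ 2 / 2 * ((d + 1 : ℕ) : ℝ) ^ 2 * pairWeight Δ b (d + 1) =
      Δ ^ 2 / 2 * ((0 : ℝ) ^ 2 * pairWeight Δ b 0 +
      2 * ∑' d : ℕ, ((d + 1 : ℕ) : ℝ) ^ 2 * pairWeight Δ b (d + 1)) := by
    simp only [mul_assoc, tsum_mul_left]; ring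
  have hω : latticeFreq Δ ^ 2 = 4 * Real.pi ^ 2 / Δ ^ 2 := by
    rw [latticeFreq, div_pow, mul_pow]; norm_num
  rw [e1, h1]
  have e2 : Δ ^ 2 / 2 * (Δ / (2 * √Real.pi) * (√(Real.pi / (Δ ^ 2 / 4)) *
      (1 / (2 * (Δ ^ 2 / 4)) * S0 - Real.pi ^ 2 / (Δ ^ 2 / 4) ^ 2 * S0') -
      b * latticeEta Δ * (√(Real.pi / (Δ ^ 2 / 4)) *
      (1 / (2 * (Δ ^ 2 / 4)) * S1 - Real.pi ^ 2 / (Δ ^ 2 / 4) ^ 2 * S1')))) =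
      (Δ / (2 * √Real.pi) * √(Real.pi / (Δ ^ 2 / 4))) * (S0 - 2 * latticeFreq Δ ^ 2 * S0' -
        b * latticeEta Δ * (S1 - 2 * latticeFreq Δ ^ 2 * S1')) := by
    rw [hω]; field_simp; ring
  rw [e2, hs, one_mul]
  have hbe : 0 ≤ b * latticeEta Δ := mul_nonneg hb (latticeEta_pos Δ).le
  have hw : 0 ≤ 2 * latticeFreq Δ ^ 2 := by positivity
  have h4 : S1 - 2 * latticeFreq Δ ^ 2 * S1' ≤ 2 * latticeEta Δ + 2.2 * latticeEta Δ ^ 9 -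
      latticeFreq Δ ^ 2 * latticeEta Δ := by
    have := mul_le_mul_of_nonneg_left d1' hw
    linarith
  have h5 := mul_le_mul_of_nonneg_left h4 hbe
  have h6 := mul_le_mul_of_nonneg_left d0' hw
  have h7 : b * latticeEta Δ * (2 * latticeEta Δ + 2.2 * latticeEta Δ ^ 9 -
      latticeFreq Δ ^ 2 * latticeEta Δ) = -(b * latticeRho Δ * (latticeFreq Δ ^ 2 - 2)) +
      2.2 * b * latticeRho Δ ^ 5 := by
    rw [← latticeEta_sq]; ring
  linarith

/-- The periodised Gaussian is a constant plus one harmonic, up to a tiny error. -/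
lemma abs_lattice_sum_sub_le (h0 : 0 < Δ) (h3 : Δ ≤ 3) (y : ℝ) :
    |Δ / √(2 * Real.pi) * ∑' n : ℤ, bump (n * Δ) y -
      (1 + 2 * latticeRho Δ * Real.cos (latticeFreq Δ * y))| ≤ 2.1 * latticeRho Δ ^ 4 := by
  have hpi := Real.pi_pos
  -- With shift -y/Δ the dual side is the lattice of bumps and the original side is its Fourier
  -- series, whose n-th harmonic has weight ρ^(n²). Everything beyond n = 1 is the error term.
  have t := tsum_theta (τ := 2 * Real.pi ^ 2 / Δ ^ 2) (by positivity) (-(y / Δ))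
  have e1 : ∀ n : ℤ, Real.exp (-(Real.pi ^ 2 / (2 * Real.pi ^ 2 / Δ ^ 2)) *
      ((n : ℝ) + -(y / Δ)) ^ 2) = bump (n * Δ) y := fun n => by
    rw [bump]; congr 1; field_simp; ring
  have e2 : √(Real.pi / (2 * Real.pi ^ 2 / Δ ^ 2)) = Δ / √(2 * Real.pi) := by
    rw [← Real.sqrt_sq h0.le, ← Real.sqrt_div (by positivity), Real.sqrt_sq h0.le]
    congr 1; field_simp
  simp only [e1, e2] at t
  rw [← t]
  have hr := latticeRho_le h0 h3
  have hr0 := latticeRho_pos Δ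
  have hs1 := summable_pow_sq hr0.le (by linarith)
  have hs : Summable fun n : ℕ => latticeRho Δ ^ (n ^ 2) * Real.cos (latticeFreq Δ * y * n) := by
    refine Summable.of_norm_bounded hs1 fun n => ?_
    rw [norm_mul, Real.norm_of_nonneg (by positivity)]
    exact mul_le_of_le_one_right (by positivity) (Real.abs_cos_le_one _)
  have e3 : ∀ n : ℕ, Real.exp (-(2 * Real.pi ^ 2 / Δ ^ 2) * (n : ℝ) ^ 2) =
      latticeRho Δ ^ (n ^ 2) := fun n => exp_neg_mul_natCast_sq _ n
  rw [tsum_int_eq_of_even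
    (g := fun n : ℕ => latticeRho Δ ^ (n ^ 2) * Real.cos (latticeFreq Δ * y * n))
    (fun n => by
      simp only [Int.cast_natCast]
      rw [e3]
      congr 1
      rw [← Real.cos_neg]; congr 1; rw [latticeFreq]; ring)
    (fun n => by
      have h := e3 (n + 1)
      push_cast at h ⊢
      rw [← h]
      congr 2
      · ring
      · rw [latticeFreq]; ring) hs]
  have hs2 : Summable fun n : ℕ => latticeRho Δ ^ ((n + 2) ^ 2) :=
    (summable_nat_add_iff (f := fun n : ℕ => latticeRho Δ ^ (n ^ 2)) 2).2 hs1
  have hT := hs.sum_add_tsum_nat_add 2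
  set T := ∑' n : ℕ, latticeRho Δ ^ ((n + 2) ^ 2) *
      Real.cos (latticeFreq Δ * y * ((n + 2 : ℕ) : ℝ)) with hTdef
  have h1 : |T| ≤ 1.01 * latticeRho Δ ^ 4 := by
    rw [← Real.norm_eq_abs]
    refine (tsum_of_norm_bounded hs2.hasSum fun n => ?_).trans (tsum_pow_sq_tail_le hr0.le hr)
    rw [norm_mul, Real.norm_of_nonneg (by positivity)]
    exact mul_le_of_le_one_right (by positivity) (Real.abs_cos_le_one _)
  have hr4 : 0 ≤ latticeRho Δ ^ 4 := by positivity
  have e5 := hs.tsum_eq_zero_add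
  rw [e5, Finset.sum_range_succ, Finset.sum_range_one] at hT
  norm_num at hT ⊢
  rw [abs_le] at h1 ⊢
  constructor <;> linarith [h1.1, h1.2]

end Dual

/-! ### Pair and triple integrals, and expansion of powers of P over the grid. -/

/-- Functions whose products with up to three Gaussian bumps are integrable. -/
structure BumpIntegrable (f : ℝ → ℝ) : Prop where
  two : ∀ x x', Integrable fun y => bump x y * bump x' y * f y
  three : ∀ x x' x'', Integrable fun y => bump x y * bump x' y * bump x'' y * f y

namespace BumpIntegrable
variable {f g : ℝ → ℝ}

lemma sub (hf : BumpIntegrable f) (hg : BumpIntegrable g) :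
    BumpIntegrable fun y => f y - g y where
  two x x' := by simp only [mul_sub]; exact (hf.two x x').sub (hg.two x x')
  three x x' x'' := by simp only [mul_sub]; exact (hf.three x x' x'').sub (hg.three x x' x'')

lemma add (hf : BumpIntegrable f) (hg : BumpIntegrable g) :
    BumpIntegrable fun y => f y + g y where
  two x x' := by simp only [mul_add]; exact (hf.two x x').add (hg.two x x')
  three x x' x'' := by simp only [mul_add]; exact (hf.three x x' x'').add (hg.three x x' x'')

lemma const_mul (hf : BumpIntegrable f) (c : ℝ) : BumpIntegrable fun y => c * f y where
  two x x' := by simpa only [mul_left_comm] using (hf.two x x').const_mul c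
  three x x' x'' := by simpa only [mul_left_comm] using (hf.three x x' x'').const_mul c

lemma exp_cos (c θ : ℝ) : BumpIntegrable fun y => Real.exp (c * y) * Real.cos (θ * y) where
  two x x' := (integral_bump_pair x x' c θ).1
  three x x' x'' := (integral_bump_triple x x' x'' c θ).1

lemma cos (θ : ℝ) : BumpIntegrable fun y => Real.cos (θ * y) := by simpa using exp_cos 0 θ
lemma exp (c : ℝ) : BumpIntegrable fun y => Real.exp (c * y) := by simpa using exp_cos c 0
lemma const (c : ℝ) : BumpIntegrable fun _ => c := by simpa using (exp 0).const_mul c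

end BumpIntegrable

/-- Normalised integral of `f` against two bumps of the grid of spacing `Δ`. -/
noncomputable def pairInt (f : ℝ → ℝ) (Δ i j : ℝ) : ℝ :=
  Δ / (2 * Real.pi) * ∫ y, bump (i * Δ) y * bump (j * Δ) y * f y

/-- Normalised integral of `f` against three bumps of the grid of spacing `Δ`. -/
noncomputable def tripleInt (f : ℝ → ℝ) (Δ i j k : ℝ) : ℝ :=
  Δ ^ 2 / (2 * Real.pi * √(2 * Real.pi)) *
    ∫ y, bump (i * Δ) y * bump (j * Δ) y * bump (k * Δ) y * f y

section Linear
variable {f g : ℝ → ℝ} (Δ : ℝ)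

lemma pairInt_sub (hf : BumpIntegrable f) (hg : BumpIntegrable g) (i j : ℝ) :
    pairInt (fun y => f y - g y) Δ i j = pairInt f Δ i j - pairInt g Δ i j := by
  unfold pairInt
  simp only [mul_sub]
  rw [integral_sub (hf.two _ _) (hg.two _ _)]; ring

lemma pairInt_add (hf : BumpIntegrable f) (hg : BumpIntegrable g) (i j : ℝ) :
    pairInt (fun y => f y + g y) Δ i j = pairInt f Δ i j + pairInt g Δ i j := by
  unfold pairInt
  simp only [mul_add]
  rw [integral_add (hf.two _ _) (hg.two _ _)]; ring

lemma pairInt_const_mul (c i j : ℝ) :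
    pairInt (fun y => c * f y) Δ i j = c * pairInt f Δ i j := by
  unfold pairInt
  simp only [mul_left_comm _ c]
  rw [integral_const_mul]; ring

lemma tripleInt_sub (hf : BumpIntegrable f) (hg : BumpIntegrable g) (i j k : ℝ) :
    tripleInt (fun y => f y - g y) Δ i j k = tripleInt f Δ i j k - tripleInt g Δ i j k := by
  unfold tripleInt
  simp only [mul_sub]
  rw [integral_sub (hf.three _ _ _) (hg.three _ _ _)]; ring

lemma tripleInt_add (hf : BumpIntegrable f) (hg : BumpIntegrable g) (i j k : ℝ) :
    tripleInt (fun y => f y + g y) Δ i j k = tripleInt f Δ i j k + tripleInt g Δ i j k := by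
  unfold tripleInt
  simp only [mul_add]
  rw [integral_add (hf.three _ _ _) (hg.three _ _ _)]; ring

lemma tripleInt_const_mul (c i j k : ℝ) :
    tripleInt (fun y => c * f y) Δ i j k = c * tripleInt f Δ i j k := by
  unfold tripleInt
  simp only [mul_left_comm _ c]
  rw [integral_const_mul]; ring

end Linear

lemma pairInt_exp_cos (c θ Δ i j : ℝ) :
    pairInt (fun y => Real.exp (c * y) * Real.cos (θ * y)) Δ i j =
      Δ / (2 * √Real.pi) * (Real.exp (-(Δ ^ 2 / 4) * (i - j) ^ 2 + (c * (Δ * (i + j) / 2) +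
        (c ^ 2 - θ ^ 2) / 4)) * Real.cos (θ * (Δ * (i + j) / 2) + c * θ / 2)) := by
  rw [pairInt, (integral_bump_pair _ _ _ _).2]
  have hpi := Real.pi_pos
  have h1 : Δ / (2 * Real.pi) * √Real.pi = Δ / (2 * √Real.pi) := by
    have h2 := Real.sq_sqrt hpi.le
    have h3 : 0 < √Real.pi := Real.sqrt_pos.2 hpi
    rw [div_mul_eq_mul_div, div_eq_div_iff (by positivity) (by positivity)]
    linear_combination (2 * Δ) * h2
  rw [← mul_assoc, h1]
  congr 3
  · ring_nf
  · ring_nf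

lemma tripleInt_exp_cos (c θ Δ i j k : ℝ) :
    tripleInt (fun y => Real.exp (c * y) * Real.cos (θ * y)) Δ i j k =
      Δ ^ 2 / (2 * Real.pi * √3) *
        (Real.exp (-(Δ ^ 2 / 2) * (i ^ 2 + j ^ 2 + k ^ 2 - (i + j + k) ^ 2 / 3) +
        (c * (Δ * (i + j + k) / 3) + (c ^ 2 - θ ^ 2) / 6)) *
        Real.cos (θ * (Δ * (i + j + k) / 3) + c * θ / 3)) := by
  rw [tripleInt, (integral_bump_triple _ _ _ _ _).2]
  have hpi := Real.pi_pos
  have h1 : Δ ^ 2 / (2 * Real.pi * √(2 * Real.pi)) * √(2 * Real.pi / 3) =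
      Δ ^ 2 / (2 * Real.pi * √3) := by
    rw [Real.sqrt_div (by positivity)]
    have h2 : 0 < √(2 * Real.pi) := Real.sqrt_pos.2 (by positivity)
    have h3 : 0 < √3 := Real.sqrt_pos.2 (by norm_num)
    field_simp
  rw [← mul_assoc, h1]
  congr 3
  · ring_nf
  · ring_nf

lemma pamMoment_zero_eq (M : ℕ) (Δ y : ℝ) :
    pamMoment M 0 Δ y = ∑ i ∈ Finset.range M, bump (i * Δ) y := by simp [pamMoment]

section Expand
variable {f : ℝ → ℝ} (M : ℕ) (Δ : ℝ)

lemma pamMoment_sq_mul (y : ℝ) : pamMoment M 0 Δ y ^ 2 * f y =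
    ∑ i ∈ Finset.range M, ∑ j ∈ Finset.range M, bump (i * Δ) y * bump (j * Δ) y * f y := by
  rw [pamMoment_zero_eq, pow_two, Finset.sum_mul_sum]
  simp only [Finset.sum_mul]

lemma pamMoment_cube_mul (y : ℝ) : pamMoment M 0 Δ y ^ 3 * f y =
    ∑ i ∈ Finset.range M, ∑ j ∈ Finset.range M, ∑ k ∈ Finset.range M,
      bump (i * Δ) y * bump (j * Δ) y * bump (k * Δ) y * f y := by
  rw [pamMoment_zero_eq, pow_succ, pow_two, Finset.sum_mul_sum]
  simp only [Finset.sum_mul]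
  refine Finset.sum_congr rfl fun i _ => Finset.sum_congr rfl fun j _ => ?_
  rw [Finset.mul_sum, Finset.sum_mul]

/-- A variance is half the mean squared difference of two independent copies. Multiplying by P²
removes all denominators, so the result is polynomial in the bumps. -/
lemma pamMoment_sq_mul_pamVar {M : ℕ} (hM : 1 ≤ M) (y : ℝ) :
    pamMoment M 0 Δ y ^ 2 * pamVar M Δ y = ∑ i ∈ Finset.range M, ∑ j ∈ Finset.range M,
      1 / 2 * ((i : ℝ) - j) ^ 2 * (bump (i * Δ) y * bump (j * Δ) y) := by
  have hp := (pamMoment_zero_pos hM Δ y).ne'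
  have h1 : pamMoment M 0 Δ y ^ 2 * pamVar M Δ y =
      pamMoment M 2 Δ y * pamMoment M 0 Δ y - pamMoment M 1 Δ y * pamMoment M 1 Δ y := by
    unfold pamVar; field_simp
  have h2 : ∀ i j : ℕ, 1 / 2 * ((i : ℝ) - j) ^ 2 * (bump (i * Δ) y * bump (j * Δ) y) =
      1 / 2 * (((i : ℝ) ^ 2 * bump (i * Δ) y) * ((j : ℝ) ^ 0 * bump (j * Δ) y) +
      ((i : ℝ) ^ 0 * bump (i * Δ) y) * ((j : ℝ) ^ 2 * bump (j * Δ) y)) -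
      ((i : ℝ) ^ 1 * bump (i * Δ) y) * ((j : ℝ) ^ 1 * bump (j * Δ) y) := fun i j => by ring
  simp only [h2, Finset.sum_sub_distrib, Finset.sum_add_distrib, ← Finset.mul_sum,
    ← Finset.sum_mul]
  rw [h1]
  simp only [pamMoment]
  ring

variable (hf : BumpIntegrable f)
include hf

lemma integral_pamMoment_sq_mul :
    Integrable (fun y => pamMoment M 0 Δ y ^ 2 * f y) ∧
    Δ / (2 * Real.pi) * ∫ y, pamMoment M 0 Δ y ^ 2 * f y =
      ∑ i ∈ Finset.range M, ∑ j ∈ Finset.range M, pairInt f Δ i j := by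
  simp only [pamMoment_sq_mul]
  have h1 : ∀ i ∈ Finset.range M, Integrable fun y =>
    ∑ j ∈ Finset.range M, bump (i * Δ) y * bump (j * Δ) y * f y := fun i _ =>
      integrable_finsetSum _ fun j _ => hf.two _ _
  refine ⟨integrable_finsetSum _ h1, ?_⟩
  rw [integral_finsetSum _ h1, Finset.mul_sum]
  refine Finset.sum_congr rfl fun i _ => ?_
  rw [integral_finsetSum _ fun j _ => hf.two _ _, Finset.mul_sum]
  rfl

lemma integral_pamMoment_cube_mul :
    Integrable (fun y => pamMoment M 0 Δ y ^ 3 * f y) ∧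
    Δ ^ 2 / (2 * Real.pi * √(2 * Real.pi)) * ∫ y, pamMoment M 0 Δ y ^ 3 * f y =
      ∑ i ∈ Finset.range M, ∑ j ∈ Finset.range M, ∑ k ∈ Finset.range M,
        tripleInt f Δ i j k := by
  simp only [pamMoment_cube_mul]
  have h2 : ∀ i, ∀ j ∈ Finset.range M, Integrable fun y => ∑ k ∈ Finset.range M,
      bump (i * Δ) y * bump (j * Δ) y * bump (k * Δ) y * f y := fun i _ _ =>
    integrable_finsetSum _ fun k _ => hf.three _ _ _
  have h1 : ∀ i ∈ Finset.range M, Integrable fun y => ∑ j ∈ Finset.range M,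
      ∑ k ∈ Finset.range M, bump (i * Δ) y * bump (j * Δ) y * bump (k * Δ) y * f y :=
    fun i _ => integrable_finsetSum _ (h2 i)
  refine ⟨integrable_finsetSum _ h1, ?_⟩
  rw [integral_finsetSum _ h1, Finset.mul_sum]
  refine Finset.sum_congr rfl fun i _ => ?_
  rw [integral_finsetSum _ (h2 i), Finset.mul_sum]
  refine Finset.sum_congr rfl fun j _ => ?_
  rw [integral_finsetSum _ fun k _ => hf.three _ _ _, Finset.mul_sum]
  rfl

lemma integral_pamMoment_sq_mul_pamVar {M : ℕ} (hM : 1 ≤ M) :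
    Integrable (fun y => pamMoment M 0 Δ y ^ 2 * pamVar M Δ y * f y) ∧
    Δ / (2 * Real.pi) * ∫ y, pamMoment M 0 Δ y ^ 2 * pamVar M Δ y * f y =
      ∑ i ∈ Finset.range M, ∑ j ∈ Finset.range M,
        1 / 2 * ((i : ℝ) - j) ^ 2 * pairInt f Δ i j := by
  simp only [pamMoment_sq_mul_pamVar Δ hM, Finset.sum_mul]
  have h2 : ∀ i j : ℝ, Integrable fun y =>
      1 / 2 * (i - j) ^ 2 * (bump (i * Δ) y * bump (j * Δ) y) * f y := fun i j => by
    refine ((hf.two (i * Δ) (j * Δ)).const_mul (1 / 2 * (i - j) ^ 2)).congr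
      (Eventually.of_forall fun y => ?_)
    ring
  have h1 : ∀ i ∈ Finset.range M, Integrable fun y => ∑ j ∈ Finset.range M,
      1 / 2 * ((i : ℝ) - j) ^ 2 * (bump (i * Δ) y * bump (j * Δ) y) * f y := fun i _ =>
    integrable_finsetSum _ fun j _ => h2 i j
  refine ⟨integrable_finsetSum _ h1, ?_⟩
  rw [integral_finsetSum _ h1, Finset.mul_sum]
  refine Finset.sum_congr rfl fun i _ => ?_
  rw [integral_finsetSum _ fun j _ => h2 i (j : ℕ), Finset.mul_sum]
  refine Finset.sum_congr rfl fun j _ => ?_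
  simp only [mul_assoc, integral_const_mul]
  rw [pairInt]
  simp only [mul_assoc]
  ring

end Expand

lemma integral_bump (x : ℝ) : Integrable (bump x) ∧ ∫ y, bump x y = √(2 * Real.pi) := by
  have := integral_bump_mul x 0 0
  simpa using this

lemma integral_pamMoment_zero (M : ℕ) (Δ : ℝ) :
    Integrable (pamMoment M 0 Δ) ∧ ∫ y, pamMoment M 0 Δ y = M * √(2 * Real.pi) := by
  have h : pamMoment M 0 Δ = fun y => ∑ i ∈ Finset.range M, bump (i * Δ) y :=
    funext fun y => pamMoment_zero_eq M Δ y
  rw [h]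
  refine ⟨integrable_finsetSum _ fun i _ => (integral_bump _).1, ?_⟩
  rw [integral_finsetSum _ fun i _ => (integral_bump _).1]
  simp [(integral_bump _).2]

lemma integrable_pamMoment_mul_pamVar_pow {M : ℕ} (hM : 1 ≤ M) (Δ : ℝ) (n : ℕ) :
    Integrable fun y => pamMoment M 0 Δ y * pamVar M Δ y ^ n := by
  have := integrable_mul_pamMoment (M := M) Δ (n := 0) (by norm_num)
    (u := fun y => pamVar M Δ y ^ n) (A := ((M : ℝ) ^ 2) ^ n)
    ((continuous_pamVar hM Δ).pow n) fun y => by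
      rw [abs_pow]
      refine (pow_le_pow_left₀ (abs_nonneg _) (pamVar_abs_le hM Δ y) n).trans ?_
      exact le_mul_of_one_le_right (by positivity) (one_le_one_add_sq y)
  simpa only [mul_comm] using this

/-! ### The tangent inequality that replaces ∫ P u² by computable integrals. -/

/-- Tangent-plane criterion: a multiplier `f` certifies the second moment bound. -/
lemma pamVarIntegral_one_le_of_multiplier {M : ℕ} (hM : 1 ≤ M) {Δ a : ℝ} (hΔ : 0 < Δ) (ha : 0 < a)
    {f : ℝ → ℝ} (hf : BumpIntegrable f) (hf2 : BumpIntegrable fun y => f y ^ 2)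
    (h : (M + 2 * ∑ i ∈ Finset.range M, ∑ j ∈ Finset.range M, pairInt f Δ i j +
      ∑ i ∈ Finset.range M, ∑ j ∈ Finset.range M, ∑ k ∈ Finset.range M,
        tripleInt (fun y => f y ^ 2) Δ i j k) / 4 ≤
      a * ∑ i ∈ Finset.range M, ∑ j ∈ Finset.range M,
        Δ ^ 2 / 2 * ((i : ℝ) - j) ^ 2 * pairInt f Δ i j) :
    pamVarIntegral M 1 Δ ≤ a * Δ ^ 2 * pamVarIntegral M 2 Δ := by
  have hpi := Real.pi_pos
  set r := √(2 * Real.pi) with hr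
  have hr0 : 0 < r := Real.sqrt_pos.2 (by positivity)
  have hrr : r ^ 2 = 2 * Real.pi := Real.sq_sqrt (by positivity)
  set α := Δ / r with hα
  have hα0 : 0 < α := by positivity
  obtain ⟨i1, e1⟩ := integral_pamMoment_zero M Δ
  obtain ⟨i2, e2⟩ := integral_pamMoment_sq_mul M Δ hf
  obtain ⟨i3, e3⟩ := integral_pamMoment_cube_mul M Δ hf2
  obtain ⟨i4, e4⟩ := integral_pamMoment_sq_mul_pamVar Δ hf hM
  have i5 := integrable_pamMoment_mul_pamVar_pow hM Δ 1
  have i6 := integrable_pamMoment_mul_pamVar_pow hM Δ 2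
  have e4' : ∑ i ∈ Finset.range M, ∑ j ∈ Finset.range M,
      Δ ^ 2 / 2 * ((i : ℝ) - j) ^ 2 * pairInt f Δ i j =
      Δ ^ 2 * (Δ / (2 * Real.pi) * ∫ y, pamMoment M 0 Δ y ^ 2 * pamVar M Δ y * f y) := by
    rw [e4, Finset.mul_sum]
    refine Finset.sum_congr rfl fun i _ => ?_
    rw [Finset.mul_sum]
    exact Finset.sum_congr rfl fun j _ => by ring
  rw [e4', ← e2, ← e3] at h
  set I1 := ∫ y, pamMoment M 0 Δ y
  set I2 := ∫ y, pamMoment M 0 Δ y ^ 2 * f y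
  set I3 := ∫ y, pamMoment M 0 Δ y ^ 3 * f y ^ 2
  set I4 := ∫ y, pamMoment M 0 Δ y ^ 2 * pamVar M Δ y * f y
  -- In this inequality the only integrals not polynomial in the bumps are the two quantities to be
  -- compared. The terms I1 to I4 expand into the single, pair and triple integrals.
  have key : 0 ≤ a * (Δ ^ 4 * pamVarIntegral M 2 Δ) - Δ ^ 2 * pamVarIntegral M 1 Δ -
      (Δ ^ 2 * α * I4 - 1 / (4 * a) * (I1 + 2 * α * I2 + α ^ 2 * I3)) := by
    have hint : ∫ y, (a * (Δ ^ 4 * (pamMoment M 0 Δ y * pamVar M Δ y ^ 2)) -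
        Δ ^ 2 * (pamMoment M 0 Δ y * pamVar M Δ y ^ 1) -
        (Δ ^ 2 * α * (pamMoment M 0 Δ y ^ 2 * pamVar M Δ y * f y) -
          1 / (4 * a) * (pamMoment M 0 Δ y + 2 * α * (pamMoment M 0 Δ y ^ 2 * f y) +
            α ^ 2 * (pamMoment M 0 Δ y ^ 3 * f y ^ 2)))) =
        a * (Δ ^ 4 * pamVarIntegral M 2 Δ) - Δ ^ 2 * pamVarIntegral M 1 Δ -
        (Δ ^ 2 * α * I4 - 1 / (4 * a) * (I1 + 2 * α * I2 + α ^ 2 * I3)) := by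
      have j1 := (i6.const_mul (Δ ^ 4)).const_mul a
      have j2 := i5.const_mul (Δ ^ 2)
      have j3 := i4.const_mul (Δ ^ 2 * α)
      have j4 := i1.add (i2.const_mul (2 * α))
      have j5 := i3.const_mul (α ^ 2)
      have j6 := (j4.add j5).const_mul (1 / (4 * a))
      have t1 := integral_sub (j1.sub j2) (j3.sub j6)
      have t2 := integral_sub j1 j2
      have t3 := integral_sub j3 j6
      have t4 := integral_add j4 j5
      have t5 := integral_add i1 (i2.const_mul (2 * α))
      have t6 := integral_const_mul (μ := volume) (1 / (4 * a)) fun y =>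
        (pamMoment M 0 Δ y + 2 * α * (pamMoment M 0 Δ y ^ 2 * f y)) +
            α ^ 2 * (pamMoment M 0 Δ y ^ 3 * f y ^ 2)
      refine t1.trans ?_
      refine (congrArg₂ (· - ·) t2 (t3.trans (congrArg₂ (· - ·) rfl (t6.trans (congrArg _
        (t4.trans (congrArg₂ (· + ·) t5 rfl))))))).trans ?_
      simp only [integral_const_mul]
      rfl
    rw [← hint]
    refine integral_nonneg fun y => ?_
    set P := pamMoment M 0 Δ y
    set u := pamVar M Δ y
    have hP : 0 ≤ P := pamMoment_nonneg _ _ _ _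
    -- Completing the square: the integrand is P times a square, vanishing where 2aΔ²u = 1 + αPf.
    -- Here αP is close to 1 in the bulk, so f close to 1 means Δ²u close to 1.
    have : a * (Δ ^ 4 * (P * u ^ 2)) - Δ ^ 2 * (P * u ^ 1) -
        (Δ ^ 2 * α * (P ^ 2 * u * f y) - 1 / (4 * a) * (P + 2 * α * (P ^ 2 * f y) +
          α ^ 2 * (P ^ 3 * f y ^ 2))) =
        P / (4 * a) * (2 * a * Δ ^ 2 * u - (1 + P * α * f y)) ^ 2 := by
      field_simp; ring
    simp only [Pi.zero_apply]
    rw [this]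
    positivity
  have h1 : α = r * (Δ / (2 * Real.pi)) := by rw [hα, ← hrr]; field_simp
  have h2 : α ^ 2 = r * (Δ ^ 2 / (2 * Real.pi * r)) := by
    rw [hα, div_pow, hrr]; field_simp
  have h3 : Δ ^ 2 * α * I4 - 1 / (4 * a) * (I1 + 2 * α * I2 + α ^ 2 * I3) =
      r / a * (a * (Δ ^ 2 * (Δ / (2 * Real.pi) * I4)) -
        (M + 2 * (Δ / (2 * Real.pi) * I2) + Δ ^ 2 / (2 * Real.pi * r) * I3) / 4) := by
    rw [h2, h1, e1, ← hr]; field_simp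
  have h4 : 0 ≤ r / a * (a * (Δ ^ 2 * (Δ / (2 * Real.pi) * I4)) -
        (M + 2 * (Δ / (2 * Real.pi) * I2) + Δ ^ 2 / (2 * Real.pi * r) * I3) / 4) :=
    mul_nonneg (by positivity) (by linarith)
  rw [h3] at key
  have h5 : Δ ^ 2 * pamVarIntegral M 1 Δ ≤ Δ ^ 2 * (a * Δ ^ 2 * pamVarIntegral M 2 Δ) := by
    nlinarith
  exact le_of_mul_le_mul_left h5 (by positivity)

/-! ### Geometric recursions in the number of levels. -/

section Recursion

/-- The cube of indices is split according to which of them vanish. Symmetry produces the factors 3,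
and covariance under the diagonal shift turns the part with no zero index into the previous sum. -/
lemma sum_range_triple_succ {K : ℕ → ℕ → ℕ → ℝ} {μ : ℝ} (hs : ∀ i j k, K i j k = K j i k)
    (hs' : ∀ i j k, K i j k = K i k j)
    (hc : ∀ i j k, K (i + 1) (j + 1) (k + 1) = μ * K i j k) (M : ℕ) :
    ∑ i ∈ Finset.range (M + 1), ∑ j ∈ Finset.range (M + 1), ∑ k ∈ Finset.range (M + 1), K i j k =
      K 0 0 0 + 3 * ∑ k ∈ Finset.range M, K 0 0 (k + 1) +
        3 * ∑ j ∈ Finset.range M, ∑ k ∈ Finset.range M, K 0 (j + 1) (k + 1) +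
        μ * ∑ i ∈ Finset.range M, ∑ j ∈ Finset.range M, ∑ k ∈ Finset.range M, K i j k := by
  simp only [Finset.sum_range_succ' _ M, hc, Finset.sum_add_distrib, ← Finset.mul_sum]
  have h1 : ∀ i j, K (i + 1) (j + 1) 0 = K 0 (i + 1) (j + 1) := fun i j => by
    rw [hs' (i + 1), hs (i + 1)]
  have h2 : ∀ i j, K (i + 1) 0 (j + 1) = K 0 (i + 1) (j + 1) := fun i j => hs _ _ _
  have h3 : ∀ i, K (i + 1) 0 0 = K 0 0 (i + 1) := fun i => by rw [hs, hs' 0]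
  have h4 : ∀ i, K 0 (i + 1) 0 = K 0 0 (i + 1) := fun i => hs' _ _ _
  simp only [h1, h2, h3, h4]
  ring

lemma le_div_of_recursion {S : ℕ → ℝ} {μ C : ℝ} (hμ : 0 ≤ μ) (hμ1 : μ < 1) (hC : 0 ≤ C)
    (h0 : S 0 = 0) (h : ∀ n, S (n + 1) ≤ C + μ * S n) (n : ℕ) : S n ≤ C / (1 - μ) := by
  have h1 : 0 < 1 - μ := by linarith
  induction n with
  | zero => rw [h0]; positivity
  | succ n ih =>
    calc S (n + 1) ≤ C + μ * (C / (1 - μ)) := (h n).trans (by gcongr)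
      _ = _ := by field_simp; ring

/-- The fixed point of the recursion is C/(1 - μ). Starting from a nonnegative value at step m, the
distance below it shrinks by μ at every step. -/
lemma div_mul_le_of_recursion {S : ℕ → ℝ} {μ C : ℝ} (hμ : 0 ≤ μ) (hμ1 : μ < 1) {m : ℕ}
    (h0 : 0 ≤ S m) (h : ∀ n, m ≤ n → C + μ * S n ≤ S (n + 1)) (n : ℕ) :
    C / (1 - μ) * (1 - μ ^ n) ≤ S (m + n) := by
  have h1 : 0 < 1 - μ := by linarith
  induction n with
  | zero => simpa using h0
  | succ n ih =>
    have h2 := h (m + n) (by omega)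
    have h3 := mul_le_mul_of_nonneg_left ih hμ
    calc _ = C + μ * (C / (1 - μ) * (1 - μ ^ n)) := by field_simp; ring
      _ ≤ _ := by rw [← add_assoc]; linarith

lemma sum_range_le_of_geometric {t : ℕ → ℝ} {A r : ℝ} (hA : 0 ≤ A) (hr : 0 ≤ r) (hr1 : r < 1)
    (h : ∀ n, t n ≤ A * r ^ n) (n : ℕ) : ∑ m ∈ Finset.range n, t m ≤ A / (1 - r) := by
  have h1 := (hasSum_geometric_of_lt_one hr hr1).mul_left A
  calc _ ≤ ∑ m ∈ Finset.range n, A * r ^ m := Finset.sum_le_sum fun m _ => h m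
    _ ≤ A * (1 - r)⁻¹ := sum_le_hasSum _ (fun m _ => by positivity) h1
    _ = _ := by rw [div_eq_mul_inv]

lemma sum_range_le_add_geometric {t : ℕ → ℝ} {A r : ℝ} (hA : 0 ≤ A) (hr : 0 ≤ r) (hr1 : r < 1)
    (m : ℕ) (h0 : ∀ n, 0 ≤ t n) (h : ∀ n, t (m + n) ≤ A * r ^ n) (n : ℕ) :
    ∑ k ∈ Finset.range n, t k ≤ ∑ k ∈ Finset.range m, t k + A / (1 - r) := by
  have h1 := sum_range_le_of_geometric hA hr hr1 h n
  calc _ ≤ ∑ k ∈ Finset.range (m + n), t k :=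
        Finset.sum_le_sum_of_subset_of_nonneg (Finset.range_subset_range.2 (by omega))
          fun k _ _ => h0 k
    _ = _ := Finset.sum_range_add _ _ _
    _ ≤ _ := by linarith

end Recursion

/-! ### Reflection of the grid, which reduces the right end to the left end. -/

section Reflect
variable (f : ℝ → ℝ) (M : ℕ) (Δ : ℝ)

lemma bump_reflect (i y : ℝ) : bump (i * Δ) ((M - 1) * Δ - y) = bump ((M - 1 - i) * Δ) y := by
  rw [bump, bump]; congr 1; ring

lemma pairInt_reflect (i j : ℝ) : pairInt (fun y => f ((M - 1) * Δ - y)) Δ i j =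
    pairInt f Δ (M - 1 - i) (M - 1 - j) := by
  rw [pairInt, pairInt, ← integral_sub_left_eq_self _ _ (((M : ℝ) - 1) * Δ)]
  simp only [bump_reflect, sub_sub_cancel]

lemma tripleInt_reflect (i j k : ℝ) : tripleInt (fun y => f ((M - 1) * Δ - y)) Δ i j k =
    tripleInt f Δ (M - 1 - i) (M - 1 - j) (M - 1 - k) := by
  rw [tripleInt, tripleInt, ← integral_sub_left_eq_self _ _ (((M : ℝ) - 1) * Δ)]
  simp only [bump_reflect, sub_sub_cancel]

lemma sum_range_reflect_real (g : ℝ → ℝ) :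
    ∑ i ∈ Finset.range M, g ((M : ℝ) - 1 - i) = ∑ i ∈ Finset.range M, g i := by
  rw [← Finset.sum_range_reflect]
  refine Finset.sum_congr rfl fun i hi => ?_
  have h := Finset.mem_range.1 hi
  congr 1
  rw [Nat.sub_sub, Nat.cast_sub (by omega)]; push_cast; ring

lemma sum_pairInt_reflect :
    ∑ i ∈ Finset.range M, ∑ j ∈ Finset.range M, pairInt (fun y => f ((M - 1) * Δ - y)) Δ i j =
      ∑ i ∈ Finset.range M, ∑ j ∈ Finset.range M, pairInt f Δ i j := by
  simp only [pairInt_reflect]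
  rw [sum_range_reflect_real M fun i => ∑ j ∈ Finset.range M, pairInt f Δ i (M - 1 - j)]
  exact Finset.sum_congr rfl fun i _ => sum_range_reflect_real M fun j => pairInt f Δ i j

lemma sum_sq_mul_pairInt_reflect :
    ∑ i ∈ Finset.range M, ∑ j ∈ Finset.range M, Δ ^ 2 / 2 * ((i : ℝ) - j) ^ 2 *
        pairInt (fun y => f ((M - 1) * Δ - y)) Δ i j =
      ∑ i ∈ Finset.range M, ∑ j ∈ Finset.range M,
        Δ ^ 2 / 2 * ((i : ℝ) - j) ^ 2 * pairInt f Δ i j := by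
  have e : ∀ i j : ℝ, Δ ^ 2 / 2 * (i - j) ^ 2 * pairInt (fun y => f ((M - 1) * Δ - y)) Δ i j =
      Δ ^ 2 / 2 * ((M - 1 - i) - (M - 1 - j)) ^ 2 * pairInt f Δ (M - 1 - i) (M - 1 - j) :=
    fun i j => by rw [pairInt_reflect]; ring
  simp only [e]
  rw [sum_range_reflect_real M fun i => ∑ j ∈ Finset.range M, Δ ^ 2 / 2 * (i - (M - 1 - j)) ^ 2 *
    pairInt f Δ i (M - 1 - j)]
  exact Finset.sum_congr rfl fun i _ => sum_range_reflect_real M fun j =>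
    Δ ^ 2 / 2 * (i - j) ^ 2 * pairInt f Δ i j

lemma sum_tripleInt_reflect :
    ∑ i ∈ Finset.range M, ∑ j ∈ Finset.range M, ∑ k ∈ Finset.range M,
        tripleInt (fun y => f ((M - 1) * Δ - y)) Δ i j k =
      ∑ i ∈ Finset.range M, ∑ j ∈ Finset.range M, ∑ k ∈ Finset.range M,
        tripleInt f Δ i j k := by
  simp only [tripleInt_reflect]
  rw [sum_range_reflect_real M fun i => ∑ j ∈ Finset.range M, ∑ k ∈ Finset.range M,
    tripleInt f Δ i (M - 1 - j) (M - 1 - k)]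
  refine Finset.sum_congr rfl fun i _ => ?_
  rw [sum_range_reflect_real M fun j => ∑ k ∈ Finset.range M, tripleInt f Δ i j (M - 1 - k)]
  exact Finset.sum_congr rfl fun j _ => sum_range_reflect_real M fun k => tripleInt f Δ i j k

end Reflect

/-! ### Index symmetry, positivity and diagonal shifts. -/

section Symmetry
variable (f : ℝ → ℝ) (Δ : ℝ)

lemma pairInt_comm (i j : ℝ) : pairInt f Δ i j = pairInt f Δ j i := by
  simp only [pairInt, mul_comm (bump (i * Δ) _)]

lemma tripleInt_comm_left (i j k : ℝ) : tripleInt f Δ i j k = tripleInt f Δ j i k := by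
  simp only [tripleInt, mul_comm (bump (i * Δ) _)]

lemma tripleInt_comm_right (i j k : ℝ) : tripleInt f Δ i j k = tripleInt f Δ i k j := by
  simp only [tripleInt, mul_right_comm (bump (i * Δ) _)]

variable {f Δ}

lemma pairInt_nonneg (hΔ : 0 ≤ Δ) (hf : ∀ y, 0 ≤ f y) (i j : ℝ) : 0 ≤ pairInt f Δ i j := by
  have := Real.pi_pos
  exact mul_nonneg (by positivity) (integral_nonneg fun y =>
    mul_nonneg (mul_nonneg (bump_pos _ _).le (bump_pos _ _).le) (hf y))

lemma tripleInt_nonneg (hf : ∀ y, 0 ≤ f y) (i j k : ℝ) : 0 ≤ tripleInt f Δ i j k := by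
  have := Real.pi_pos
  exact mul_nonneg (by positivity) (integral_nonneg fun y => mul_nonneg
    (mul_nonneg (mul_nonneg (bump_pos _ _).le (bump_pos _ _).le) (bump_pos _ _).le) (hf y))

lemma bump_succ_mul (i y : ℝ) : bump ((i + 1) * Δ) (y + Δ) = bump (i * Δ) y := by
  rw [bump, bump]; congr 1; ring

/-- Translation by one spacing moves both bumps by one level. A multiplier that scales by μ under it
makes the double sums satisfy a geometric recursion: μ = 1 for the bulk multiplier and μ < 1 for the
tilt. -/
lemma pairInt_shift {μ : ℝ} (hf : ∀ y, f (y + Δ) = μ * f y) (i j : ℝ) :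
    pairInt f Δ (i + 1) (j + 1) = μ * pairInt f Δ i j := by
  rw [pairInt, pairInt, ← integral_add_right_eq_self _ Δ]
  simp only [bump_succ_mul, hf, mul_left_comm _ μ, integral_const_mul]

lemma tripleInt_shift {μ : ℝ} (hf : ∀ y, f (y + Δ) = μ * f y) (i j k : ℝ) :
    tripleInt f Δ (i + 1) (j + 1) (k + 1) = μ * tripleInt f Δ i j k := by
  rw [tripleInt, tripleInt, ← integral_add_right_eq_self _ Δ]
  simp only [bump_succ_mul, hf, mul_left_comm _ μ, integral_const_mul]

end Symmetry

/-! ### The multiplier: explicit integrals of its bulk and edge parts. -/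

/-- Exponential tilt that corrects the multiplier near the edge of the constellation. -/
noncomputable def edgeTilt (Δ y : ℝ) : ℝ := Real.exp (-(3 / 5 * Δ) * y)

/-- The multiplier `1 - b cos (ω y)` used in the bulk of the constellation. -/
noncomputable def bulkMultiplier (Δ b y : ℝ) : ℝ := 1 - b * Real.cos (latticeFreq Δ * y)

/-- The decay `exp (-r Δ²)`. -/
noncomputable def decay (Δ r : ℝ) : ℝ := Real.exp (-(r * Δ ^ 2))

/-- The constant `exp (-2π²/(3Δ²))`. -/
noncomputable def latticeTau (Δ : ℝ) : ℝ := Real.exp (-(2 * Real.pi ^ 2 / (3 * Δ ^ 2)))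

/-- Normalisation of pair integrals. -/
noncomputable def pairCoef (Δ : ℝ) : ℝ := Δ / (2 * √Real.pi)

/-- Normalisation of triple integrals. -/
noncomputable def tripleCoef (Δ : ℝ) : ℝ := Δ ^ 2 / (2 * Real.pi * √3)

lemma decay_pos (Δ r : ℝ) : 0 < decay Δ r := Real.exp_pos _

lemma decay_add (Δ r t : ℝ) : decay Δ (r + t) = decay Δ r * decay Δ t := by
  rw [decay, decay, decay, ← Real.exp_add]; congr 1; ring

lemma decay_nat_mul (Δ r : ℝ) (n : ℕ) : decay Δ (n * r) = decay Δ r ^ n := by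
  rw [decay, decay, ← Real.exp_nat_mul]; congr 1; ring

lemma decay_anti (Δ : ℝ) {r t : ℝ} (h : r ≤ t) : decay Δ t ≤ decay Δ r :=
  Real.exp_le_exp.2 (by nlinarith [sq_nonneg Δ])

lemma decay_lt_one {Δ r : ℝ} (hΔ : Δ ≠ 0) (h : 0 < r) : decay Δ r < 1 := by
  have h1 : 0 < Δ ^ 2 := by positivity
  rw [decay, ← Real.exp_zero]
  exact Real.exp_lt_exp.2 (by nlinarith)

lemma pairCoef_pos {Δ : ℝ} (h : 0 < Δ) : 0 < pairCoef Δ := by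
  have := Real.pi_pos; unfold pairCoef; positivity

lemma tripleCoef_pos {Δ : ℝ} (h : 0 < Δ) : 0 < tripleCoef Δ := by
  have := Real.pi_pos; unfold tripleCoef; positivity

lemma bumpIntegrable_edgeTilt (Δ : ℝ) : BumpIntegrable (edgeTilt Δ) := BumpIntegrable.exp _

lemma bumpIntegrable_bulkMultiplier (Δ b : ℝ) : BumpIntegrable (bulkMultiplier Δ b) :=
  (BumpIntegrable.const 1).sub ((BumpIntegrable.cos _).const_mul b)

lemma edgeTilt_shift (Δ y : ℝ) : edgeTilt Δ (y + Δ) = decay Δ (3 / 5) * edgeTilt Δ y := by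
  rw [edgeTilt, edgeTilt, decay, ← Real.exp_add]; congr 1; ring

lemma bulkMultiplier_shift {Δ : ℝ} (hΔ : Δ ≠ 0) (b y : ℝ) :
    bulkMultiplier Δ b (y + Δ) = bulkMultiplier Δ b y := by
  have : latticeFreq Δ * (y + Δ) = latticeFreq Δ * y + 2 * Real.pi := by
    rw [latticeFreq]; field_simp
  rw [bulkMultiplier, bulkMultiplier, this, Real.cos_add_two_pi]

section Values
variable {Δ : ℝ}

lemma pairInt_edgeTilt (i j : ℝ) : pairInt (edgeTilt Δ) Δ i j =
    pairCoef Δ * decay Δ ((i - j) ^ 2 / 4 + 3 / 10 * (i + j) - 9 / 100) := by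
  have := pairInt_exp_cos (-(3 / 5 * Δ)) 0 Δ i j
  simp only [zero_mul, Real.cos_zero, mul_one, mul_zero, zero_div, add_zero] at this
  rw [pairCoef, decay]
  refine (this : pairInt (edgeTilt Δ) Δ i j = _).trans ?_
  congr 2; ring

lemma edgeTilt_sq (y : ℝ) : edgeTilt Δ y ^ 2 = Real.exp (-(6 / 5 * Δ) * y) := by
  rw [edgeTilt, ← Real.exp_nat_mul]; congr 1; push_cast; ring

lemma tripleInt_edgeTilt_sq (i j k : ℝ) : tripleInt (fun y => edgeTilt Δ y ^ 2) Δ i j k =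
    tripleCoef Δ * decay Δ ((i ^ 2 + j ^ 2 + k ^ 2 - i * j - j * k - i * k) / 3 +
      2 / 5 * (i + j + k) - 6 / 25) := by
  have := tripleInt_exp_cos (-(6 / 5 * Δ)) 0 Δ i j k
  simp only [zero_mul, Real.cos_zero, mul_one, mul_zero, zero_div, add_zero] at this
  simp only [edgeTilt_sq]
  rw [tripleCoef, decay, this]
  congr 2; ring

/-- Three bumps times the tilt form a Gaussian of variance 1/3 centred at Δ(i + j + k)/3 - Δ/5. At
frequency 2π/Δ the shift Δ/5 becomes the phase 2π/5, and the variance gives the damping factor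
exp(-2π²/(3Δ²)). -/
lemma tripleInt_bulk_mul_edge (hΔ : Δ ≠ 0) (b i j k : ℝ) :
    tripleInt (fun y => bulkMultiplier Δ b y * edgeTilt Δ y) Δ i j k =
    tripleCoef Δ * (decay Δ ((i ^ 2 + j ^ 2 + k ^ 2 - i * j - j * k - i * k) / 3 +
      1 / 5 * (i + j + k) - 3 / 50) *
      (1 - b * latticeTau Δ * Real.cos (2 * Real.pi * (i + j + k) / 3 - 2 * Real.pi / 5))) := by
  have h1 := tripleInt_exp_cos (-(3 / 5 * Δ)) 0 Δ i j k
  have h2 := tripleInt_exp_cos (-(3 / 5 * Δ)) (latticeFreq Δ) Δ i j k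
  have e : (fun y => bulkMultiplier Δ b y * edgeTilt Δ y) = fun y =>
      Real.exp (-(3 / 5 * Δ) * y) * Real.cos (0 * y) -
        b * (Real.exp (-(3 / 5 * Δ) * y) * Real.cos (latticeFreq Δ * y)) := by
    funext y; rw [bulkMultiplier, edgeTilt]; simp; ring
  rw [e, tripleInt_sub _ (.exp_cos _ _) ((BumpIntegrable.exp_cos _ _).const_mul b),
    tripleInt_const_mul, h1, h2, tripleCoef, decay, latticeTau]
  have a1 : latticeFreq Δ * (Δ * (i + j + k) / 3) + -(3 / 5 * Δ) * latticeFreq Δ / 3 =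
      2 * Real.pi * (i + j + k) / 3 - 2 * Real.pi / 5 := by
    rw [latticeFreq]; field_simp; ring
  have a2 : -(Δ ^ 2 / 2) * (i ^ 2 + j ^ 2 + k ^ 2 - (i + j + k) ^ 2 / 3) +
      (-(3 / 5 * Δ) * (Δ * (i + j + k) / 3) + ((-(3 / 5 * Δ)) ^ 2 - latticeFreq Δ ^ 2) / 6) =
      -(((i ^ 2 + j ^ 2 + k ^ 2 - i * j - j * k - i * k) / 3 +
      1 / 5 * (i + j + k) - 3 / 50) * Δ ^ 2) + -(2 * Real.pi ^ 2 / (3 * Δ ^ 2)) := by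
    rw [latticeFreq]; field_simp; ring
  have a3 : -(Δ ^ 2 / 2) * (i ^ 2 + j ^ 2 + k ^ 2 - (i + j + k) ^ 2 / 3) +
      (-(3 / 5 * Δ) * (Δ * (i + j + k) / 3) + ((-(3 / 5 * Δ)) ^ 2 - (0 : ℝ) ^ 2) / 6) =
      -(((i ^ 2 + j ^ 2 + k ^ 2 - i * j - j * k - i * k) / 3 +
      1 / 5 * (i + j + k) - 3 / 50) * Δ ^ 2) := by ring
  rw [a1, a2, a3, Real.exp_add]
  simp only [zero_mul, Real.cos_zero, mul_zero, zero_div, add_zero, mul_one]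
  ring

end Values

/-! ### Bounds for the sums involving the edge tilt. -/

section EdgeSums
variable {Δ : ℝ}

lemma decay_le_inv_pow {Δ r : ℝ} {n : ℕ} (h : n ≤ r * Δ ^ 2) : decay Δ r ≤ (1 / 2.7) ^ n := by
  have h1 : Real.exp 1 ^ n ≤ Real.exp (r * Δ ^ 2) := by
    rw [← Real.exp_nat_mul]; exact Real.exp_le_exp.2 (by simpa using h)
  have h2 : (2.7 : ℝ) ^ n ≤ Real.exp 1 ^ n :=
    pow_le_pow_left₀ (by norm_num) (by linarith [Real.exp_one_gt_d9]) n
  rw [decay, Real.exp_neg, one_div, inv_pow]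
  exact inv_anti₀ (by positivity) (h2.trans h1)

/-- By the shift recursion the pairs containing level 0 determine the bound. At distance d the
exponent is d²/4 + 3d/10 - 9/100, that is 0.46, 1.51, 3.06 for d = 1, 2, 3. Distances 1 and 2 are
kept exactly, and the factor 10 instead of 3² = 9 pays for all d > 3. -/
lemma sum_sq_mul_pairInt_edgeTilt_le (h0 : 0 < Δ) (h4 : 4 ≤ Δ ^ 2) (M : ℕ) :
    ∑ i ∈ Finset.range M, ∑ j ∈ Finset.range M,
      Δ ^ 2 / 2 * ((i : ℝ) - j) ^ 2 * pairInt (edgeTilt Δ) Δ i j ≤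
    pairCoef Δ * Δ ^ 2 * (decay Δ 0.46 + 4 * decay Δ 1.51 + 10 * decay Δ 3.06) /
      (1 - decay Δ (3 / 5)) := by
  have hp := pairCoef_pos h0
  have hd := fun r => decay_pos Δ r
  refine le_div_of_recursion (hd _).le (decay_lt_one h0.ne' (by norm_num))
    (by have := hd 0.46; have := hd 1.51; have := hd 3.06; positivity)
    (S := fun M => ∑ i ∈ Finset.range M, ∑ j ∈ Finset.range M,
      Δ ^ 2 / 2 * ((i : ℝ) - j) ^ 2 * pairInt (edgeTilt Δ) Δ i j) (by simp) (fun n => ?_) M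
  rw [sum_range_pair_succ (μ := decay Δ (3 / 5))
    (G := fun i j : ℕ => Δ ^ 2 / 2 * ((i : ℝ) - j) ^ 2 * pairInt (edgeTilt Δ) Δ i j)
    (fun i j => by rw [pairInt_comm]; ring)
    (fun i j => by
      push_cast
      rw [pairInt_shift (edgeTilt_shift Δ)]; ring)]
  have key : 2 * ∑ j ∈ Finset.range n,
      Δ ^ 2 / 2 * (((0 : ℕ) : ℝ) - (j + 1 : ℕ)) ^ 2 *
        pairInt (edgeTilt Δ) Δ ((0 : ℕ) : ℝ) ((j + 1 : ℕ) : ℝ) =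
      pairCoef Δ * Δ ^ 2 * ∑ j ∈ Finset.range n, ((j : ℝ) + 1) ^ 2 *
        decay Δ (((j : ℝ) + 1) ^ 2 / 4 + 3 / 10 * (j + 1) - 9 / 100) := by
    rw [Finset.mul_sum, Finset.mul_sum]
    refine Finset.sum_congr rfl fun j _ => ?_
    rw [pairInt_edgeTilt]
    push_cast
    rw [show (0 - ((j : ℝ) + 1)) ^ 2 = ((j : ℝ) + 1) ^ 2 by ring, zero_add]
    ring
  rw [key]
  have h1 : 4 * decay Δ 1.8 ≤ 1 / 10 := by
    have := decay_le_inv_pow (Δ := Δ) (r := 1.8) (n := 7) (by push_cast; linarith)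
    norm_num at this ⊢; linarith
  have h2 := sum_range_le_add_geometric
    (t := fun j : ℕ => ((j : ℝ) + 1) ^ 2 *
        decay Δ (((j : ℝ) + 1) ^ 2 / 4 + 3 / 10 * (j + 1) - 9 / 100))
    (A := 9 * decay Δ 3.06) (r := 4 * decay Δ 1.8) (by have := hd 3.06; positivity)
    (by have := hd 1.8; positivity) (by linarith) 2
    (fun j => mul_nonneg (by positivity) (hd _).le) (fun j => by
      push_cast
      have e1 : decay Δ ((2 + (j : ℝ) + 1) ^ 2 / 4 + 3 / 10 * (2 + j + 1) - 9 / 100) ≤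
          decay Δ (3.06 + j * 1.8) := decay_anti Δ (by nlinarith [sq_nonneg (j : ℝ)])
      have e2 : (2 + (j : ℝ) + 1) ^ 2 ≤ 9 * 4 ^ j := by
        have h2 : (j : ℝ) + 1 ≤ 2 ^ j := by
          exact_mod_cast Nat.succ_le_of_lt j.lt_two_pow_self
        have h3 : (4 : ℝ) ^ j = 2 ^ j * 2 ^ j := by rw [← mul_pow]; norm_num
        have : (0 : ℝ) ≤ j := by positivity
        rw [h3]; nlinarith
      calc _ ≤ (9 * 4 ^ j) * decay Δ (3.06 + j * 1.8) :=
            mul_le_mul e2 e1 (hd _).le (by positivity)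
        _ = _ := by rw [decay_add, decay_nat_mul, mul_pow]; ring) n
  have h3 : 9 * decay Δ 3.06 / (1 - 4 * decay Δ 1.8) ≤ 10 * decay Δ 3.06 := by
    rw [div_le_iff₀ (by linarith)]
    have := hd 3.06
    nlinarith
  have h4 : ∑ k ∈ Finset.range 2, ((k : ℝ) + 1) ^ 2 *
      decay Δ (((k : ℝ) + 1) ^ 2 / 4 + 3 / 10 * (k + 1) - 9 / 100) =
      decay Δ 0.46 + 4 * decay Δ 1.51 := by
    rw [Finset.sum_range_succ, Finset.sum_range_one]
    norm_num
  rw [h4] at h2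
  have h5 := mul_le_mul_of_nonneg_left (h2.trans (add_le_add_right h3 _))
    (by positivity : 0 ≤ pairCoef Δ * Δ ^ 2)
  simp only [Nat.cast_zero, sub_self]
  linarith

/-- All pair integrals are positive, so the row of level 0 may be cut at distance 2. The cut row
requires at least two further levels, hence the recursion starts at size 2 and loses a power of the
ratio. -/
lemma sum_pairInt_edgeTilt_ge (h0 : 0 < Δ) {M : ℕ} (hM : 2 ≤ M) :
    pairCoef Δ * (decay Δ (-0.09) + 2 * decay Δ 0.46 + 2 * decay Δ 1.51) /
      (1 - decay Δ (3 / 5)) * (1 - decay Δ (3 / 5) ^ (M - 2)) ≤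
    ∑ i ∈ Finset.range M, ∑ j ∈ Finset.range M, pairInt (edgeTilt Δ) Δ i j := by
  have hn : ∀ i j, 0 ≤ pairInt (edgeTilt Δ) Δ i j := fun i j =>
    pairInt_nonneg h0.le (fun y => (Real.exp_pos _).le) i j
  have := div_mul_le_of_recursion (decay_pos Δ (3 / 5)).le (decay_lt_one h0.ne' (by norm_num))
    (S := fun M => ∑ i ∈ Finset.range M, ∑ j ∈ Finset.range M, pairInt (edgeTilt Δ) Δ i j)
    (m := 2) (C := pairCoef Δ * (decay Δ (-0.09) + 2 * decay Δ 0.46 + 2 * decay Δ 1.51))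
    (Finset.sum_nonneg fun i _ => Finset.sum_nonneg fun j _ => hn i j) (fun n hn2 => ?_) (M - 2)
  · simpa [Nat.add_sub_cancel' hM] using this
  rw [sum_range_pair_succ (μ := decay Δ (3 / 5))
    (G := fun i j : ℕ => pairInt (edgeTilt Δ) Δ i j)
    (fun i j => pairInt_comm _ _ _ _)
    (fun i j => by push_cast; rw [pairInt_shift (edgeTilt_shift Δ)])]
  have h1 : ∑ j ∈ Finset.range 2, pairInt (edgeTilt Δ) Δ ((0 : ℕ) : ℝ) ((j + 1 : ℕ) : ℝ) ≤
      ∑ j ∈ Finset.range n, pairInt (edgeTilt Δ) Δ ((0 : ℕ) : ℝ) ((j + 1 : ℕ) : ℝ) :=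
    Finset.sum_le_sum_of_subset_of_nonneg (Finset.range_subset_range.2 hn2) fun j _ _ => hn _ _
  rw [Finset.sum_range_succ, Finset.sum_range_one] at h1
  simp only [pairInt_edgeTilt] at h1 ⊢
  norm_num at h1 ⊢
  linarith

/-- The square of the tilt scales by the square of the ratio. The constants 3.022 and 3.17 exceed
3/(1 - 0.007) and 3/(1 - 0.027)², the geometric sums over one and two positive indices. -/
lemma sum_tripleInt_edgeTilt_sq_le (h0 : 0 < Δ) (h4 : 4.06 ≤ Δ ^ 2) (M : ℕ) :
    ∑ i ∈ Finset.range M, ∑ j ∈ Finset.range M, ∑ k ∈ Finset.range M,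
      tripleInt (fun y => edgeTilt Δ y ^ 2) Δ i j k ≤
    tripleCoef Δ * (decay Δ (-0.24) + 3.022 * decay Δ (1 / 3 + 0.16) +
      3.17 * decay Δ (1 / 3 + 0.56)) / (1 - decay Δ (3 / 5) ^ 2) := by
  have hp := tripleCoef_pos h0
  have hd := fun r => decay_pos Δ r
  have hμ : decay Δ (3 / 5) ^ 2 < 1 := pow_lt_one₀ (hd _).le (decay_lt_one h0.ne' (by norm_num))
    two_ne_zero
  refine le_div_of_recursion (by positivity) hμ
    (by have := hd (-0.24); have := hd (1 / 3 + 0.16); have := hd (1 / 3 + 0.56); positivity)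
    (S := fun M => ∑ i ∈ Finset.range M, ∑ j ∈ Finset.range M, ∑ k ∈ Finset.range M,
      tripleInt (fun y => edgeTilt Δ y ^ 2) Δ i j k) (by simp) (fun n => ?_) M
  rw [sum_range_triple_succ (μ := decay Δ (3 / 5) ^ 2)
    (K := fun i j k : ℕ => tripleInt (fun y => edgeTilt Δ y ^ 2) Δ i j k)
    (fun i j k => tripleInt_comm_left _ _ _ _ _) (fun i j k => tripleInt_comm_right _ _ _ _ _)
    (fun i j k => by
      push_cast
      rw [tripleInt_shift (μ := decay Δ (3 / 5) ^ 2) fun y => by rw [edgeTilt_shift, mul_pow]])]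
  simp only [tripleInt_edgeTilt_sq]
  push_cast
  have h9 : decay Δ 0.9 ≤ 0.027 := by
    have := decay_le_inv_pow (Δ := Δ) (r := 3 / 4 * 0.9) (n := 2) (by norm_num; linarith)
    have h3 : (3.65 : ℝ) ≤ 0.9 * Δ ^ 2 := by linarith
    have h5 : Real.exp (-(0.9 * Δ ^ 2)) ≤ Real.exp (-3.65) := Real.exp_le_exp.2 (by linarith)
    have h6 : (2.718 : ℝ) ^ 3 * 1.9 ≤ Real.exp 3.65 := by
      have e : Real.exp 3.65 = Real.exp 1 ^ 3 * Real.exp 0.65 := by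
        rw [← Real.exp_nat_mul, ← Real.exp_add]; norm_num
      rw [e]
      have h7 := Real.quadratic_le_exp_of_nonneg (show (0 : ℝ) ≤ 0.65 by norm_num)
      have h8 : (2.718 : ℝ) ^ 3 ≤ Real.exp 1 ^ 3 :=
        pow_le_pow_left₀ (by norm_num) (by linarith [Real.exp_one_gt_d9]) 3
      have h10 : (1.861 : ℝ) ≤ Real.exp 0.65 := by norm_num at h7 ⊢; linarith
      have h11 := Real.sum_le_exp_of_nonneg (show (0 : ℝ) ≤ 0.65 by norm_num) 5
      norm_num [Finset.sum_range_succ, Nat.factorial] at h11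
      exact mul_le_mul h8 (by norm_num; linarith) (by norm_num) (by positivity)
    refine h5.trans ?_
    rw [Real.exp_neg]
    exact (inv_anti₀ (by norm_num) h6).trans (by norm_num)
  have h14 : decay Δ 1.4 ≤ 0.007 := by
    have := decay_le_inv_pow (Δ := Δ) (r := 1.4) (n := 5) (by push_cast; linarith)
    norm_num at this ⊢; linarith
  have hsq : ∀ k : ℕ, (k : ℝ) ≤ (k : ℝ) ^ 2 := fun k => by
    exact_mod_cast Nat.le_self_pow two_ne_zero k
  have s1 : ∑ k ∈ Finset.range n, decay Δ ((0 ^ 2 + 0 ^ 2 + ((k : ℝ) + 1) ^ 2 - 0 * 0 -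
      0 * (k + 1) - 0 * (k + 1)) / 3 + 2 / 5 * (0 + 0 + (k + 1)) - 6 / 25) ≤
      decay Δ (1 / 3 + 0.16) * (3.022 / 3) := by
    refine (sum_range_le_of_geometric (A := decay Δ (1 / 3 + 0.16)) (r := decay Δ 1.4) (hd _).le
      (hd _).le (by linarith) (fun k => ?_) n).trans ?_
    · rw [← decay_nat_mul, ← decay_add]
      exact decay_anti Δ (by linarith [hsq k])
    · rw [div_le_iff₀ (by linarith)]
      nlinarith [hd (1 / 3 + 0.16)]
  have s2 : ∑ j ∈ Finset.range n, ∑ k ∈ Finset.range n,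
      decay Δ ((0 ^ 2 + ((j : ℝ) + 1) ^ 2 + ((k : ℝ) + 1) ^ 2 - 0 * (j + 1) -
      (j + 1) * (k + 1) - 0 * (k + 1)) / 3 + 2 / 5 * (0 + (j + 1) + (k + 1)) - 6 / 25) ≤
      decay Δ (1 / 3 + 0.56) * (3.17 / 3) := by
    have hg := sum_range_le_of_geometric (t := fun k : ℕ => decay Δ 0.9 ^ k) (A := 1)
      (r := decay Δ 0.9) zero_le_one (hd _).le (by linarith) (fun k => by simp) n
    have hg' : 1 / (1 - decay Δ 0.9) ≤ 1.0278 := by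
      rw [div_le_iff₀ (by linarith)]; linarith
    have hg0 : 0 ≤ ∑ k ∈ Finset.range n, decay Δ 0.9 ^ k :=
      Finset.sum_nonneg fun k _ => pow_nonneg (hd _).le _
    calc _ ≤ ∑ j ∈ Finset.range n, ∑ k ∈ Finset.range n,
          decay Δ (1 / 3 + 0.56) * (decay Δ 0.9 ^ j * decay Δ 0.9 ^ k) :=
          Finset.sum_le_sum fun j _ => Finset.sum_le_sum fun k _ => by
            rw [← decay_nat_mul, ← decay_nat_mul, ← decay_add, ← decay_add]
            exact decay_anti Δ (by nlinarith [sq_nonneg ((j : ℝ) - k), hsq j, hsq k])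
      _ = decay Δ (1 / 3 + 0.56) * ((∑ j ∈ Finset.range n, decay Δ 0.9 ^ j) *
          ∑ k ∈ Finset.range n, decay Δ 0.9 ^ k) := by
          rw [Finset.sum_mul_sum, Finset.mul_sum]; simp only [Finset.mul_sum]
      _ ≤ _ := mul_le_mul_of_nonneg_left (by nlinarith) (hd _).le
  simp only [← Finset.mul_sum]
  have e0 : decay Δ ((0 ^ 2 + 0 ^ 2 + 0 ^ 2 - 0 * 0 - 0 * 0 - 0 * 0) / 3 +
      2 / 5 * (0 + 0 + 0) - 6 / 25) = decay Δ (-0.24) := by norm_num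
  rw [e0]
  have := mul_le_mul_of_nonneg_left s1 hp.le
  have := mul_le_mul_of_nonneg_left s2 hp.le
  linarith

/-- For 0 ≤ b ≤ 1 the product of multiplier and tilt is nonnegative, so only triples with smallest
index 0 and largest at most 2 are kept. The six summands come from 000, 001, 011, 012, 002 and 022.
-/
lemma sum_tripleInt_bulk_mul_edge_ge (h0 : 0 < Δ) {b : ℝ} (hb0 : 0 ≤ b) (hb1 : b ≤ 1) {M : ℕ}
    (hM : 2 ≤ M) :
    tripleCoef Δ * (decay Δ (-0.06) * (1 - 0.3091 * (b * latticeTau Δ)) +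
      3 * decay Δ (1 / 3 + 0.14) * (1 - 0.68 * (b * latticeTau Δ)) +
      3 * decay Δ (1 / 3 + 0.34) * (1 + 0.978 * (b * latticeTau Δ)) +
      6 * decay Δ 1.54 * (1 - 0.3091 * (b * latticeTau Δ)) +
      3 * decay Δ (4 / 3 + 0.34) * (1 + 0.978 * (b * latticeTau Δ)) +
      3 * decay Δ (4 / 3 + 0.74) * (1 - 0.68 * (b * latticeTau Δ))) /
      (1 - decay Δ (3 / 5)) * (1 - decay Δ (3 / 5) ^ (M - 2)) ≤
    ∑ i ∈ Finset.range M, ∑ j ∈ Finset.range M, ∑ k ∈ Finset.range M,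
      tripleInt (fun y => bulkMultiplier Δ b y * edgeTilt Δ y) Δ i j k := by
  set K := tripleInt (fun y => bulkMultiplier Δ b y * edgeTilt Δ y) Δ with hK
  have hbm : ∀ y, 0 ≤ bulkMultiplier Δ b y := fun y => by
    have := Real.cos_le_one (latticeFreq Δ * y)
    rw [bulkMultiplier]; nlinarith
  have hn : ∀ i j k, 0 ≤ K i j k := fun i j k =>
    tripleInt_nonneg (fun y => mul_nonneg (hbm y) (Real.exp_pos _).le) i j k
  set C := K 0 0 0 + 3 * (K 0 0 1 + K 0 0 2) + 3 * (K 0 1 1 + 2 * K 0 1 2 + K 0 2 2)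
  have hμ1 := decay_lt_one (r := 3 / 5) h0.ne' (by norm_num)
  have hμ0 := decay_pos Δ (3 / 5)
  have key := div_mul_le_of_recursion hμ0.le hμ1
    (S := fun M => ∑ i ∈ Finset.range M, ∑ j ∈ Finset.range M, ∑ k ∈ Finset.range M, K i j k)
    (m := 2) (C := C)
    (Finset.sum_nonneg fun i _ => Finset.sum_nonneg fun j _ => Finset.sum_nonneg fun k _ =>
      hn i j k) (fun n hn2 => ?_) (M - 2)
  · rw [Nat.add_sub_cancel' hM] at key
    refine le_trans (mul_le_mul_of_nonneg_right (div_le_div_of_nonneg_right ?_ (by linarith))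
      (sub_nonneg.2 (pow_le_one₀ hμ0.le hμ1.le))) key
    have hpi := Real.pi_pos
    have hpi2 := Real.pi_lt_d4
    have hpi3 := Real.pi_gt_d4
    -- Modulo 2π the phases 2πs/3 - 2π/5 take only the values -2π/5, 4π/15 and 14π/15, so three
    -- cosine bounds suffice.
    have c0 : Real.cos (2 * Real.pi / 5) ≤ 0.3091 := by
      have h1 : Real.cos (2 * Real.pi / 5) = 2 * Real.cos (Real.pi / 5) ^ 2 - 1 := by
        rw [← Real.cos_two_mul]; congr 1; ring
      have h5 : √5 ≤ 2.2361 := Real.sqrt_le_iff.2 ⟨by norm_num, by norm_num⟩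
      have h5' := Real.sq_sqrt (show (0 : ℝ) ≤ 5 by norm_num)
      rw [h1, Real.cos_pi_div_five]
      nlinarith
    have c1 : Real.cos (4 * Real.pi / 15) ≤ 0.68 := by
      have h1 := Real.cos_bound (x := 4 * Real.pi / 15) (by rw [abs_of_pos (by positivity)]; linarith)
      rw [abs_le, abs_of_pos (by positivity)] at h1
      have h2 : (4 * Real.pi / 15) ≤ 0.838 := by linarith
      have h3 : 0.8377 ≤ (4 * Real.pi / 15) := by linarith
      set x := 4 * Real.pi / 15
      have h4 : x ^ 4 ≤ 0.838 ^ 4 := pow_le_pow_left₀ (by linarith) h2 4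
      nlinarith [h1.2]
    have c2 : Real.cos (14 * Real.pi / 15) ≤ -0.978 := by
      have h1 : Real.cos (14 * Real.pi / 15) = -Real.cos (Real.pi / 15) := by
        rw [← Real.cos_pi_sub]; congr 1; ring
      have h2 := Real.one_sub_sq_div_two_le_cos (x := Real.pi / 15)
      rw [h1]
      have h3 : Real.pi / 15 ≤ 0.2097 := by linarith
      nlinarith [show 0 < Real.pi / 15 by positivity]
    have hτ : 0 ≤ b * latticeTau Δ := mul_nonneg hb0 (Real.exp_pos _).le
    have f0 : Real.cos (2 * Real.pi * (0 + 0 + 0) / 3 - 2 * Real.pi / 5) ≤ 0.3091 := by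
      rw [show 2 * Real.pi * (0 + 0 + 0) / 3 - 2 * Real.pi / 5 = -(2 * Real.pi / 5) by ring,
        Real.cos_neg]; exact c0
    have f1 : Real.cos (2 * Real.pi * (0 + 0 + 1) / 3 - 2 * Real.pi / 5) ≤ 0.68 := by
      rw [show 2 * Real.pi * (0 + 0 + 1) / 3 - 2 * Real.pi / 5 = 4 * Real.pi / 15 by ring]; exact c1
    have f2 : Real.cos (2 * Real.pi * (0 + 0 + 2) / 3 - 2 * Real.pi / 5) ≤ -0.978 := by
      rw [show 2 * Real.pi * (0 + 0 + 2) / 3 - 2 * Real.pi / 5 = 14 * Real.pi / 15 by ring]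
      exact c2
    have f2' : Real.cos (2 * Real.pi * (0 + 1 + 1) / 3 - 2 * Real.pi / 5) ≤ -0.978 := by
      rw [show 2 * Real.pi * (0 + 1 + 1) / 3 - 2 * Real.pi / 5 = 14 * Real.pi / 15 by ring]
      exact c2
    have f3 : Real.cos (2 * Real.pi * (0 + 1 + 2) / 3 - 2 * Real.pi / 5) ≤ 0.3091 := by
      rw [show 2 * Real.pi * (0 + 1 + 2) / 3 - 2 * Real.pi / 5 =
        -(2 * Real.pi / 5) + 2 * Real.pi by ring, Real.cos_add_two_pi, Real.cos_neg]; exact c0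
    have f4 : Real.cos (2 * Real.pi * (0 + 2 + 2) / 3 - 2 * Real.pi / 5) ≤ 0.68 := by
      rw [show 2 * Real.pi * (0 + 2 + 2) / 3 - 2 * Real.pi / 5 =
        4 * Real.pi / 15 + 2 * Real.pi by ring, Real.cos_add_two_pi]; exact c1
    have step : ∀ (i j k r x : ℝ), (i ^ 2 + j ^ 2 + k ^ 2 - i * j - j * k - i * k) / 3 +
        1 / 5 * (i + j + k) - 3 / 50 = r →
        Real.cos (2 * Real.pi * (i + j + k) / 3 - 2 * Real.pi / 5) ≤ x →
        tripleCoef Δ * (decay Δ r * (1 - x * (b * latticeTau Δ))) ≤ K i j k := by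
      intro i j k r x hr hx
      rw [hK, tripleInt_bulk_mul_edge h0.ne', hr]
      refine mul_le_mul_of_nonneg_left (mul_le_mul_of_nonneg_left ?_ (decay_pos _ _).le)
        (tripleCoef_pos h0).le
      have := mul_le_mul_of_nonneg_left hx hτ
      linarith
    have g0 := step 0 0 0 (-0.06) _ (by norm_num) f0
    have g1 := step 0 0 1 (1 / 3 + 0.14) _ (by norm_num) f1
    have g2 := step 0 0 2 (4 / 3 + 0.34) _ (by norm_num) f2
    have g3 := step 0 1 1 (1 / 3 + 0.34) _ (by norm_num) f2'
    have g4 := step 0 1 2 1.54 _ (by norm_num) f3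
    have g5 := step 0 2 2 (4 / 3 + 0.74) _ (by norm_num) f4
    linarith
  · rw [sum_range_triple_succ (μ := decay Δ (3 / 5)) (K := fun i j k : ℕ => K i j k)
      (fun i j k => tripleInt_comm_left _ _ _ _ _) (fun i j k => tripleInt_comm_right _ _ _ _ _)
      (fun i j k => by
        push_cast
        rw [hK, tripleInt_shift (μ := decay Δ (3 / 5)) fun y => by
          rw [edgeTilt_shift, bulkMultiplier_shift h0.ne']; ring])]
    have hsub := Finset.range_subset_range.2 hn2
    have h1 : ∑ k ∈ Finset.range 2, K ((0 : ℕ) : ℝ) ((0 : ℕ) : ℝ) ((k + 1 : ℕ) : ℝ) ≤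
        ∑ k ∈ Finset.range n, K ((0 : ℕ) : ℝ) ((0 : ℕ) : ℝ) ((k + 1 : ℕ) : ℝ) :=
      Finset.sum_le_sum_of_subset_of_nonneg hsub fun j _ _ => hn _ _ _
    have h2 : ∑ j ∈ Finset.range 2, ∑ k ∈ Finset.range 2,
        K ((0 : ℕ) : ℝ) ((j + 1 : ℕ) : ℝ) ((k + 1 : ℕ) : ℝ) ≤
        ∑ j ∈ Finset.range n, ∑ k ∈ Finset.range n,
        K ((0 : ℕ) : ℝ) ((j + 1 : ℕ) : ℝ) ((k + 1 : ℕ) : ℝ) :=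
      (Finset.sum_le_sum fun j _ => Finset.sum_le_sum_of_subset_of_nonneg hsub
        fun k _ _ => hn _ _ _).trans (Finset.sum_le_sum_of_subset_of_nonneg hsub
          fun j _ _ => Finset.sum_nonneg fun k _ => hn _ _ _)
    simp only [Finset.sum_range_succ, Finset.sum_range_zero] at h1 h2
    have h3 : K 0 2 1 = K 0 1 2 := tripleInt_comm_right _ _ _ _ _
    norm_num at h1 h2 ⊢
    rw [h3] at h2
    linarith

end EdgeSums

/-! ### Bulk pair sums with explicit edge corrections. -/

section BulkPairs
variable {Δ : ℝ}

lemma pairInt_bulkMultiplier (hΔ : Δ ≠ 0) (b i j : ℝ) : pairInt (bulkMultiplier Δ b) Δ i j =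
    Δ / (2 * √Real.pi) * (Real.exp (-(Δ ^ 2 / 4) * (i - j) ^ 2) *
      (1 - b * latticeEta Δ * Real.cos (Real.pi * (i + j)))) := by
  have h1 := pairInt_exp_cos 0 0 Δ i j
  have h2 := pairInt_exp_cos 0 (latticeFreq Δ) Δ i j
  have e : bulkMultiplier Δ b = fun y => Real.exp (0 * y) * Real.cos (0 * y) -
      b * (Real.exp (0 * y) * Real.cos (latticeFreq Δ * y)) := by
    funext y; rw [bulkMultiplier]; simp
  rw [e, pairInt_sub _ (.exp_cos _ _) ((BumpIntegrable.exp_cos _ _).const_mul b),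
    pairInt_const_mul, h1, h2, latticeEta]
  have a1 : latticeFreq Δ * (Δ * (i + j) / 2) + 0 * latticeFreq Δ / 2 = Real.pi * (i + j) := by
    rw [latticeFreq]; field_simp; ring
  have a2 : -(Δ ^ 2 / 4) * (i - j) ^ 2 + (0 * (Δ * (i + j) / 2) + ((0 : ℝ) ^ 2 - latticeFreq Δ ^ 2) / 4) =
      -(Δ ^ 2 / 4) * (i - j) ^ 2 + -(Real.pi ^ 2 / Δ ^ 2) := by
    rw [latticeFreq]; field_simp; ring
  have a3 : -(Δ ^ 2 / 4) * (i - j) ^ 2 + (0 * (Δ * (i + j) / 2) + ((0 : ℝ) ^ 2 - 0 ^ 2) / 4) =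
      -(Δ ^ 2 / 4) * (i - j) ^ 2 := by ring
  rw [a1, a2, a3, Real.exp_add]
  simp only [zero_mul, Real.cos_zero, mul_zero, zero_div, add_zero, mul_one]
  ring

lemma pairInt_bulk_zero (hΔ : Δ ≠ 0) (b : ℝ) (d : ℕ) :
    pairInt (bulkMultiplier Δ b) Δ ((0 : ℕ) : ℝ) d = pairWeight Δ b d := by
  rw [pairInt_bulkMultiplier hΔ, pairWeight]; norm_num

lemma pairWeight_nonneg (h0 : 0 < Δ) {b : ℝ} (hb : 0 ≤ b) (hbe : b * latticeEta Δ ≤ 1) (d : ℕ) :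
    0 ≤ pairWeight Δ b d := by
  have h1 := Real.cos_le_one (Real.pi * d)
  have h2 : 0 ≤ b * latticeEta Δ := mul_nonneg hb (latticeEta_pos Δ).le
  have h3 : 0 ≤ 1 - b * latticeEta Δ * Real.cos (Real.pi * d) := by nlinarith
  unfold pairWeight
  have := Real.pi_pos
  positivity

lemma pairWeight_of_odd (b : ℝ) {d : ℕ} (hd : Odd d) :
    pairWeight Δ b d = pairCoef Δ * (decay Δ ((d : ℝ) ^ 2 / 4) * (1 + b * latticeEta Δ)) := by
  have : Real.cos (Real.pi * d) = -1 := by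
    rw [mul_comm, Real.cos_nat_mul_pi, hd.neg_one_pow]
  rw [pairWeight, this, pairCoef, decay]
  congr 2
  · congr 1; ring
  · ring

lemma pairWeight_of_even (b : ℝ) {d : ℕ} (hd : Even d) :
    pairWeight Δ b d = pairCoef Δ * (decay Δ ((d : ℝ) ^ 2 / 4) * (1 - b * latticeEta Δ)) := by
  have : Real.cos (Real.pi * d) = 1 := by
    rw [mul_comm, Real.cos_nat_mul_pi, hd.neg_one_pow]
  rw [pairWeight, this, pairCoef, decay]
  congr 2
  · congr 1; ring
  · ring

lemma pairWeight_le (h0 : 0 < Δ) {b : ℝ} (hb : 0 ≤ b) (d : ℕ) :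
    pairWeight Δ b d ≤ pairCoef Δ * (decay Δ ((d : ℝ) ^ 2 / 4) * (1 + b * latticeEta Δ)) := by
  have h2 : 0 ≤ b * latticeEta Δ := mul_nonneg hb (latticeEta_pos Δ).le
  have h3 := pairCoef_pos h0
  have h4 := decay_pos Δ ((d : ℝ) ^ 2 / 4)
  rcases Nat.even_or_odd d with h | h
  · rw [pairWeight_of_even b h]
    exact mul_le_mul_of_nonneg_left (mul_le_mul_of_nonneg_left (by linarith) h4.le) h3.le
  · rw [pairWeight_of_odd b h]

lemma sum_pairInt_bulk_le (h0 : 0 < Δ) (h3 : Δ ≤ 3) {b : ℝ} (hb : 0 ≤ b)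
    (hbe : b * latticeEta Δ ≤ 1) {M : ℕ} (hM : 2 ≤ M) :
    ∑ i ∈ Finset.range M, ∑ j ∈ Finset.range M, pairInt (bulkMultiplier Δ b) Δ i j ≤
      M * (1 + 2 * latticeRho Δ ^ 2 + 3 * latticeRho Δ ^ 8 - 2 * b * latticeRho Δ) -
      2 * pairCoef Δ * (decay Δ (1 / 4) * (1 + b * latticeEta Δ) +
        2 * decay Δ 1 * (1 - b * latticeEta Δ)) := by
  have h := sum_range_pair_le (G := fun i j : ℕ => pairInt (bulkMultiplier Δ b) Δ i j)
    (g := pairWeight Δ b) (fun i j => pairInt_comm _ _ _ _)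
    (fun i j => by
      push_cast
      rw [pairInt_shift (μ := 1) fun y => by rw [bulkMultiplier_shift h0.ne', one_mul], one_mul])
    (fun d => pairInt_bulk_zero h0.ne' b d)
    (by simpa using summable_pair_aux h0 b 0) (pairWeight_nonneg h0 hb hbe) hM
  refine h.trans ?_
  have h1 := mul_le_mul_of_nonneg_left (bulk_pair_le h0 h3 hb) (Nat.cast_nonneg M : (0 : ℝ) ≤ M)
  have e1 := pairWeight_of_odd (Δ := Δ) b (d := 1) (by decide)
  have e2 := pairWeight_of_even (Δ := Δ) b (d := 2) (by decide)
  norm_num at e1 e2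
  rw [e1, e2]
  linarith

/-- The edge correction is the first moment of the squared-distance weights, hence a sum of d³ times
the pair weight. Distances 1, 2, 3 give the coefficients 1, 8, 27, and 70 instead of 4³ = 64 covers
all d ≥ 4. -/
lemma sum_sq_mul_pairInt_bulk_ge (h0 : 0 < Δ) (h3 : Δ ≤ 3) (h4 : 4 ≤ Δ ^ 2) {b : ℝ} (hb : 0 ≤ b)
    (hbe : b * latticeEta Δ ≤ 1) (M : ℕ) :
      M * (1 + 2 * latticeRho Δ ^ 2 -
        2 * latticeFreq Δ ^ 2 * (2 * latticeRho Δ ^ 2 + 9 * latticeRho Δ ^ 8) +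
        b * latticeRho Δ * (latticeFreq Δ ^ 2 - 2) - 2.2 * b * latticeRho Δ ^ 5) -
      pairCoef Δ * Δ ^ 2 * ((decay Δ (1 / 4) + 27 * decay Δ (9 / 4) + 70 * decay Δ 4) *
        (1 + b * latticeEta Δ) + 8 * decay Δ 1 * (1 - b * latticeEta Δ)) ≤
    ∑ i ∈ Finset.range M, ∑ j ∈ Finset.range M,
      Δ ^ 2 / 2 * ((i : ℝ) - j) ^ 2 * pairInt (bulkMultiplier Δ b) Δ i j := by
  have hp := pairCoef_pos h0
  have hpw := pairWeight_nonneg h0 hb hbe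
  have hd := fun r => decay_pos Δ r
  have hbe0 : 0 ≤ b * latticeEta Δ := mul_nonneg hb (latticeEta_pos Δ).le
  have hs2 : Summable fun d : ℕ => Δ ^ 2 / 2 * (d : ℝ) ^ 2 * pairWeight Δ b d := by
    simpa only [mul_assoc] using (summable_pair_aux h0 b 2).mul_left (Δ ^ 2 / 2)
  have hs3 : Summable fun d : ℕ => (d : ℝ) * (Δ ^ 2 / 2 * (d : ℝ) ^ 2 * pairWeight Δ b d) :=
    ((summable_pair_aux h0 b 3).mul_left (Δ ^ 2 / 2)).congr fun d => by ring
  have h := sum_range_pair_ge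
    (G := fun i j : ℕ => Δ ^ 2 / 2 * ((i : ℝ) - j) ^ 2 * pairInt (bulkMultiplier Δ b) Δ i j)
    (g := fun d => Δ ^ 2 / 2 * (d : ℝ) ^ 2 * pairWeight Δ b d)
    (fun i j => by rw [pairInt_comm]; ring)
    (fun i j => by
      push_cast
      rw [pairInt_shift (μ := 1) fun y => by rw [bulkMultiplier_shift h0.ne', one_mul], one_mul]
      ring)
    (fun d => by rw [pairInt_bulk_zero h0.ne']; push_cast; ring)
    hs2 hs3 (fun d => mul_nonneg (by positivity) (hpw d)) M
  refine le_trans ?_ h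
  have h1 := mul_le_mul_of_nonneg_left (bulk_pair_sq_ge h0 h3 hb)
    (Nat.cast_nonneg M : (0 : ℝ) ≤ M)
  set t : ℕ → ℝ := fun d => ((d + 1 : ℕ) : ℝ) ^ 3 * pairWeight Δ b (d + 1) with ht
  have hst : Summable t := (summable_nat_add_iff 1).2 (summable_pair_aux h0 b 3)
  have e1 : 2 * ∑' d : ℕ, ((d : ℝ) + 1) *
      (Δ ^ 2 / 2 * ((d + 1 : ℕ) : ℝ) ^ 2 * pairWeight Δ b (d + 1)) = Δ ^ 2 * ∑' d, t d := by
    rw [← tsum_mul_left, ← tsum_mul_left]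
    exact tsum_congr fun d => by rw [ht]; push_cast; ring
  have h8 : 2 * decay Δ 2 ≤ 1 / 20 := by
    have := decay_le_inv_pow (Δ := Δ) (r := 2) (n := 8) (by push_cast; linarith)
    norm_num at this ⊢; linarith
  have h2 : ∑' d, t d ≤ ∑ d ∈ Finset.range 3, t d +
      pairCoef Δ * (1 + b * latticeEta Δ) * (64 * decay Δ 4) / (1 - 2 * decay Δ 2) := by
    have h8' := hd 2
    have h8'' := hd 4
    refine hst.tsum_le_of_sum_range_le fun n => ?_
    refine sum_range_le_add_geometric (by positivity) (by positivity) (by linarith) 3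
      (fun d => mul_nonneg (by positivity) (hpw _)) (fun d => ?_) n
    have a1 : ((3 + d + 1 : ℕ) : ℝ) ^ 3 ≤ 64 * 2 ^ d := by
      have : (3 + d + 1) ^ 3 ≤ 64 * 2 ^ d := by
        induction d with
        | zero => norm_num
        | succ d ih =>
          have : (3 + (d + 1) + 1) ^ 3 ≤ 2 * (3 + d + 1) ^ 3 := by ring_nf; nlinarith
          rw [pow_succ 2 d]; omega
      exact_mod_cast this
    have a2 : decay Δ (((3 + d + 1 : ℕ) : ℝ) ^ 2 / 4) ≤ decay Δ (4 + d * 2) :=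
      decay_anti Δ (by push_cast; nlinarith [sq_nonneg (d : ℝ)])
    calc t (3 + d) ≤ ((3 + d + 1 : ℕ) : ℝ) ^ 3 * (pairCoef Δ *
          (decay Δ (((3 + d + 1 : ℕ) : ℝ) ^ 2 / 4) * (1 + b * latticeEta Δ))) :=
          mul_le_mul_of_nonneg_left (pairWeight_le h0 hb _) (by positivity)
      _ ≤ (64 * 2 ^ d) * (pairCoef Δ * (decay Δ (4 + d * 2) * (1 + b * latticeEta Δ))) := by
          have := hd (((3 + d + 1 : ℕ) : ℝ) ^ 2 / 4)
          gcongr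
      _ = _ := by rw [decay_add, decay_nat_mul, mul_pow]; ring
  have h5 : pairCoef Δ * (1 + b * latticeEta Δ) * (64 * decay Δ 4) / (1 - 2 * decay Δ 2) ≤
      pairCoef Δ * (1 + b * latticeEta Δ) * (70 * decay Δ 4) := by
    rw [div_le_iff₀ (by linarith)]
    have := hd 4
    have h6 : 0 ≤ pairCoef Δ * (1 + b * latticeEta Δ) * decay Δ 4 := by positivity
    nlinarith
  have e2 : ∑ d ∈ Finset.range 3, t d = pairCoef Δ * ((decay Δ (1 / 4) + 27 * decay Δ (9 / 4)) *
        (1 + b * latticeEta Δ) + 8 * decay Δ 1 * (1 - b * latticeEta Δ)) := by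
    have f1 := pairWeight_of_odd (Δ := Δ) b (d := 1) (by decide)
    have f2 := pairWeight_of_even (Δ := Δ) b (d := 2) (by decide)
    have f3 := pairWeight_of_odd (Δ := Δ) b (d := 3) (by decide)
    norm_num at f1 f2 f3
    simp only [ht, Finset.sum_range_succ, Finset.sum_range_zero]
    norm_num [f1, f2, f3]
    ring
  have h7 := mul_le_mul_of_nonneg_left (h2.trans (add_le_add_right h5 _)) (sq_nonneg Δ)
  rw [e2] at h7
  simp only [e1]
  norm_num at h1 h7 ⊢
  linarith

end BulkPairs

/-! ### Bulk triple sums: comparison of P³ with the full lattice. -/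

/-- The bumps summed over the full lattice. -/
noncomputable def latticeSum (Δ y : ℝ) : ℝ := ∑' n : ℤ, bump (n * Δ) y

/-- Mean of `(1 - b cos)² (1 + 2ρ cos)²` under a unit Gaussian, plus the Poisson error. -/
noncomputable def bulkSquareMean (Δ b : ℝ) : ℝ :=
  let ρ := latticeRho Δ
  let p := 2 * ρ - b
  let q := 2 * ρ * b
  (1 - q / 2) ^ 2 + p ^ 2 / 2 + q ^ 2 / 8 + (2 * p * (1 - q / 2) - p * q / 2) * ρ +
    (p ^ 2 / 2 - q * (1 - q / 2)) * ρ ^ 4 - p * q / 2 * ρ ^ 9 + q ^ 2 / 8 * ρ ^ 16 +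
    (1 + b) ^ 2 * (2 * (1 + 2 * ρ) * (2.1 * ρ ^ 4) + (2.1 * ρ ^ 4) ^ 2)

/-- Coefficients and indices of the edge polynomial. -/
def edgeTerms : Fin 8 → ℝ × ℤ × ℤ × ℤ :=
  ![(1, 0, -1, -1), (2, 0, 0, -1), (4, -1, 0, 1), (2, -2, -1, 0), (1, 0, -2, -2), (2, -2, 0, 0),
    (1, 1, -1, -1), (2, -1, 1, 1)]

lemma sum_edgeTerms (f : ℝ → ℤ → ℤ → ℤ → ℝ) :
    ∑ t, f (edgeTerms t).1 (edgeTerms t).2.1 (edgeTerms t).2.2.1 (edgeTerms t).2.2.2 =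
      f 1 0 (-1) (-1) + f 2 0 0 (-1) + f 4 (-1) 0 1 + f 2 (-2) (-1) 0 + f 1 0 (-2) (-2) +
        f 2 (-2) 0 0 + f 1 1 (-1) (-1) + f 2 (-1) 1 1 := by
  rw [Fin.sum_univ_eight]; rfl

/-- Edge polynomial in the bumps adjacent to the left end of the constellation. -/
noncomputable def edgePoly (Δ y : ℝ) : ℝ :=
  ∑ t, (edgeTerms t).1 * (bump ((edgeTerms t).2.1 * Δ) y * bump ((edgeTerms t).2.2.1 * Δ) y *
    bump ((edgeTerms t).2.2.2 * Δ) y)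

/-- The right-hand side expands into the edge polynomial plus the monomials containing both the bump
at Δ and the one at -2Δ. Those are the most distant pair and are dropped. -/
lemma edgePoly_le (Δ y : ℝ) : edgePoly Δ y ≤
    (bump (0 * Δ) y + bump (1 * Δ) y) * (bump (-1 * Δ) y + bump (-2 * Δ) y) *
      (2 * (bump (0 * Δ) y + bump (1 * Δ) y) + (bump (-1 * Δ) y + bump (-2 * Δ) y)) := by
  rw [edgePoly, sum_edgeTerms fun c i j k => c * (bump (i * Δ) y * bump (j * Δ) y *
    bump (k * Δ) y)]
  norm_num
  have a0 := bump_pos 0 y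
  have a1 := bump_pos Δ y
  have a2 := bump_pos (-Δ) y
  have a3 := bump_pos (-(2 * Δ)) y
  set p := bump 0 y
  set q := bump Δ y
  set r := bump (-Δ) y
  set s := bump (-(2 * Δ)) y
  have h : 0 ≤ q * s * (2 * p + 2 * q + r + s) + q * s * r + 2 * p * q * s := by positivity
  nlinarith

section Pointwise
variable {Δ : ℝ}

lemma summable_bump (h0 : 0 < Δ) (y : ℝ) : Summable fun n : ℤ => bump (n * Δ) y := by
  have := summable_exp_neg_mul_sq (τ := Δ ^ 2 / 2) (by positivity) (-(y / Δ))
  refine this.congr fun n => ?_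
  rw [bump]; congr 1; field_simp; ring

lemma latticeSum_ge (h0 : 0 < Δ) (M : ℕ) (y : ℝ) :
    bump (-2 * Δ) y + bump (-1 * Δ) y + pamMoment M 0 Δ y + bump (M * Δ) y +
      bump ((M + 1) * Δ) y ≤ latticeSum Δ y := by
  obtain ⟨e, he⟩ : ∃ e : ℕ ↪ ℤ, ∀ k : ℕ, e k = k - 2 :=
    ⟨⟨fun k => k - 2, fun a b h => by simpa using h⟩, fun _ => rfl⟩
  have h := (summable_bump h0 y).sum_le_tsum ((Finset.range (M + 4)).map e)
    fun n _ => (bump_pos _ _).le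
  rw [Finset.sum_map, Finset.sum_range_succ, Finset.sum_range_succ, Finset.sum_range_succ',
    Finset.sum_range_succ'] at h
  simp only [he] at h
  refine le_trans (le_of_eq ?_) h
  rw [pamMoment_zero_eq]
  push_cast
  simp only [show ∀ k : ℝ, k + 1 + 1 - 2 = k from fun k => by ring, add_sub_cancel_right]
  rw [show ((M : ℝ) + 3 - 2) = M + 1 by ring]
  ring

/-- The lattice sum is at least P + l + r, where l and r are the two nearest missing bumps on the
left and on the right. Expanding P(P + l + r)² leaves Pl(2P + l) and Pr(2P + r) besides P³. These
are kept, after shrinking P to two end levels, because they are a gain of the same order as the edge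
losses. -/
lemma pamMoment_cube_le (h0 : 0 < Δ) {M : ℕ} (hM : 2 ≤ M) (y : ℝ) :
    pamMoment M 0 Δ y ^ 3 + edgePoly Δ y + edgePoly Δ ((M - 1) * Δ - y) ≤
      pamMoment M 0 Δ y * latticeSum Δ y ^ 2 := by
  have hL := latticeSum_ge h0 M y
  have hp : ∀ k, 0 < bump (k * Δ) y := fun k => bump_pos _ _
  have hP1 : bump (0 * Δ) y + bump (1 * Δ) y ≤ pamMoment M 0 Δ y := by
    rw [pamMoment_zero_eq]
    have := Finset.sum_le_sum_of_subset_of_nonneg (f := fun i : ℕ => bump (i * Δ) y)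
      (Finset.range_subset_range.2 hM) fun i _ _ => (hp i).le
    simpa [Finset.sum_range_succ] using this
  have hP2 : bump ((M - 1 - 0) * Δ) y + bump ((M - 1 - 1) * Δ) y ≤ pamMoment M 0 Δ y := by
    obtain ⟨m, rfl⟩ : ∃ m, M = m + 2 := ⟨M - 2, by omega⟩
    rw [pamMoment_zero_eq, Finset.sum_range_succ, Finset.sum_range_succ]
    have : 0 ≤ ∑ i ∈ Finset.range m, bump (i * Δ) y := Finset.sum_nonneg fun i _ => (hp i).le
    push_cast
    rw [show ((m : ℝ) + 2 - 1 - 0) = m + 1 by ring, show ((m : ℝ) + 2 - 1 - 1) = m by ring]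
    linarith
  have f1 := edgePoly_le Δ y
  have f2 := edgePoly_le Δ ((M - 1) * Δ - y)
  simp only [bump_reflect] at f2
  rw [show ((M : ℝ) - 1 - -1) = M by ring, show ((M : ℝ) - 1 - -2) = M + 1 by ring] at f2
  have q1 := hp (-1)
  have q2 := hp (-2)
  have q3 := hp M
  have q4 := hp (M + 1)
  have a1 := hp 0
  have a2 := hp 1
  have a3 := hp (M - 1 - 0)
  have a4 := hp (M - 1 - 1)
  set P := pamMoment M 0 Δ y
  set l := bump (-1 * Δ) y + bump (-2 * Δ) y with hl
  set r := bump (M * Δ) y + bump ((M + 1) * Δ) y with hr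
  set a := bump (0 * Δ) y + bump (1 * Δ) y with ha
  set a' := bump ((M - 1 - 0) * Δ) y + bump ((M - 1 - 1) * Δ) y with ha'
  have hl0 : 0 < l := by positivity
  have hr0 : 0 < r := by positivity
  have ha0 : 0 < a := by positivity
  have ha0' : 0 < a' := by positivity
  have hP0 : 0 < P := ha0.trans_le hP1
  have e1 : P * (P + l + r) ^ 2 ≤ P * latticeSum Δ y ^ 2 :=
    mul_le_mul_of_nonneg_left (pow_le_pow_left₀ (by positivity) (by linarith) 2) hP0.le
  have e2 : a * l * (2 * a + l) ≤ P * l * (2 * P + l) := by gcongr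
  have e3 : a' * r * (2 * a' + r) ≤ P * r * (2 * P + r) := by gcongr
  have e4 : 0 ≤ 2 * P * l * r := by positivity
  nlinarith

lemma latticeSum_sq_le (h0 : 0 < Δ) (h3 : Δ ≤ 3) (y : ℝ) :
    (Δ / √(2 * Real.pi) * latticeSum Δ y) ^ 2 ≤
      (1 + 2 * latticeRho Δ * Real.cos (latticeFreq Δ * y)) ^ 2 +
      (2 * (1 + 2 * latticeRho Δ) * (2.1 * latticeRho Δ ^ 4) + (2.1 * latticeRho Δ ^ 4) ^ 2) := by
  have h := (abs_le.1 (abs_lattice_sum_sub_le h0 h3 y)).2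
  have hr := latticeRho_pos Δ
  have hc := Real.cos_le_one (latticeFreq Δ * y)
  have hL : 0 ≤ Δ / √(2 * Real.pi) * latticeSum Δ y :=
    mul_nonneg (by positivity) (tsum_nonneg fun n => (bump_pos _ _).le)
  have hδ : 0 ≤ 2.1 * latticeRho Δ ^ 4 := by positivity
  change Δ / √(2 * Real.pi) * latticeSum Δ y - _ ≤ _ at h
  set δ := 2.1 * latticeRho Δ ^ 4
  set u := 1 + 2 * latticeRho Δ * Real.cos (latticeFreq Δ * y)
  have hu : u ≤ 1 + 2 * latticeRho Δ := by nlinarith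
  calc _ ≤ (u + δ) ^ 2 := pow_le_pow_left₀ hL (by linarith) 2
    _ ≤ _ := by nlinarith

end Pointwise

section Bulk
variable {Δ : ℝ}

lemma integral_pamMoment_mul_cos (hΔ : Δ ≠ 0) (M n : ℕ) :
    Integrable (fun y => pamMoment M 0 Δ y * Real.cos (n * (latticeFreq Δ * y))) ∧
    ∫ y, pamMoment M 0 Δ y * Real.cos (n * (latticeFreq Δ * y)) =
      √(2 * Real.pi) * (M * latticeRho Δ ^ (n ^ 2)) := by
  have h : ∀ k : ℕ, Integrable (fun y => bump (k * Δ) y * Real.cos (n * (latticeFreq Δ * y))) ∧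
      ∫ y, bump (k * Δ) y * Real.cos (n * (latticeFreq Δ * y)) =
        √(2 * Real.pi) * latticeRho Δ ^ (n ^ 2) := fun k => by
    have := integral_bump_mul (k * Δ) 0 (n * latticeFreq Δ)
    simp only [zero_mul, Real.exp_zero, one_mul, mul_assoc] at this ⊢
    refine ⟨this.1, this.2.trans ?_⟩
    have a1 : (n : ℝ) * (latticeFreq Δ * (k * Δ)) + 0 = (n * k : ℕ) * (2 * Real.pi) := by
      rw [latticeFreq]; push_cast; field_simp; ring
    rw [a1, Real.cos_nat_mul_two_pi, mul_one, latticeRho, ← Real.exp_nat_mul]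
    congr 2
    rw [latticeFreq]; push_cast; field_simp; ring
  simp only [pamMoment_zero_eq, Finset.sum_mul]
  refine ⟨integrable_finsetSum _ fun k _ => (h k).1, ?_⟩
  rw [integral_finsetSum _ fun k _ => (h k).1]
  simp only [(h _).2, Finset.sum_const, Finset.card_range, nsmul_eq_mul]
  ring

/-- With x = ωy, (1 - b cos x)(1 + 2ρ cos x) = (1 - q/2) + p cos x - (q/2) cos 2x. Its square is a
cosine polynomial of degree 4, and cos nx has mean ρ^(n²) under every bump of the grid. The Fourier
error is absorbed in the constant term. -/
lemma bulk_sq_mul_le (h0 : 0 < Δ) (h3 : Δ ≤ 3) {b : ℝ} (hb : 0 ≤ b) (y : ℝ) :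
    bulkMultiplier Δ b y ^ 2 * (Δ / √(2 * Real.pi) * latticeSum Δ y) ^ 2 ≤
      let ρ := latticeRho Δ
      let p := 2 * ρ - b
      let q := 2 * ρ * b
      let c := fun n : ℕ => Real.cos (n * (latticeFreq Δ * y))
      ((1 - q / 2) ^ 2 + p ^ 2 / 2 + q ^ 2 / 8 +
        (1 + b) ^ 2 * (2 * (1 + 2 * ρ) * (2.1 * ρ ^ 4) + (2.1 * ρ ^ 4) ^ 2)) * c 0 +
        (2 * p * (1 - q / 2) - p * q / 2) * c 1 + (p ^ 2 / 2 - q * (1 - q / 2)) * c 2 -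
        p * q / 2 * c 3 + q ^ 2 / 8 * c 4 := by
  dsimp only
  have h := latticeSum_sq_le h0 h3 y
  have hr := latticeRho_pos Δ
  set x := latticeFreq Δ * y with hx
  set E := 2 * (1 + 2 * latticeRho Δ) * (2.1 * latticeRho Δ ^ 4) + (2.1 * latticeRho Δ ^ 4) ^ 2
    with hE
  have hE0 : 0 ≤ E := by positivity
  set c : ℕ → ℝ := fun n => Real.cos (n * x) with hc
  have c0 : c 0 = 1 := by simp [c]
  have c1 : c 1 = Real.cos x := by simp [c, hx]
  have c2 : c 2 = 2 * Real.cos x ^ 2 - 1 := by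
    rw [← Real.cos_two_mul]; simp [c, hx]
  have c3 : c 3 = 4 * Real.cos x ^ 3 - 3 * Real.cos x := by
    rw [← Real.cos_three_mul]; simp [c, hx]
  have c4 : c 4 = 2 * (2 * Real.cos x ^ 2 - 1) ^ 2 - 1 := by
    rw [← Real.cos_two_mul, ← Real.cos_two_mul]; simp only [c, hx]; congr 1; push_cast; ring
  have hb2 : bulkMultiplier Δ b y ^ 2 ≤ (1 + b) ^ 2 := by
    have h1 := Real.cos_le_one x
    have h2 := Real.neg_one_le_cos x
    rw [bulkMultiplier, ← hx]
    exact sq_le_sq' (by nlinarith) (by nlinarith)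
  calc _ ≤ bulkMultiplier Δ b y ^ 2 * ((1 + 2 * latticeRho Δ * Real.cos x) ^ 2 + E) :=
        mul_le_mul_of_nonneg_left h (sq_nonneg _)
    _ ≤ bulkMultiplier Δ b y ^ 2 * (1 + 2 * latticeRho Δ * Real.cos x) ^ 2 + (1 + b) ^ 2 * E := by
        rw [mul_add]; gcongr
    _ = ((1 - 2 * latticeRho Δ * b / 2) ^ 2 + (2 * latticeRho Δ - b) ^ 2 / 2 +
        (2 * latticeRho Δ * b) ^ 2 / 8 + (1 + b) ^ 2 * E) * c 0 +
        (2 * (2 * latticeRho Δ - b) * (1 - 2 * latticeRho Δ * b / 2) -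
          (2 * latticeRho Δ - b) * (2 * latticeRho Δ * b) / 2) * c 1 +
        ((2 * latticeRho Δ - b) ^ 2 / 2 - 2 * latticeRho Δ * b * (1 - 2 * latticeRho Δ * b / 2)) * c 2 -
        (2 * latticeRho Δ - b) * (2 * latticeRho Δ * b) / 2 * c 3 +
        (2 * latticeRho Δ * b) ^ 2 / 8 * c 4 := by
        rw [c0, c1, c2, c3, c4, bulkMultiplier, ← hx]
        ring

lemma bumpIntegrable_bulk_sq (Δ b : ℝ) : BumpIntegrable fun y => bulkMultiplier Δ b y ^ 2 := by
  have e : (fun y => bulkMultiplier Δ b y ^ 2) = fun y =>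
      ((1 + b ^ 2 / 2) - 2 * b * Real.cos (latticeFreq Δ * y)) +
        b ^ 2 / 2 * Real.cos (2 * latticeFreq Δ * y) := by
    funext y
    rw [mul_assoc 2 (latticeFreq Δ), Real.cos_two_mul, bulkMultiplier]; ring
  rw [e]
  exact ((BumpIntegrable.const _).sub ((BumpIntegrable.cos _).const_mul _)).add
    ((BumpIntegrable.cos _).const_mul _)

lemma tripleInt_bulk_sq (hΔ : Δ ≠ 0) (b i j k : ℝ) :
    tripleInt (fun y => bulkMultiplier Δ b y ^ 2) Δ i j k =
    tripleCoef Δ * (decay Δ ((i ^ 2 + j ^ 2 + k ^ 2 - i * j - j * k - i * k) / 3) *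
      (1 + b ^ 2 / 2 - 2 * b * latticeTau Δ * Real.cos (2 * Real.pi * (i + j + k) / 3) +
        b ^ 2 / 2 * latticeTau Δ ^ 4 * Real.cos (4 * Real.pi * (i + j + k) / 3))) := by
  have e : (fun y => bulkMultiplier Δ b y ^ 2) = fun y =>
      ((1 + b ^ 2 / 2) * (Real.exp (0 * y) * Real.cos (0 * y)) -
        2 * b * (Real.exp (0 * y) * Real.cos (latticeFreq Δ * y))) +
        b ^ 2 / 2 * (Real.exp (0 * y) * Real.cos (2 * latticeFreq Δ * y)) := by
    funext y
    rw [mul_assoc 2 (latticeFreq Δ), Real.cos_two_mul, bulkMultiplier]; simp; ring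
  have i0 := BumpIntegrable.exp_cos
  rw [e, tripleInt_add _ (((i0 _ _).const_mul _).sub ((i0 _ _).const_mul _)) ((i0 _ _).const_mul _),
    tripleInt_sub _ ((i0 _ _).const_mul _) ((i0 _ _).const_mul _), tripleInt_const_mul,
    tripleInt_const_mul, tripleInt_const_mul, tripleInt_exp_cos, tripleInt_exp_cos,
    tripleInt_exp_cos, tripleCoef, decay, latticeTau, ← Real.exp_nat_mul]
  set D := (i ^ 2 + j ^ 2 + k ^ 2 - i * j - j * k - i * k) / 3
  have a0 : -(Δ ^ 2 / 2) * (i ^ 2 + j ^ 2 + k ^ 2 - (i + j + k) ^ 2 / 3) = -(D * Δ ^ 2) := by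
    simp only [D]; ring
  have a1 : -(D * Δ ^ 2) + (0 * (Δ * (i + j + k) / 3) + ((0 : ℝ) ^ 2 - 0 ^ 2) / 6) =
      -(D * Δ ^ 2) := by ring
  have a2 : -(D * Δ ^ 2) + (0 * (Δ * (i + j + k) / 3) + ((0 : ℝ) ^ 2 - latticeFreq Δ ^ 2) / 6) =
      -(D * Δ ^ 2) + -(2 * Real.pi ^ 2 / (3 * Δ ^ 2)) := by
    rw [latticeFreq]; field_simp; ring
  have a3 : -(D * Δ ^ 2) + (0 * (Δ * (i + j + k) / 3) +
      ((0 : ℝ) ^ 2 - (2 * latticeFreq Δ) ^ 2) / 6) =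
      -(D * Δ ^ 2) + (4 : ℕ) * -(2 * Real.pi ^ 2 / (3 * Δ ^ 2)) := by
    rw [latticeFreq]; push_cast; field_simp; ring
  have b2 : latticeFreq Δ * (Δ * (i + j + k) / 3) + 0 * latticeFreq Δ / 3 =
      2 * Real.pi * (i + j + k) / 3 := by rw [latticeFreq]; field_simp; ring
  have b3 : 2 * latticeFreq Δ * (Δ * (i + j + k) / 3) + 0 * (2 * latticeFreq Δ) / 3 =
      4 * Real.pi * (i + j + k) / 3 := by rw [latticeFreq]; field_simp; ring
  rw [a0, a1, a2, a3, b2, b3, Real.exp_add, Real.exp_add]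
  simp only [zero_mul, Real.cos_zero, mul_zero, zero_div, add_zero, mul_one]
  ring

lemma cos_two_pi_third : Real.cos (2 * Real.pi / 3) = -(1 / 2) := by
  rw [show 2 * Real.pi / 3 = Real.pi - Real.pi / 3 by ring, Real.cos_pi_sub, Real.cos_pi_div_three]

lemma cos_two_pi_mul_int_div (n : ℤ) :
    Real.cos (2 * Real.pi * n / 3) = if 3 ∣ n then 1 else -(1 / 2) := by
  split_ifs with h
  · obtain ⟨m, rfl⟩ := h
    rw [← Real.cos_int_mul_two_pi m]; congr 1; push_cast; ring
  · rcases (by omega : n % 3 = 1 ∨ n % 3 = 2) with h1 | h1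
    · obtain ⟨m, rfl⟩ : ∃ m, n = 3 * m + 1 := ⟨n / 3, by omega⟩
      rw [← cos_two_pi_third, ← Real.cos_add_int_mul_two_pi (2 * Real.pi / 3) m]
      congr 1; push_cast; ring
    · obtain ⟨m, rfl⟩ : ∃ m, n = 3 * m - 1 := ⟨n / 3 + 1, by omega⟩
      rw [← cos_two_pi_third, ← Real.cos_neg (2 * Real.pi / 3),
        ← Real.cos_add_int_mul_two_pi (-(2 * Real.pi / 3)) m]
      congr 1; push_cast; ring

/-- The product of three bumps is centred at Δ(i + j + k)/3, so the cosines depend only on i + j + k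
modulo 3. Doubling the frequency does not change divisibility by 3. -/
lemma tripleInt_bulk_sq_int (hΔ : Δ ≠ 0) (b : ℝ) (i j k : ℤ) :
    tripleInt (fun y => bulkMultiplier Δ b y ^ 2) Δ i j k =
    tripleCoef Δ * (decay Δ (((i ^ 2 + j ^ 2 + k ^ 2 - i * j - j * k - i * k : ℤ) : ℝ) / 3) *
      if 3 ∣ i + j + k then
        1 + b ^ 2 / 2 - 2 * (b * latticeTau Δ) + b ^ 2 / 2 * latticeTau Δ ^ 4
      else 1 + b ^ 2 / 2 + b * latticeTau Δ - b ^ 2 / 4 * latticeTau Δ ^ 4) := by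
  rw [tripleInt_bulk_sq hΔ]
  have h1 := cos_two_pi_mul_int_div (i + j + k)
  have h2 := cos_two_pi_mul_int_div (2 * (i + j + k))
  have h3 : (3 ∣ 2 * (i + j + k)) ↔ 3 ∣ i + j + k := by omega
  simp only [h3] at h2
  push_cast at h1 h2 ⊢
  rw [show 4 * Real.pi * ((i : ℝ) + j + k) / 3 = 2 * Real.pi * (2 * (i + j + k)) / 3 by ring,
    h1, h2]
  split_ifs <;> ring

lemma integral_edgePoly_mul (h0 : 0 < Δ) {b : ℝ} :
    Integrable (fun y => edgePoly Δ y * bulkMultiplier Δ b y ^ 2) ∧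
    Δ ^ 2 / (2 * Real.pi * √(2 * Real.pi)) * ∫ y, edgePoly Δ y * bulkMultiplier Δ b y ^ 2 =
      tripleCoef Δ * ((3 * decay Δ (1 / 3) + 6 * decay Δ (4 / 3)) *
          (1 + b ^ 2 / 2 + b * latticeTau Δ - b ^ 2 / 4 * latticeTau Δ ^ 4) +
        6 * decay Δ 1 *
          (1 + b ^ 2 / 2 - 2 * (b * latticeTau Δ) + b ^ 2 / 2 * latticeTau Δ ^ 4)) := by
  have hi : ∀ t, Integrable fun y => (edgeTerms t).1 * (bump ((edgeTerms t).2.1 * Δ) y *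
      bump ((edgeTerms t).2.2.1 * Δ) y * bump ((edgeTerms t).2.2.2 * Δ) y *
        bulkMultiplier Δ b y ^ 2) :=
    fun t => ((bumpIntegrable_bulk_sq Δ b).three _ _ _).const_mul _
  simp only [edgePoly, Finset.sum_mul, mul_assoc (edgeTerms _).1]
  refine ⟨integrable_finsetSum _ fun t _ => hi t, ?_⟩
  rw [integral_finsetSum _ fun t _ => hi t, Finset.mul_sum]
  have e : ∀ t, Δ ^ 2 / (2 * Real.pi * √(2 * Real.pi)) * ∫ y, (edgeTerms t).1 *
      (bump ((edgeTerms t).2.1 * Δ) y * bump ((edgeTerms t).2.2.1 * Δ) y *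
        bump ((edgeTerms t).2.2.2 * Δ) y * bulkMultiplier Δ b y ^ 2) =
      (edgeTerms t).1 * tripleInt (fun y => bulkMultiplier Δ b y ^ 2) Δ (edgeTerms t).2.1
        (edgeTerms t).2.2.1 (edgeTerms t).2.2.2 := fun t => by
    rw [integral_const_mul, tripleInt]; ring
  simp only [e, tripleInt_bulk_sq_int h0.ne']
  rw [sum_edgeTerms fun c i j k => c * (tripleCoef Δ * (decay Δ
    (((i ^ 2 + j ^ 2 + k ^ 2 - i * j - j * k - i * k : ℤ) : ℝ) / 3) *
      if 3 ∣ i + j + k then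
        1 + b ^ 2 / 2 - 2 * (b * latticeTau Δ) + b ^ 2 / 2 * latticeTau Δ ^ 4
      else 1 + b ^ 2 / 2 + b * latticeTau Δ - b ^ 2 / 4 * latticeTau Δ ^ 4))]
  norm_num
  ring

/-- P³ is replaced by P times the squared lattice sum minus the edge polynomials at both ends. The
lattice sum is then replaced by its constant and first harmonic. The multiplier is invariant under
reflection of the grid, so the two edge integrals coincide. -/
lemma sum_tripleInt_bulk_sq_le (h0 : 0 < Δ) (h3 : Δ ≤ 3) {b : ℝ} (hb : 0 ≤ b) {M : ℕ}
    (hM : 2 ≤ M) :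
    ∑ i ∈ Finset.range M, ∑ j ∈ Finset.range M, ∑ k ∈ Finset.range M,
      tripleInt (fun y => bulkMultiplier Δ b y ^ 2) Δ i j k ≤
    M * bulkSquareMean Δ b -
      tripleCoef Δ * ((6 * decay Δ (1 / 3) + 12 * decay Δ (4 / 3)) *
          (1 + b ^ 2 / 2 + b * latticeTau Δ - b ^ 2 / 4 * latticeTau Δ ^ 4) +
        12 * decay Δ 1 *
          (1 + b ^ 2 / 2 - 2 * (b * latticeTau Δ) + b ^ 2 / 2 * latticeTau Δ ^ 4)) := by
  have hpi := Real.pi_pos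
  obtain ⟨i3, e3⟩ := integral_pamMoment_cube_mul M Δ (bumpIntegrable_bulk_sq Δ b)
  obtain ⟨iE, eE⟩ := integral_edgePoly_mul h0 (b := b)
  set r := √(2 * Real.pi) with hr
  have hr0 : 0 < r := Real.sqrt_pos.2 (by positivity)
  have hrr : r ^ 2 = 2 * Real.pi := Real.sq_sqrt (by positivity)
  set κ := Δ ^ 2 / (2 * Real.pi * r) with hκ
  have hκ0 : 0 < κ := by positivity
  have hbm : ∀ y, bulkMultiplier Δ b ((M - 1) * Δ - y) = bulkMultiplier Δ b y := fun y => by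
    rw [bulkMultiplier, bulkMultiplier, ← Real.cos_neg]
    congr 2
    rw [← Real.cos_add_int_mul_two_pi (latticeFreq Δ * y) (-((M : ℤ) - 1))]
    congr 1
    have := h0.ne'
    rw [latticeFreq]; push_cast; field_simp; ring
  have iE' : Integrable fun y => edgePoly Δ ((M - 1) * Δ - y) * bulkMultiplier Δ b y ^ 2 := by
    have := iE.comp_sub_left ((M - 1) * Δ)
    simpa only [hbm] using this
  have eE' : ∫ y, edgePoly Δ ((M - 1) * Δ - y) * bulkMultiplier Δ b y ^ 2 =
      ∫ y, edgePoly Δ y * bulkMultiplier Δ b y ^ 2 := by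
    rw [← integral_sub_left_eq_self _ _ (((M : ℝ) - 1) * Δ)]
    simp only [hbm, sub_sub_cancel]
  have hc := integral_pamMoment_mul_cos h0.ne' M
  set ρ := latticeRho Δ with hρ
  set p := 2 * ρ - b with hp
  set q := 2 * ρ * b with hq
  set a0 := (1 - q / 2) ^ 2 + p ^ 2 / 2 + q ^ 2 / 8 +
        (1 + b) ^ 2 * (2 * (1 + 2 * ρ) * (2.1 * ρ ^ 4) + (2.1 * ρ ^ 4) ^ 2) with ha0
  set a1 := 2 * p * (1 - q / 2) - p * q / 2 with ha1
  set a2 := p ^ 2 / 2 - q * (1 - q / 2) with ha2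
  set F : ℕ → ℝ → ℝ := fun n y => pamMoment M 0 Δ y * Real.cos (n * (latticeFreq Δ * y)) with hF
  have hpt : ∀ y, κ * (pamMoment M 0 Δ y ^ 3 * bulkMultiplier Δ b y ^ 2 +
      edgePoly Δ y * bulkMultiplier Δ b y ^ 2 +
      edgePoly Δ ((M - 1) * Δ - y) * bulkMultiplier Δ b y ^ 2) ≤
      1 / r * (a0 * F 0 y + a1 * F 1 y + a2 * F 2 y - p * q / 2 * F 3 y + q ^ 2 / 8 * F 4 y) := by
    intro y
    have h1 := pamMoment_cube_le h0 hM y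
    have h2 := bulk_sq_mul_le h0 h3 hb y
    dsimp only at h2
    rw [← hρ, ← hp, ← hq, ← ha0, ← ha1, ← ha2, ← hr] at h2
    have hP : 0 ≤ pamMoment M 0 Δ y := pamMoment_nonneg _ _ _ _
    calc _ = κ * bulkMultiplier Δ b y ^ 2 * (pamMoment M 0 Δ y ^ 3 + edgePoly Δ y +
          edgePoly Δ ((M - 1) * Δ - y)) := by ring
      _ ≤ κ * bulkMultiplier Δ b y ^ 2 * (pamMoment M 0 Δ y * latticeSum Δ y ^ 2) :=
          mul_le_mul_of_nonneg_left h1 (by positivity)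
      _ = pamMoment M 0 Δ y / r * (bulkMultiplier Δ b y ^ 2 * (Δ / r * latticeSum Δ y) ^ 2) := by
          rw [hκ, ← hrr]; field_simp
      _ ≤ _ := by
          refine (mul_le_mul_of_nonneg_left h2 (by positivity)).trans (le_of_eq ?_)
          simp only [hF]; ring
  have j0 := (hc 0).1.const_mul a0
  have j1 := j0.add ((hc 1).1.const_mul a1)
  have j2 := j1.add ((hc 2).1.const_mul a2)
  have j3 := j2.sub ((hc 3).1.const_mul (p * q / 2))
  have j4 := j3.add ((hc 4).1.const_mul (q ^ 2 / 8))
  have hmono := integral_mono (((i3.add iE).add iE').const_mul κ) (j4.const_mul (1 / r)) hpt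
  have eL : ∫ y, κ * (pamMoment M 0 Δ y ^ 3 * bulkMultiplier Δ b y ^ 2 +
      edgePoly Δ y * bulkMultiplier Δ b y ^ 2 +
      edgePoly Δ ((M - 1) * Δ - y) * bulkMultiplier Δ b y ^ 2) =
      κ * (∫ y, pamMoment M 0 Δ y ^ 3 * bulkMultiplier Δ b y ^ 2) +
        2 * (κ * ∫ y, edgePoly Δ y * bulkMultiplier Δ b y ^ 2) := by
    have t1 := integral_add (i3.add iE) iE'
    have t2 := integral_add i3 iE
    rw [integral_const_mul]
    refine (congrArg (κ * ·) (t1.trans (congrArg₂ (· + ·) t2 eE'))).trans ?_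
    ring
  have eR : ∫ y, 1 / r * (a0 * F 0 y + a1 * F 1 y + a2 * F 2 y - p * q / 2 * F 3 y +
      q ^ 2 / 8 * F 4 y) = M * bulkSquareMean Δ b := by
    have t4 := integral_add j3 ((hc 4).1.const_mul (q ^ 2 / 8))
    have t3 := integral_sub j2 ((hc 3).1.const_mul (p * q / 2))
    have t2 := integral_add j1 ((hc 2).1.const_mul a2)
    have t1 := integral_add j0 ((hc 1).1.const_mul a1)
    rw [integral_const_mul]
    refine (congrArg ((1 / r) * ·) (t4.trans (congrArg₂ (· + ·) (t3.trans (congrArg₂ (· - ·)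
      (t2.trans (congrArg₂ (· + ·) t1 rfl)) rfl)) rfl))).trans ?_
    simp only [integral_const_mul, (hc _).2]
    rw [bulkSquareMean]
    simp only [← hρ, ← hp, ← hq]
    rw [ha0, ha1, ha2]
    field_simp
    ring
  have hmono' := (eL.symm.le.trans hmono).trans eR.le
  rw [e3, eE] at hmono'
  linarith

end Bulk

/-! ### Assembly: gain per symbol against balance at the ends. -/

/-- Density (per symbol) of the linear functional at the bulk multiplier. -/
noncomputable def bulkLinear (Δ b : ℝ) : ℝ :=
  1 + 2 * latticeRho Δ ^ 2 -
    2 * latticeFreq Δ ^ 2 * (2 * latticeRho Δ ^ 2 + 9 * latticeRho Δ ^ 8) +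
    b * latticeRho Δ * (latticeFreq Δ ^ 2 - 2) - 2.2 * b * latticeRho Δ ^ 5

/-- Density (per symbol) of the gain of the bulk multiplier. -/
noncomputable def bulkGain (Δ b : ℝ) : ℝ :=
  bulkLinear Δ b - (1 + 2 * (1 + 2 * latticeRho Δ ^ 2 + 3 * latticeRho Δ ^ 8 -
    2 * b * latticeRho Δ) + bulkSquareMean Δ b) / 4

/-- Edge loss of the linear functional at the bulk multiplier. -/
noncomputable def bulkEdgeLoss (Δ b : ℝ) : ℝ :=
  pairCoef Δ * Δ ^ 2 * ((decay Δ (1 / 4) + 27 * decay Δ (9 / 4) + 70 * decay Δ 4) *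
    (1 + b * latticeEta Δ) + 8 * decay Δ 1 * (1 - b * latticeEta Δ))

/-- Edge gain of the quadratic functional at the bulk multiplier. -/
noncomputable def bulkEdgeGain (Δ b : ℝ) : ℝ :=
  pairCoef Δ * (decay Δ (1 / 4) * (1 + b * latticeEta Δ) +
    2 * decay Δ 1 * (1 - b * latticeEta Δ)) +
  tripleCoef Δ * ((6 * decay Δ (1 / 3) + 12 * decay Δ (4 / 3)) *
      (1 + b ^ 2 / 2 + b * latticeTau Δ - b ^ 2 / 4 * latticeTau Δ ^ 4) +
    12 * decay Δ 1 *
      (1 + b ^ 2 / 2 - 2 * (b * latticeTau Δ) + b ^ 2 / 2 * latticeTau Δ ^ 4)) / 4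

/-- Linear loss of the edge tilt. -/
noncomputable def tiltLoss (Δ : ℝ) : ℝ :=
  pairCoef Δ * Δ ^ 2 * (decay Δ 0.46 + 4 * decay Δ 1.51 + 10 * decay Δ 3.06) /
    (1 - decay Δ (3 / 5))

/-- Linear gain of the edge tilt. -/
noncomputable def tiltGain (Δ b : ℝ) : ℝ :=
  pairCoef Δ * (decay Δ (-0.09) + 2 * decay Δ 0.46 + 2 * decay Δ 1.51) / (1 - decay Δ (3 / 5)) +
  tripleCoef Δ * (decay Δ (-0.06) * (1 - 0.3091 * (b * latticeTau Δ)) +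
    3 * decay Δ (1 / 3 + 0.14) * (1 - 0.68 * (b * latticeTau Δ)) +
    3 * decay Δ (1 / 3 + 0.34) * (1 + 0.978 * (b * latticeTau Δ)) +
    6 * decay Δ 1.54 * (1 - 0.3091 * (b * latticeTau Δ)) +
    3 * decay Δ (4 / 3 + 0.34) * (1 + 0.978 * (b * latticeTau Δ)) +
    3 * decay Δ (4 / 3 + 0.74) * (1 - 0.68 * (b * latticeTau Δ))) / (1 - decay Δ (3 / 5))

/-- Quadratic loss of the edge tilt. -/
noncomputable def tiltSquareLoss (Δ : ℝ) : ℝ :=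
  tripleCoef Δ * (decay Δ (-0.24) + 3.022 * decay Δ (1 / 3 + 0.16) +
    3.17 * decay Δ (1 / 3 + 0.56)) / (1 - decay Δ (3 / 5) ^ 2)

/-- Total edge contribution of the multiplier with tilt amplitude `c`. -/
noncomputable def edgeBalance (Δ b c : ℝ) : ℝ :=
  bulkEdgeGain Δ b - bulkEdgeLoss Δ b + c * ((1 - 1e-9) * tiltGain Δ b - 2 * tiltLoss Δ) -
    c ^ 2 * (tiltSquareLoss Δ / 2 + 1e-6)

section Assemble
variable {Δ : ℝ}

lemma bumpIntegrable_bulk_mul_exp (Δ b c : ℝ) :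
    BumpIntegrable fun y => bulkMultiplier Δ b y * Real.exp (c * y) := by
  have e : (fun y => bulkMultiplier Δ b y * Real.exp (c * y)) = fun y =>
      Real.exp (c * y) - b * (Real.exp (c * y) * Real.cos (latticeFreq Δ * y)) := by
    funext y; rw [bulkMultiplier]; ring
  rw [e]
  exact (BumpIntegrable.exp c).sub ((BumpIntegrable.exp_cos _ _).const_mul b)

lemma edgeTilt_reflect (Δ T y : ℝ) :
    edgeTilt Δ (T - y) = edgeTilt Δ T * Real.exp (3 / 5 * Δ * y) := by
  rw [edgeTilt, edgeTilt, ← Real.exp_add]; congr 1; ring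

/-- The two tilts decay in opposite directions at the same rate, so their product is a constant,
exponentially small in M. Their interaction is therefore negligible. -/
lemma edgeTilt_mul_reflect (Δ : ℝ) {M : ℕ} (hM : 1 ≤ M) (y : ℝ) :
    edgeTilt Δ y * edgeTilt Δ ((M - 1) * Δ - y) = decay Δ (3 / 5) ^ (M - 1) := by
  rw [edgeTilt, edgeTilt, decay, ← Real.exp_add, ← Real.exp_nat_mul]
  congr 1
  rw [Nat.cast_sub hM]; push_cast; ring

lemma bulkMultiplier_reflect (hΔ : Δ ≠ 0) (b : ℝ) (M : ℕ) (y : ℝ) :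
    bulkMultiplier Δ b ((M - 1) * Δ - y) = bulkMultiplier Δ b y := by
  rw [bulkMultiplier, bulkMultiplier, ← Real.cos_neg]
  congr 2
  rw [← Real.cos_add_int_mul_two_pi (latticeFreq Δ * y) (-((M : ℤ) - 1))]
  congr 1
  rw [latticeFreq]; push_cast; field_simp; ring

lemma bulkSquareMean_zero_le (h0 : 0 < Δ) (h3 : Δ ≤ 3) : bulkSquareMean Δ 0 ≤ 2 := by
  have hr := latticeRho_le h0 h3
  have hr0 := latticeRho_pos Δ
  set ρ := latticeRho Δ
  have h4 : ρ ^ 4 ≤ (1 / 8) ^ 4 := pow_le_pow_left₀ hr0.le hr 4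
  have h40 : 0 ≤ ρ ^ 4 := by positivity
  have e : bulkSquareMean Δ 0 = 1 + 6 * ρ ^ 2 + 2 * ρ ^ 2 * ρ ^ 4 + 4.2 * (1 + 2 * ρ) * ρ ^ 4 +
      2.1 ^ 2 * (ρ ^ 4 * ρ ^ 4) := by rw [bulkSquareMean]; ring
  rw [e]
  nlinarith

lemma bulkEdgeLoss_nonneg (h0 : 0 < Δ) {b : ℝ} (hb : 0 ≤ b) (hbe : b * latticeEta Δ ≤ 1) :
    0 ≤ bulkEdgeLoss Δ b := by
  have hp := pairCoef_pos h0
  have hd := fun r => decay_pos Δ r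
  have h1 := hd (1 / 4)
  have h2 := hd (9 / 4)
  have h3 := hd 4
  have h4 := hd 1
  have h5 : 0 ≤ 1 - b * latticeEta Δ := by linarith
  have h6 := latticeEta_pos Δ
  unfold bulkEdgeLoss; positivity

lemma tiltLoss_nonneg (h0 : 0 < Δ) : 0 ≤ tiltLoss Δ := by
  have hp := pairCoef_pos h0
  have hd := fun r => decay_pos Δ r
  have h1 := hd 0.46
  have h2 := hd 1.51
  have h3 := hd 3.06
  have h4 := sub_pos.2 (decay_lt_one (r := 3 / 5) h0.ne' (by norm_num))
  unfold tiltLoss; positivity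

lemma tiltGain_nonneg (h0 : 0 < Δ) {b : ℝ} (hb : 0 ≤ b) (hb1 : b ≤ 1) : 0 ≤ tiltGain Δ b := by
  have hp := pairCoef_pos h0
  have hq := tripleCoef_pos h0
  have hd := fun r => decay_pos Δ r
  have h1 := hd 0.46
  have h2 := hd 1.51
  have h3 := hd (-0.09)
  have h4 := sub_pos.2 (decay_lt_one (r := 3 / 5) h0.ne' (by norm_num))
  have g1 := hd (-0.06)
  have g2 := hd (1 / 3 + 0.14)
  have g3 := hd (1 / 3 + 0.34)
  have g4 := hd 1.54
  have g5 := hd (4 / 3 + 0.34)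
  have g6 := hd (4 / 3 + 0.74)
  have ht0 : 0 < latticeTau Δ := Real.exp_pos _
  have ht : latticeTau Δ ≤ 1 := Real.exp_le_one_iff.2 (by
    have := Real.pi_pos
    rw [Left.neg_nonpos_iff]; positivity)
  have hbt : b * latticeTau Δ ≤ 1 := mul_le_one₀ hb1 ht0.le ht
  have hbt0 : 0 ≤ b * latticeTau Δ := by positivity
  have k1 : 0 ≤ 1 - 0.3091 * (b * latticeTau Δ) := by linarith
  have k2 : 0 ≤ 1 - 0.68 * (b * latticeTau Δ) := by linarith
  have k3 : 0 ≤ 1 + 0.978 * (b * latticeTau Δ) := by linarith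
  unfold tiltGain; positivity

set_option maxHeartbeats 1000000 in
/-- Explicit criterion for the second moment bound in terms of bulk gain and edge balance. -/
theorem pamVarIntegral_one_le_of_balance (h0 : 0 < Δ) (h3 : Δ ≤ 3) (h4 : 4.06 ≤ Δ ^ 2) {b c : ℝ}
    (hb : 0 ≤ b) (hbe : b * latticeEta Δ ≤ 1) (hc : 0 ≤ c) (hcb : c = 0 ∨ b ≤ 1)
    {M : ℕ} (hM : 16 ≤ M)
    (hK : 0 ≤ bulkLinear Δ b - (bulkEdgeLoss Δ b + 2 * c * tiltLoss Δ) / 16)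
    (h : 0 ≤ M * bulkGain Δ b + edgeBalance Δ b c +
      12 / (M * Δ ^ 2) * (bulkLinear Δ b - (bulkEdgeLoss Δ b + 2 * c * tiltLoss Δ) / 16)) :
    pamVarIntegral M 1 Δ ≤ (Δ ^ 2 + 12 / ((M : ℝ) ^ 2 - 1)) * pamVarIntegral M 2 Δ := by
  have hMr : (16 : ℝ) ≤ M := by exact_mod_cast hM
  have hM1 : 0 < (M : ℝ) ^ 2 - 1 := by nlinarith
  have hΔ2 : 0 < Δ ^ 2 := by positivity
  set T := ((M : ℝ) - 1) * Δ with hT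
  set hB := bulkMultiplier Δ b with hhB
  set e1 := edgeTilt Δ with he1
  set e2 : ℝ → ℝ := fun y => edgeTilt Δ (T - y) with he2
  have iB : BumpIntegrable hB := bumpIntegrable_bulkMultiplier Δ b
  have i1 : BumpIntegrable e1 := bumpIntegrable_edgeTilt Δ
  have i2 : BumpIntegrable e2 := by
    simp only [he2, edgeTilt_reflect]; exact (BumpIntegrable.exp _).const_mul _
  have iB2 : BumpIntegrable fun y => hB y ^ 2 := bumpIntegrable_bulk_sq Δ b
  have iB1 : BumpIntegrable fun y => hB y * e1 y := bumpIntegrable_bulk_mul_exp Δ b _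
  have iBr : BumpIntegrable fun y => hB y * e2 y := by
    have := (bumpIntegrable_bulk_mul_exp Δ b (3 / 5 * Δ)).const_mul (edgeTilt Δ T)
    simp only [he2, edgeTilt_reflect]
    simpa only [mul_left_comm] using this
  have i11 : BumpIntegrable fun y => e1 y ^ 2 := by
    simp only [he1, edgeTilt_sq]; exact BumpIntegrable.exp _
  have i22 : BumpIntegrable fun y => e2 y ^ 2 := by
    have : (fun y => e2 y ^ 2) = fun y => edgeTilt Δ T ^ 2 * Real.exp ((6 / 5 * Δ) * y) := by
      funext y
      simp only [he2, edgeTilt_reflect, mul_pow, ← Real.exp_nat_mul]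
      congr 2; push_cast; ring
    rw [this]; exact (BumpIntegrable.exp _).const_mul _
  set κ := decay Δ (3 / 5) ^ (M - 1) with hκ
  -- The multiplier: bulk part minus c times the left tilt and its mirror image.
  set f : ℝ → ℝ := fun y => hB y - c * (e1 y + e2 y) with hf
  have hf2 : (fun y => f y ^ 2) = fun y => (hB y ^ 2 + c ^ 2 * (e1 y ^ 2 + e2 y ^ 2) +
      2 * c ^ 2 * κ) - 2 * c * (hB y * e1 y + hB y * e2 y) := by
    funext y
    have : e1 y * e2 y = κ := edgeTilt_mul_reflect Δ (by omega) y
    simp only [hf]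
    rw [← this]; ring
  have jf : BumpIntegrable f := iB.sub ((i1.add i2).const_mul c)
  have j2 := (iB2.add ((i11.add i22).const_mul (c ^ 2))).add (BumpIntegrable.const (2 * c ^ 2 * κ))
  have jf2 : BumpIntegrable fun y => f y ^ 2 := by
    rw [hf2]; exact j2.sub ((iB1.add iBr).const_mul (2 * c))
  have p1 : ∀ i j, pairInt f Δ i j = pairInt hB Δ i j - c * (pairInt e1 Δ i j + pairInt e2 Δ i j) :=
    fun i j => by
      rw [hf, pairInt_sub Δ iB ((i1.add i2).const_mul c), pairInt_const_mul, pairInt_add Δ i1 i2]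
  have p2 : ∀ i j k, tripleInt (fun y => f y ^ 2) Δ i j k =
      tripleInt (fun y => hB y ^ 2) Δ i j k + c ^ 2 * (tripleInt (fun y => e1 y ^ 2) Δ i j k +
        tripleInt (fun y => e2 y ^ 2) Δ i j k) + 2 * c ^ 2 * κ * tripleInt (fun _ => 1) Δ i j k -
      2 * c * (tripleInt (fun y => hB y * e1 y) Δ i j k + tripleInt (fun y => hB y * e2 y) Δ i j k) :=
    fun i j k => by
      have e : tripleInt (fun _ => 2 * c ^ 2 * κ) Δ i j k =
          2 * c ^ 2 * κ * tripleInt (fun _ => 1) Δ i j k := by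
        rw [← tripleInt_const_mul]; simp only [mul_one]
      rw [hf2, tripleInt_sub Δ j2 ((iB1.add iBr).const_mul (2 * c)), tripleInt_const_mul,
        tripleInt_add Δ iB1 iBr, tripleInt_add Δ (iB2.add ((i11.add i22).const_mul (c ^ 2)))
        (BumpIntegrable.const (2 * c ^ 2 * κ)), tripleInt_add Δ iB2 ((i11.add i22).const_mul _),
        tripleInt_const_mul, tripleInt_add Δ i11 i22, e]
  have r1 : ∑ i ∈ Finset.range M, ∑ j ∈ Finset.range M, pairInt e2 Δ i j =
      ∑ i ∈ Finset.range M, ∑ j ∈ Finset.range M, pairInt e1 Δ i j := sum_pairInt_reflect e1 M Δ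
  have r2 : ∑ i ∈ Finset.range M, ∑ j ∈ Finset.range M,
      Δ ^ 2 / 2 * ((i : ℝ) - j) ^ 2 * pairInt e2 Δ i j =
      ∑ i ∈ Finset.range M, ∑ j ∈ Finset.range M,
        Δ ^ 2 / 2 * ((i : ℝ) - j) ^ 2 * pairInt e1 Δ i j := sum_sq_mul_pairInt_reflect e1 M Δ
  have r3 : ∑ i ∈ Finset.range M, ∑ j ∈ Finset.range M, ∑ k ∈ Finset.range M,
      tripleInt (fun y => e2 y ^ 2) Δ i j k = ∑ i ∈ Finset.range M, ∑ j ∈ Finset.range M,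
      ∑ k ∈ Finset.range M, tripleInt (fun y => e1 y ^ 2) Δ i j k :=
    sum_tripleInt_reflect (fun y => e1 y ^ 2) M Δ
  have r4 : ∑ i ∈ Finset.range M, ∑ j ∈ Finset.range M, ∑ k ∈ Finset.range M,
      tripleInt (fun y => hB y * e2 y) Δ i j k = ∑ i ∈ Finset.range M, ∑ j ∈ Finset.range M,
      ∑ k ∈ Finset.range M, tripleInt (fun y => hB y * e1 y) Δ i j k := by
    rw [← sum_tripleInt_reflect (fun y => hB y * e1 y) M Δ]
    simp only [hhB, bulkMultiplier_reflect h0.ne', he2, he1, hT]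
  have s1 := sum_pairInt_bulk_le h0 h3 hb hbe (M := M) (by omega)
  have s2 := sum_sq_mul_pairInt_bulk_ge h0 h3 (by linarith) hb hbe M
  have s3 := sum_tripleInt_bulk_sq_le h0 h3 hb (M := M) (by omega)
  have s4 := sum_sq_mul_pairInt_edgeTilt_le h0 (by linarith) M
  have s5 := sum_pairInt_edgeTilt_ge h0 (M := M) (by omega)
  have s6 := sum_tripleInt_edgeTilt_sq_le h0 h4 M
  have s8 : ∑ i ∈ Finset.range M, ∑ j ∈ Finset.range M, ∑ k ∈ Finset.range M,
      tripleInt (fun _ => 1) Δ i j k ≤ M * 2 := by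
    have := sum_tripleInt_bulk_sq_le h0 h3 (le_refl 0) (M := M) (by omega)
    simp only [bulkMultiplier, zero_mul, sub_zero, one_pow] at this
    refine this.trans ?_
    have h1 := mul_le_mul_of_nonneg_left (bulkSquareMean_zero_le h0 h3)
      (Nat.cast_nonneg M : (0 : ℝ) ≤ M)
    have h2 : 0 ≤ tripleCoef Δ * ((6 * decay Δ (1 / 3) + 12 * decay Δ (4 / 3)) *
          (1 + (0 : ℝ) ^ 2 / 2 + 0 - 0 ^ 2 / 4 * latticeTau Δ ^ 4) +
        12 * decay Δ 1 * (1 + (0 : ℝ) ^ 2 / 2 - 2 * 0 + 0 ^ 2 / 2 * latticeTau Δ ^ 4)) := by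
      have := tripleCoef_pos h0
      have := decay_pos Δ (1 / 3)
      have := decay_pos Δ (4 / 3)
      have := decay_pos Δ 1
      norm_num; positivity
    linarith
  have hμ0 := decay_pos Δ (3 / 5)
  -- Since 0.6 · 4.06 ≥ 2, the ratio is at most 2.7⁻² < 1/7. Its powers 14 = 16 - 2 and 15 = 16 - 1
  -- are what make the errors 1e-9 and 1e-6 in the edge balance sufficient.
  have hμ : decay Δ (3 / 5) ≤ 1 / 7 := by
    have := decay_le_inv_pow (Δ := Δ) (r := 3 / 5) (n := 2) (by push_cast; linarith)
    norm_num at this ⊢; linarith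
  have hμM : decay Δ (3 / 5) ^ (M - 2) ≤ 1e-9 :=
    ((pow_le_pow_of_le_one hμ0.le (by linarith) (by omega : 14 ≤ M - 2)).trans
      (pow_le_pow_left₀ hμ0.le hμ 14)).trans (by norm_num)
  have hκM : κ * M ≤ 5e-7 := by
    have e : M - 1 = (M - 16) + 15 := by omega
    have h1 : (M : ℝ) ≤ 16 * 2 ^ (M - 16) := by
      have h2 : M ≤ 16 * 2 ^ (M - 16) := by
        have := (M - 16).lt_two_pow_self
        omega
      exact_mod_cast h2
    have h2 : decay Δ (3 / 5) ^ 15 ≤ (1 / 7) ^ 15 := pow_le_pow_left₀ hμ0.le hμ 15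
    have h5 : decay Δ (3 / 5) ^ (M - 16) * 2 ^ (M - 16) ≤ 1 := by
      rw [← mul_pow]; exact pow_le_one₀ (by positivity) (by linarith)
    calc κ * M ≤ κ * (16 * 2 ^ (M - 16)) := by rw [hκ]; gcongr
      _ = 16 * (decay Δ (3 / 5) ^ (M - 16) * 2 ^ (M - 16)) * decay Δ (3 / 5) ^ 15 := by
          rw [hκ, e, pow_add]; ring
      _ ≤ 16 * 1 * (1 / 7) ^ 15 := by gcongr
      _ ≤ _ := by norm_num
  -- Without tilt both sides vanish. The bound b ≤ 1, which makes the mixed triple integrals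
  -- nonnegative, is needed only when a tilt is present.
  have hg : c * ((1 - 1e-9) * tiltGain Δ b) ≤
      c * (∑ i ∈ Finset.range M, ∑ j ∈ Finset.range M, pairInt e1 Δ i j +
        ∑ i ∈ Finset.range M, ∑ j ∈ Finset.range M, ∑ k ∈ Finset.range M,
          tripleInt (fun y => hB y * e1 y) Δ i j k) := by
    rcases hcb with rfl | hb1
    · simp
    · refine mul_le_mul_of_nonneg_left ?_ hc
      have s7 := sum_tripleInt_bulk_mul_edge_ge h0 hb hb1 (M := M) (by omega)
      have h1 := mul_le_mul_of_nonneg_right (sub_le_sub_left hμM 1) (tiltGain_nonneg h0 hb hb1)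
      refine h1.trans (le_trans (le_of_eq ?_) (add_le_add s5 s7))
      rw [tiltGain]; ring
  -- This a makes aΔ² equal to Δ² + 12/(M² - 1).
  refine (pamVarIntegral_one_le_of_multiplier (a := 1 + 12 / (((M : ℝ) ^ 2 - 1) * Δ ^ 2))
    (by omega) h0 (by positivity) jf jf2 ?_).trans (le_of_eq ?_)
  swap
  · congr 1; field_simp
  have q1 : ∑ i ∈ Finset.range M, ∑ j ∈ Finset.range M, pairInt f Δ i j =
      ∑ i ∈ Finset.range M, ∑ j ∈ Finset.range M, pairInt hB Δ i j -
        2 * c * ∑ i ∈ Finset.range M, ∑ j ∈ Finset.range M, pairInt e1 Δ i j := by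
    simp only [p1, Finset.sum_sub_distrib, Finset.sum_add_distrib, ← Finset.mul_sum]
    rw [r1]; ring
  have q2 : ∑ i ∈ Finset.range M, ∑ j ∈ Finset.range M,
      Δ ^ 2 / 2 * ((i : ℝ) - j) ^ 2 * pairInt f Δ i j =
      ∑ i ∈ Finset.range M, ∑ j ∈ Finset.range M,
        Δ ^ 2 / 2 * ((i : ℝ) - j) ^ 2 * pairInt hB Δ i j -
        2 * c * ∑ i ∈ Finset.range M, ∑ j ∈ Finset.range M,
          Δ ^ 2 / 2 * ((i : ℝ) - j) ^ 2 * pairInt e1 Δ i j := by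
    have e : ∀ i j : ℝ, Δ ^ 2 / 2 * (i - j) ^ 2 * pairInt f Δ i j =
        Δ ^ 2 / 2 * (i - j) ^ 2 * pairInt hB Δ i j - c * (Δ ^ 2 / 2 * (i - j) ^ 2 *
          pairInt e1 Δ i j + Δ ^ 2 / 2 * (i - j) ^ 2 * pairInt e2 Δ i j) := fun i j => by
      rw [p1]; ring
    simp only [e, Finset.sum_sub_distrib, Finset.sum_add_distrib, ← Finset.mul_sum _ _ c]
    rw [r2]; ring
  have q3 : ∑ i ∈ Finset.range M, ∑ j ∈ Finset.range M, ∑ k ∈ Finset.range M,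
      tripleInt (fun y => f y ^ 2) Δ i j k =
      ∑ i ∈ Finset.range M, ∑ j ∈ Finset.range M, ∑ k ∈ Finset.range M,
        tripleInt (fun y => hB y ^ 2) Δ i j k +
      2 * c ^ 2 * ∑ i ∈ Finset.range M, ∑ j ∈ Finset.range M, ∑ k ∈ Finset.range M,
        tripleInt (fun y => e1 y ^ 2) Δ i j k +
      2 * c ^ 2 * κ * ∑ i ∈ Finset.range M, ∑ j ∈ Finset.range M, ∑ k ∈ Finset.range M,
        tripleInt (fun _ => 1) Δ i j k -
      4 * c * ∑ i ∈ Finset.range M, ∑ j ∈ Finset.range M, ∑ k ∈ Finset.range M,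
        tripleInt (fun y => hB y * e1 y) Δ i j k := by
    simp only [p2, Finset.sum_sub_distrib, Finset.sum_add_distrib, ← Finset.mul_sum]
    rw [r3, r4]; ring
  rw [q1, q2, q3]
  set S1 := ∑ i ∈ Finset.range M, ∑ j ∈ Finset.range M, pairInt hB Δ i j
  set S2 := ∑ i ∈ Finset.range M, ∑ j ∈ Finset.range M,
      Δ ^ 2 / 2 * ((i : ℝ) - j) ^ 2 * pairInt hB Δ i j
  set S3 := ∑ i ∈ Finset.range M, ∑ j ∈ Finset.range M, ∑ k ∈ Finset.range M,
        tripleInt (fun y => hB y ^ 2) Δ i j k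
  set S4 := ∑ i ∈ Finset.range M, ∑ j ∈ Finset.range M,
          Δ ^ 2 / 2 * ((i : ℝ) - j) ^ 2 * pairInt e1 Δ i j
  set S5 := ∑ i ∈ Finset.range M, ∑ j ∈ Finset.range M, pairInt e1 Δ i j
  set S6 := ∑ i ∈ Finset.range M, ∑ j ∈ Finset.range M, ∑ k ∈ Finset.range M,
        tripleInt (fun y => e1 y ^ 2) Δ i j k
  set S7 := ∑ i ∈ Finset.range M, ∑ j ∈ Finset.range M, ∑ k ∈ Finset.range M,
        tripleInt (fun y => hB y * e1 y) Δ i j k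
  set S8 := ∑ i ∈ Finset.range M, ∑ j ∈ Finset.range M, ∑ k ∈ Finset.range M,
        tripleInt (fun _ => 1) Δ i j k
  have hκ0 : 0 ≤ κ := by positivity
  have u4 := mul_le_mul_of_nonneg_left s4 hc
  have u6 := mul_le_mul_of_nonneg_left s6 (sq_nonneg c)
  have u8 : c ^ 2 * (κ * S8) ≤ c ^ 2 * 1e-6 := by
    refine mul_le_mul_of_nonneg_left ?_ (sq_nonneg c)
    nlinarith [mul_le_mul_of_nonneg_left s8 hκ0]
  change c * S4 ≤ c * tiltLoss Δ at u4
  change c ^ 2 * S6 ≤ c ^ 2 * tiltSquareLoss Δ at u6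
  change M * bulkLinear Δ b - bulkEdgeLoss Δ b ≤ S2 at s2
  have hX : M * bulkLinear Δ b - (bulkEdgeLoss Δ b + 2 * c * tiltLoss Δ) ≤ S2 - 2 * c * S4 := by
    linarith
  have hloss : 0 ≤ bulkEdgeLoss Δ b + 2 * c * tiltLoss Δ := by
    have := bulkEdgeLoss_nonneg h0 hb hbe
    have := tiltLoss_nonneg h0
    positivity
  set K0 := bulkLinear Δ b - (bulkEdgeLoss Δ b + 2 * c * tiltLoss Δ) / 16
  have hX' : M * K0 ≤ S2 - 2 * c * S4 := by
    refine le_trans ?_ hX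
    simp only [K0]
    nlinarith
  -- The excess a - 1 multiplies the linear functional, which is at least M K0. Replacing M² - 1 by
  -- M² turns it into a term of order 1/M.
  have hX'' : 12 / (M * Δ ^ 2) * K0 ≤ 12 / (((M : ℝ) ^ 2 - 1) * Δ ^ 2) * (S2 - 2 * c * S4) := by
    calc 12 / (M * Δ ^ 2) * K0 = 12 / ((M : ℝ) ^ 2 * Δ ^ 2) * (M * K0) := by field_simp
      _ ≤ 12 / (((M : ℝ) ^ 2 - 1) * Δ ^ 2) * (M * K0) := by
        refine mul_le_mul_of_nonneg_right ?_ (by positivity)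
        exact div_le_div_of_nonneg_left (by norm_num) (by positivity)
          (mul_le_mul_of_nonneg_right (by linarith) hΔ2.le)
      _ ≤ _ := mul_le_mul_of_nonneg_left hX' (by positivity)
  rw [edgeBalance, bulkGain, bulkEdgeGain] at h
  rw [add_mul, one_mul]
  refine le_trans ?_ (add_le_add_right hX'' _)
  clear_value S1 S2 S3 S4 S5 S6 S7 S8 K0 κ
  linarith only [h, hg, s1, s3, u6, u8, u4, s2, sq_nonneg c]

end Assemble

/-! ### The optimal amplitude and the resulting gain per symbol. -/

/-- Amplitude of the bulk multiplier that maximises the leading part of the bulk gain. -/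
noncomputable def bulkAmplitude (Δ : ℝ) : ℝ :=
  2 * latticeRho Δ * (2 * latticeFreq Δ ^ 2 + 1)

section Amplitude
variable {Δ D : ℝ}

lemma latticeRho_eq_exp_freq (Δ : ℝ) : latticeRho Δ = Real.exp (-(latticeFreq Δ ^ 2 / 2)) := by
  rw [latticeRho, latticeFreq]; congr 2; rw [div_pow]; ring

lemma latticeFreq_sq_ge (h0 : 0 < Δ) (h3 : Δ ≤ 3) : 4.38 ≤ latticeFreq Δ ^ 2 := by
  have hpi := Real.pi_gt_d2
  rw [latticeFreq, div_pow, le_div_iff₀ (by positivity)]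
  nlinarith

lemma latticeFreq_sq_le_of_le (h0 : 0 < D) (h : D ≤ Δ) :
    latticeFreq Δ ^ 2 ≤ latticeFreq D ^ 2 := by
  have := Real.pi_pos
  have := h0.trans_le h
  unfold latticeFreq
  gcongr

lemma latticeFreq_sq_mul_rho_le (Δ : ℝ) : latticeFreq Δ ^ 2 * latticeRho Δ ≤ 1 := by
  rw [latticeRho_eq_exp_freq, Real.exp_neg, ← div_eq_mul_inv, div_le_one (Real.exp_pos _)]
  have h1 := Real.exp_one_mul_le_exp (x := latticeFreq Δ ^ 2 / 2)
  have h2 := Real.exp_one_gt_d9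
  nlinarith [sq_nonneg (latticeFreq Δ)]

lemma bulkAmplitude_nonneg (Δ : ℝ) : 0 ≤ bulkAmplitude Δ := by
  have := latticeRho_pos Δ
  unfold bulkAmplitude; positivity

/-- With the amplitude inserted the excess over 1 is ρ²(4ω⁴ - 10ω² - 2) up to much smaller terms,
and ω² ≥ 4.38 for Δ ≤ 3. -/
lemma one_le_bulkLinear (h0 : 0 < Δ) (h3 : Δ ≤ 3) : 1 ≤ bulkLinear Δ (bulkAmplitude Δ) := by
  have hx := latticeFreq_sq_ge h0 h3
  have hr := latticeRho_le h0 h3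
  have hr0 := latticeRho_pos Δ
  have hxr := latticeFreq_sq_mul_rho_le Δ
  rw [bulkLinear, bulkAmplitude]
  set r := latticeRho Δ
  set x := latticeFreq Δ ^ 2
  have e : 1 + 2 * r ^ 2 - 2 * x * (2 * r ^ 2 + 9 * r ^ 8) + 2 * r * (2 * x + 1) * r * (x - 2) -
      2.2 * (2 * r * (2 * x + 1)) * r ^ 5 = 1 + r ^ 2 * ((4 * x ^ 2 - 10 * x - 2) -
        18 * (x * r) * r ^ 5 - 8.8 * (x * r) * r ^ 3 - 4.4 * r ^ 4) := by ring
  rw [e]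
  have h5 : r ^ 5 ≤ (1 / 8) ^ 5 := pow_le_pow_left₀ hr0.le hr 5
  have h3' : r ^ 3 ≤ (1 / 8) ^ 3 := pow_le_pow_left₀ hr0.le hr 3
  have h4 : r ^ 4 ≤ (1 / 8) ^ 4 := pow_le_pow_left₀ hr0.le hr 4
  have k1 : x * r * r ^ 5 ≤ 1 * (1 / 8) ^ 5 := mul_le_mul hxr h5 (by positivity) zero_le_one
  have k2 : x * r * r ^ 3 ≤ 1 * (1 / 8) ^ 3 := mul_le_mul hxr h3' (by positivity) zero_le_one
  have : 0 ≤ r ^ 2 * ((4 * x ^ 2 - 10 * x - 2) -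
        18 * (x * r) * r ^ 5 - 8.8 * (x * r) * r ^ 3 - 4.4 * r ^ 4) := by
    apply mul_nonneg (by positivity)
    nlinarith
  linarith

/-- To leading order the gain is ρ(ω² + 1/2) b - b²/8 plus terms free of b, namely -4ρ²ω² and
smaller. Its maximum over b is at b = 2ρ(2ω² + 1), where it collapses to 2ρ²(ω⁴ - ω²). The
subtracted terms bound everything of higher order. -/
lemma bulkGain_ge (h0 : 0 < Δ) (h3 : Δ ≤ 3) :
    2 * latticeRho Δ ^ 2 * (latticeFreq Δ ^ 2 * latticeFreq Δ ^ 2 - latticeFreq Δ ^ 2) -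
      9 / 8 * latticeRho Δ ^ 2 * bulkAmplitude Δ ^ 2 -
      2 * latticeRho Δ ^ 4 * (1 + bulkAmplitude Δ) ^ 2 ≤ bulkGain Δ (bulkAmplitude Δ) := by
  have hx := latticeFreq_sq_ge h0 h3
  have hr := latticeRho_le h0 h3
  have hr0 := latticeRho_pos Δ
  have hxr := latticeFreq_sq_mul_rho_le Δ
  have hb0 := bulkAmplitude_nonneg Δ
  have hb : bulkAmplitude Δ = 2 * latticeRho Δ * (2 * latticeFreq Δ ^ 2 + 1) := rfl
  rw [bulkGain, bulkLinear, bulkSquareMean]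
  set r := latticeRho Δ
  set x := latticeFreq Δ ^ 2
  set b := bulkAmplitude Δ
  have hb2 : 2 * r ≤ b := by rw [hb]; nlinarith
  have h4 : 0 < r ^ 4 := by positivity
  have t1 : x * r ^ 8 ≤ r ^ 4 / 500 := by
    have : r ^ 3 ≤ (1 / 8) ^ 3 := pow_le_pow_left₀ hr0.le hr 3
    calc x * r ^ 8 = (x * r) * r ^ 3 * r ^ 4 := by ring
      _ ≤ 1 * (1 / 8) ^ 3 * r ^ 4 := by gcongr
      _ ≤ _ := by norm_num; linarith
  have t2 : b * r ^ 5 ≤ b * r ^ 4 / 8 := by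
    have := mul_le_mul_of_nonneg_left hr (by positivity : 0 ≤ b * r ^ 4)
    linarith
  have t3 : r ^ 8 ≤ r ^ 4 / 4000 := by
    have : r ^ 4 ≤ (1 / 8) ^ 4 := pow_le_pow_left₀ hr0.le hr 4
    nlinarith
  have t4 : (2 * r - b) ^ 2 * r ^ 4 ≤ b ^ 2 * r ^ 4 := by
    refine mul_le_mul_of_nonneg_right ?_ h4.le
    nlinarith
  have t5 : (2 * r * b) ^ 2 * r ^ 4 ≤ b ^ 2 * r ^ 4 / 16 := by
    have : (2 * r) ^ 2 ≤ (1 / 4) ^ 2 := pow_le_pow_left₀ (by positivity) (by linarith) 2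
    calc (2 * r * b) ^ 2 * r ^ 4 = (2 * r) ^ 2 * (b ^ 2 * r ^ 4) := by ring
      _ ≤ (1 / 4) ^ 2 * (b ^ 2 * r ^ 4) := by gcongr
      _ = _ := by ring
  have t6 : (b - 2 * r) * (2 * r * b) * r ^ 9 ≤ b ^ 2 * r ^ 4 / 1000 := by
    have h6 : r ^ 6 ≤ (1 / 8) ^ 6 := pow_le_pow_left₀ hr0.le hr 6
    calc (b - 2 * r) * (2 * r * b) * r ^ 9 ≤ b * (2 * r * b) * r ^ 9 := by gcongr; linarith
      _ = 2 * r ^ 6 * (b ^ 2 * r ^ 4) := by ring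
      _ ≤ 2 * (1 / 8) ^ 6 * (b ^ 2 * r ^ 4) := by gcongr
      _ ≤ _ := by norm_num; nlinarith [mul_nonneg (sq_nonneg b) h4.le]
  have t7 : (2 * r * b) ^ 2 * r ^ 16 ≤ b ^ 2 * r ^ 4 / 1000 := by
    have h6 : r ^ 14 ≤ (1 / 8) ^ 14 := pow_le_pow_left₀ hr0.le hr 14
    calc (2 * r * b) ^ 2 * r ^ 16 = 4 * r ^ 14 * (b ^ 2 * r ^ 4) := by ring
      _ ≤ 4 * (1 / 8) ^ 14 * (b ^ 2 * r ^ 4) := by gcongr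
      _ ≤ _ := by norm_num; nlinarith [mul_nonneg (sq_nonneg b) h4.le]
  have t8 : (1 + b) ^ 2 * (2 * (1 + 2 * r) * (2.1 * r ^ 4) + (2.1 * r ^ 4) ^ 2) ≤
      (1 + b) ^ 2 * (5.3 * r ^ 4) := by
    refine mul_le_mul_of_nonneg_left ?_ (sq_nonneg _)
    nlinarith
  have e1 : 1.5 * r ^ 3 * b ≥ 0 := by positivity
  have e2 : 2 * r * b * r ^ 4 ≥ 0 := by positivity
  have e3 : b * r ^ 4 ≥ 0 := by positivity
  have e4 : b ^ 2 * r ^ 4 ≥ 0 := by positivity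
  have key : 1 + 2 * r ^ 2 - 2 * x * (2 * r ^ 2 + 9 * r ^ 8) + b * r * (x - 2) -
      2.2 * b * r ^ 5 - (1 + 2 * (1 + 2 * r ^ 2 + 3 * r ^ 8 - 2 * b * r) +
      ((1 - 2 * r * b / 2) ^ 2 + (2 * r - b) ^ 2 / 2 + (2 * r * b) ^ 2 / 8 +
        (2 * (2 * r - b) * (1 - 2 * r * b / 2) - (2 * r - b) * (2 * r * b) / 2) * r +
        ((2 * r - b) ^ 2 / 2 - 2 * r * b * (1 - 2 * r * b / 2)) * r ^ 4 -
        (2 * r - b) * (2 * r * b) / 2 * r ^ 9 + (2 * r * b) ^ 2 / 8 * r ^ 16 +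
        (1 + b) ^ 2 * (2 * (1 + 2 * r) * (2.1 * r ^ 4) + (2.1 * r ^ 4) ^ 2))) / 4 =
      2 * r ^ 2 * (x * x - x) - 9 / 8 * r ^ 2 * b ^ 2 + 1.5 * r ^ 3 * b - 18 * (x * r ^ 8) -
        2.2 * (b * r ^ 5) - 1.5 * r ^ 8 - ((2 * r - b) ^ 2 * r ^ 4 / 2 - 2 * r * b * r ^ 4 +
        (2 * r * b) ^ 2 * r ^ 4 / 2 + (b - 2 * r) * (2 * r * b) * r ^ 9 / 2 +
        (2 * r * b) ^ 2 * r ^ 16 / 8 +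
        (1 + b) ^ 2 * (2 * (1 + 2 * r) * (2.1 * r ^ 4) + (2.1 * r ^ 4) ^ 2)) / 4 := by
    rw [hb]; ring
  rw [key]
  nlinarith

/-- In terms of x = ω² the amplitude is 2(2x + 1)e^(-x/2), which decreases in x in the range x ≥
4.38, and x decreases in Δ. -/
lemma bulkAmplitude_mono (h0 : 0 < D) (h : D ≤ Δ) (h3 : Δ ≤ 3) :
    bulkAmplitude D ≤ bulkAmplitude Δ := by
  have hx := latticeFreq_sq_ge (h0.trans_le h) h3
  have hxx := latticeFreq_sq_le_of_le h0 h
  rw [bulkAmplitude, bulkAmplitude, latticeRho_eq_exp_freq, latticeRho_eq_exp_freq]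
  set x := latticeFreq Δ ^ 2
  set X := latticeFreq D ^ 2
  have h1 : 2 * X + 1 ≤ (2 * x + 1) * Real.exp ((X - x) / 2) := by
    have := Real.add_one_le_exp ((X - x) / 2)
    nlinarith
  have h2 : Real.exp (-(x / 2)) = Real.exp (-(X / 2)) * Real.exp ((X - x) / 2) := by
    rw [← Real.exp_add]; congr 1; ring
  rw [h2]
  have := mul_le_mul_of_nonneg_left h1 (Real.exp_pos (-(X / 2))).le
  linarith

/-- The same reasoning for (x² - x)e^(-x) with x = ω². The square of e^s ≥ 1 + s supplies the needed
second order. -/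
lemma rho_sq_mul_freq_mono (h0 : 0 < D) (h : D ≤ Δ) (h3 : Δ ≤ 3) :
    latticeRho D ^ 2 * (latticeFreq D ^ 2 * latticeFreq D ^ 2 - latticeFreq D ^ 2) ≤
    latticeRho Δ ^ 2 * (latticeFreq Δ ^ 2 * latticeFreq Δ ^ 2 - latticeFreq Δ ^ 2) := by
  have hx := latticeFreq_sq_ge (h0.trans_le h) h3
  have hxx := latticeFreq_sq_le_of_le h0 h
  rw [latticeRho_eq_exp_freq, latticeRho_eq_exp_freq]
  set x := latticeFreq Δ ^ 2
  set X := latticeFreq D ^ 2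
  have h1 : X * X - X ≤ (x * x - x) * Real.exp ((X - x) / 2) ^ 2 := by
    have h2 := Real.add_one_le_exp ((X - x) / 2)
    have h3 : (1 + (X - x) / 2) ^ 2 ≤ Real.exp ((X - x) / 2) ^ 2 :=
      pow_le_pow_left₀ (by linarith) (by linarith) 2
    have h4 : 0 ≤ x * x - x := by nlinarith
    refine le_trans ?_ (mul_le_mul_of_nonneg_left h3 h4)
    have hd : 0 ≤ X - x := by linarith
    have : X * X - X = (x * x - x) + (X - x) * (2 * x - 1) + (X - x) ^ 2 := by ring
    rw [this]
    nlinarith [mul_nonneg hd (by nlinarith : 0 ≤ x * x - x - (2 * x - 1)),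
      mul_nonneg (sq_nonneg (X - x)) (by nlinarith : 0 ≤ x * x - x - 4)]
  have h2 : Real.exp (-(x / 2)) = Real.exp (-(X / 2)) * Real.exp ((X - x) / 2) := by
    rw [← Real.exp_add]; congr 1; ring
  rw [h2, mul_pow]
  have := mul_le_mul_of_nonneg_left h1 (sq_nonneg (Real.exp (-(X / 2))))
  linarith

end Amplitude

/-! ### Numerical bounds for exponentials and for π. -/

section Bounds

lemma exp_neg_bounds {x : ℝ} (h0 : 0 ≤ x) (h1 : x ≤ 1) :
    1 - x + x ^ 2 / 2 - x ^ 3 / 6 + x ^ 4 / 24 - x ^ 5 / 120 - x ^ 6 / 600 ≤ Real.exp (-x) ∧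
    Real.exp (-x) ≤
      1 - x + x ^ 2 / 2 - x ^ 3 / 6 + x ^ 4 / 24 - x ^ 5 / 120 + x ^ 6 / 600 := by
  have h := Real.exp_bound (x := -x) (by rwa [abs_neg, abs_of_nonneg h0]) (n := 6) (by norm_num)
  rw [abs_neg, abs_of_nonneg h0] at h
  norm_num [Finset.sum_range_succ, Nat.factorial] at h
  have := abs_le.1 h
  have h6 : 0 ≤ x ^ 6 := by positivity
  constructor <;> nlinarith

/-- As a function of s = Δ², the logarithm (n/2) log s - rs is concave, so it lies below its tangent
at D². The hypothesis says that this tangent does not rise from D² towards Δ². -/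
lemma pow_mul_decay_le {D Δ r : ℝ} (hD : 0 < D) (hΔ : 0 < Δ) (n : ℕ)
    (h : ((n : ℝ) - 2 * r * D ^ 2) * (Δ ^ 2 - D ^ 2) ≤ 0) :
    Δ ^ n * decay Δ r ≤ D ^ n * decay D r := by
  have h1 : Δ / D ≤ Real.exp ((Δ ^ 2 / D ^ 2 - 1) / 2) := by
    have h2 := Real.add_one_le_exp (Δ ^ 2 / D ^ 2 - 1)
    have h3 : (Δ / D) ^ 2 ≤ Real.exp ((Δ ^ 2 / D ^ 2 - 1) / 2) ^ 2 := by
      rw [← Real.exp_nat_mul, div_pow]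
      refine le_trans (by linarith) (h2.trans (le_of_eq ?_))
      congr 1; push_cast; ring
    exact le_of_sq_le_sq h3 (Real.exp_pos _).le
  have h2 : (Δ / D) ^ n ≤ Real.exp (r * (Δ ^ 2 - D ^ 2)) := by
    refine (pow_le_pow_left₀ (by positivity) h1 n).trans ?_
    rw [← Real.exp_nat_mul]
    refine Real.exp_le_exp.2 ?_
    have : (n : ℝ) * ((Δ ^ 2 / D ^ 2 - 1) / 2) - r * (Δ ^ 2 - D ^ 2) =
        ((n : ℝ) - 2 * r * D ^ 2) * (Δ ^ 2 - D ^ 2) / (2 * D ^ 2) := by field_simp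
    have h3 : ((n : ℝ) - 2 * r * D ^ 2) * (Δ ^ 2 - D ^ 2) / (2 * D ^ 2) ≤ 0 :=
      div_nonpos_of_nonpos_of_nonneg h (by positivity)
    linarith
  rw [div_pow, div_le_iff₀ (by positivity)] at h2
  have h3 : decay D r = Real.exp (r * (Δ ^ 2 - D ^ 2)) * decay Δ r := by
    rw [decay, decay, ← Real.exp_add]; congr 1; ring
  rw [h3]
  have := mul_le_mul_of_nonneg_right h2 (decay_pos Δ r).le
  linarith

lemma one_div_two_sqrt_pi_bounds :
    0.28209 ≤ 1 / (2 * √Real.pi) ∧ 1 / (2 * √Real.pi) ≤ 0.2821 := by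
  have h1 := Real.pi_gt_d6
  have h2 := Real.pi_lt_d6
  have h3 : √Real.pi ≤ 1.7724540 := Real.sqrt_le_iff.2 ⟨by norm_num, by norm_num at *; linarith⟩
  have h4 : 1.7724530 ≤ √Real.pi := Real.le_sqrt_of_sq_le (by norm_num at *; linarith)
  have h5 : 0 < √Real.pi := Real.sqrt_pos.2 Real.pi_pos
  constructor
  · rw [le_div_iff₀ (by positivity)]; linarith
  · rw [div_le_iff₀ (by positivity)]; linarith

lemma one_div_two_pi_sqrt_three_bounds :
    0.09188 ≤ 1 / (2 * Real.pi * √3) ∧ 1 / (2 * Real.pi * √3) ≤ 0.09189 := by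
  have h1 := Real.pi_gt_d6
  have h2 := Real.pi_lt_d6
  have h3 : √3 ≤ 1.732051 := Real.sqrt_le_iff.2 ⟨by norm_num, by norm_num⟩
  have h4 : 1.73205 ≤ √3 := Real.le_sqrt_of_sq_le (by norm_num)
  have h5 : 0 < √3 := by positivity
  have h6 := Real.pi_pos
  constructor
  · rw [le_div_iff₀ (by positivity)]; nlinarith
  · rw [div_le_iff₀ (by positivity)]; nlinarith

lemma pi_sq_bounds : 9.8696 ≤ Real.pi ^ 2 ∧ Real.pi ^ 2 ≤ 9.8697 := by
  have h1 := Real.pi_gt_d6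
  have h2 := Real.pi_lt_d6
  norm_num at h1 h2
  constructor <;> nlinarith

end Bounds

/-! ### Interval bounds for each constituent of the balance. -/

section Components
variable {Δ b b0 b1 n0 n1 t0 t1 : ℝ}

lemma pairCoef_eq (Δ : ℝ) : pairCoef Δ = 1 / (2 * √Real.pi) * Δ := by rw [pairCoef]; ring

lemma tripleCoef_eq (Δ : ℝ) : tripleCoef Δ = 1 / (2 * Real.pi * √3) * Δ ^ 2 := by
  rw [tripleCoef]; ring

lemma bulkEdgeLoss_le (h0 : 0 < Δ) (hb0 : 0 ≤ b0) (hb : b0 ≤ b) (hb1 : b ≤ b1) (hn0 : 0 ≤ n0)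
    (hn : n0 ≤ latticeEta Δ) (hn1 : latticeEta Δ ≤ n1) (hbn : b1 * n1 ≤ 1) {U1 U2 U3 U4 : ℝ}
    (h1 : Δ ^ 3 * decay Δ (1 / 4) ≤ U1) (h2 : Δ ^ 3 * decay Δ (9 / 4) ≤ U2)
    (h3 : Δ ^ 3 * decay Δ 1 ≤ U3) (h4 : Δ ^ 3 * decay Δ 4 ≤ U4) :
    bulkEdgeLoss Δ b ≤ 0.2821 * ((U1 + 27 * U2 + 70 * U4) * (1 + b1 * n1) +
      8 * U3 * (1 - b0 * n0)) := by
  have hk := one_div_two_sqrt_pi_bounds.2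
  have hk0 : 0 ≤ 1 / (2 * √Real.pi) := by positivity
  have hlo : b0 * n0 ≤ b * latticeEta Δ := mul_le_mul hb hn hn0 (hb0.trans hb)
  have hhi : b * latticeEta Δ ≤ b1 * n1 :=
    mul_le_mul hb1 hn1 (hn0.trans hn) (hb0.trans (hb.trans hb1))
  have e : bulkEdgeLoss Δ b = 1 / (2 * √Real.pi) * ((Δ ^ 3 * decay Δ (1 / 4) +
      27 * (Δ ^ 3 * decay Δ (9 / 4)) + 70 * (Δ ^ 3 * decay Δ 4)) * (1 + b * latticeEta Δ) +
      8 * (Δ ^ 3 * decay Δ 1) * (1 - b * latticeEta Δ)) := by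
    rw [bulkEdgeLoss, pairCoef_eq]; ring
  have d := fun r => mul_pos (pow_pos h0 3) (decay_pos Δ r)
  have d1 := d (1 / 4)
  have d2 := d (9 / 4)
  have d3 := d 1
  have d4 := d 4
  have hbn0 : 0 ≤ b * latticeEta Δ := mul_nonneg (hb0.trans hb) (hn0.trans hn)
  have g1 : 0 ≤ 1 - b * latticeEta Δ := by linarith
  rw [e]
  refine mul_le_mul hk (add_le_add (mul_le_mul (by linarith) (by linarith) (by linarith)
    (by linarith)) (mul_le_mul (by linarith) (by linarith) g1 (by linarith))) ?_ (by norm_num)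
  positivity

lemma bulkEdgeGain_ge (hb0 : 0 ≤ b0) (hb : b0 ≤ b) (hb1 : b ≤ b1) (hn0 : 0 ≤ n0)
    (hn : n0 ≤ latticeEta Δ) (hn1 : latticeEta Δ ≤ n1) (hbn : b1 * n1 ≤ 1) (ht0 : 0 ≤ t0)
    (ht : t0 ≤ latticeTau Δ) (ht1 : latticeTau Δ ≤ t1) {V1 V2 W1 W2 W3 H1 H0 : ℝ}
    (h1 : V1 ≤ Δ ^ 1 * decay Δ (1 / 4)) (h2 : V2 ≤ Δ ^ 1 * decay Δ 1)
    (w1 : W1 ≤ Δ ^ 2 * decay Δ (1 / 3)) (w2 : W2 ≤ Δ ^ 2 * decay Δ (4 / 3))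
    (w3 : W3 ≤ Δ ^ 2 * decay Δ 1) (p1 : 0 ≤ V1) (p2 : 0 ≤ V2) (q1 : 0 ≤ W1) (q2 : 0 ≤ W2)
    (q3 : 0 ≤ W3) (hH1 : H1 ≤ 1 + b0 ^ 2 / 2 + b0 * t0 - b1 ^ 2 / 4 * t1 ^ 4)
    (hH0 : H0 ≤ 1 + b0 ^ 2 / 2 - 2 * (b1 * t1) + b0 ^ 2 / 2 * t0 ^ 4)
    (r1 : 0 ≤ H1) (r0 : 0 ≤ H0) :
    0.28209 * (V1 * (1 + b0 * n0) + 2 * V2 * (1 - b1 * n1)) +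
      0.09188 * ((6 * W1 + 12 * W2) * H1 + 12 * W3 * H0) / 4 ≤ bulkEdgeGain Δ b := by
  have hk := one_div_two_sqrt_pi_bounds.1
  have hk' := one_div_two_pi_sqrt_three_bounds.1
  have hlo : b0 * n0 ≤ b * latticeEta Δ := mul_le_mul hb hn hn0 (hb0.trans hb)
  have hhi : b * latticeEta Δ ≤ b1 * n1 :=
    mul_le_mul hb1 hn1 (hn0.trans hn) (hb0.trans (hb.trans hb1))
  have hbn0 : 0 ≤ b0 * n0 := mul_nonneg hb0 hn0
  have u1 : b0 * t0 ≤ b * latticeTau Δ := mul_le_mul hb ht ht0 (hb0.trans hb)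
  have u2 : b * latticeTau Δ ≤ b1 * t1 :=
    mul_le_mul hb1 ht1 (ht0.trans ht) (hb0.trans (hb.trans hb1))
  have u3 : b0 ^ 2 ≤ b ^ 2 := pow_le_pow_left₀ hb0 hb 2
  have u4 : b ^ 2 ≤ b1 ^ 2 := pow_le_pow_left₀ (hb0.trans hb) hb1 2
  have u5 : t0 ^ 4 ≤ latticeTau Δ ^ 4 := pow_le_pow_left₀ ht0 ht 4
  have u6 : latticeTau Δ ^ 4 ≤ t1 ^ 4 := pow_le_pow_left₀ (ht0.trans ht) ht1 4
  have u7 : b0 ^ 2 * t0 ^ 4 ≤ b ^ 2 * latticeTau Δ ^ 4 :=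
    mul_le_mul u3 u5 (by positivity) (by positivity)
  have u8 : b ^ 2 * latticeTau Δ ^ 4 ≤ b1 ^ 2 * t1 ^ 4 :=
    mul_le_mul u4 u6 (by positivity) (by positivity)
  have v1 : H1 ≤ 1 + b ^ 2 / 2 + b * latticeTau Δ - b ^ 2 / 4 * latticeTau Δ ^ 4 := by linarith
  have v0 : H0 ≤ 1 + b ^ 2 / 2 - 2 * (b * latticeTau Δ) + b ^ 2 / 2 * latticeTau Δ ^ 4 := by
    linarith
  have e : bulkEdgeGain Δ b = 1 / (2 * √Real.pi) * (Δ ^ 1 * decay Δ (1 / 4) *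
        (1 + b * latticeEta Δ) + 2 * (Δ ^ 1 * decay Δ 1) * (1 - b * latticeEta Δ)) +
      1 / (2 * Real.pi * √3) * ((6 * (Δ ^ 2 * decay Δ (1 / 3)) +
        12 * (Δ ^ 2 * decay Δ (4 / 3))) *
        (1 + b ^ 2 / 2 + b * latticeTau Δ - b ^ 2 / 4 * latticeTau Δ ^ 4) +
      12 * (Δ ^ 2 * decay Δ 1) *
        (1 + b ^ 2 / 2 - 2 * (b * latticeTau Δ) + b ^ 2 / 2 * latticeTau Δ ^ 4)) / 4 := by
    rw [bulkEdgeGain, pairCoef_eq, tripleCoef_eq]; ring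
  rw [e]
  have g1 : 0 ≤ 1 - b1 * n1 := by linarith
  have k1 : 0.28209 * (V1 * (1 + b0 * n0) + 2 * V2 * (1 - b1 * n1)) ≤
      1 / (2 * √Real.pi) * (Δ ^ 1 * decay Δ (1 / 4) *
        (1 + b * latticeEta Δ) + 2 * (Δ ^ 1 * decay Δ 1) * (1 - b * latticeEta Δ)) :=
    mul_le_mul hk (add_le_add (mul_le_mul h1 (by linarith) (by linarith) (by linarith))
      (mul_le_mul (by linarith) (by linarith) g1 (by linarith))) (by positivity)
      (by positivity)
  have k2 : 0.09188 * ((6 * W1 + 12 * W2) * H1 + 12 * W3 * H0) ≤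
      1 / (2 * Real.pi * √3) * ((6 * (Δ ^ 2 * decay Δ (1 / 3)) +
        12 * (Δ ^ 2 * decay Δ (4 / 3))) *
        (1 + b ^ 2 / 2 + b * latticeTau Δ - b ^ 2 / 4 * latticeTau Δ ^ 4) +
      12 * (Δ ^ 2 * decay Δ 1) *
        (1 + b ^ 2 / 2 - 2 * (b * latticeTau Δ) + b ^ 2 / 2 * latticeTau Δ ^ 4)) :=
    mul_le_mul hk' (add_le_add (mul_le_mul (by linarith) v1 r1 (by linarith))
      (mul_le_mul (by linarith) v0 r0 (by linarith))) (by positivity)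
      (by have := Real.pi_pos; positivity)
  linarith

lemma tiltLoss_le (h0 : 0 < Δ) {U1 U2 U3 m : ℝ} (h1 : Δ ^ 3 * decay Δ 0.46 ≤ U1)
    (h2 : Δ ^ 3 * decay Δ 1.51 ≤ U2) (h3 : Δ ^ 3 * decay Δ 3.06 ≤ U3)
    (hm : decay Δ (3 / 5) ≤ m) (hm1 : m < 1) :
    tiltLoss Δ ≤ 0.2821 * (U1 + 4 * U2 + 10 * U3) / (1 - m) := by
  have hk := one_div_two_sqrt_pi_bounds.2
  have d := fun r => mul_pos (pow_pos h0 3) (decay_pos Δ r)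
  have d1 := d 0.46
  have d2 := d 1.51
  have d3 := d 3.06
  have e : tiltLoss Δ = 1 / (2 * √Real.pi) * (Δ ^ 3 * decay Δ 0.46 + 4 * (Δ ^ 3 * decay Δ 1.51) +
      10 * (Δ ^ 3 * decay Δ 3.06)) / (1 - decay Δ (3 / 5)) := by
    rw [tiltLoss, pairCoef_eq]; ring
  rw [e]
  exact div_le_div₀ (by linarith) (mul_le_mul hk (by linarith) (by linarith) (by norm_num))
    (by linarith) (by linarith)

lemma tiltGain_ge (h0 : 0 < Δ) (hb0 : 0 ≤ b0) (hb : b0 ≤ b) (hb1 : b ≤ b1) (ht0 : 0 ≤ t0)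
    (ht : t0 ≤ latticeTau Δ) (ht1 : latticeTau Δ ≤ t1) (hbt : b1 * t1 ≤ 1)
    {V1 V2 V3 W1 W2 W3 W4 m : ℝ}
    (h1 : V1 ≤ Δ ^ 1 * decay Δ (-0.09)) (h2 : V2 ≤ Δ ^ 1 * decay Δ 0.46)
    (h3 : V3 ≤ Δ ^ 1 * decay Δ 1.51)
    (w1 : W1 ≤ Δ ^ 2 * decay Δ (-0.06)) (w2 : W2 ≤ Δ ^ 2 * decay Δ (1 / 3 + 0.14))
    (w3 : W3 ≤ Δ ^ 2 * decay Δ (1 / 3 + 0.34)) (w4 : W4 ≤ Δ ^ 2 * decay Δ 1.54)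
    (p1 : 0 ≤ V1) (p2 : 0 ≤ V2) (p3 : 0 ≤ V3) (q1 : 0 ≤ W1) (q2 : 0 ≤ W2)
    (q3 : 0 ≤ W3) (q4 : 0 ≤ W4) (hm : m ≤ decay Δ (3 / 5)) (hm1 : decay Δ (3 / 5) < 1) :
    (0.28209 * (V1 + 2 * V2 + 2 * V3) + 0.09188 * (W1 * (1 - 0.3091 * (b1 * t1)) +
      3 * W2 * (1 - 0.68 * (b1 * t1)) + 3 * W3 * (1 + 0.978 * (b0 * t0)) +
      6 * W4 * (1 - 0.3091 * (b1 * t1)))) / (1 - m) ≤ tiltGain Δ b := by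
  have hk := one_div_two_sqrt_pi_bounds.1
  have hk' := one_div_two_pi_sqrt_three_bounds.1
  have u1 : b0 * t0 ≤ b * latticeTau Δ := mul_le_mul hb ht ht0 (hb0.trans hb)
  have u2 : b * latticeTau Δ ≤ b1 * t1 :=
    mul_le_mul hb1 ht1 (ht0.trans ht) (hb0.trans (hb.trans hb1))
  have u0 : 0 ≤ b0 * t0 := mul_nonneg hb0 ht0
  set z := b * latticeTau Δ
  have d1 := decay_pos Δ (4 / 3 + 0.34)
  have d2 := decay_pos Δ (4 / 3 + 0.74)
  have e : tiltGain Δ b = (1 / (2 * √Real.pi) * (Δ ^ 1 * decay Δ (-0.09) +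
      2 * (Δ ^ 1 * decay Δ 0.46) + 2 * (Δ ^ 1 * decay Δ 1.51)) +
      1 / (2 * Real.pi * √3) * (Δ ^ 2 * decay Δ (-0.06) * (1 - 0.3091 * z) +
        3 * (Δ ^ 2 * decay Δ (1 / 3 + 0.14)) * (1 - 0.68 * z) +
        3 * (Δ ^ 2 * decay Δ (1 / 3 + 0.34)) * (1 + 0.978 * z) +
        6 * (Δ ^ 2 * decay Δ 1.54) * (1 - 0.3091 * z) +
        Δ ^ 2 * (3 * decay Δ (4 / 3 + 0.34) * (1 + 0.978 * z) +
        3 * decay Δ (4 / 3 + 0.74) * (1 - 0.68 * z)))) / (1 - decay Δ (3 / 5)) := by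
    rw [tiltGain, pairCoef_eq, tripleCoef_eq]; ring
  rw [e]
  have g1 : 0 ≤ 1 - 0.3091 * z := by linarith
  have g2 : 0 ≤ 1 - 0.68 * z := by linarith
  have g3 : 0 ≤ 1 + 0.978 * z := by linarith
  have g1' : 0 ≤ 1 - 0.3091 * (b1 * t1) := by linarith
  have g2' : 0 ≤ 1 - 0.68 * (b1 * t1) := by linarith
  have g3' : 0 ≤ 1 + 0.978 * (b0 * t0) := by linarith
  have k0 : 0 ≤ Δ ^ 2 * (3 * decay Δ (4 / 3 + 0.34) * (1 + 0.978 * z) +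
        3 * decay Δ (4 / 3 + 0.74) * (1 - 0.68 * z)) := by positivity
  have k1 : 0.28209 * (V1 + 2 * V2 + 2 * V3) ≤ 1 / (2 * √Real.pi) * (Δ ^ 1 * decay Δ (-0.09) +
      2 * (Δ ^ 1 * decay Δ 0.46) + 2 * (Δ ^ 1 * decay Δ 1.51)) :=
    mul_le_mul hk (by linarith) (by linarith) (by positivity)
  have a1 := mul_le_mul w1 (by linarith : 1 - 0.3091 * (b1 * t1) ≤ 1 - 0.3091 * z) g1'
    (q1.trans w1)
  have a2 := mul_le_mul w2 (by linarith : 1 - 0.68 * (b1 * t1) ≤ 1 - 0.68 * z) g2' (q2.trans w2)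
  have a3 := mul_le_mul w3 (by linarith : 1 + 0.978 * (b0 * t0) ≤ 1 + 0.978 * z) g3' (q3.trans w3)
  have a4 := mul_le_mul w4 (by linarith : 1 - 0.3091 * (b1 * t1) ≤ 1 - 0.3091 * z) g1'
    (q4.trans w4)
  have k2 : 0.09188 * (W1 * (1 - 0.3091 * (b1 * t1)) +
      3 * W2 * (1 - 0.68 * (b1 * t1)) + 3 * W3 * (1 + 0.978 * (b0 * t0)) +
      6 * W4 * (1 - 0.3091 * (b1 * t1))) ≤
      1 / (2 * Real.pi * √3) * (Δ ^ 2 * decay Δ (-0.06) * (1 - 0.3091 * z) +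
        3 * (Δ ^ 2 * decay Δ (1 / 3 + 0.14)) * (1 - 0.68 * z) +
        3 * (Δ ^ 2 * decay Δ (1 / 3 + 0.34)) * (1 + 0.978 * z) +
        6 * (Δ ^ 2 * decay Δ 1.54) * (1 - 0.3091 * z) +
        Δ ^ 2 * (3 * decay Δ (4 / 3 + 0.34) * (1 + 0.978 * z) +
        3 * decay Δ (4 / 3 + 0.74) * (1 - 0.68 * z))) :=
    mul_le_mul hk' (by linarith) (by positivity) (by have := Real.pi_pos; positivity)
  have k3 : 0 ≤ 0.09188 * (W1 * (1 - 0.3091 * (b1 * t1)) +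
      3 * W2 * (1 - 0.68 * (b1 * t1)) + 3 * W3 * (1 + 0.978 * (b0 * t0)) +
      6 * W4 * (1 - 0.3091 * (b1 * t1))) := by positivity
  exact div_le_div₀ (by linarith) (add_le_add k1 k2) (by linarith) (by linarith)

lemma tiltSquareLoss_le (h0 : 0 < Δ) {U1 U2 U3 m : ℝ} (h1 : Δ ^ 2 * decay Δ (-0.24) ≤ U1)
    (h2 : Δ ^ 2 * decay Δ (1 / 3 + 0.16) ≤ U2) (h3 : Δ ^ 2 * decay Δ (1 / 3 + 0.56) ≤ U3)
    (hm : decay Δ (3 / 5) ≤ m) (hm1 : m < 1) :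
    tiltSquareLoss Δ ≤ 0.09189 * (U1 + 3.022 * U2 + 3.17 * U3) / (1 - m ^ 2) := by
  have hk := one_div_two_pi_sqrt_three_bounds.2
  have d := fun r => mul_pos (pow_pos h0 2) (decay_pos Δ r)
  have d1 := d (-0.24)
  have d2 := d (1 / 3 + 0.16)
  have d3 := d (1 / 3 + 0.56)
  have hm0 := decay_pos Δ (3 / 5)
  have hm2 : decay Δ (3 / 5) ^ 2 ≤ m ^ 2 := pow_le_pow_left₀ hm0.le hm 2
  have hm3 : m ^ 2 < 1 := pow_lt_one₀ (hm0.le.trans hm) hm1 (by norm_num)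
  have e : tiltSquareLoss Δ = 1 / (2 * Real.pi * √3) * (Δ ^ 2 * decay Δ (-0.24) +
      3.022 * (Δ ^ 2 * decay Δ (1 / 3 + 0.16)) + 3.17 * (Δ ^ 2 * decay Δ (1 / 3 + 0.56))) /
      (1 - decay Δ (3 / 5) ^ 2) := by
    rw [tiltSquareLoss, tripleCoef_eq]; ring
  rw [e]
  exact div_le_div₀ (by linarith) (mul_le_mul hk (by linarith) (by linarith) (by norm_num))
    (by linarith) (by linarith)

/-- The positive main term is increasing in Δ and is evaluated at the left end D, the negative terms
at upper bounds for Δ. The number 39.4784 is four times the lower bound for π². -/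
lemma bulkGain_ge_of_bounds {D x A : ℝ} (hD : 0 < D) (hDΔ : D ≤ Δ) (h3 : Δ ≤ 3)
    (hx : x * D ^ 2 ≤ 39.4784) (hx1 : 1 ≤ x) (hn0 : 0 ≤ n0) (hn : n0 ≤ latticeEta D)
    (hn1 : latticeEta Δ ≤ n1) (hb1 : bulkAmplitude Δ ≤ b1)
    (hA : A ≤ 2 * n0 ^ 4 * (x * x - x) - 9 / 8 * n1 ^ 4 * b1 ^ 2 - 2 * n1 ^ 8 * (1 + b1) ^ 2) :
    A ≤ bulkGain Δ (bulkAmplitude Δ) := by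
  have hb0 := bulkAmplitude_nonneg Δ
  have h := bulkGain_ge (hD.trans_le hDΔ) h3
  have hm := rho_sq_mul_freq_mono hD hDΔ h3
  have hX : x ≤ latticeFreq D ^ 2 := by
    rw [latticeFreq, div_pow, le_div_iff₀ (by positivity)]
    have := pi_sq_bounds.1
    linarith
  simp only [← latticeEta_sq, ← pow_mul] at h hm
  have e0 := (latticeEta_pos Δ).le
  have k1 : n0 ^ 4 ≤ latticeEta D ^ 4 := pow_le_pow_left₀ hn0 hn 4
  have k2 : latticeEta Δ ^ 4 ≤ n1 ^ 4 := pow_le_pow_left₀ e0 hn1 4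
  have k3 : latticeEta Δ ^ 8 ≤ n1 ^ 8 := pow_le_pow_left₀ e0 hn1 8
  have k4 : bulkAmplitude Δ ^ 2 ≤ b1 ^ 2 := pow_le_pow_left₀ hb0 hb1 2
  have k5 : (1 + bulkAmplitude Δ) ^ 2 ≤ (1 + b1) ^ 2 :=
    pow_le_pow_left₀ (by linarith) (by linarith) 2
  have k6 : x * x - x ≤ latticeFreq D ^ 2 * latticeFreq D ^ 2 - latticeFreq D ^ 2 := by nlinarith
  have l1 := mul_le_mul k1 k6 (by nlinarith) (by positivity)
  have l2 := mul_le_mul k2 k4 (by positivity) (by positivity)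
  have l3 := mul_le_mul k3 k5 (by positivity) (by positivity)
  norm_num at h hm
  linarith

/-- For k ≤ 256A the expression is nondecreasing in M ≥ 16, so M = 16 is the worst case. -/
lemma add_div_nonneg_of_sixteen_le {A B k M : ℝ} (hM : 16 ≤ M) (hk : k ≤ 256 * A) (hA : 0 ≤ A)
    (h : 0 ≤ 16 * A + k / 16 + B) : 0 ≤ M * A + B + k / M := by
  have hM0 : 0 < M := by linarith
  have e : k / M = k / 16 - k * ((M - 16) / (16 * M)) := by field_simp; ring
  have h2 : k * ((M - 16) / (16 * M)) ≤ A * (M - 16) := by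
    have h3 : 0 ≤ (M - 16) / (16 * M) := div_nonneg (by linarith) (by linarith)
    have h4 : 256 * A * ((M - 16) / (16 * M)) ≤ A * (M - 16) := by
      have : 256 * A * ((M - 16) / (16 * M)) = A * (M - 16) * (16 / M) := by
        field_simp; ring
      rw [this]
      exact mul_le_of_le_one_right (mul_nonneg hA (by linarith)) ((div_le_one hM0).2 hM)
    exact (mul_le_mul_of_nonneg_right hk h3).trans h4
  rw [e]
  linarith

end Components

/-! ### Rational certificates on a subinterval of spacings. -/

section Cells

/-- All exponents that occur are multiples of 1/300, so brackets of a single exponential at each end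
of the cell control every decay factor. -/
lemma decay_eq_pow (D : ℝ) {r : ℝ} (n : ℕ) (h : r = n / 300) :
    decay D r = decay D (1 / 300) ^ n := by
  rw [← decay_nat_mul, h]; congr 1; ring

lemma decay_neg_eq_inv (D r : ℝ) : decay D (-r) = (decay D r)⁻¹ := by
  rw [decay, decay, ← Real.exp_neg]; congr 1; ring

/-- Numeric brackets of the decay and lattice constants on the interval `[D0, D1]`. -/
structure CellBracket (D0 D1 p0 p1 q1 n0 n1 t0 t1 b0 b1 : ℝ) : Prop where
  lt : 2.015 ≤ D0
  le : D0 ≤ D1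
  le_three : D1 ≤ 3
  decay_le_left : decay D0 (1 / 300) ≤ p0
  decay_le_right : decay D1 (1 / 300) ≤ p1
  le_decay_right : q1 ≤ decay D1 (1 / 300)
  pos_decay : 0 < q1
  le_eta : n0 ≤ latticeEta D0
  eta_le : latticeEta D1 ≤ n1
  le_tau : t0 ≤ latticeTau D0
  tau_le : latticeTau D1 ≤ t1
  eta_nonneg : 0 ≤ n0
  tau_nonneg : 0 ≤ t0
  amp_nonneg : 0 ≤ b0
  -- The amplitude equals 2η²(8π² + Δ²)/Δ², and 8π² lies between 78.9568 and 78.9576.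
  le_amp : b0 * D0 ^ 2 ≤ 2 * n0 ^ 2 * (78.9568 + D0 ^ 2)
  amp_le : 2 * n1 ^ 2 * (78.9576 + D1 ^ 2) ≤ b1 * D1 ^ 2
  mul_le : b1 * n1 ≤ 1

lemma latticeEta_mono {D Δ : ℝ} (h0 : 0 < D) (h : D ≤ Δ) : latticeEta D ≤ latticeEta Δ := by
  have := h0.trans_le h
  unfold latticeEta; gcongr

lemma latticeTau_mono {D Δ : ℝ} (h0 : 0 < D) (h : D ≤ Δ) : latticeTau D ≤ latticeTau Δ := by
  have := h0.trans_le h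
  unfold latticeTau; gcongr

/-- Dividing the exponent by 96 makes the argument of the Taylor bounds small. The constant τ has
two thirds of the exponent of η, that is 64/96. -/
lemma latticeEta_eq_pow (D : ℝ) :
    latticeEta D = Real.exp (-(Real.pi ^ 2 / (96 * D ^ 2))) ^ 96 := by
  rw [latticeEta, ← Real.exp_nat_mul]; congr 1; push_cast; ring

lemma latticeTau_eq_pow (D : ℝ) :
    latticeTau D = Real.exp (-(Real.pi ^ 2 / (96 * D ^ 2))) ^ 64 := by
  rw [latticeTau, ← Real.exp_nat_mul]; congr 1; push_cast; ring

lemma sq_div_mem_unit {D : ℝ} (h0 : 2.015 ≤ D) (h3 : D ≤ 3) :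
    0 ≤ D ^ 2 / 300 ∧ D ^ 2 / 300 ≤ 1 := ⟨by positivity, by nlinarith⟩

lemma exp_neg_lower_nonneg {v : ℝ} (h0 : 0 ≤ v) (h1 : v ≤ 1) :
    0 ≤ 1 - v + v ^ 2 / 2 - v ^ 3 / 6 + v ^ 4 / 24 - v ^ 5 / 120 - v ^ 6 / 600 := by
  have z1 : v ^ 3 ≤ v ^ 2 := pow_le_pow_of_le_one h0 h1 (by norm_num)
  have z2 : v ^ 5 ≤ v ^ 4 := pow_le_pow_of_le_one h0 h1 (by norm_num)
  have z3 : v ^ 6 ≤ v ^ 4 := pow_le_pow_of_le_one h0 h1 (by norm_num)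
  have z4 : 0 ≤ v ^ 4 := by positivity
  have z5 : 0 ≤ v ^ 2 := by positivity
  linarith

/-- Rational certificate for a `CellBracket`. -/
lemma CellBracket.of_bounds {D0 D1 p0 p1 q1 n0 n1 t0 t1 b0 b1 v0 v1 : ℝ} (h0 : 2.015 ≤ D0)
    (h1 : D0 ≤ D1) (h3 : D1 ≤ 3)
    (a1 : 1 - D0 ^ 2 / 300 + (D0 ^ 2 / 300) ^ 2 / 2 - (D0 ^ 2 / 300) ^ 3 / 6 +
      (D0 ^ 2 / 300) ^ 4 / 24 - (D0 ^ 2 / 300) ^ 5 / 120 + (D0 ^ 2 / 300) ^ 6 / 600 ≤ p0)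
    (a2 : 1 - D1 ^ 2 / 300 + (D1 ^ 2 / 300) ^ 2 / 2 - (D1 ^ 2 / 300) ^ 3 / 6 +
      (D1 ^ 2 / 300) ^ 4 / 24 - (D1 ^ 2 / 300) ^ 5 / 120 + (D1 ^ 2 / 300) ^ 6 / 600 ≤ p1)
    (a3 : q1 ≤ 1 - D1 ^ 2 / 300 + (D1 ^ 2 / 300) ^ 2 / 2 - (D1 ^ 2 / 300) ^ 3 / 6 +
      (D1 ^ 2 / 300) ^ 4 / 24 - (D1 ^ 2 / 300) ^ 5 / 120 - (D1 ^ 2 / 300) ^ 6 / 600)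
    (a4 : 0 < q1) (v0' : 0 ≤ v0) (v0'' : v0 ≤ 1) (v1' : 0 ≤ v1) (v1'' : v1 ≤ 1)
    (hv0 : 9.8697 ≤ v0 * (96 * D0 ^ 2)) (hv1 : v1 * (96 * D1 ^ 2) ≤ 9.8696)
    (e0 : n0 ≤ (1 - v0 + v0 ^ 2 / 2 - v0 ^ 3 / 6 + v0 ^ 4 / 24 - v0 ^ 5 / 120 - v0 ^ 6 / 600) ^ 96)
    (e1 : (1 - v1 + v1 ^ 2 / 2 - v1 ^ 3 / 6 + v1 ^ 4 / 24 - v1 ^ 5 / 120 + v1 ^ 6 / 600) ^ 96 ≤ n1)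
    (f0 : t0 ≤ (1 - v0 + v0 ^ 2 / 2 - v0 ^ 3 / 6 + v0 ^ 4 / 24 - v0 ^ 5 / 120 - v0 ^ 6 / 600) ^ 64)
    (f1 : (1 - v1 + v1 ^ 2 / 2 - v1 ^ 3 / 6 + v1 ^ 4 / 24 - v1 ^ 5 / 120 + v1 ^ 6 / 600) ^ 64 ≤ t1)
    (i1 : 0 ≤ n0) (i2 : 0 ≤ t0) (i3 : 0 ≤ b0)
    (i4 : b0 * D0 ^ 2 ≤ 2 * n0 ^ 2 * (78.9568 + D0 ^ 2))
    (i5 : 2 * n1 ^ 2 * (78.9576 + D1 ^ 2) ≤ b1 * D1 ^ 2) (i6 : b1 * n1 ≤ 1) :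
    CellBracket D0 D1 p0 p1 q1 n0 n1 t0 t1 b0 b1 := by
  have hd : ∀ D : ℝ, decay D (1 / 300) = Real.exp (-(D ^ 2 / 300)) := fun D => by
    rw [decay]; congr 1; ring
  have s0 := sq_div_mem_unit h0 (h1.trans h3)
  have s1 := sq_div_mem_unit (h0.trans h1) h3
  have b0' := exp_neg_bounds s0.1 s0.2
  have b1' := exp_neg_bounds s1.1 s1.2
  have pb := pi_sq_bounds
  have hD0 : 0 < D0 := by linarith only [h0]
  have hD1 : 0 < D1 := hD0.trans_le h1
  have w0 : Real.pi ^ 2 / (96 * D0 ^ 2) ≤ v0 := by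
    rw [div_le_iff₀ (by positivity)]; exact pb.2.trans hv0
  have w1 : v1 ≤ Real.pi ^ 2 / (96 * D1 ^ 2) := by
    rw [le_div_iff₀ (by positivity)]; exact hv1.trans pb.1
  have c0 := exp_neg_bounds v0' v0''
  have c1 := exp_neg_bounds v1' v1''
  have k0 := c0.1.trans (Real.exp_le_exp.2 (neg_le_neg w0))
  have k1 := (Real.exp_le_exp.2 (neg_le_neg w1)).trans c1.2
  have y0 := exp_neg_lower_nonneg v0' v0''
  refine ⟨h0, h1, h3, ?_, ?_, ?_, a4, ?_, ?_, ?_, ?_, i1, i2, i3, i4, i5, i6⟩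
  · rw [hd]; exact b0'.2.trans a1
  · rw [hd]; exact b1'.2.trans a2
  · rw [hd]; exact a3.trans b1'.1
  · rw [latticeEta_eq_pow]
    exact e0.trans (pow_le_pow_left₀ y0 k0 _)
  · rw [latticeEta_eq_pow]
    exact (pow_le_pow_left₀ (Real.exp_pos _).le k1 _).trans e1
  · rw [latticeTau_eq_pow]
    exact f0.trans (pow_le_pow_left₀ y0 k0 _)
  · rw [latticeTau_eq_pow]
    exact (pow_le_pow_left₀ (Real.exp_pos _).le k1 _).trans f1

namespace CellBracket
variable {D0 D1 p0 p1 q1 n0 n1 t0 t1 b0 b1 Δ : ℝ}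

lemma amplitude_bounds (H : CellBracket D0 D1 p0 p1 q1 n0 n1 t0 t1 b0 b1) (hl : D0 ≤ Δ)
    (hr : Δ ≤ D1) : b0 ≤ bulkAmplitude Δ ∧ bulkAmplitude Δ ≤ b1 := by
  have hD0 : 0 < D0 := by linarith only [H.lt]
  have hD1 : 0 < D1 := by linarith [H.le]
  have e : ∀ D : ℝ, 0 < D → bulkAmplitude D =
      2 * latticeEta D ^ 2 * (8 * Real.pi ^ 2 + D ^ 2) / D ^ 2 := fun D hD => by
    rw [bulkAmplitude, latticeEta_sq, latticeFreq]; field_simp; ring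
  have pb := pi_sq_bounds
  constructor
  · refine le_trans ?_ (bulkAmplitude_mono hD0 hl (hr.trans H.le_three))
    rw [e D0 hD0, le_div_iff₀ (by positivity)]
    refine H.le_amp.trans ?_
    have := pow_le_pow_left₀ H.eta_nonneg H.le_eta 2
    refine mul_le_mul (by linarith) (by linarith) (by positivity) (by positivity)
  · refine (bulkAmplitude_mono (hD0.trans_le hl) hr H.le_three).trans ?_
    rw [e D1 hD1, div_le_iff₀ (by positivity)]
    refine le_trans ?_ H.amp_le
    have := pow_le_pow_left₀ (latticeEta_pos D1).le H.eta_le 2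
    refine mul_le_mul (by linarith) (by linarith) (by positivity) (by positivity)

/-- On the cell Δ² ≥ 4.06, so k ≤ 8.12 r gives k ≤ 2rΔ². The function Δ^k exp(-rΔ²) is then
decreasing, and its least value is at the right end. -/
lemma le_unit_right (H : CellBracket D0 D1 p0 p1 q1 n0 n1 t0 t1 b0 b1) (hl : D0 ≤ Δ)
    (hr : Δ ≤ D1) {r : ℝ} (k n : ℕ) (h : r = n / 300) (hk : (k : ℝ) ≤ 8.12 * r) :
    D1 ^ k * q1 ^ n ≤ Δ ^ k * decay Δ r := by
  have hD0 : 0 < D0 := by linarith only [H.lt]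
  have hΔ : 0 < Δ := hD0.trans_le hl
  have hD1 : 0 < D1 := hΔ.trans_le hr
  have h1 : 4.06 ≤ Δ ^ 2 := by nlinarith [H.lt]
  refine le_trans ?_ (pow_mul_decay_le hΔ hD1 (r := r) k ?_)
  · rw [decay_eq_pow D1 n h]
    exact mul_le_mul_of_nonneg_left (pow_le_pow_left₀ H.pos_decay.le H.le_decay_right n)
      (by positivity)
  · have hr0 : 0 ≤ r := by rw [h]; positivity
    exact mul_nonpos_of_nonpos_of_nonneg (by nlinarith) (by nlinarith)

lemma unit_le_left (H : CellBracket D0 D1 p0 p1 q1 n0 n1 t0 t1 b0 b1) (hl : D0 ≤ Δ)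
    {r : ℝ} (k n : ℕ) (h : r = n / 300) (hk : (k : ℝ) ≤ 8.12 * r) :
    Δ ^ k * decay Δ r ≤ D0 ^ k * p0 ^ n := by
  have hD0 : 0 < D0 := by linarith only [H.lt]
  have hΔ : 0 < Δ := hD0.trans_le hl
  have h1 : 4.06 ≤ D0 ^ 2 := by nlinarith [H.lt]
  refine (pow_mul_decay_le hD0 hΔ (r := r) k ?_).trans ?_
  · have hr0 : 0 ≤ r := by rw [h]; positivity
    exact mul_nonpos_of_nonpos_of_nonneg (by nlinarith) (by nlinarith)
  · rw [decay_eq_pow D0 n h]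
    exact mul_le_mul_of_nonneg_left (pow_le_pow_left₀ (decay_pos _ _).le H.decay_le_left n)
      (by positivity)

lemma le_unit_left_neg (H : CellBracket D0 D1 p0 p1 q1 n0 n1 t0 t1 b0 b1) (hl : D0 ≤ Δ)
    {r : ℝ} (k n : ℕ) (h : r = n / 300) :
    D0 ^ k / p0 ^ n ≤ Δ ^ k * decay Δ (-r) := by
  have hD0 : 0 < D0 := by linarith only [H.lt]
  have hΔ : 0 < Δ := hD0.trans_le hl
  refine le_trans ?_ (pow_mul_decay_le hΔ hD0 (r := -r) k ?_)
  · rw [decay_neg_eq_inv, decay_eq_pow D0 n h, ← div_eq_mul_inv]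
    exact div_le_div_of_nonneg_left (by positivity) (pow_pos (decay_pos _ _) n)
      (pow_le_pow_left₀ (decay_pos _ _).le H.decay_le_left n)
  · have hr0 : 0 ≤ r := by rw [h]; positivity
    refine mul_nonpos_of_nonneg_of_nonpos ?_ (by nlinarith)
    have : (0 : ℝ) ≤ k := by positivity
    nlinarith [mul_nonneg hr0 (sq_nonneg Δ)]

lemma unit_le_right_neg (H : CellBracket D0 D1 p0 p1 q1 n0 n1 t0 t1 b0 b1) (hl : D0 ≤ Δ)
    (hr : Δ ≤ D1) {r : ℝ} (k n : ℕ) (h : r = n / 300) :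
    Δ ^ k * decay Δ (-r) ≤ D1 ^ k / q1 ^ n := by
  have hD0 : 0 < D0 := by linarith only [H.lt]
  have hΔ : 0 < Δ := hD0.trans_le hl
  have hD1 : 0 < D1 := hΔ.trans_le hr
  refine (pow_mul_decay_le hD1 hΔ (r := -r) k ?_).trans ?_
  · have hr0 : 0 ≤ r := by rw [h]; positivity
    refine mul_nonpos_of_nonneg_of_nonpos ?_ (by nlinarith)
    have : (0 : ℝ) ≤ k := by positivity
    nlinarith [mul_nonneg hr0 (sq_nonneg D1)]
  · rw [decay_neg_eq_inv, decay_eq_pow D1 n h, ← div_eq_mul_inv]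
    exact div_le_div_of_nonneg_left (by positivity) (pow_pos H.pos_decay n)
      (pow_le_pow_left₀ H.pos_decay.le H.le_decay_right n)

/-- The exponent 1/4 is the exception to monotone decrease: Δ³ exp(-Δ²/4) increases until Δ² = 6, so
the upper bound is taken at the right end. -/
lemma unit_le_right (H : CellBracket D0 D1 p0 p1 q1 n0 n1 t0 t1 b0 b1) (hl : D0 ≤ Δ)
    (hr : Δ ≤ D1) (h6 : D1 ^ 2 ≤ 6) :
    Δ ^ 3 * decay Δ (1 / 4) ≤ D1 ^ 3 * p1 ^ 75 := by
  have hD0 : 0 < D0 := by linarith only [H.lt]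
  have hΔ : 0 < Δ := hD0.trans_le hl
  have hD1 : 0 < D1 := hΔ.trans_le hr
  refine (pow_mul_decay_le hD1 hΔ (r := 1 / 4) 3 ?_).trans ?_
  · exact mul_nonpos_of_nonneg_of_nonpos (by push_cast; linarith) (by nlinarith)
  · rw [decay_eq_pow D1 75 (by norm_num : (1 / 4 : ℝ) = (75 : ℕ) / 300)]
    exact mul_le_mul_of_nonneg_left (pow_le_pow_left₀ (decay_pos _ _).le H.decay_le_right 75)
      (by positivity)

lemma edge_bounds (H : CellBracket D0 D1 p0 p1 q1 n0 n1 t0 t1 b0 b1) (hl : D0 ≤ Δ)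
    (hr : Δ ≤ D1) {U H1 H0 BL BG : ℝ} (hU : Δ ^ 3 * decay Δ (1 / 4) ≤ U)
    (hH1 : H1 ≤ 1 + b0 ^ 2 / 2 + b0 * t0 - b1 ^ 2 / 4 * t1 ^ 4)
    (hH0 : H0 ≤ 1 + b0 ^ 2 / 2 - 2 * (b1 * t1) + b0 ^ 2 / 2 * t0 ^ 4)
    (r1 : 0 ≤ H1) (r0 : 0 ≤ H0)
    (hBL : 0.2821 * ((U + 27 * (D0 ^ 3 * p0 ^ 675) + 70 * (D0 ^ 3 * p0 ^ 1200)) * (1 + b1 * n1) +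
      8 * (D0 ^ 3 * p0 ^ 300) * (1 - b0 * n0)) ≤ BL)
    (hBG : BG ≤ 0.28209 * (D1 ^ 1 * q1 ^ 75 * (1 + b0 * n0) +
        2 * (D1 ^ 1 * q1 ^ 300) * (1 - b1 * n1)) +
      0.09188 * ((6 * (D1 ^ 2 * q1 ^ 100) + 12 * (D1 ^ 2 * q1 ^ 400)) * H1 +
        12 * (D1 ^ 2 * q1 ^ 300) * H0) / 4) :
    bulkEdgeLoss Δ (bulkAmplitude Δ) ≤ BL ∧ BG ≤ bulkEdgeGain Δ (bulkAmplitude Δ) := by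
  have hD0 : 0 < D0 := by linarith only [H.lt]
  have hΔ : 0 < Δ := hD0.trans_le hl
  have hD1 : 0 < D1 := hΔ.trans_le hr
  have hq := H.pos_decay
  obtain ⟨hb0, hb1⟩ := H.amplitude_bounds hl hr
  have hn0 := H.le_eta.trans (latticeEta_mono hD0 hl)
  have hn1 := (latticeEta_mono hΔ hr).trans H.eta_le
  have ht0 := H.le_tau.trans (latticeTau_mono hD0 hl)
  have ht1 := (latticeTau_mono hΔ hr).trans H.tau_le
  refine ⟨(bulkEdgeLoss_le hΔ H.amp_nonneg hb0 hb1 H.eta_nonneg hn0 hn1 H.mul_le hU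
    (H.unit_le_left hl 3 675 (by norm_num) (by norm_num))
    (H.unit_le_left hl 3 300 (by norm_num) (by norm_num))
    (H.unit_le_left hl 3 1200 (by norm_num) (by norm_num))).trans hBL,
    hBG.trans (bulkEdgeGain_ge H.amp_nonneg hb0 hb1 H.eta_nonneg hn0 hn1 H.mul_le
      H.tau_nonneg ht0 ht1
      (H.le_unit_right hl hr 1 75 (by norm_num) (by norm_num))
      (H.le_unit_right hl hr 1 300 (by norm_num) (by norm_num))
      (H.le_unit_right hl hr 2 100 (by norm_num) (by norm_num))
      (H.le_unit_right hl hr 2 400 (by norm_num) (by norm_num))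
      (H.le_unit_right hl hr 2 300 (by norm_num) (by norm_num)) ?_ ?_ ?_ ?_ ?_ hH1 hH0 r1 r0)⟩ <;>
    positivity

/-- Certificate without edge tilt. -/
theorem pamVarIntegral_one_le (H : CellBracket D0 D1 p0 p1 q1 n0 n1 t0 t1 b0 b1) {M : ℕ}
    (hM : 16 ≤ M) (hl : D0 ≤ Δ) (hr : Δ ≤ D1) {x A H1 H0 BL BG : ℝ}
    (hx : x * D0 ^ 2 ≤ 39.4784) (hx1 : 1 ≤ x)
    (hA : A ≤ 2 * n0 ^ 4 * (x * x - x) - 9 / 8 * n1 ^ 4 * b1 ^ 2 - 2 * n1 ^ 8 * (1 + b1) ^ 2)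
    (hH1 : H1 ≤ 1 + b0 ^ 2 / 2 + b0 * t0 - b1 ^ 2 / 4 * t1 ^ 4)
    (hH0 : H0 ≤ 1 + b0 ^ 2 / 2 - 2 * (b1 * t1) + b0 ^ 2 / 2 * t0 ^ 4)
    (r1 : 0 ≤ H1) (r0 : 0 ≤ H0)
    (hBL : 0.2821 * ((3.28 + 27 * (D0 ^ 3 * p0 ^ 675) + 70 * (D0 ^ 3 * p0 ^ 1200)) *
      (1 + b1 * n1) + 8 * (D0 ^ 3 * p0 ^ 300) * (1 - b0 * n0)) ≤ BL)
    (hBG : BG ≤ 0.28209 * (D1 ^ 1 * q1 ^ 75 * (1 + b0 * n0) +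
        2 * (D1 ^ 1 * q1 ^ 300) * (1 - b1 * n1)) +
      0.09188 * ((6 * (D1 ^ 2 * q1 ^ 100) + 12 * (D1 ^ 2 * q1 ^ 400)) * H1 +
        12 * (D1 ^ 2 * q1 ^ 300) * H0) / 4) (hBL16 : BL ≤ 16) (hA0 : 0 ≤ A)
    (h : 0 ≤ 16 * A + BG - BL) :
    pamVarIntegral M 1 Δ ≤ (Δ ^ 2 + 12 / ((M : ℝ) ^ 2 - 1)) * pamVarIntegral M 2 Δ := by
  have hD0 : 0 < D0 := by linarith only [H.lt]
  have hΔ : 0 < Δ := hD0.trans_le hl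
  have h3 : Δ ≤ 3 := hr.trans H.le_three
  have h406 : 4.06 ≤ Δ ^ 2 := by nlinarith only [H.lt, hl]
  have hMr : (16 : ℝ) ≤ M := by exact_mod_cast hM
  obtain ⟨hb0, hb1⟩ := H.amplitude_bounds hl hr
  have hn1 := (latticeEta_mono hΔ hr).trans H.eta_le
  -- The global maximum, attained at Δ² = 6. It is used here because a cell may contain this point.
  have hU : Δ ^ 3 * decay Δ (1 / 4) ≤ 3.28 := by
    have h6 : √6 ^ 2 = 6 := Real.sq_sqrt (by norm_num)
    refine (pow_mul_decay_le (D := √6) (by positivity) hΔ 3 (by rw [h6]; norm_num)).trans ?_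
    have h7 : √6 ≤ 2.4495 := Real.sqrt_le_iff.2 ⟨by norm_num, by norm_num⟩
    have h8 : decay (√6) (1 / 4) ≤ 0.22314 := by
      have h9 := (exp_neg_bounds (x := 3 / 8) (by norm_num) (by norm_num)).2
      have e : decay (√6) (1 / 4) = Real.exp (-(3 / 8)) ^ 4 := by
        rw [decay, h6, ← Real.exp_nat_mul]; norm_num
      rw [e]
      exact (pow_le_pow_left₀ (Real.exp_pos _).le h9 4).trans (by norm_num)
    calc √6 ^ 3 * decay (√6) (1 / 4) ≤ 2.4495 ^ 3 * 0.22314 :=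
        mul_le_mul (pow_le_pow_left₀ (by positivity) h7 3) h8 (decay_pos _ _).le (by norm_num)
      _ ≤ _ := by norm_num
  obtain ⟨gL, gG⟩ := H.edge_bounds hl hr hU hH1 hH0 r1 r0 hBL hBG
  have gA := bulkGain_ge_of_bounds hD0 hl h3 hx hx1 H.eta_nonneg H.le_eta hn1 hb1 hA
  have hlin := one_le_bulkLinear hΔ h3
  have hbe : bulkAmplitude Δ * latticeEta Δ ≤ 1 :=
    (mul_le_mul hb1 hn1 (latticeEta_pos Δ).le (H.amp_nonneg.trans (hb0.trans hb1))).trans H.mul_le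
  have hK : 0 ≤ bulkLinear Δ (bulkAmplitude Δ) -
      (bulkEdgeLoss Δ (bulkAmplitude Δ) + 2 * 0 * tiltLoss Δ) / 16 := by
    linarith only [hlin, gL, hBL16]
  refine pamVarIntegral_one_le_of_balance (b := bulkAmplitude Δ) (c := 0) hΔ h3
    h406 (bulkAmplitude_nonneg Δ) hbe le_rfl (Or.inl rfl) hM hK ?_
  -- Only the sign of the 1/M term is used in the untilted certificate.
  have h1 : 0 ≤ 12 / (M * Δ ^ 2) * (bulkLinear Δ (bulkAmplitude Δ) -
      (bulkEdgeLoss Δ (bulkAmplitude Δ) + 2 * 0 * tiltLoss Δ) / 16) :=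
    mul_nonneg (by positivity) hK
  have h2 : 16 * A ≤ M * bulkGain Δ (bulkAmplitude Δ) :=
    mul_le_mul hMr gA hA0 (by positivity)
  have h3 : edgeBalance Δ (bulkAmplitude Δ) 0 =
    bulkEdgeGain Δ (bulkAmplitude Δ) - bulkEdgeLoss Δ (bulkAmplitude Δ) := by
    rw [edgeBalance]; ring
  rw [h3]
  linarith only [h, h1, h2, gL, gG]

/-- Certificate with edge tilt. -/
theorem pamVarIntegral_one_le_tilt (H : CellBracket D0 D1 p0 p1 q1 n0 n1 t0 t1 b0 b1) {M : ℕ}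
    (hM : 16 ≤ M) (hl : D0 ≤ Δ) (hr : Δ ≤ D1) {x c A H1 H0 BL BG TL TG TS k m0 m1 : ℝ}
    (h6 : D1 ^ 2 ≤ 6) (hc : 0 ≤ c) (hb1' : b1 ≤ 1) (hbt : b1 * t1 ≤ 1)
    (hx : x * D0 ^ 2 ≤ 39.4784) (hx1 : 1 ≤ x)
    (hA : A ≤ 2 * n0 ^ 4 * (x * x - x) - 9 / 8 * n1 ^ 4 * b1 ^ 2 - 2 * n1 ^ 8 * (1 + b1) ^ 2)
    (hH1 : H1 ≤ 1 + b0 ^ 2 / 2 + b0 * t0 - b1 ^ 2 / 4 * t1 ^ 4)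
    (hH0 : H0 ≤ 1 + b0 ^ 2 / 2 - 2 * (b1 * t1) + b0 ^ 2 / 2 * t0 ^ 4)
    (r1 : 0 ≤ H1) (r0 : 0 ≤ H0)
    (hBL : 0.2821 * ((D1 ^ 3 * p1 ^ 75 + 27 * (D0 ^ 3 * p0 ^ 675) + 70 * (D0 ^ 3 * p0 ^ 1200)) *
      (1 + b1 * n1) + 8 * (D0 ^ 3 * p0 ^ 300) * (1 - b0 * n0)) ≤ BL)
    (hBG : BG ≤ 0.28209 * (D1 ^ 1 * q1 ^ 75 * (1 + b0 * n0) +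
        2 * (D1 ^ 1 * q1 ^ 300) * (1 - b1 * n1)) +
      0.09188 * ((6 * (D1 ^ 2 * q1 ^ 100) + 12 * (D1 ^ 2 * q1 ^ 400)) * H1 +
        12 * (D1 ^ 2 * q1 ^ 300) * H0) / 4)
    (hm0 : m0 ≤ q1 ^ 180) (hm1 : p0 ^ 180 ≤ m1) (hm1' : m1 < 1)
    (hTL : 0.2821 * (D0 ^ 3 * p0 ^ 138 + 4 * (D0 ^ 3 * p0 ^ 453) + 10 * (D0 ^ 3 * p0 ^ 918)) /
      (1 - m1) ≤ TL)
    (hTG : TG ≤ (0.28209 * (D0 ^ 1 / p0 ^ 27 + 2 * (D1 ^ 1 * q1 ^ 138) +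
      2 * (D1 ^ 1 * q1 ^ 453)) + 0.09188 * (D0 ^ 2 / p0 ^ 18 * (1 - 0.3091 * (b1 * t1)) +
      3 * (D1 ^ 2 * q1 ^ 142) * (1 - 0.68 * (b1 * t1)) +
      3 * (D1 ^ 2 * q1 ^ 202) * (1 + 0.978 * (b0 * t0)) +
      6 * (D1 ^ 2 * q1 ^ 462) * (1 - 0.3091 * (b1 * t1)))) / (1 - m0))
    (hTS : 0.09189 * (D1 ^ 2 / q1 ^ 72 + 3.022 * (D0 ^ 2 * p0 ^ 148) +
      3.17 * (D0 ^ 2 * p0 ^ 268)) / (1 - m1 ^ 2) ≤ TS)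
    (hk : k * D1 ^ 2 ≤ 12 * (1 - (BL + 2 * c * TL) / 16)) (hk0 : 0 ≤ k) (hA0 : 0 ≤ A)
    (hkA : k ≤ 256 * A)
    (h : 0 ≤ 16 * A + k / 16 + (BG - BL + c * ((1 - 1e-9) * TG - 2 * TL) -
      c ^ 2 * (TS / 2 + 1e-6))) :
    pamVarIntegral M 1 Δ ≤ (Δ ^ 2 + 12 / ((M : ℝ) ^ 2 - 1)) * pamVarIntegral M 2 Δ := by
  have hD0 : 0 < D0 := by linarith only [H.lt]
  have hΔ : 0 < Δ := hD0.trans_le hl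
  have hD1 : 0 < D1 := hΔ.trans_le hr
  have hp0 : 0 < p0 := (decay_pos _ _).trans_le H.decay_le_left
  have hq := H.pos_decay
  have h3 : Δ ≤ 3 := hr.trans H.le_three
  have h406 : 4.06 ≤ Δ ^ 2 := by nlinarith only [H.lt, hl]
  have hMr : (16 : ℝ) ≤ M := by exact_mod_cast hM
  obtain ⟨hb0, hb1⟩ := H.amplitude_bounds hl hr
  have hn1 := (latticeEta_mono hΔ hr).trans H.eta_le
  have ht0 := H.le_tau.trans (latticeTau_mono hD0 hl)
  have ht1 := (latticeTau_mono hΔ hr).trans H.tau_le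
  obtain ⟨gL, gG⟩ := H.edge_bounds hl hr (H.unit_le_right hl hr h6) hH1 hH0 r1 r0 hBL hBG
  have gA := bulkGain_ge_of_bounds hD0 hl h3 hx hx1 H.eta_nonneg H.le_eta hn1 hb1 hA
  have gm1 : decay Δ (3 / 5) ≤ m1 := by
    have := H.unit_le_left hl (r := 3 / 5) 0 180 (by norm_num) (by norm_num)
    simp only [pow_zero, one_mul] at this
    exact this.trans hm1
  have gm0 : m0 ≤ decay Δ (3 / 5) := by
    have := H.le_unit_right hl hr (r := 3 / 5) 0 180 (by norm_num) (by norm_num)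
    simp only [pow_zero, one_mul] at this
    exact hm0.trans this
  have gTL : tiltLoss Δ ≤ TL := (tiltLoss_le hΔ
    (H.unit_le_left hl 3 138 (by norm_num) (by norm_num))
    (H.unit_le_left hl 3 453 (by norm_num) (by norm_num))
    (H.unit_le_left hl 3 918 (by norm_num) (by norm_num)) gm1 hm1').trans hTL
  have gTG : TG ≤ tiltGain Δ (bulkAmplitude Δ) := by
    refine hTG.trans (tiltGain_ge hΔ H.amp_nonneg hb0 hb1 H.tau_nonneg ht0 ht1 hbt
      (H.le_unit_left_neg hl 1 27 (by norm_num))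
      (H.le_unit_right hl hr 1 138 (by norm_num) (by norm_num))
      (H.le_unit_right hl hr 1 453 (by norm_num) (by norm_num))
      (H.le_unit_left_neg hl 2 18 (by norm_num))
      (H.le_unit_right hl hr 2 142 (by norm_num) (by norm_num))
      (H.le_unit_right hl hr 2 202 (by norm_num) (by norm_num))
      (H.le_unit_right hl hr 2 462 (by norm_num) (by norm_num)) ?_ ?_ ?_ ?_ ?_ ?_ ?_ gm0
      (gm1.trans_lt hm1')) <;> positivity
  have gTS : tiltSquareLoss Δ ≤ TS := (tiltSquareLoss_le hΔ
    (H.unit_le_right_neg hl hr 2 72 (by norm_num))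
    (H.unit_le_left hl 2 148 (by norm_num) (by norm_num))
    (H.unit_le_left hl 2 268 (by norm_num) (by norm_num)) gm1 hm1').trans hTS
  have hlin := one_le_bulkLinear hΔ h3
  have hbe : bulkAmplitude Δ * latticeEta Δ ≤ 1 :=
    (mul_le_mul hb1 hn1 (latticeEta_pos Δ).le (H.amp_nonneg.trans (hb0.trans hb1))).trans H.mul_le
  have cTL := mul_le_mul_of_nonneg_left gTL hc
  have hs : Δ ^ 2 ≤ D1 ^ 2 := pow_le_pow_left₀ hΔ.le hr 2
  set K := bulkLinear Δ (bulkAmplitude Δ) -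
      (bulkEdgeLoss Δ (bulkAmplitude Δ) + 2 * c * tiltLoss Δ) / 16 with hKdef
  have hK1 : k * Δ ^ 2 ≤ 12 * K := by
    have := mul_le_mul_of_nonneg_left hs hk0
    rw [hKdef]; linarith only [this, hk, gL, cTL, hlin]
  have hK : 0 ≤ K := by
    have : 0 ≤ k * Δ ^ 2 := by positivity
    linarith only [this, hK1]
  refine pamVarIntegral_one_le_of_balance (b := bulkAmplitude Δ) (c := c) hΔ h3
    h406 (bulkAmplitude_nonneg Δ) hbe hc (Or.inr (hb1.trans hb1')) hM hK ?_
  have hkM : k / M ≤ 12 / (M * Δ ^ 2) * K := by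
    have e : 12 / (M * Δ ^ 2) * K = 12 * K / Δ ^ 2 / M := by field_simp
    rw [e]
    exact div_le_div_of_nonneg_right ((le_div_iff₀ (by positivity)).2 hK1) (by positivity)
  have hedge : BG - BL + c * ((1 - 1e-9) * TG - 2 * TL) - c ^ 2 * (TS / 2 + 1e-6) ≤
      edgeBalance Δ (bulkAmplitude Δ) c := by
    have k1 := mul_le_mul_of_nonneg_left gTG hc
    have k2 := mul_le_mul_of_nonneg_left gTS (sq_nonneg c)
    rw [edgeBalance]
    linarith only [k1, k2, gL, cTL, gG]
  -- Reduction of all M ≥ 16 to the single numerical check at M = 16.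
  have hfin := add_div_nonneg_of_sixteen_le hMr hkA hA0 h
  have h2 : M * A ≤ M * bulkGain Δ (bulkAmplitude Δ) :=
    mul_le_mul_of_nonneg_left gA (by positivity)
  change 0 ≤ _ + _ + 12 / (M * Δ ^ 2) * K
  linarith only [hkM, hedge, hfin, h2]

end CellBracket
end Cells

/-! ### The ten cells covering [2.017, 3]. -/

section Range
variable {M : ℕ} {Δ : ℝ}

-- The tightest cell, with a final margin of about 0.0025. The cells can widen as Δ grows because
-- the gain per symbol increases rapidly.
set_option exponentiation.threshold 1500 in
lemma second_moment_bound_from_2017 (hM : 16 ≤ M) (hl : 2.017 ≤ Δ) (hr : Δ ≤ 2.025) :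
    pamVarIntegral M 1 Δ ≤ (Δ ^ 2 + 12 / ((M : ℝ) ^ 2 - 1)) * pamVarIntegral M 2 Δ := by
  have H : CellBracket 2.017 2.025
    0.986530572293 0.986424243181 0.98642424318 0.08838901 0.09009843 0.19842612
    0.20097628 0.31887765 0.32884939 := by
    apply CellBracket.of_bounds (v0 := 0.0252709125) (v1 := 0.0250713813) <;> norm_num
  apply H.pamVarIntegral_one_le_tilt hM hl hr
    (x := 9.703932) (A := 0.010302623) (H1 := 1.11407102) (H0 := 0.91873843) (BL := 1.179934)
    (BG := 0.4120667) (c := 0.86) (TL := 0.4121369) (TG := 1.8569791) (TS := 1.2003705)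
    (k := 2.580921) (m0 := 0.08540291) (m1 := 0.08707606) <;>
    norm_num

set_option exponentiation.threshold 1500 in
lemma second_moment_bound_from_2025 (hM : 16 ≤ M) (hl : 2.025 ≤ Δ) (hr : Δ ≤ 2.037) :
    pamVarIntegral M 1 Δ ≤ (Δ ^ 2 + 12 / ((M : ℝ) ^ 2 - 1)) * pamVarIntegral M 2 Δ := by
  have H : CellBracket 2.025 2.037
    0.986424243181 0.98626398199 0.986263981989 0.09009622 0.09268223 0.200973
    0.20480049 0.32883008 0.34409498 := by
    apply CellBracket.of_bounds (v0 := 0.0250716355) (v1 := 0.0247768596) <;> norm_num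
  apply H.pamVarIntegral_one_le_tilt hM hl hr
    (x := 9.62741) (A := 0.010935918) (H1 := 1.1200985) (H0 := 0.91321116) (BL := 1.17958)
    (BG := 0.4094143) (c := 0.84) (TL := 0.4094192) (TG := 1.8550422) (TS := 1.222308)
    (k := 2.554471) (m0 := 0.08294136) (m1 := 0.08540292) <;>
    norm_num

set_option exponentiation.threshold 1500 in
lemma second_moment_bound_from_2037 (hM : 16 ≤ M) (hl : 2.037 ≤ Δ) (hr : Δ ≤ 2.055) :
    pamVarIntegral M 1 Δ ≤ (Δ ^ 2 + 12 / ((M : ℝ) ^ 2 - 1)) * pamVarIntegral M 2 Δ := by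
  have H : CellBracket 2.037 2.055
    0.98626398199 0.986021864181 0.98602186418 0.09267999 0.09660812 0.20479719
    0.21054379 0.34407503 0.36766796 := by
    apply CellBracket.of_bounds (v0 := 0.0247771107) (v1 := 0.0243447134) <;> norm_num
  apply H.pamVarIntegral_one_le_tilt hM hl hr
    (x := 9.514314) (A := 0.011940388) (H1 := 1.129593) (H0 := 0.90447753) (BL := 1.1792305)
    (BG := 0.4055387) (c := 0.82) (TL := 0.405358) (TG := 1.8524895) (TS := 1.2563043)
    (k := 2.514071) (m0 := 0.0793557) (m1 := 0.08294137) <;>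
    norm_num

set_option exponentiation.threshold 1500 in
lemma second_moment_bound_from_2055 (hM : 16 ≤ M) (hl : 2.055 ≤ Δ) (hr : Δ ≤ 2.086) :
    pamVarIntegral M 1 Δ ≤ (Δ ^ 2 + 12 / ((M : ℝ) ^ 2 - 1)) * pamVarIntegral M 2 Δ := by
  have H : CellBracket 2.055 2.086
    0.986021864181 0.985600032397 0.985600032396 0.09660583 0.10350394 0.21054045
    0.2204472 0.36764699 0.41021077 := by
    apply CellBracket.of_bounds (v0 := 0.0243449601) (v1 := 0.0236265174) <;> norm_num
  apply H.pamVarIntegral_one_le_tilt hM hl hr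
    (x := 9.348369) (A := 0.013573271) (H1 := 1.14488736) (H0 := 0.88685531) (BL := 1.1813804)
    (BG := 0.3986762) (c := 0.78) (TL := 0.3992986) (TG := 1.8451871) (TS := 1.3187798)
    (k := 2.446751) (m0 := 0.07347297) (m1 := 0.07935571) <;>
    norm_num

set_option exponentiation.threshold 1500 in
lemma second_moment_bound_from_2086 (hM : 16 ≤ M) (hl : 2.086 ≤ Δ) (hr : Δ ≤ 2.14) :
    pamVarIntegral M 1 Δ ≤ (Δ ^ 2 + 12 / ((M : ℝ) ^ 2 - 1)) * pamVarIntegral M 2 Δ := by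
  have H : CellBracket 2.086 2.14
    0.985600032397 0.984850591243 0.984850591242 0.10350155 0.11588897 0.22044381
    0.23769939 0.41018788 0.48996671 := by
    apply CellBracket.of_bounds (v0 := 0.0236267568) (v1 := 0.0224491949) <;> norm_num
  apply H.pamVarIntegral_one_le_tilt hM hl hr
    (x := 9.072582) (A := 0.016760873) (H1 := 1.17435883) (H0 := 0.85139613) (BL := 1.1867479)
    (BG := 0.3873474) (c := 0.75) (TL := 0.3889425) (TG := 1.8345872) (TS := 1.4380487)
    (k := 2.330417) (m0 := 0.06407122) (m1 := 0.07347298) <;>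
    norm_num

set_option exponentiation.threshold 1500 in
lemma second_moment_bound_from_214 (hM : 16 ≤ M) (hl : 2.14 ≤ Δ) (hr : Δ ≤ 2.24) :
    pamVarIntegral M 1 Δ ≤ (Δ ^ 2 + 12 / ((M : ℝ) ^ 2 - 1)) * pamVarIntegral M 2 Δ := by
  have H : CellBracket 2.14 2.24
    0.984850591243 0.983413758523 0.983413758522 0.11588643 0.1398764 0.23769592
    0.26946123 0.48994053 0.65489836 := by
    apply CellBracket.of_bounds (v0 := 0.0224494225) (v1 := 0.0204895434) <;> norm_num
  apply H.pamVarIntegral_one_le_tilt hM hl hr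
    (x := 8.62049) (A := 0.0235105) (H1 := 1.23591243) (H0 := 0.76746455) (BL := 1.204016)
    (BG := 0.3677093) (c := 0.7) (TL := 0.371096) (TG := 1.8180039) (TS := 1.6993597)
    (k := 2.133955) (m0 := 0.04926408) (m1 := 0.06407123) <;>
    norm_num

set_option exponentiation.threshold 1500 in
lemma second_moment_bound_from_224 (hM : 16 ≤ M) (hl : 2.24 ≤ Δ) (hr : Δ ≤ 2.38) :
    pamVarIntegral M 1 Δ ≤ (Δ ^ 2 + 12 / ((M : ℝ) ^ 2 - 1)) * pamVarIntegral M 2 Δ := by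
  have H : CellBracket 2.24 2.38
    0.983413758523 0.981295802436 0.981295802435 0.1398736 0.17510123 0.26945764
    0.31298687 0.65486589 0.9160892 := by
    apply CellBracket.of_bounds (v0 := 0.0204897511) (v1 := 0.018149907) <;> norm_num
  apply H.pamVarIntegral_one_le_tilt hM hl hr
    (x := 7.867984) (A := 0.040474094) (H1 := 1.38886993) (H0 := 0.64210729) (BL := 1.2246668)
    (BG := 0.3504652) (c := 0.7) (TL := 0.3385019) (TG := 1.8484439) (TS := 2.1658813)
    (k := 1.893593) (m0 := 0.03341868) (m1 := 0.04926409) <;>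
    norm_num

-- From here on the bulk gain of sixteen symbols alone outweighs the loss at the ends, so no tilt is
-- used. The upper bracket of the amplitude exceeds 1, which the tilted certificate would not allow.
set_option exponentiation.threshold 1500 in
lemma second_moment_bound_from_238 (hM : 16 ≤ M) (hl : 2.38 ≤ Δ) (hr : Δ ≤ 2.6) :
    pamVarIntegral M 1 Δ ≤ (Δ ^ 2 + 12 / ((M : ℝ) ^ 2 - 1)) * pamVarIntegral M 2 Δ := by
  have H : CellBracket 2.38 2.6
    0.981295802436 0.977718646029 0.977718646028 0.17509812 0.23223628 0.31298318
    0.37782154 0.91604799 1.36777114 := by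
    apply CellBracket.of_bounds (v0 := 0.018150091) (v1 := 0.0152083333) <;> norm_num
  apply H.pamVarIntegral_one_le hM hl hr
    (x := 6.969564) (A := 0.072000575) (H1 := 1.69674911) (H0 := 0.39005131) (BL := 1.3081655)
    (BG := 0.3254883) <;>
    norm_num

set_option exponentiation.threshold 1500 in
lemma second_moment_bound_from_26 (hM : 16 ≤ M) (hl : 2.6 ≤ Δ) (hr : Δ ≤ 2.8) :
    pamVarIntegral M 1 Δ ≤ (Δ ^ 2 + 12 / ((M : ℝ) ^ 2 - 1)) * pamVarIntegral M 2 Δ := by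
  have H : CellBracket 2.6 2.8
    0.977718646029 0.974205186924 0.974205186922 0.23223283 0.2839726 0.3778178
    0.4320337 1.36771773 1.78556032 := by
    apply CellBracket.of_bounds (v0 := 0.0152084875) (v1 := 0.0131133078) <;> norm_num
  apply H.pamVarIntegral_one_le hM hl hr
    (x := 5.84) (A := 0.140450131) (H1 := 2.42430504) (H0 := 0.4115401) (BL := 1.4258819)
    (BG := 0.3393851) <;>
    norm_num

set_option exponentiation.threshold 1500 in
lemma second_moment_bound_from_28 (hM : 16 ≤ M) (hl : 2.8 ≤ Δ) (hr : Δ ≤ 3) :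
    pamVarIntegral M 1 Δ ≤ (Δ ^ 2 + 12 / ((M : ℝ) ^ 2 - 1)) * pamVarIntegral M 2 Δ := by
  have H : CellBracket 2.8 3
    0.974205186924 0.970445533549 0.970445533546 0.28396897 0.33399736 0.43203001
    0.4813881 1.78549821 2.18045399 := by
    apply CellBracket.of_bounds (v0 := 0.0131134407) (v1 := 0.0114231481) <;> norm_num
  apply H.pamVarIntegral_one_le hM hl hr
    (x := 5.03551) (A := 0.194580864) (H1 := 3.30156214) (H0 := 0.55024487) (BL := 1.6087644)
    (BG := 0.3385841) <;>
    norm_num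

/-- The second moment inequality for moderate spacing. -/
theorem pamVarIntegral_one_le_of_le_three (hM : 16 ≤ M) (hl : 2.017 ≤ Δ) (hr : Δ ≤ 3) :
    pamVarIntegral M 1 Δ ≤ (Δ ^ 2 + 12 / ((M : ℝ) ^ 2 - 1)) * pamVarIntegral M 2 Δ := by
  rcases le_total Δ 2.025 with h | h
  · exact second_moment_bound_from_2017 hM hl h
  have h_prev := h
  rcases le_total Δ 2.037 with h | h
  · exact second_moment_bound_from_2025 hM h_prev h
  have h_prev := h
  rcases le_total Δ 2.055 with h | h
  · exact second_moment_bound_from_2037 hM h_prev h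
  have h_prev := h
  rcases le_total Δ 2.086 with h | h
  · exact second_moment_bound_from_2055 hM h_prev h
  have h_prev := h
  rcases le_total Δ 2.14 with h | h
  · exact second_moment_bound_from_2086 hM h_prev h
  have h_prev := h
  rcases le_total Δ 2.24 with h | h
  · exact second_moment_bound_from_214 hM h_prev h
  have h_prev := h
  rcases le_total Δ 2.38 with h | h
  · exact second_moment_bound_from_224 hM h_prev h
  have h_prev := h
  rcases le_total Δ 2.6 with h | h
  · exact second_moment_bound_from_238 hM h_prev h
  have h_prev := h
  rcases le_total Δ 2.8 with h | h
  · exact second_moment_bound_from_26 hM h_prev h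
  have h_prev := h
  exact second_moment_bound_from_28 hM h_prev hr

end Range

/-! ### Gaussian integrals of powers of sech, for large spacing. -/

/-- Gaussian-weighted hyperbolic secant power `exp (-z²/2) / cosh (c z) ^ n`. -/
noncomputable def gaussSech (c : ℝ) (n : ℕ) (z : ℝ) : ℝ :=
  Real.exp (-z ^ 2 / 2) / Real.cosh (c * z) ^ n

section Sech
variable {c : ℝ}

@[fun_prop]
lemma continuous_gaussSech (c : ℝ) (n : ℕ) : Continuous (gaussSech c n) := by
  unfold gaussSech
  exact Continuous.div (by fun_prop) (by fun_prop) fun z => (pow_pos (Real.cosh_pos _) n).ne'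

lemma gaussSech_pos (c : ℝ) (n : ℕ) (z : ℝ) : 0 < gaussSech c n z :=
  div_pos (Real.exp_pos _) (pow_pos (Real.cosh_pos _) n)

lemma gaussSech_neg (c : ℝ) (n : ℕ) (z : ℝ) : gaussSech c n (-z) = gaussSech c n z := by
  simp [gaussSech]

lemma gaussSech_le_bump (c : ℝ) (n : ℕ) (z : ℝ) : gaussSech c n z ≤ bump 0 z := by
  rw [gaussSech, bump, sub_zero]
  exact div_le_self (Real.exp_pos _).le (one_le_pow₀ (Real.one_le_cosh _))

lemma integrable_gaussSech (c : ℝ) (n : ℕ) : Integrable (gaussSech c n) :=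
  (integral_bump 0).1.mono' (continuous_gaussSech c n).aestronglyMeasurable
    (.of_forall fun z => by
      rw [Real.norm_of_nonneg (gaussSech_pos c n z).le]; exact gaussSech_le_bump c n z)

lemma hasDerivAt_neg_sq_div_two (z : ℝ) : HasDerivAt (fun z : ℝ => -z ^ 2 / 2) (-z) z := by
  refine ((hasDerivAt_pow 2 z).neg.div_const 2).congr_deriv ?_
  push_cast; ring

/-- For z > c, 1/cosh(cz) ≤ 2 exp(-cz) and 2 ≤ (z + c)/c. The resulting majorant is an exact
derivative, so the tail is at most exp(-3c²/2)/c. -/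
lemma integral_Ioi_gaussSech_le (hc : 1 ≤ c) :
    ∫ z in Set.Ioi c, gaussSech c 1 z ≤
      Real.exp (-c ^ 2 / 2) * Real.sinh (c * c) / Real.cosh (c * c) ^ 2 / c := by
  have hc0 : 0 < c := by linarith
  set F : ℝ → ℝ := fun z => -(Real.exp (-z ^ 2 / 2 - c * z) / c)
  set F' : ℝ → ℝ := fun z => (z + c) / c * Real.exp (-z ^ 2 / 2 - c * z)
  have hF : ∀ z, HasDerivAt F (F' z) z := fun z => by
    have h1 : HasDerivAt (fun z => -z ^ 2 / 2 - c * z) (-z - c) z :=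
      (hasDerivAt_neg_sq_div_two z).sub (((hasDerivAt_id z).const_mul c).congr_deriv (mul_one c))
    refine (h1.exp.div_const c).neg.congr_deriv ?_
    simp only [F']
    field_simp
    ring
  have hpos : ∀ z ∈ Set.Ioi c, 0 ≤ F' z := fun z hz => by
    have : c < z := hz
    have : 0 < z := hc0.trans this
    positivity
  have hlim : Tendsto F atTop (𝓝 0) := by
    have h1 : Tendsto (fun z : ℝ => z ^ 2 / 2 + c * z) atTop atTop :=
      tendsto_atTop_mono (f := fun z => c * z) (fun z => by nlinarith [sq_nonneg z])
        (tendsto_id.const_mul_atTop hc0)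
    have h2 := ((Real.tendsto_exp_neg_atTop_nhds_zero.comp h1).div_const c).neg
    simp only [zero_div, neg_zero] at h2
    refine h2.congr fun z => ?_
    simp only [F, Function.comp]
    congr 3; ring
  have hint := integrableOn_Ioi_deriv_of_nonneg' (fun z _ => hF z) hpos hlim
  have hval := integral_Ioi_of_hasDerivAt_of_tendsto' (fun z _ => hF z) hint hlim
  calc ∫ z in Set.Ioi c, gaussSech c 1 z ≤ ∫ z in Set.Ioi c, F' z := by
        refine setIntegral_mono_on (integrable_gaussSech c 1).integrableOn hint
          measurableSet_Ioi fun z hz => ?_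
        have hz' : c < z := hz
        have e1 : Real.exp (-z ^ 2 / 2 - c * z) = Real.exp (-z ^ 2 / 2) * Real.exp (-(c * z)) := by
          rw [← Real.exp_add]; congr 1
        have e2 : 1 ≤ 2 * Real.exp (-(c * z)) * Real.cosh (c * z) := by
          rw [Real.cosh_eq]
          have : Real.exp (-(c * z)) * Real.exp (c * z) = 1 := by rw [← Real.exp_add]; simp
          nlinarith [mul_pos (Real.exp_pos (-(c * z))) (Real.exp_pos (-(c * z)))]
        have e3 : 2 ≤ (z + c) / c := by rw [le_div_iff₀ hc0]; linarith
        simp only [gaussSech, F', e1, pow_one]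
        rw [div_le_iff₀ (Real.cosh_pos _)]
        have hE := Real.exp_pos (-z ^ 2 / 2)
        have h5 : 0 ≤ Real.exp (-(c * z)) * Real.cosh (c * z) :=
          (mul_pos (Real.exp_pos _) (Real.cosh_pos _)).le
        have h4 : 1 ≤ (z + c) / c * (Real.exp (-(c * z)) * Real.cosh (c * z)) := by nlinarith
        nlinarith
    _ = Real.exp (-c ^ 2 / 2 - c * c) / c := by rw [hval]; simp [F]
    _ ≤ _ := by
        refine div_le_div_of_nonneg_right ?_ hc0.le
        have e1 : Real.exp (-c ^ 2 / 2 - c * c) = Real.exp (-c ^ 2 / 2) * Real.exp (-(c * c)) := by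
          rw [← Real.exp_add]; congr 1
        rw [e1, mul_div_assoc]
        refine mul_le_mul_of_nonneg_left ?_ (Real.exp_pos _).le
        rw [le_div_iff₀ (pow_pos (Real.cosh_pos _) 2), Real.cosh_eq, Real.sinh_eq]
        have h1 : 2.7 ≤ Real.exp (c * c) :=
          (by linarith [Real.exp_one_gt_d9] : (2.7 : ℝ) ≤ Real.exp 1).trans
            (Real.exp_le_exp.2 (by nlinarith))
        rw [Real.exp_neg]
        set E := Real.exp (c * c)
        have hE : 0 < E := by linarith
        have : E⁻¹ * ((E + E⁻¹) / 2) ^ 2 = (E ^ 2 + 1) ^ 2 / (4 * E ^ 3) := by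
          field_simp; norm_num
        rw [this]
        have : (E - E⁻¹) / 2 = (E ^ 2 - 1) * (2 * E ^ 2) / (4 * E ^ 3) := by field_simp; ring
        rw [this]
        have hE2 : 7 ≤ E ^ 2 := by nlinarith
        exact div_le_div_of_nonneg_right (by nlinarith) (by positivity)

/-- The function G(z) = exp(-z²/2) sinh(cz)/cosh(cz)² has derivative -zG + c(2S₃ - S₁), where S_n is
the Gaussian times sechⁿ, and zG ≥ 0. Integrating over [-c, c] leaves the boundary value 2G(c)/c,
which pays for both tails of S₁. -/
lemma integral_gaussSech_le (hc : 1 ≤ c) :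
    ∫ z, gaussSech c 1 z ≤ 2 * ∫ z in (-c)..c, gaussSech c 3 z := by
  have hc0 : 0 < c := by linarith
  set G : ℝ → ℝ := fun z => Real.exp (-z ^ 2 / 2) * Real.sinh (c * z) / Real.cosh (c * z) ^ 2
  set G' : ℝ → ℝ := fun z => -z * G z + c * (2 * gaussSech c 3 z - gaussSech c 1 z)
  have hG : ∀ z, HasDerivAt G (G' z) z := fun z => by
    have hl : HasDerivAt (fun z => c * z) c z :=
      ((hasDerivAt_id z).const_mul c).congr_deriv (mul_one c)
    have h1 : HasDerivAt (fun z => Real.exp (-z ^ 2 / 2) * Real.sinh (c * z)) _ z :=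
      (hasDerivAt_neg_sq_div_two z).exp.mul hl.sinh
    have h2 : HasDerivAt (fun z => Real.cosh (c * z) ^ 2) _ z := hl.cosh.pow 2
    refine (h1.div h2 (pow_pos (Real.cosh_pos _) 2).ne').congr_deriv ?_
    have h1 := Real.cosh_pos (c * z)
    simp only [G', G, gaussSech]
    have h3 : Real.sinh (c * z) ^ 2 = Real.cosh (c * z) ^ 2 - 1 := by
      rw [Real.cosh_sq]; ring
    generalize Real.sinh (c * z) = S at *
    generalize Real.cosh (c * z) = C at *
    field_simp
    push_cast
    linear_combination (-2 * c * C) * h3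
  have hGc : Continuous G := by
    refine Continuous.div (by fun_prop) (by fun_prop) fun z => (pow_pos (Real.cosh_pos _) 2).ne'
  have hG'c : Continuous G' := by fun_prop
  have hftc := intervalIntegral.integral_eq_sub_of_hasDerivAt (a := -c) (b := c)
    (fun z _ => hG z) (hG'c.intervalIntegrable _ _)
  have hle : ∫ z in (-c)..c, G' z ≤
      ∫ z in (-c)..c, c * (2 * gaussSech c 3 z - gaussSech c 1 z) := by
    refine intervalIntegral.integral_mono_on (by linarith) (hG'c.intervalIntegrable _ _)
      (Continuous.intervalIntegrable (by fun_prop) _ _) fun z _ => ?_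
    have : 0 ≤ z * G z := by
      have h1 : 0 ≤ z * Real.sinh (c * z) := by
        rcases le_total 0 z with h | h
        · exact mul_nonneg h (Real.sinh_nonneg_iff.2 (by positivity))
        · exact mul_nonneg_of_nonpos_of_nonpos h
            (Real.sinh_nonpos_iff.2 (mul_nonpos_of_nonneg_of_nonpos hc0.le h))
      have : z * G z = Real.exp (-z ^ 2 / 2) * (z * Real.sinh (c * z)) / Real.cosh (c * z) ^ 2 := by
        simp only [G]; ring
      rw [this]; positivity
    simp only [G']
    linarith
  have hodd : G (-c) = -G c := by simp [G, neg_div]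
  rw [hftc, hodd, intervalIntegral.integral_const_mul, intervalIntegral.integral_sub
    (Continuous.intervalIntegrable (by fun_prop) _ _)
    (Continuous.intervalIntegrable (by fun_prop) _ _),
    intervalIntegral.integral_const_mul] at hle
  have htail : ∫ z in Set.Ioi c, gaussSech c 1 z ≤ G c / c := integral_Ioi_gaussSech_le hc
  have hleft : ∫ z in Set.Iic (-c), gaussSech c 1 z = ∫ z in Set.Ioi c, gaussSech c 1 z := by
    rw [← integral_comp_neg_Ioi]
    simp only [gaussSech_neg]
  have hi := integrable_gaussSech c 1
  have hsplit : ∫ z, gaussSech c 1 z = (∫ z in Set.Iic (-c), gaussSech c 1 z) +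
      ((∫ z in (-c)..c, gaussSech c 1 z) + ∫ z in Set.Ioi c, gaussSech c 1 z) := by
    rw [← intervalIntegral.integral_Iic_add_Ioi (b := -c) hi.integrableOn hi.integrableOn,
      ← intervalIntegral.integral_interval_add_Ioi hi.integrableOn hi.integrableOn]
  rw [hsplit, hleft]
  have h2 : 2 * (G c / c) ≤ 2 * (∫ z in (-c)..c, gaussSech c 3 z) -
      ∫ z in (-c)..c, gaussSech c 1 z := by
    rw [← mul_div_assoc, div_le_iff₀ hc0]
    linarith
  linarith

/-- On |z| ≤ 1/(2c), an interval of length 1/c, cosh(cz) ≤ exp(c²z²/2) keeps the integrand above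
1/2. -/
lemma one_div_le_integral_gaussSech (hc : 3 / 2 ≤ c) : 1 / (2 * c) ≤ ∫ z, gaussSech c 1 z := by
  have hc0 : 0 < c := by linarith
  have hle : (0 : ℝ) ≤ 1 / (2 * c) := by positivity
  have hl : -(1 / (2 * c)) ≤ 1 / (2 * c) := by linarith
  have hi := integrable_gaussSech c 1
  calc 1 / (2 * c) = ∫ z in (-(1 / (2 * c)))..(1 / (2 * c)), (1 / 2 : ℝ) := by
        rw [intervalIntegral.integral_const, smul_eq_mul]; ring
    _ ≤ ∫ z in (-(1 / (2 * c)))..(1 / (2 * c)), gaussSech c 1 z := by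
        refine intervalIntegral.integral_mono_on hl (by simp)
          ((continuous_gaussSech c 1).intervalIntegrable _ _) fun z hz => ?_
        have h1 : z ^ 2 ≤ (1 / (2 * c)) ^ 2 := sq_le_sq' hz.1 hz.2
        have h2 : c ^ 2 * z ^ 2 ≤ 1 / 4 := by
          calc c ^ 2 * z ^ 2 ≤ c ^ 2 * (1 / (2 * c)) ^ 2 := by gcongr
            _ = 1 / 4 := by field_simp; norm_num
        have h3 : z ^ 2 ≤ 1 / 4 := by nlinarith
        have h4 := Real.cosh_le_exp_half_sq (c * z)
        have h5 := Real.add_one_le_exp (-z ^ 2 / 2 - (c * z) ^ 2 / 2)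
        rw [gaussSech, pow_one, le_div_iff₀ (Real.cosh_pos _)]
        have h6 : Real.exp (-z ^ 2 / 2) = Real.exp (-z ^ 2 / 2 - (c * z) ^ 2 / 2) *
            Real.exp ((c * z) ^ 2 / 2) := by rw [← Real.exp_add]; congr 1; ring
        rw [h6]
        refine mul_le_mul ?_ h4 (Real.cosh_pos _).le (Real.exp_pos _).le
        rw [mul_pow] at h5
        rw [mul_pow]
        linarith
    _ ≤ _ := by
        rw [intervalIntegral.integral_of_le hl]
        exact setIntegral_le_integral hi (.of_forall fun z => (gaussSech_pos c 1 z).le)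

end Sech

/-! ### The inequality for Δ ≥ 3, one gap between adjacent levels at a time. -/

section Gap
variable {M : ℕ} {Δ : ℝ}

lemma bump_sub_eq (c x y : ℝ) : bump (x - c) y =
    Real.exp (-(y - x) ^ 2 / 2) * Real.exp (-c ^ 2 / 2) * Real.exp (-(c * (y - x))) := by
  rw [bump, ← Real.exp_add, ← Real.exp_add]; congr 1; ring

lemma bump_add_eq (c x y : ℝ) : bump (x + c) y =
    Real.exp (-(y - x) ^ 2 / 2) * Real.exp (-c ^ 2 / 2) * Real.exp (c * (y - x)) := by
  rw [bump, ← Real.exp_add, ← Real.exp_add]; congr 1; ring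

lemma bump_sub_add_bump_add (c x y : ℝ) : bump (x - c) y + bump (x + c) y =
    2 * (Real.exp (-(y - x) ^ 2 / 2) * Real.exp (-c ^ 2 / 2)) * Real.cosh (c * (y - x)) := by
  rw [bump_sub_eq, bump_add_eq, Real.cosh_eq]; ring

lemma bump_sub_mul_bump_add (c x y : ℝ) : bump (x - c) y * bump (x + c) y =
    (Real.exp (-(y - x) ^ 2 / 2) * Real.exp (-c ^ 2 / 2)) ^ 2 := by
  have : Real.exp (-(c * (y - x))) * Real.exp (c * (y - x)) = 1 := by rw [← Real.exp_add]; simp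
  rw [bump_sub_eq, bump_add_eq]
  linear_combination (Real.exp (-(y - x) ^ 2 / 2) * Real.exp (-c ^ 2 / 2)) ^ 2 * this

/-- For two isolated adjacent levels with weights A and B, P u = AB/(A + B) and P u² = (AB)²/(A +
B)³. With c half the spacing and x the midpoint these are multiples of the first and third power of
sech. -/
lemma bump_pair_ratio (c x y : ℝ) : bump (x - c) y * bump (x + c) y /
    (bump (x - c) y + bump (x + c) y) = Real.exp (-c ^ 2 / 2) / 2 * gaussSech c 1 (y - x) := by
  rw [bump_sub_add_bump_add, bump_sub_mul_bump_add, gaussSech]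
  have := Real.cosh_pos (c * (y - x))
  field_simp

lemma bump_pair_sq_ratio (c x y : ℝ) : (bump (x - c) y * bump (x + c) y) ^ 2 /
    (bump (x - c) y + bump (x + c) y) ^ 3 =
      Real.exp (-c ^ 2 / 2) / 8 * gaussSech c 3 (y - x) := by
  rw [bump_sub_add_bump_add, bump_sub_mul_bump_add, gaussSech]
  have := Real.cosh_pos (c * (y - x))
  field_simp
  norm_num

lemma half_sum_sq_mul_eq (a : ℕ → ℝ) (M : ℕ) :
    ∑ i ∈ Finset.range M, ∑ j ∈ Finset.range M, 1 / 2 * ((i : ℝ) - j) ^ 2 * (a i * a j) =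
    ∑ j ∈ Finset.range M, ∑ i ∈ Finset.range j, ((j : ℝ) - i) ^ 2 * (a i * a j) := by
  induction M with
  | zero => simp
  | succ n ih =>
    simp only [Finset.sum_range_succ, Finset.sum_add_distrib]
    rw [ih]
    have h1 : ∑ i ∈ Finset.range n, 1 / 2 * ((i : ℝ) - n) ^ 2 * (a i * a n) =
        1 / 2 * ∑ i ∈ Finset.range n, ((n : ℝ) - i) ^ 2 * (a i * a n) := by
      rw [Finset.mul_sum]; exact Finset.sum_congr rfl fun i _ => by ring
    have h2 : ∑ j ∈ Finset.range n, 1 / 2 * ((n : ℝ) - j) ^ 2 * (a n * a j) =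
        1 / 2 * ∑ i ∈ Finset.range n, ((n : ℝ) - i) ^ 2 * (a i * a n) := by
      rw [Finset.mul_sum]; exact Finset.sum_congr rfl fun i _ => by ring
    rw [h1, h2]
    ring

/-- Moving both levels inwards by one step multiplies the product of the bumps by exp((n + 1)Δ²),
where n + 2 is the original distance. This beats the square of the distance. -/
lemma bump_mul_le_of_gap {Δ : ℝ} (h1 : 1 ≤ Δ ^ 2) {i j : ℕ} (hij : i < j) (y : ℝ) :
    ((j : ℝ) + 1 - i) ^ 2 * (bump (i * Δ) y * bump ((j + 1 : ℕ) * Δ) y) ≤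
      4 * Real.exp (-Δ ^ 2) * (bump ((i + 1 : ℕ) * Δ) y * bump (j * Δ) y) := by
  obtain ⟨n, rfl⟩ : ∃ n, j = i + 1 + n := Nat.exists_eq_add_of_le hij
  have e : bump (i * Δ) y * bump ((i + 1 + n + 1 : ℕ) * Δ) y =
      Real.exp (-((n + 1) * Δ ^ 2)) * (bump ((i + 1 : ℕ) * Δ) y * bump ((i + 1 + n : ℕ) * Δ) y) := by
    simp only [bump, ← Real.exp_add]; congr 1; push_cast; ring
  rw [e, ← mul_assoc]
  refine mul_le_mul_of_nonneg_right ?_ (mul_pos (bump_pos _ _) (bump_pos _ _)).le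
  have h2 := Real.add_one_le_exp (n * Δ ^ 2 / 2)
  have h3 : (n : ℝ) * 1 ≤ n * Δ ^ 2 := mul_le_mul_of_nonneg_left h1 (by positivity)
  have h4 : ((n : ℝ) + 2) ^ 2 ≤ 4 * Real.exp (n * Δ ^ 2) := by
    have h5 : Real.exp (n * Δ ^ 2) = Real.exp (n * Δ ^ 2 / 2) ^ 2 := by
      rw [← Real.exp_nat_mul]; congr 1; push_cast; ring
    rw [h5]
    have h6 : (n : ℝ) + 2 ≤ 2 * Real.exp (n * Δ ^ 2 / 2) := by linarith
    have := pow_le_pow_left₀ (by positivity) h6 2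
    linarith
  have e2 : Real.exp (-Δ ^ 2) = Real.exp (n * Δ ^ 2) * Real.exp (-((n + 1) * Δ ^ 2)) := by
    rw [← Real.exp_add]; congr 1; ring
  rw [e2]
  have := mul_le_mul_of_nonneg_right h4 (Real.exp_pos (-(((n : ℝ) + 1) * Δ ^ 2))).le
  push_cast
  nlinarith

lemma bump_le_pamMoment {j : ℕ} (hj : j < M) (y : ℝ) : bump (j * Δ) y ≤ pamMoment M 0 Δ y := by
  rw [pamMoment_zero_eq]
  exact Finset.single_le_sum (f := fun i : ℕ => bump (i * Δ) y) (fun i _ => (bump_pos _ _).le)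
    (Finset.mem_range.2 hj)

lemma bump_add_bump_le_pamMoment {j : ℕ} (hj : j + 1 < M) (y : ℝ) :
    bump (j * Δ) y + bump ((j + 1 : ℕ) * Δ) y ≤ pamMoment M 0 Δ y := by
  rw [pamMoment_zero_eq, ← Finset.sum_pair (f := fun i : ℕ => bump (i * Δ) y) (by omega : j ≠ j + 1)]
  refine Finset.sum_le_sum_of_subset_of_nonneg ?_ fun i _ _ => (bump_pos _ _).le
  intro i hi
  simp only [Finset.mem_insert, Finset.mem_singleton] at hi
  rw [Finset.mem_range]; omega

/-- The local fluctuation is dominated by adjacent pairs. -/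
lemma pamMoment_sq_mul_pamVar_le (h1 : 1 ≤ Δ ^ 2) (m : ℕ) (y : ℝ) :
    pamMoment (m + 1) 0 Δ y ^ 2 * pamVar (m + 1) Δ y ≤
      ∑ j ∈ Finset.range m, bump (j * Δ) y * bump ((j + 1 : ℕ) * Δ) y +
        4 * Real.exp (-Δ ^ 2) * pamMoment (m + 1) 0 Δ y ^ 2 := by
  rw [pamMoment_sq_mul_pamVar Δ (by omega), half_sum_sq_mul_eq fun i => bump (i * Δ) y,
    Finset.sum_range_succ']
  simp only [Finset.range_zero, Finset.sum_empty, add_zero, Finset.sum_range_succ (M := ℝ),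
    Finset.sum_add_distrib]
  rw [add_comm]
  refine add_le_add (le_of_eq (Finset.sum_congr rfl fun j _ => by push_cast; ring)) ?_
  set P := pamMoment (m + 1) 0 Δ y with hP
  have hP0 : 0 < P := pamMoment_zero_pos (by omega) _ _
  -- Non-adjacent pairs only: after moving both levels inwards, the products are summands of P · P.
  have hin : ∀ j ∈ Finset.range m, ∑ i ∈ Finset.range j,
      (((j + 1 : ℕ) : ℝ) - i) ^ 2 * (bump (i * Δ) y * bump ((j + 1 : ℕ) * Δ) y) ≤
      4 * Real.exp (-Δ ^ 2) * P * bump (j * Δ) y := fun j hj => by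
    have hj' := Finset.mem_range.1 hj
    calc _ ≤ ∑ i ∈ Finset.range j,
          4 * Real.exp (-Δ ^ 2) * (bump ((i + 1 : ℕ) * Δ) y * bump (j * Δ) y) :=
          Finset.sum_le_sum fun i hi => by
            have := bump_mul_le_of_gap h1 (Finset.mem_range.1 hi) y
            push_cast at this ⊢; exact this
      _ = 4 * Real.exp (-Δ ^ 2) * (∑ i ∈ Finset.range j, bump ((i + 1 : ℕ) * Δ) y) *
          bump (j * Δ) y := by
          rw [Finset.mul_sum, Finset.sum_mul]
          exact Finset.sum_congr rfl fun i _ => by ring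
      _ ≤ _ := by
          have hb := bump_pos (j * Δ) y
          have : ∑ i ∈ Finset.range j, bump ((i + 1 : ℕ) * Δ) y ≤ P := by
            rw [hP, pamMoment_zero_eq, Finset.sum_range_succ']
            have h2 : ∑ i ∈ Finset.range j, bump ((i + 1 : ℕ) * Δ) y ≤
                ∑ i ∈ Finset.range m, bump ((i + 1 : ℕ) * Δ) y :=
              Finset.sum_le_sum_of_subset_of_nonneg (Finset.range_mono hj'.le)
                fun i _ _ => (bump_pos _ _).le
            have := bump_pos (((0 : ℕ) : ℝ) * Δ) y
            linarith
          gcongr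
  refine (Finset.sum_le_sum hin).trans ?_
  rw [← Finset.mul_sum]
  have h2 : ∑ j ∈ Finset.range m, bump (j * Δ) y ≤ P := by
    rw [hP, pamMoment_zero_eq, Finset.sum_range_succ]
    have := bump_pos ((m : ℕ) * Δ) y
    linarith
  have := mul_le_mul_of_nonneg_left h2 (by positivity : 0 ≤ 4 * Real.exp (-Δ ^ 2) * P)
  linarith

lemma bump_mul_bump_le (j : ℕ) (hj : j + 1 < M) (y : ℝ) :
    bump (j * Δ) y * bump ((j + 1 : ℕ) * Δ) y ≤ pamMoment M 0 Δ y ^ 2 * pamVar M Δ y := by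
  rw [pamMoment_sq_mul_pamVar Δ (by omega), half_sum_sq_mul_eq fun i => bump (i * Δ) y]
  have hn : ∀ j i : ℕ, 0 ≤ ((j : ℝ) - i) ^ 2 * (bump (i * Δ) y * bump (j * Δ) y) := fun j i =>
    mul_nonneg (sq_nonneg _) (mul_pos (bump_pos _ _) (bump_pos _ _)).le
  refine le_trans ?_ (Finset.single_le_sum (f := fun j : ℕ => ∑ i ∈ Finset.range j,
    ((j : ℝ) - i) ^ 2 * (bump (i * Δ) y * bump (j * Δ) y))
    (fun j _ => Finset.sum_nonneg fun i _ => hn j i) (Finset.mem_range.2 hj))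
  refine le_trans (le_of_eq ?_) (Finset.single_le_sum (f := fun i : ℕ =>
    (((j + 1 : ℕ) : ℝ) - i) ^ 2 * (bump (i * Δ) y * bump ((j + 1 : ℕ) * Δ) y))
    (fun i _ => hn _ i) (Finset.mem_range.2 j.lt_succ_self))
  push_cast; ring

lemma sum_pow_le_of_le {r : ℝ} (h0 : 0 ≤ r) (hr : r ≤ 1 / 90) (n : ℕ) :
    ∑ i ∈ Finset.range n, r ^ i ≤ 90 / 89 := by
  have h1 : ∑ i ∈ Finset.range n, r ^ i ≤ (1 - r)⁻¹ := by
    rw [← tsum_geometric_of_lt_one h0 (by linarith)]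
    exact Summable.sum_le_tsum _ (fun i _ => by positivity)
      (summable_geometric_of_lt_one h0 (by linarith))
  refine h1.trans ?_
  rw [inv_le_comm₀ (by linarith) (by norm_num)]
  norm_num; linarith

/-- Moving away from the gap, each further bump is smaller than the previous one by at least
exp(-Δ²/2) ≤ exp(-9/2) ≤ 1/90, so a geometric series bounds each side. -/
lemma pamMoment_le_of_mem_gap (h3 : 3 ≤ Δ) {j : ℕ} (hj : j + 1 < M) {y : ℝ}
    (hl : j * Δ ≤ y) (hr : y ≤ (j + 1 : ℕ) * Δ) :
    pamMoment M 0 Δ y ≤ 90 / 89 * (bump (j * Δ) y + bump ((j + 1 : ℕ) * Δ) y) := by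
  set r := Real.exp (-Δ ^ 2 / 2) with hrdef
  have hr0 : 0 < r := Real.exp_pos _
  have hr90 : r ≤ 1 / 90 := by
    have h1 : r ≤ Real.exp (-(9 / 2)) := Real.exp_le_exp.2 (by nlinarith)
    have h2 : Real.exp (-(9 / 2)) = Real.exp (-(9 / 16)) ^ 8 := by
      rw [← Real.exp_nat_mul]; norm_num
    have h4 := (exp_neg_bounds (x := 9 / 16) (by norm_num) (by norm_num)).2
    rw [h2] at h1
    exact h1.trans ((pow_le_pow_left₀ (Real.exp_pos _).le h4 8).trans (by norm_num))
  have hpow : ∀ n : ℕ, r ^ n = Real.exp (-(n * Δ ^ 2 / 2)) := fun n => by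
    rw [hrdef, ← Real.exp_nat_mul]; congr 1; ring
  have hsq : ∀ n : ℕ, (n : ℝ) * Δ ^ 2 ≤ (n : ℝ) ^ 2 * Δ ^ 2 := fun n => by
    have : (n : ℝ) ≤ (n : ℝ) ^ 2 := by exact_mod_cast Nat.le_self_pow (by norm_num) n
    exact mul_le_mul_of_nonneg_right this (sq_nonneg _)
  obtain ⟨m, rfl⟩ : ∃ m, M = j + 1 + m := Nat.exists_eq_add_of_le (by omega)
  rw [pamMoment_zero_eq, Finset.sum_range_add, ← Finset.sum_range_reflect]
  have h1 : ∑ i ∈ Finset.range (j + 1), bump ((j + 1 - 1 - i : ℕ) * Δ) y ≤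
      90 / 89 * bump (j * Δ) y := by
    calc _ ≤ ∑ i ∈ Finset.range (j + 1), r ^ i * bump (j * Δ) y :=
          Finset.sum_le_sum fun i hi => by
            have hi' : i ≤ j := by have := Finset.mem_range.1 hi; omega
            rw [hpow, bump, bump, ← Real.exp_add]
            refine Real.exp_le_exp.2 ?_
            rw [Nat.add_sub_cancel, Nat.cast_sub hi']
            have := hsq i
            have : 0 ≤ (i : ℝ) * Δ * (y - j * Δ) :=
              mul_nonneg (by positivity) (by linarith)
            nlinarith
      _ ≤ _ := by
          rw [← Finset.sum_mul]
          exact mul_le_mul_of_nonneg_right (sum_pow_le_of_le hr0.le hr90 _) (bump_pos _ _).le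
  have h2 : ∑ i ∈ Finset.range m, bump ((j + 1 + i : ℕ) * Δ) y ≤
      90 / 89 * bump ((j + 1 : ℕ) * Δ) y := by
    calc _ ≤ ∑ i ∈ Finset.range m, r ^ i * bump ((j + 1 : ℕ) * Δ) y :=
          Finset.sum_le_sum fun i hi => by
            rw [hpow, bump, bump, ← Real.exp_add]
            refine Real.exp_le_exp.2 ?_
            have := hsq i
            have : 0 ≤ (i : ℝ) * Δ * ((j + 1 : ℕ) * Δ - y) :=
              mul_nonneg (by positivity) (by linarith)
            push_cast at this ⊢
            nlinarith
      _ ≤ _ := by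
          rw [← Finset.sum_mul]
          exact mul_le_mul_of_nonneg_right (sum_pow_le_of_le hr0.le hr90 _) (bump_pos _ _).le
  linarith

/-- P is bounded below by the two bumps of a gap, which makes each adjacent pair contribute one sech
integral over the whole line. The remaining pairs cost 4 exp(-Δ²) P. -/
lemma pamVarIntegral_one_le_gaussSech (h1 : 1 ≤ Δ ^ 2) (m : ℕ) :
    pamVarIntegral (m + 1) 1 Δ ≤
      m * (Real.exp (-(Δ / 2) ^ 2 / 2) / 2 * ∫ z, gaussSech (Δ / 2) 1 z) +
        4 * Real.exp (-Δ ^ 2) * ((m + 1 : ℕ) * √(2 * Real.pi)) := by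
  set c := Δ / 2
  have iS : ∀ j : ℕ, Integrable fun y =>
      Real.exp (-c ^ 2 / 2) / 2 * gaussSech c 1 (y - ((j : ℝ) * Δ + c)) := fun j =>
    ((integrable_gaussSech c 1).comp_sub_right _).const_mul _
  have iP := (integral_pamMoment_zero (m + 1) Δ).1.const_mul (4 * Real.exp (-Δ ^ 2))
  have iSum : Integrable fun y => ∑ j ∈ Finset.range m,
      Real.exp (-c ^ 2 / 2) / 2 * gaussSech c 1 (y - ((j : ℝ) * Δ + c)) :=
    integrable_finsetSum _ fun j _ => iS j
  have hpt : ∀ y, pamMoment (m + 1) 0 Δ y * pamVar (m + 1) Δ y ^ 1 ≤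
      ∑ j ∈ Finset.range m, Real.exp (-c ^ 2 / 2) / 2 * gaussSech c 1 (y - ((j : ℝ) * Δ + c)) +
        4 * Real.exp (-Δ ^ 2) * pamMoment (m + 1) 0 Δ y := fun y => by
    have hP := pamMoment_zero_pos (by omega : 1 ≤ m + 1) Δ y
    have h2 := pamMoment_sq_mul_pamVar_le h1 m y
    have h3 : ∑ j ∈ Finset.range m, bump (j * Δ) y * bump ((j + 1 : ℕ) * Δ) y ≤
        (∑ j ∈ Finset.range m, Real.exp (-c ^ 2 / 2) / 2 *
          gaussSech c 1 (y - ((j : ℝ) * Δ + c))) * pamMoment (m + 1) 0 Δ y := by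
      rw [Finset.sum_mul]
      refine Finset.sum_le_sum fun j hj => ?_
      have hj' := Finset.mem_range.1 hj
      have e1 : (j : ℝ) * Δ + c - c = j * Δ := by ring
      have e2 : (j : ℝ) * Δ + c + c = (j + 1 : ℕ) * Δ := by push_cast; simp only [c]; ring
      rw [← bump_pair_ratio, e1, e2, div_mul_eq_mul_div,
        le_div_iff₀ (add_pos (bump_pos _ _) (bump_pos _ _))]
      exact mul_le_mul_of_nonneg_left (bump_add_bump_le_pamMoment (by omega) y)
        (mul_pos (bump_pos _ _) (bump_pos _ _)).le
    rw [pow_one]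
    refine le_of_mul_le_mul_left ?_ hP
    linarith
  refine (integral_mono (integrable_pamMoment_mul_pamVar_pow (by omega) Δ 1)
    (iSum.add iP) hpt).trans (le_of_eq ?_)
  rw [integral_add' iSum iP, integral_finsetSum _ fun j _ => iS j, integral_const_mul,
    (integral_pamMoment_zero (m + 1) Δ).2]
  congr 1
  simp only [integral_const_mul, integral_sub_right_eq_self (gaussSech c 1), Finset.sum_const,
    Finset.card_range, nsmul_eq_mul]

/-- P u² = (P²u)²/P³. On each gap P²u is at least the product of the adjacent bumps and P exceeds
their sum by at most 90/89. The gaps are disjoint, so their integrals add up. -/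
lemma gaussSech_le_pamVarIntegral_two (h3 : 3 ≤ Δ) (m : ℕ) :
    m * ((89 / 90) ^ 3 * (Real.exp (-(Δ / 2) ^ 2 / 2) / 8 *
      ∫ z in (-(Δ / 2))..(Δ / 2), gaussSech (Δ / 2) 3 z)) ≤ pamVarIntegral (m + 1) 2 Δ := by
  set c := Δ / 2
  set f : ℝ → ℝ := fun y => pamMoment (m + 1) 0 Δ y * pamVar (m + 1) Δ y ^ 2
  have hf : Integrable f := integrable_pamMoment_mul_pamVar_pow (by omega) Δ 2
  have hf0 : ∀ y, 0 ≤ f y := fun y =>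
    mul_nonneg (pamMoment_zero_pos (by omega) Δ y).le (sq_nonneg _)
  have hfi : ∀ a b : ℝ, IntervalIntegrable f volume a b := fun a b => hf.intervalIntegrable
  have hsum := intervalIntegral.sum_integral_adjacent_intervals (f := f) (μ := volume)
    (a := fun j : ℕ => (j : ℝ) * Δ) (n := m) fun j _ => hfi _ _
  have h0 : ((0 : ℕ) : ℝ) * Δ ≤ (m : ℝ) * Δ := by
    rw [Nat.cast_zero, zero_mul]; positivity
  calc _ = ∑ j ∈ Finset.range m, (89 / 90) ^ 3 * (Real.exp (-c ^ 2 / 2) / 8 *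
        ∫ z in (-c)..c, gaussSech c 3 z) := by simp
    _ ≤ ∑ j ∈ Finset.range m, ∫ y in ((j : ℝ) * Δ)..((j + 1 : ℕ) * Δ), f y := by
        refine Finset.sum_le_sum fun j hj => ?_
        have hj' := Finset.mem_range.1 hj
        have e1 : (j : ℝ) * Δ + c - c = j * Δ := by ring
        have e2 : (j : ℝ) * Δ + c + c = (j + 1 : ℕ) * Δ := by push_cast; simp only [c]; ring
        have e3 : (∫ z in (-c)..c, gaussSech c 3 z) =
            ∫ y in ((j : ℝ) * Δ)..((j + 1 : ℕ) * Δ), gaussSech c 3 (y - (j * Δ + c)) := by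
          rw [intervalIntegral.integral_comp_sub_right]
          congr 1
          · ring
          · rw [← e2]; ring
        rw [e3, ← intervalIntegral.integral_const_mul, ← intervalIntegral.integral_const_mul]
        refine intervalIntegral.integral_mono_on (by push_cast; nlinarith)
          (Continuous.intervalIntegrable (by fun_prop) _ _) (hfi _ _) fun y hy => ?_
        have hP := pamMoment_zero_pos (by omega : 1 ≤ m + 1) Δ y
        have hg := pamMoment_le_of_mem_gap h3 (M := m + 1) (by omega) hy.1 hy.2
        have hb := bump_mul_bump_le (M := m + 1) (Δ := Δ) j (by omega) y
        rw [← bump_pair_sq_ratio, e1, e2]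
        have p1 := bump_pos (j * Δ) y
        have p2 := bump_pos ((j + 1 : ℕ) * Δ) y
        have e4 : f y = (pamMoment (m + 1) 0 Δ y ^ 2 * pamVar (m + 1) Δ y) ^ 2 /
            pamMoment (m + 1) 0 Δ y ^ 3 := by
          simp only [f]; field_simp
        rw [e4]
        set A := bump (j * Δ) y
        set B := bump ((j + 1 : ℕ) * Δ) y
        calc (89 / 90) ^ 3 * ((A * B) ^ 2 / (A + B) ^ 3) = (A * B) ^ 2 /
              (90 / 89 * (A + B)) ^ 3 := by field_simp
          _ ≤ _ := div_le_div₀ (sq_nonneg _) (pow_le_pow_left₀ (by positivity) hb 2)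
              (by positivity) (pow_le_pow_left₀ hP.le hg 3)
    _ = ∫ y in (((0 : ℕ) : ℝ) * Δ)..(m * Δ), f y := hsum
    _ ≤ _ := by
        rw [intervalIntegral.integral_of_le h0]
        exact setIntegral_le_integral hf (.of_forall hf0)

/-- The second moment inequality for large spacing. -/
theorem pamVarIntegral_one_le_of_three_le (hM : 2 ≤ M) (h3 : 3 ≤ Δ) :
    pamVarIntegral M 1 Δ ≤ Δ ^ 2 * pamVarIntegral M 2 Δ := by
  obtain ⟨m, rfl⟩ : ∃ m, M = m + 1 := ⟨M - 1, by omega⟩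
  have hm : (1 : ℝ) ≤ m := by exact_mod_cast (by omega : 1 ≤ m)
  have hs : 9 ≤ Δ ^ 2 := by nlinarith
  have hup := pamVarIntegral_one_le_gaussSech (Δ := Δ) (by linarith) m
  have hlo := gaussSech_le_pamVarIntegral_two h3 m
  have hc : 3 / 2 ≤ Δ / 2 := by linarith
  have hK := integral_gaussSech_le (c := Δ / 2) (by linarith)
  have hK0 := one_div_le_integral_gaussSech hc
  set K := ∫ z, gaussSech (Δ / 2) 1 z
  set K3 := ∫ z in (-(Δ / 2))..(Δ / 2), gaussSech (Δ / 2) 3 z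
  set E := Real.exp (-(Δ / 2) ^ 2 / 2) with hE
  have hE0 : 0 < E := Real.exp_pos _
  have hpi : √(2 * Real.pi) ≤ 2.51 :=
    Real.sqrt_le_iff.2 ⟨by norm_num, by have := Real.pi_lt_d2; norm_num at *; linarith⟩
  rw [show 2 * (Δ / 2) = Δ by ring] at hK0
  -- The error from non-adjacent pairs is made comparable with the main term, using that the sech
  -- integral is at least 1/Δ.
  have hexp : Real.exp (-Δ ^ 2) ≤ E * (1 / (600 * Δ)) := by
    have e1 : Real.exp (-Δ ^ 2) = E * Real.exp (-(7 / 8 * Δ ^ 2)) := by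
      rw [hE, ← Real.exp_add]; congr 1; ring
    rw [e1]
    refine mul_le_mul_of_nonneg_left ?_ hE0.le
    rw [Real.exp_neg, ← one_div]
    refine one_div_le_one_div_of_le (by positivity) ?_
    have h4 : Real.exp (7 / 8 * 9) * Real.exp (7 / 8 * (Δ ^ 2 - 9)) =
        Real.exp (7 / 8 * Δ ^ 2) := by rw [← Real.exp_add]; congr 1; ring
    have h5 : 2.7 ^ 7 * 1.875 ≤ Real.exp (7 / 8 * 9) := by
      have h6 : Real.exp (7 / 8 * 9) = Real.exp 1 ^ 7 * Real.exp 0.875 := by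
        rw [← Real.exp_nat_mul, ← Real.exp_add]; norm_num
      rw [h6]
      refine mul_le_mul (pow_le_pow_left₀ (by norm_num) (by linarith [Real.exp_one_gt_d9]) 7)
        (by linarith [Real.add_one_le_exp (0.875 : ℝ)]) (by norm_num) (by positivity)
    have h7 := Real.add_one_le_exp (7 / 8 * (Δ ^ 2 - 9))
    rw [← h4]
    refine le_trans ?_ (mul_le_mul h5 h7 (by linarith) (Real.exp_pos _).le)
    norm_num
    nlinarith
  have hΔ0 : 0 < Δ := by linarith
  have hK0' : 1 / (600 * Δ) ≤ K / 600 := by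
    calc 1 / (600 * Δ) = 1 / Δ / 600 := by field_simp
      _ ≤ _ := by linarith
  have hKp : 0 < K := (by positivity : 0 < 1 / Δ).trans_le hK0
  have u1 : 4 * Real.exp (-Δ ^ 2) * ((m + 1 : ℕ) * √(2 * Real.pi)) ≤
      4 * (E * (K / 600)) * ((2 * m) * 2.51) := by
    have h8 : Real.exp (-Δ ^ 2) ≤ E * (K / 600) :=
      hexp.trans (mul_le_mul_of_nonneg_left hK0' hE0.le)
    have h9 : ((m + 1 : ℕ) : ℝ) ≤ 2 * m := by push_cast; linarith
    gcongr
  have hmEK : 0 < m * E * K := by positivity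
  have u2 := mul_le_mul_of_nonneg_left hlo (sq_nonneg Δ)
  -- In units of m·E·K the lower bound is (9/16)(89/90)³ ≈ 0.544, against 1/2 plus an error of about
  -- 0.034 in the upper bound.
  have u3 : 9 * (m * ((89 / 90) ^ 3 * (E / 8 * (K / 2)))) ≤
      Δ ^ 2 * (m * ((89 / 90) ^ 3 * (E / 8 * K3))) := by
    refine mul_le_mul hs ?_ (by positivity) (sq_nonneg Δ)
    gcongr
    linarith
  norm_num at u3
  linarith

end Gap

/-! ### Concavity of the PAM information in the log-SNR variable. -/

/-- Mutual information of `M`-PAM with spacing `Δ` in unit-variance real Gaussian noise. -/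
noncomputable def pamInformation (M : ℕ) (Δ : ℝ) : ℝ :=
  Real.log M - 1 / 2 - pamLogIntegral M Δ / (M * √(2 * Real.pi))

section Concave
variable {M : ℕ} {Δ : ℝ}

theorem pamVarIntegral_one_le (hM : 16 ≤ M) (hl : 2.017 ≤ Δ) :
    pamVarIntegral M 1 Δ ≤ (Δ ^ 2 + 12 / ((M : ℝ) ^ 2 - 1)) * pamVarIntegral M 2 Δ := by
  rcases le_total Δ 3 with h | h
  · exact pamVarIntegral_one_le_of_le_three hM hl h
  · have h1 := pamVarIntegral_one_le_of_three_le (M := M) (by omega) h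
    have h2 : 0 ≤ pamVarIntegral M 2 Δ := integral_nonneg fun y =>
      mul_nonneg (pamMoment_zero_pos (by omega) _ _).le (sq_nonneg _)
    have h3 : (16 : ℝ) ≤ M := by exact_mod_cast hM
    have h4 : 0 ≤ 12 / ((M : ℝ) ^ 2 - 1) := div_nonneg (by norm_num) (by nlinarith)
    nlinarith [mul_nonneg h4 h2]

lemma hasDerivAt_pamInformation (hM : 1 ≤ M) (Δ : ℝ) :
    HasDerivAt (pamInformation M) (Δ * pamVarIntegral M 1 Δ / (M * √(2 * Real.pi))) Δ := by
  have := ((hasDerivAt_pamLogIntegral hM Δ).div_const (M * √(2 * Real.pi))).const_sub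
    (Real.log M - 1 / 2)
  refine this.congr_deriv ?_
  ring

lemma continuous_pamInformation (hM : 1 ≤ M) : Continuous (pamInformation M) :=
  continuous_iff_continuousAt.2 fun Δ => (hasDerivAt_pamInformation hM Δ).continuousAt

/-- Spacing as a function of the log-SNR variable. -/
noncomputable def logSpacing (a t : ℝ) : ℝ := √(a * (Real.exp t - 1))

lemma logSpacing_sq {a t : ℝ} (ha : 0 ≤ a) (ht : 0 ≤ t) :
    logSpacing a t ^ 2 = a * (Real.exp t - 1) :=
  Real.sq_sqrt (mul_nonneg ha (by linarith [Real.add_one_le_exp t]))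

lemma hasDerivAt_logSpacing {a t : ℝ} (ha : 0 < a) (ht : 0 < t) :
    HasDerivAt (logSpacing a) (a * Real.exp t / (2 * logSpacing a t)) t := by
  have h1 : 0 < a * (Real.exp t - 1) := mul_pos ha (by linarith [Real.add_one_le_exp t])
  exact (((Real.hasDerivAt_exp t).sub_const 1).const_mul a).sqrt h1.ne'

/-- Concavity of the information as a function of the log-SNR variable. -/
theorem concaveOn_pamInformation_logSpacing (hM : 16 ≤ M) {t0 : ℝ} (ht0 : 0 < t0)
    (h0 : 2.017 ≤ logSpacing (12 / ((M : ℝ) ^ 2 - 1)) t0) :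
    ConcaveOn ℝ (Set.Ici t0) fun t =>
      pamInformation M (logSpacing (12 / ((M : ℝ) ^ 2 - 1)) t) := by
  have hMr : (16 : ℝ) ≤ M := by exact_mod_cast hM
  have hM1 : 1 ≤ M := by omega
  set a := 12 / ((M : ℝ) ^ 2 - 1)
  have ha : 0 < a := div_pos (by norm_num) (by nlinarith)
  set k := 1 / (2 * (M * √(2 * Real.pi)))
  have hk : 0 ≤ k := by positivity
  have hmono : ∀ t, t0 ≤ t → 2.017 ≤ logSpacing a t := fun t ht =>
    h0.trans (Real.sqrt_le_sqrt (mul_le_mul_of_nonneg_left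
      (sub_le_sub_right (Real.exp_le_exp.2 ht) 1) ha.le))
  have hd1 : ∀ t, t0 ≤ t → HasDerivAt (fun t => pamInformation M (logSpacing a t))
      (k * (a * Real.exp t * pamVarIntegral M 1 (logSpacing a t))) t := fun t ht => by
    have hp : 0 < logSpacing a t := by linarith [hmono t ht]
    refine ((hasDerivAt_pamInformation hM1 _).comp t
      (hasDerivAt_logSpacing ha (ht0.trans_le ht))).congr_deriv ?_
    simp only [k]
    have : (M : ℝ) * √(2 * Real.pi) ≠ 0 := by have := Real.pi_pos; positivity
    field_simp
  -- The chain rule contributes a e^t/(2Δ), which turns -2ΔV_2 into -a e^t V_2. Since a e^t = Δ² +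
  -- a, the second derivative is a positive multiple of V_1 - (Δ² + a)V_2.
  have hd2 : ∀ t, t0 ≤ t → HasDerivAt
      (fun t => k * (a * Real.exp t * pamVarIntegral M 1 (logSpacing a t)))
      (k * (a * Real.exp t * (pamVarIntegral M 1 (logSpacing a t) -
        (logSpacing a t ^ 2 + a) * pamVarIntegral M 2 (logSpacing a t)))) t := fun t ht => by
    have hp : 0 < logSpacing a t := by linarith [hmono t ht]
    have h1 := (hasDerivAt_pamVarIntegral_one hM1 (logSpacing a t)).comp t
      (hasDerivAt_logSpacing ha (ht0.trans_le ht))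
    refine ((((Real.hasDerivAt_exp t).const_mul a).mul h1).const_mul k).congr_deriv ?_
    rw [logSpacing_sq ha.le (ht0.le.trans ht)]
    simp only [Function.comp]
    field_simp
    ring
  refine concaveOn_of_hasDerivWithinAt2_nonpos (convex_Ici t0)
    (fun t ht => (hd1 t ht).continuousAt.continuousWithinAt)
    (fun t ht => (hd1 t (interior_subset ht)).hasDerivWithinAt)
    (fun t ht => (hd2 t (interior_subset ht)).hasDerivWithinAt) fun t ht => ?_
  have ht' : t0 ≤ t := interior_subset ht
  have := pamVarIntegral_one_le hM (hmono t ht')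
  exact mul_nonpos_of_nonneg_of_nonpos hk (mul_nonpos_of_nonneg_of_nonpos (by positivity)
    (by linarith))

end Concave

/-! ### Mutual information as an average log-likelihood ratio. -/

section Density
variable {α β : Type*} [MeasurableSpace α] [MeasurableSpace β]

/-- Mutual information of a pair with a joint density. -/
lemma toReal_klDiv_prod_of_density (ρ : Measure (α × β)) [IsProbabilityMeasure ρ] (U : Measure α)
    [IsProbabilityMeasure U] (μ : Measure β) [SigmaFinite μ] {p : α × β → ENNReal}
    {q : β → ENNReal} (hp : Measurable p) (hq : Measurable q) (hq0 : ∀ y, q y ≠ 0)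
    (hqt : ∀ y, q y ≠ ⊤) (hρ : ρ = (U.prod μ).withDensity p) (hfst : ρ.fst = U)
    (hsnd : ρ.snd = μ.withDensity q) :
    (InformationTheory.klDiv ρ (ρ.fst.prod ρ.snd)).toReal =
      ∫ z, Real.log (p z / q z.2).toReal ∂ρ := by
  have hprod : ρ.fst.prod ρ.snd = (U.prod μ).withDensity fun z => q z.2 := by
    have : SFinite (μ.withDensity q) := by rw [← hsnd]; infer_instance
    rw [hfst, hsnd, prod_withDensity_right hq]
  have hr : Measurable fun z : α × β => p z / q z.2 := hp.div (hq.comp measurable_snd)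
  have hdens : ρ = (ρ.fst.prod ρ.snd).withDensity fun z => p z / q z.2 := by
    rw [hprod, ← withDensity_mul (U.prod μ) (f := fun z => q z.2) (hq.comp measurable_snd) hr]
    conv_lhs => rw [hρ]
    congr 1
    funext z
    exact (ENNReal.mul_div_cancel (hq0 _) (hqt _)).symm
  have hac : ρ ≪ ρ.fst.prod ρ.snd := by
    conv_lhs => rw [hdens]
    exact withDensity_absolutelyContinuous _ _
  rw [InformationTheory.toReal_klDiv_of_measure_eq hac (by simp)]
  refine integral_congr_ae ?_
  have hrn := Measure.rnDeriv_withDensity (ρ.fst.prod ρ.snd) hr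
  rw [← hdens] at hrn
  filter_upwards [hac.ae_le hrn] with z hz
  rw [llr, hz]

end Density

section Channel

lemma lintegral_uniformOn (S : Finset ℂ) (f : ℂ → ENNReal) :
    ∫⁻ x, f x ∂(uniformOn (S : Set ℂ)) = (S.card : ENNReal)⁻¹ * ∑ x ∈ S, f x := by
  rw [uniformOn, ProbabilityTheory.cond, lintegral_smul_measure, lintegral_finset]
  simp [Measure.count_apply_finset]

instance isProbabilityMeasure_stdComplexGaussian : IsProbabilityMeasure stdComplexGaussian :=
  Measure.isProbabilityMeasure_map (by
    exact (Complex.measurableEquivRealProd.symm.measurable).aemeasurable)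

variable {S : Finset ℂ} {γ : ℝ}

lemma lintegral_gaussianChannelLaw (S : Finset ℂ) (γ : ℝ) {f : ℂ × ℂ → ENNReal}
    (hf : Measurable f) : ∫⁻ z, f z ∂(gaussianChannelLaw S γ) = (S.card : ENNReal)⁻¹ *
      ∑ x ∈ S, ∫⁻ n, f (x, (√γ : ℂ) * x + n) ∂stdComplexGaussian := by
  have hm : Measurable fun p : ℂ × ℂ => (p.1, (√γ : ℂ) * p.1 + p.2) := by fun_prop
  rw [gaussianChannelLaw, lintegral_map hf hm, lintegral_prod _ (by fun_prop),
    lintegral_uniformOn]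

lemma gaussianChannelLaw_eq_sum (S : Finset ℂ) (γ : ℝ) :
    gaussianChannelLaw S γ = (S.card : ENNReal)⁻¹ •
      ∑ x ∈ S, stdComplexGaussian.map fun n => (x, (√γ : ℂ) * x + n) := by
  refine Measure.ext_of_lintegral _ fun f hf => ?_
  rw [lintegral_gaussianChannelLaw S γ hf, lintegral_smul_measure, lintegral_finsetSum_measure]
  congr 1
  refine Finset.sum_congr rfl fun x _ => ?_
  rw [lintegral_map hf (by fun_prop)]

lemma integral_gaussianChannelLaw {f : ℂ × ℂ → ℝ} (hf : Measurable f)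
    (hi : ∀ x ∈ S, Integrable (fun n => f (x, (√γ : ℂ) * x + n)) stdComplexGaussian) :
    ∫ z, f z ∂(gaussianChannelLaw S γ) =
      (∑ x ∈ S, ∫ n, f (x, (√γ : ℂ) * x + n) ∂stdComplexGaussian) / S.card := by
  have hm : ∀ x : ℂ, Measurable fun n : ℂ => (x, (√γ : ℂ) * x + n) := fun x => by fun_prop
  rw [gaussianChannelLaw_eq_sum, integral_smul_measure, integral_finsetSum_measure]
  · rw [Finset.sum_congr rfl fun x _ =>
      integral_map (hm x).aemeasurable hf.aestronglyMeasurable, div_eq_inv_mul]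
    simp
  · intro x hx
    exact (integrable_map_measure hf.aestronglyMeasurable (hm x).aemeasurable).2 (hi x hx)

/-- Density of the standard complex Gaussian. -/
noncomputable def complexGaussianDensity (z : ℂ) : ℝ :=
  (Real.pi)⁻¹ * Real.exp (-(z.re ^ 2 + z.im ^ 2))

lemma complexGaussianDensity_pos (z : ℂ) : 0 < complexGaussianDensity z :=
  mul_pos (inv_pos.2 Real.pi_pos) (Real.exp_pos _)

@[fun_prop]
lemma measurable_complexGaussianDensity : Measurable complexGaussianDensity := by
  unfold complexGaussianDensity; fun_prop

lemma stdComplexGaussian_eq_withDensity : stdComplexGaussian =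
    (volume : Measure ℂ).withDensity fun z => ENNReal.ofReal (complexGaussianDensity z) := by
  have hv : ((1 : NNReal) / 2) ≠ 0 := by norm_num
  have hmp := Complex.volume_preserving_equiv_real_prod.symm
  have he : (fun p : ℝ × ℝ => (⟨p.1, p.2⟩ : ℂ)) = Complex.measurableEquivRealProd.symm := rfl
  refine Measure.ext_of_lintegral _ fun f hf => ?_
  rw [stdComplexGaussian, gaussianReal_of_var_ne_zero 0 hv,
    prod_withDensity (measurable_gaussianPDF 0 _) (measurable_gaussianPDF 0 _), he,
    lintegral_map_equiv, lintegral_withDensity_eq_lintegral_mul _ (by fun_prop) (by fun_prop),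
    lintegral_withDensity_eq_lintegral_mul _ (by fun_prop) hf, ← hmp.map_eq, lintegral_map_equiv]
  refine lintegral_congr fun p => ?_
  simp only [Pi.mul_apply]
  congr 1
  rw [gaussianPDF, gaussianPDF, ← ENNReal.ofReal_mul (gaussianPDFReal_nonneg _ _ _)]
  congr 1
  have h1 : (2 : ℝ) * Real.pi * ((1 / 2 : NNReal) : ℝ) = Real.pi := by push_cast; ring
  have h2 : (2 : ℝ) * ((1 / 2 : NNReal) : ℝ) = 1 := by push_cast; ring
  simp only [gaussianPDFReal, complexGaussianDensity, h1, h2, sub_zero, div_one]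
  rw [mul_mul_mul_comm, ← mul_inv, Real.mul_self_sqrt Real.pi_pos.le, ← Real.exp_add]
  congr 2
  change -p.1 ^ 2 + -p.2 ^ 2 = -(p.1 ^ 2 + p.2 ^ 2)
  ring

/-- Density of the channel output. -/
noncomputable def channelOutputDensity (S : Finset ℂ) (γ : ℝ) (y : ℂ) : ℝ :=
  (∑ x ∈ S, complexGaussianDensity (y - (√γ : ℂ) * x)) / S.card

lemma channelOutputDensity_pos (hS : S.Nonempty) (y : ℂ) : 0 < channelOutputDensity S γ y :=
  div_pos (Finset.sum_pos (fun x _ => complexGaussianDensity_pos _) hS)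
    (by exact_mod_cast hS.card_pos)

@[fun_prop]
lemma measurable_channelOutputDensity (S : Finset ℂ) (γ : ℝ) :
    Measurable (channelOutputDensity S γ) := by
  unfold channelOutputDensity
  exact (Finset.measurable_sum _ fun x _ => by fun_prop).div_const _

/-- Mutual information of the channel as an average of log-likelihood ratios. -/
lemma mutualInformation_gaussianChannelLaw (hS : S.Nonempty)
    (hi : ∀ x ∈ S, Integrable (fun n => Real.log (complexGaussianDensity n /
      channelOutputDensity S γ ((√γ : ℂ) * x + n))) stdComplexGaussian) :
    mutualInformation (gaussianChannelLaw S γ) =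
      (∑ x ∈ S, ∫ n, Real.log (complexGaussianDensity n /
        channelOutputDensity S γ ((√γ : ℂ) * x + n)) ∂stdComplexGaussian) / S.card := by
  have hU : IsProbabilityMeasure (uniformOn (S : Set ℂ)) :=
    isProbabilityMeasure_uniformOn S.finite_toSet (by simpa using hS)
  have hm : Measurable fun p : ℂ × ℂ => (p.1, (√γ : ℂ) * p.1 + p.2) := by fun_prop
  have hρ : IsProbabilityMeasure (gaussianChannelLaw S γ) :=
    Measure.isProbabilityMeasure_map hm.aemeasurable
  have hc0 : (S.card : ENNReal) ≠ 0 := by exact_mod_cast hS.card_pos.ne'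
  have hct : (S.card : ENNReal) ≠ ⊤ := ENNReal.natCast_ne_top _
  set p : ℂ × ℂ → ENNReal := fun z =>
    ENNReal.ofReal (complexGaussianDensity (z.2 - (√γ : ℂ) * z.1))
  set q : ℂ → ENNReal := fun y => ENNReal.ofReal (channelOutputDensity S γ y)
  have hp : Measurable p := by fun_prop
  have hq : Measurable q := by fun_prop
  have hshift : ∀ (x : ℂ) (f : ℂ → ENNReal), Measurable f →
      ∫⁻ n, f ((√γ : ℂ) * x + n) ∂stdComplexGaussian = ∫⁻ y, p (x, y) * f y := fun x f hf => by
    rw [stdComplexGaussian_eq_withDensity,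
      lintegral_withDensity_eq_lintegral_mul _ (by fun_prop) (by fun_prop),
      ← lintegral_add_left_eq_self (fun y => p (x, y) * f y) ((√γ : ℂ) * x)]
    simp [p]
  have hdens : gaussianChannelLaw S γ = ((uniformOn (S : Set ℂ)).prod volume).withDensity p := by
    refine Measure.ext_of_lintegral _ fun f hf => ?_
    rw [lintegral_gaussianChannelLaw S γ hf, lintegral_withDensity_eq_lintegral_mul _ hp hf,
      lintegral_prod _ (by fun_prop), lintegral_uniformOn]
    congr 1
    exact Finset.sum_congr rfl fun x _ => hshift x (fun y => f (x, y)) (by fun_prop)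
  have hfst : (gaussianChannelLaw S γ).fst = uniformOn (S : Set ℂ) := by
    refine Measure.ext_of_lintegral _ fun f hf => ?_
    rw [Measure.fst, lintegral_map hf measurable_fst,
      lintegral_gaussianChannelLaw S γ (f := fun z => f z.1) (by fun_prop), lintegral_uniformOn]
    simp
  have hsnd : (gaussianChannelLaw S γ).snd = (volume : Measure ℂ).withDensity q := by
    refine Measure.ext_of_lintegral _ fun f hf => ?_
    rw [Measure.snd, lintegral_map hf measurable_snd,
      lintegral_gaussianChannelLaw S γ (f := fun z => f z.2) (by fun_prop),
      lintegral_withDensity_eq_lintegral_mul _ hq hf, Finset.sum_congr rfl fun x _ => hshift x f hf,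
      ← lintegral_finsetSum _ fun x _ => by fun_prop, ← lintegral_const_mul _ (by fun_prop)]
    refine lintegral_congr fun y => ?_
    rw [← Finset.sum_mul, ← mul_assoc, Pi.mul_apply]
    congr 1
    simp only [p, q, channelOutputDensity]
    rw [ENNReal.ofReal_div_of_pos (by exact_mod_cast hS.card_pos),
      ENNReal.ofReal_sum_of_nonneg fun x _ => (complexGaussianDensity_pos _).le,
      ENNReal.ofReal_natCast, div_eq_mul_inv, mul_comm]
  rw [mutualInformation, toReal_klDiv_prod_of_density _ _ volume hp hq
    (fun y => (ENNReal.ofReal_pos.2 (channelOutputDensity_pos hS y)).ne')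
    (fun y => ENNReal.ofReal_ne_top) hdens hfst hsnd]
  have he : ∀ z : ℂ × ℂ, Real.log (p z / q z.2).toReal =
      Real.log (complexGaussianDensity (z.2 - (√γ : ℂ) * z.1) / channelOutputDensity S γ z.2) :=
    fun z => by
      rw [ENNReal.toReal_div, ENNReal.toReal_ofReal (complexGaussianDensity_pos _).le,
        ENNReal.toReal_ofReal (channelOutputDensity_pos hS _).le]
  simp only [he]
  rw [integral_gaussianChannelLaw (by fun_prop)]
  · simp
  · simpa using hi

end Channel

/-! ### Log-likelihood ratios of a single PAM quadrature. -/

section PamLikelihood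
variable {M : ℕ}

/-- Log-likelihood ratio of level `k` against the output mixture of `M`-PAM with spacing `Δ`. -/
noncomputable def pamLogRatio (M : ℕ) (Δ : ℝ) (k : ℕ) (y : ℝ) : ℝ :=
  Real.log M - (y - k * Δ) ^ 2 / 2 - Real.log (pamMoment M 0 Δ y)

lemma continuous_pamLogRatio (hM : 1 ≤ M) (Δ : ℝ) (k : ℕ) : Continuous (pamLogRatio M Δ k) := by
  have : Continuous fun y => Real.log (pamMoment M 0 Δ y) :=
    (continuous_pamMoment M 0 Δ).log fun y => (pamMoment_zero_pos hM Δ y).ne'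
  unfold pamLogRatio
  fun_prop

lemma integrable_bump_mul_log_pamMoment {Δ : ℝ} {k : ℕ} (hk : k < M) :
    Integrable fun y => bump (k * Δ) y * Real.log (pamMoment M 0 Δ y) := by
  have hM : 1 ≤ M := by omega
  have hc : Continuous fun y => Real.log (pamMoment M 0 Δ y) :=
    (continuous_pamMoment M 0 Δ).log fun y => (pamMoment_zero_pos hM Δ y).ne'
  refine (integrable_pamLog hM Δ).mono ((continuous_bump _).mul hc).aestronglyMeasurable
    (Eventually.of_forall fun y => ?_)
  rw [norm_mul, norm_mul, Real.norm_of_nonneg (bump_pos _ _).le,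
    Real.norm_of_nonneg (pamMoment_zero_pos hM Δ y).le]
  exact mul_le_mul_of_nonneg_right (bump_le_pamMoment hk y) (norm_nonneg _)

lemma gaussianPDFReal_one (x y : ℝ) : gaussianPDFReal x 1 y = (√(2 * Real.pi))⁻¹ * bump x y := by
  simp [gaussianPDFReal, bump]

lemma integrable_gaussianReal_one_iff (x : ℝ) {f : ℝ → ℝ} :
    Integrable f (gaussianReal x 1) ↔ Integrable fun y => bump x y * f y := by
  rw [gaussianReal_of_var_ne_zero x one_ne_zero,
    integrable_withDensity_iff_integrable_smul' (measurable_gaussianPDF x 1)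
      (Eventually.of_forall fun _ => gaussianPDF_lt_top)]
  simp only [toReal_gaussianPDF, gaussianPDFReal_one, smul_eq_mul, mul_assoc]
  exact integrable_const_mul_iff (by
    have : 0 < √(2 * Real.pi) := by positivity
    exact (isUnit_iff_ne_zero.2 (inv_pos.2 this).ne')) _

lemma integral_gaussianReal_one (x : ℝ) (f : ℝ → ℝ) :
    ∫ y, f y ∂(gaussianReal x 1) = (∫ y, bump x y * f y) / √(2 * Real.pi) := by
  rw [integral_gaussianReal_eq_integral_smul one_ne_zero]
  simp only [gaussianPDFReal_one, smul_eq_mul, mul_assoc]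
  rw [integral_const_mul, inv_mul_eq_div]

lemma integrable_sub_sq_gaussianReal_one (x : ℝ) :
    Integrable (fun y => (y - x) ^ 2 / 2) (gaussianReal x 1) := by
  have h : MemLp (fun y : ℝ => y) 2 (gaussianReal x 1) := memLp_id_gaussianReal 2
  simpa using ((h.sub (memLp_const x)).integrable_sq).div_const 2

lemma integral_sub_sq_gaussianReal_one (x : ℝ) :
    ∫ y, (y - x) ^ 2 / 2 ∂(gaussianReal x 1) = 1 / 2 := by
  have h := variance_fun_id_gaussianReal (μ := x) (v := 1)
  rw [variance_eq_integral (by fun_prop), integral_id_gaussianReal] at h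
  rw [integral_div, h]
  simp

lemma integrable_pamLogRatio {Δ : ℝ} {k : ℕ} (hk : k < M) :
    Integrable (pamLogRatio M Δ k) (gaussianReal (k * Δ) 1) :=
  ((integrable_const _).sub (integrable_sub_sq_gaussianReal_one _)).sub
    ((integrable_gaussianReal_one_iff _).2 (integrable_bump_mul_log_pamMoment hk))

lemma integral_pamLogRatio {Δ : ℝ} {k : ℕ} (hk : k < M) :
    ∫ y, pamLogRatio M Δ k y ∂(gaussianReal (k * Δ) 1) = Real.log M - 1 / 2 -
      (∫ y, bump (k * Δ) y * Real.log (pamMoment M 0 Δ y)) / √(2 * Real.pi) := by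
  have h1 := integrable_sub_sq_gaussianReal_one (k * Δ)
  have h2 := (integrable_gaussianReal_one_iff _).2 (integrable_bump_mul_log_pamMoment (Δ := Δ) hk)
  unfold pamLogRatio
  have h3 : Integrable (fun y => Real.log M - (y - k * Δ) ^ 2 / 2) (gaussianReal (k * Δ) 1) :=
    (integrable_const _).sub h1
  rw [integral_sub h3 h2, integral_sub (integrable_const _) h1,
    integral_sub_sq_gaussianReal_one,
    integral_gaussianReal_one _ fun y => Real.log (pamMoment M 0 Δ y)]
  simp

/-- Summed over the levels the bumps make up P, so the logarithmic terms combine into ∫ P log P. The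
noise energy contributes 1/2 per level. -/
lemma sum_integral_pamLogRatio (hM : 1 ≤ M) (Δ : ℝ) :
    ∑ k ∈ Finset.range M, ∫ y, pamLogRatio M Δ k y ∂(gaussianReal (k * Δ) 1) =
      M * pamInformation M Δ := by
  have hM' : (M : ℝ) ≠ 0 := by positivity
  rw [Finset.sum_congr rfl fun k hk => integral_pamLogRatio (Finset.mem_range.1 hk),
    Finset.sum_sub_distrib, ← Finset.sum_div, ← integral_finsetSum _ fun k hk =>
      integrable_bump_mul_log_pamMoment (Finset.mem_range.1 hk)]
  simp only [← Finset.sum_mul, ← pamMoment_zero_eq]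
  rw [pamInformation, pamLogIntegral]
  simp
  field_simp

/-- Law of the rescaled quadrature output when level `k` is sent. -/
lemma gaussianReal_half_map (c : ℝ) :
    (gaussianReal 0 (1 / 2)).map (fun t => c + √2 * t) = gaussianReal c 1 := by
  have h := gaussianReal_map_const_mul (μ := 0) (v := 1 / 2) (√2)
  have h' := gaussianReal_map_const_add (μ := 0) (v := 1) c
  have e : NNReal.mk (√2 ^ 2) (sq_nonneg _) * (1 / 2) = 1 := by
    ext
    change √2 ^ 2 * (1 / 2 : ℝ) = 1
    norm_num
  rw [e, mul_zero] at h
  rw [zero_add, ← h, Measure.map_map (by fun_prop) (by fun_prop)] at h'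
  exact h'

end PamLikelihood

/-! ### Splitting square QAM into two PAM constellations. -/

section QAM
variable {M : ℕ} {γ : ℝ}

lemma qamMinDist_pos (hM : 2 ≤ M) : 0 < qamMinDist M := by
  have : (2 : ℝ) ≤ M := by exact_mod_cast hM
  exact Real.sqrt_pos.2 (div_pos (by norm_num) (by nlinarith))

lemma pamLevel_sub (M a k : ℕ) : pamLevel M a - pamLevel M k = qamMinDist M * (a - k) := by
  unfold pamLevel; ring

lemma pamLevel_injective (hM : 2 ≤ M) : Function.Injective (pamLevel M) := fun a k h => by
  have h1 := pamLevel_sub M a k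
  rw [h, sub_self, eq_comm, mul_eq_zero] at h1
  have h2 := h1.resolve_left (qamMinDist_pos hM).ne'
  exact_mod_cast sub_eq_zero.1 h2

lemma sum_squareQAM (hM : 2 ≤ M) (f : ℂ → ℝ) : ∑ x ∈ squareQAM M, f x =
    ∑ a ∈ Finset.range M, ∑ b ∈ Finset.range M, f ⟨pamLevel M a, pamLevel M b⟩ := by
  rw [squareQAM, Finset.sum_image, Finset.sum_product]
  rintro ⟨a, b⟩ - ⟨c, d⟩ - h
  have := Complex.ext_iff.1 h
  exact Prod.ext (pamLevel_injective hM this.1) (pamLevel_injective hM this.2)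

lemma card_squareQAM (hM : 2 ≤ M) : (squareQAM M).card = M ^ 2 := by
  have := sum_squareQAM hM fun _ => 1
  simp only [Finset.sum_const, Finset.card_range, nsmul_eq_mul, mul_one] at this
  rw [sq]; exact_mod_cast this

/-- Spacing of the quadrature PAM grids at SNR `γ`, in units of the noise standard deviation. -/
noncomputable def qamSpacing (M : ℕ) (γ : ℝ) : ℝ := √2 * √γ * qamMinDist M

lemma complexGaussianDensity_qam (γ : ℝ) (a b k l : ℕ) (t s : ℝ) :
    complexGaussianDensity ((√γ : ℂ) * ⟨pamLevel M a, pamLevel M b⟩ + ⟨t, s⟩ -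
      (√γ : ℂ) * ⟨pamLevel M k, pamLevel M l⟩) =
    Real.pi⁻¹ * (bump (k * qamSpacing M γ) (a * qamSpacing M γ + √2 * t) *
      bump (l * qamSpacing M γ) (b * qamSpacing M γ + √2 * s)) := by
  have h2 : √2 ^ 2 = (2 : ℝ) := Real.sq_sqrt (by norm_num)
  rw [complexGaussianDensity, bump, bump, ← Real.exp_add]
  congr 2
  simp only [Complex.sub_re, Complex.add_re, Complex.sub_im, Complex.add_im,
    Complex.re_ofReal_mul, Complex.im_ofReal_mul, qamSpacing, pamLevel]
  ring_nf
  rw [h2]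
  ring

/-- Both the noise density and the uniform grid are products over the two coordinates, so the output
density factorises and the logarithm is a sum. The factor √2 rescales noise of variance 1/2 to
variance 1. -/
lemma log_density_ratio_qam (hM : 2 ≤ M) (γ : ℝ) {a b : ℕ} (t s : ℝ) :
    Real.log (complexGaussianDensity ⟨t, s⟩ / channelOutputDensity (squareQAM M) γ
      ((√γ : ℂ) * ⟨pamLevel M a, pamLevel M b⟩ + ⟨t, s⟩)) =
    pamLogRatio M (qamSpacing M γ) a (a * qamSpacing M γ + √2 * t) +
      pamLogRatio M (qamSpacing M γ) b (b * qamSpacing M γ + √2 * s) := by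
  set Δ := qamSpacing M γ with hΔ
  have hM1 : 1 ≤ M := by omega
  have hM0 : (M : ℝ) ≠ 0 := by positivity
  have h0 := complexGaussianDensity_qam (M := M) γ a b a b t s
  rw [add_sub_cancel_left, ← hΔ] at h0
  have hq : channelOutputDensity (squareQAM M) γ
      ((√γ : ℂ) * ⟨pamLevel M a, pamLevel M b⟩ + ⟨t, s⟩) =
      Real.pi⁻¹ * (pamMoment M 0 Δ (a * Δ + √2 * t) * pamMoment M 0 Δ (b * Δ + √2 * s)) /
        (M : ℝ) ^ 2 := by
    rw [channelOutputDensity, sum_squareQAM hM, card_squareQAM hM]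
    simp only [complexGaussianDensity_qam, ← hΔ]
    rw [pamMoment_zero_eq, pamMoment_zero_eq, Finset.sum_mul_sum]
    simp only [Finset.mul_sum]
    push_cast
    rfl
  have p1 := pamMoment_zero_pos hM1 Δ (a * Δ + √2 * t)
  have p2 := pamMoment_zero_pos hM1 Δ (b * Δ + √2 * s)
  have b1 := bump_pos (a * Δ) (a * Δ + √2 * t)
  have b2 := bump_pos (b * Δ) (b * Δ + √2 * s)
  have hr : complexGaussianDensity ⟨t, s⟩ / channelOutputDensity (squareQAM M) γ
      ((√γ : ℂ) * ⟨pamLevel M a, pamLevel M b⟩ + ⟨t, s⟩) =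
      (M * bump (a * Δ) (a * Δ + √2 * t) / pamMoment M 0 Δ (a * Δ + √2 * t)) *
      (M * bump (b * Δ) (b * Δ + √2 * s) / pamMoment M 0 Δ (b * Δ + √2 * s)) := by
    rw [hq, h0]
    have := Real.pi_pos.ne'
    field_simp
  have hl : ∀ x y : ℝ, Real.log (bump x y) = -((y - x) ^ 2 / 2) := fun x y => by
    rw [bump, Real.log_exp]; ring
  rw [hr, Real.log_mul (by positivity) (by positivity), Real.log_div (by positivity) p1.ne',
    Real.log_div (by positivity) p2.ne', Real.log_mul hM0 b1.ne', Real.log_mul hM0 b2.ne', hl, hl]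
  unfold pamLogRatio
  ring

lemma measurable_complex_mk : Measurable fun p : ℝ × ℝ => (⟨p.1, p.2⟩ : ℂ) :=
  Complex.measurableEquivRealProd.symm.measurable

lemma integrable_half_pamLogRatio {k : ℕ} (hk : k < M) (Δ : ℝ) :
    Integrable (fun t => pamLogRatio M Δ k (k * Δ + √2 * t)) (gaussianReal 0 (1 / 2)) := by
  have h := integrable_pamLogRatio (Δ := Δ) hk
  rw [← gaussianReal_half_map] at h
  exact h.comp_measurable (by fun_prop)

lemma integral_half_pamLogRatio {k : ℕ} (hk : k < M) (Δ : ℝ) :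
    ∫ t, pamLogRatio M Δ k (k * Δ + √2 * t) ∂(gaussianReal 0 (1 / 2)) =
      ∫ y, pamLogRatio M Δ k y ∂(gaussianReal (k * Δ) 1) := by
  rw [← gaussianReal_half_map, integral_map (by fun_prop)
    (continuous_pamLogRatio (by omega) Δ k).aestronglyMeasurable]

/-- Square QAM is two PAM constellations in quadrature. -/
theorem scalarInformation_squareQAM (hM : 2 ≤ M) (γ : ℝ) :
    scalarInformation (squareQAM M) γ = 2 * pamInformation M (qamSpacing M γ) := by
  set Δ := qamSpacing M γ with hΔ
  have hS : (squareQAM M).Nonempty := Finset.card_pos.1 (by rw [card_squareQAM hM]; positivity)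
  have hmeas : ∀ x : ℂ, Measurable fun n => Real.log (complexGaussianDensity n /
      channelOutputDensity (squareQAM M) γ ((√γ : ℂ) * x + n)) := fun x => by fun_prop
  have hfst : ∀ a < M, Integrable (fun p : ℝ × ℝ => pamLogRatio M Δ a (a * Δ + √2 * p.1))
      ((gaussianReal 0 (1 / 2)).prod (gaussianReal 0 (1 / 2))) := fun a ha =>
    (integrable_half_pamLogRatio ha Δ).comp_fst _
  have hsnd : ∀ b < M, Integrable (fun p : ℝ × ℝ => pamLogRatio M Δ b (b * Δ + √2 * p.2))
      ((gaussianReal 0 (1 / 2)).prod (gaussianReal 0 (1 / 2))) := fun b hb =>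
    (integrable_half_pamLogRatio hb Δ).comp_snd _
  have hint : ∀ a < M, ∀ b < M, ∫ n, Real.log (complexGaussianDensity n /
      channelOutputDensity (squareQAM M) γ ((√γ : ℂ) * ⟨pamLevel M a, pamLevel M b⟩ + n))
      ∂stdComplexGaussian =
      (∫ y, pamLogRatio M Δ a y ∂(gaussianReal (a * Δ) 1)) +
        ∫ y, pamLogRatio M Δ b y ∂(gaussianReal (b * Δ) 1) := fun a ha b hb => by
    rw [stdComplexGaussian, integral_map measurable_complex_mk.aemeasurable
      (hmeas _).aestronglyMeasurable]
    simp only [log_density_ratio_qam hM, ← hΔ]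
    rw [integral_add (hfst a ha) (hsnd b hb),
      integral_fun_fst (fun t => pamLogRatio M Δ a (a * Δ + √2 * t)),
      integral_fun_snd (fun t => pamLogRatio M Δ b (b * Δ + √2 * t)),
      integral_half_pamLogRatio ha, integral_half_pamLogRatio hb]
    simp
  rw [scalarInformation, mutualInformation_gaussianChannelLaw hS, sum_squareQAM hM,
    card_squareQAM hM, Finset.sum_congr rfl fun a ha => Finset.sum_congr rfl fun b hb =>
      hint a (Finset.mem_range.1 ha) b (Finset.mem_range.1 hb)]
  · simp only [Finset.sum_add_distrib, Finset.sum_const, Finset.card_range, nsmul_eq_mul,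
      ← Finset.mul_sum, sum_integral_pamLogRatio (show 1 ≤ M by omega)]
    have : (M : ℝ) ≠ 0 := by positivity
    push_cast
    field_simp
    ring
  · intro x hx
    obtain ⟨⟨a, b⟩, hab, rfl⟩ := Finset.mem_image.1 hx
    rw [Finset.mem_product, Finset.mem_range, Finset.mem_range] at hab
    rw [stdComplexGaussian, integrable_map_measure (hmeas _).aestronglyMeasurable
      measurable_complex_mk.aemeasurable]
    refine ((hfst a hab.1).add (hsnd b hab.2)).congr (Eventually.of_forall fun p => ?_)
    exact (log_density_ratio_qam hM γ p.1 p.2).symm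

end QAM

/-! ### A lower bound for the Gaussian tail at 2.017/2. -/

section GaussianTail

lemma exp_neg_le_quartic {x : ℝ} (h0 : 0 ≤ x) (h1 : x ≤ 1) :
    Real.exp (-x) ≤ 1 - x + x ^ 2 / 2 - x ^ 3 / 6 + x ^ 4 / 24 := by
  have h := (exp_neg_bounds h0 h1).2
  have : x ^ 6 / 600 ≤ x ^ 5 / 120 := by
    have : x ^ 6 ≤ x ^ 5 := pow_le_pow_of_le_one h0 h1 (by norm_num)
    have : 0 ≤ x ^ 5 := by positivity
    linarith
  linarith

/-- The fourth-order Taylor polynomial dominates exp(-x) on [0, 1], and with x = y²/2 it integrates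
exactly. -/
lemma integral_bump_zero_le :
    ∫ y in (-1.0085 : ℝ)..1.0085, bump 0 y ≤ 1.72302 := by
  have h : ∫ y in (-1.0085 : ℝ)..1.0085, bump 0 y ≤ ∫ y in (-1.0085 : ℝ)..1.0085,
      (1 - (1 / 2) * y ^ 2 + (1 / 8) * y ^ 4 - (1 / 48) * y ^ 6 + (1 / 384) * y ^ 8) := by
    refine intervalIntegral.integral_mono_on (by norm_num)
      ((continuous_bump 0).intervalIntegrable _ _)
      (Continuous.intervalIntegrable (by fun_prop) _ _) fun y hy => ?_
    have hy2 : y ^ 2 ≤ 1.0085 ^ 2 := sq_le_sq' hy.1 hy.2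
    have := exp_neg_le_quartic (x := y ^ 2 / 2) (by positivity) (by norm_num at hy2; linarith)
    rw [bump, show -(y - 0) ^ 2 / 2 = -(y ^ 2 / 2) by ring]
    linear_combination this
  refine h.trans ?_
  have hd : ∀ y : ℝ, HasDerivAt
      (fun y => y - y ^ 3 / 6 + y ^ 5 / 40 - y ^ 7 / 336 + y ^ 9 / 3456)
      (1 - (1 / 2) * y ^ 2 + (1 / 8) * y ^ 4 - (1 / 48) * y ^ 6 + (1 / 384) * y ^ 8) y := fun y => by
    have := (((((hasDerivAt_id y).sub ((hasDerivAt_pow 3 y).div_const 6)).add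
      ((hasDerivAt_pow 5 y).div_const 40)).sub ((hasDerivAt_pow 7 y).div_const 336)).add
      ((hasDerivAt_pow 9 y).div_const 3456))
    refine this.congr_deriv ?_
    push_cast
    ring
  rw [intervalIntegral.integral_eq_sub_of_hasDerivAt (fun y _ => hd y)
    (Continuous.intervalIntegrable (by fun_prop) _ _)]
  norm_num

lemma gaussianReal_real_Icc_le :
    (gaussianReal 0 1).real (Set.Icc (-1.0085) 1.0085) ≤ 0.6874 := by
  rw [Measure.real, gaussianReal_apply_eq_integral 0 one_ne_zero, ENNReal.toReal_ofReal
    (setIntegral_nonneg measurableSet_Icc fun y _ => gaussianPDFReal_nonneg _ _ _)]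
  simp only [gaussianPDFReal_one]
  rw [integral_const_mul, integral_Icc_eq_integral_Ioc,
    ← intervalIntegral.integral_of_le (by norm_num)]
  have h2 : (2.50658 : ℝ) ≤ √(2 * Real.pi) := by
    refine Real.le_sqrt_of_sq_le ?_
    have := Real.pi_gt_d6
    norm_num
    linarith
  have h3 := integral_bump_zero_le
  rw [inv_mul_le_iff₀ (by positivity)]
  linarith

lemma gaussianReal_real_Iio_neg (c : ℝ) :
    (gaussianReal 0 1).real (Set.Iio (-c)) = (gaussianReal 0 1).real (Set.Ioi c) := by
  have h := gaussianReal_map_neg (μ := 0) (v := 1)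
  rw [neg_zero] at h
  conv_lhs => rw [← h]
  rw [map_measureReal_apply (by fun_prop) measurableSet_Iio]
  congr 1
  ext x
  simp

/-- By symmetry each tail carries half of the mass outside [-1.0085, 1.0085], and (1 - 0.6874)/2 =
0.1563. -/
lemma le_gaussianReal_real_Ioi {c : ℝ} (hc : c ≤ 1.0085) :
    0.1563 ≤ (gaussianReal 0 1).real (Set.Ioi c) := by
  have h1 : (gaussianReal 0 1).real (Set.Ioi 1.0085) ≤ (gaussianReal 0 1).real (Set.Ioi c) :=
    measureReal_mono (Set.Ioi_subset_Ioi hc)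
  have h2 : (1 : ℝ) ≤ (gaussianReal 0 1).real (Set.Icc (-1.0085) 1.0085) +
      ((gaussianReal 0 1).real (Set.Iio (-1.0085)) + (gaussianReal 0 1).real (Set.Ioi 1.0085)) := by
    have hu : (Set.univ : Set ℝ) ⊆
        Set.Icc (-1.0085) 1.0085 ∪ (Set.Iio (-1.0085) ∪ Set.Ioi 1.0085) := fun y _ => by
      by_cases h1 : y < -1.0085
      · exact Or.inr (Or.inl h1)
      by_cases h2 : 1.0085 < y
      · exact Or.inr (Or.inr h2)
      exact Or.inl ⟨not_lt.1 h1, not_lt.1 h2⟩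
    calc (1 : ℝ) = (gaussianReal 0 1).real Set.univ := by simp
      _ ≤ _ := measureReal_mono hu
      _ ≤ _ := (measureReal_union_le _ _).trans
        (add_le_add_right (measureReal_union_le _ _) _)
  have h3 := gaussianReal_real_Icc_le
  rw [gaussianReal_real_Iio_neg] at h2
  linarith

end GaussianTail

/-! ### From the error rate to a lower bound on the spacing. -/

section SymbolError
variable {M : ℕ} {γ : ℝ}

/-- Decision interval, around `0`, of level `a` of `M`-PAM with spacing `Δ`. -/
def pamDecisionSet (M a : ℕ) (Δ : ℝ) : Set ℝ :=
  {y | (a + 1 < M → y < Δ / 2) ∧ (0 < a → -(Δ / 2) < y)}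

lemma measurableSet_pamDecisionSet (M a : ℕ) (Δ : ℝ) : MeasurableSet (pamDecisionSet M a Δ) := by
  have h1 : MeasurableSet {y : ℝ | a + 1 < M → y < Δ / 2} := by
    by_cases h : a + 1 < M
    · simp only [h, forall_const]
      exact measurableSet_Iio
    · simp [h]
  have h2 : MeasurableSet {y : ℝ | 0 < a → -(Δ / 2) < y} := by
    by_cases h : 0 < a
    · simp only [h, forall_const]
      exact measurableSet_Ioi
    · simp [h]
  exact h1.inter h2

lemma gaussianReal_real_pamDecisionSet_le (M a : ℕ) {Δ : ℝ} (hΔ : 0 ≤ Δ) :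
    (gaussianReal 0 1).real (pamDecisionSet M a Δ) ≤
      1 - (if a + 1 < M then (gaussianReal 0 1).real (Set.Ioi (Δ / 2)) else 0) -
        (if 0 < a then (gaussianReal 0 1).real (Set.Ioi (Δ / 2)) else 0) := by
  set G := gaussianReal 0 1
  set U : Set ℝ := if a + 1 < M then Set.Ioi (Δ / 2) else ∅ with hU
  set V : Set ℝ := if 0 < a then Set.Iio (-(Δ / 2)) else ∅ with hV
  have hVm : MeasurableSet V := by rw [hV]; split_ifs <;> measurability
  have hUe : G.real U = if a + 1 < M then G.real (Set.Ioi (Δ / 2)) else 0 := by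
    rw [hU]; split_ifs <;> simp
  have hVe : G.real V = if 0 < a then G.real (Set.Ioi (Δ / 2)) else 0 := by
    rw [hV]; split_ifs
    · exact gaussianReal_real_Iio_neg _
    · simp
  have hd : Disjoint U V := by
    rw [Set.disjoint_left]
    intro y hy hy'
    rw [hU] at hy
    rw [hV] at hy'
    split_ifs at hy hy'
    · simp only [Set.mem_Ioi, Set.mem_Iio] at hy hy'; linarith
    all_goals simp_all
  have hsub : U ∪ V ⊆ (pamDecisionSet M a Δ)ᶜ := by
    rintro y (hy | hy) ⟨h1, h2⟩
    · rw [hU] at hy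
      split_ifs at hy with h
      · exact lt_asymm (h1 h) hy
      · exact hy
    · rw [hV] at hy
      split_ifs at hy with h
      · exact lt_asymm (h2 h) hy
      · exact hy
  have h1 := measureReal_mono (μ := G) hsub
  rw [measureReal_union hd hVm, hUe, hVe,
    probReal_compl_eq_one_sub (measurableSet_pamDecisionSet M a Δ)] at h1
  linarith

/-- Interior levels lose two tails and end levels only one, so 2(M - 1) tails are lost in all. -/
lemma sum_gaussianReal_real_pamDecisionSet_le (hM : 1 ≤ M) {Δ : ℝ} (hΔ : 0 ≤ Δ) :
    ∑ a ∈ Finset.range M, (gaussianReal 0 1).real (pamDecisionSet M a Δ) ≤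
      M - 2 * (M - 1) * (gaussianReal 0 1).real (Set.Ioi (Δ / 2)) := by
  refine (Finset.sum_le_sum fun a _ => gaussianReal_real_pamDecisionSet_le M a hΔ).trans_eq ?_
  set Q := (gaussianReal 0 1).real (Set.Ioi (Δ / 2))
  obtain ⟨m, rfl⟩ : ∃ m, M = m + 1 := ⟨M - 1, by omega⟩
  have h1 : ∑ a ∈ Finset.range (m + 1), (if a + 1 < m + 1 then Q else 0) = m * Q := by
    rw [Finset.sum_range_succ, if_neg (lt_irrefl _), add_zero,
      Finset.sum_congr rfl fun a ha => if_pos (by have := Finset.mem_range.1 ha; omega)]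
    simp
  have h2 : ∑ a ∈ Finset.range (m + 1), (if 0 < a then Q else 0) = m * Q := by
    rw [Finset.sum_range_succ']
    simp
  rw [Finset.sum_sub_distrib, Finset.sum_sub_distrib, h1, h2]
  simp
  ring

lemma stdComplexGaussian_real_rectangle {A B : Set ℝ} (hA : MeasurableSet A)
    (hB : MeasurableSet B) :
    stdComplexGaussian.real {n | √2 * n.re ∈ A ∧ √2 * n.im ∈ B} =
      (gaussianReal 0 1).real A * (gaussianReal 0 1).real B := by
  have hm : Measurable fun t : ℝ => 0 + √2 * t := by fun_prop
  have hset : MeasurableSet {n : ℂ | √2 * n.re ∈ A ∧ √2 * n.im ∈ B} :=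
    (hA.preimage (by fun_prop : Measurable fun n : ℂ => √2 * n.re)).inter
      (hB.preimage (by fun_prop : Measurable fun n : ℂ => √2 * n.im))
  rw [stdComplexGaussian, map_measureReal_apply measurable_complex_mk hset,
    ← gaussianReal_half_map 0, map_measureReal_apply hm hA, map_measureReal_apply hm hB,
    ← measureReal_prod_prod]
  congr 1
  ext p
  simp

/-- If detection succeeds, the output is closer to x than to each of its horizontal and vertical
neighbours. This confines both noise coordinates to their decision intervals, and the coordinates
are independent. -/
lemma one_sub_le_symbolError (hM : 2 ≤ M) {a b : ℕ} (ha : a < M) (hb : b < M) :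
    1 - (gaussianReal 0 1).real (pamDecisionSet M a (qamSpacing M γ)) *
        (gaussianReal 0 1).real (pamDecisionSet M b (qamSpacing M γ)) ≤
      stdComplexGaussian.real {n : ℂ | ∃ x' ∈ squareQAM M, x' ≠ ⟨pamLevel M a, pamLevel M b⟩ ∧
        ‖((√γ : ℂ) * ⟨pamLevel M a, pamLevel M b⟩ + n) - (√γ : ℂ) * x'‖ ≤
          ‖((√γ : ℂ) * ⟨pamLevel M a, pamLevel M b⟩ + n) -
            (√γ : ℂ) * ⟨pamLevel M a, pamLevel M b⟩‖} := by
  set E := {n : ℂ | ∃ x' ∈ squareQAM M, x' ≠ ⟨pamLevel M a, pamLevel M b⟩ ∧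
        ‖((√γ : ℂ) * ⟨pamLevel M a, pamLevel M b⟩ + n) - (√γ : ℂ) * x'‖ ≤
          ‖((√γ : ℂ) * ⟨pamLevel M a, pamLevel M b⟩ + n) -
            (√γ : ℂ) * ⟨pamLevel M a, pamLevel M b⟩‖} with hE
  have hd := qamMinDist_pos hM
  have hs2 : √2 ^ 2 = (2 : ℝ) := Real.sq_sqrt (by norm_num)
  have hs20 : 0 < √(2 : ℝ) := by positivity
  have hγ := Real.sqrt_nonneg γ
  have key : ∀ n ∉ E, ∀ k < M, ∀ l < M, (k ≠ a ∨ l ≠ b) →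
      n.re ^ 2 + n.im ^ 2 < (√γ * (qamMinDist M * (a - k)) + n.re) ^ 2 +
        (√γ * (qamMinDist M * (b - l)) + n.im) ^ 2 := by
    intro n hn k hk l hl hne
    by_contra hcon
    refine hn ⟨⟨pamLevel M k, pamLevel M l⟩, ?_, ?_, ?_⟩
    · exact Finset.mem_image.2 ⟨(k, l), by simp [hk, hl], rfl⟩
    · intro h
      have h' := Complex.ext_iff.1 h
      rcases hne with hne | hne
      · exact hne (pamLevel_injective hM h'.1)
      · exact hne (pamLevel_injective hM h'.2)
    · rw [add_sub_cancel_left, ← sq_le_sq₀ (norm_nonneg _) (norm_nonneg _),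
        ← Complex.normSq_eq_norm_sq, ← Complex.normSq_eq_norm_sq, Complex.normSq_apply,
        Complex.normSq_apply]
      simp only [Complex.sub_re, Complex.add_re, Complex.sub_im, Complex.add_im,
        Complex.re_ofReal_mul, Complex.im_ofReal_mul]
      rw [← pamLevel_sub, ← pamLevel_sub] at hcon
      linarith
  have hΔ : qamSpacing M γ / 2 = √2 * (√γ * qamMinDist M / 2) := by unfold qamSpacing; ring
  have upper : ∀ {D t : ℝ}, 0 ≤ D → t ^ 2 < (-D + t) ^ 2 → t < D / 2 := by
    intro D t hD h
    by_contra hc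
    nlinarith
  have lower : ∀ {D t : ℝ}, 0 ≤ D → t ^ 2 < (D + t) ^ 2 → -(D / 2) < t := by
    intro D t hD h
    by_contra hc
    nlinarith
  have hD : 0 ≤ √γ * qamMinDist M := by positivity
  have hsub : Eᶜ ⊆ {n | √2 * n.re ∈ pamDecisionSet M a (qamSpacing M γ) ∧
      √2 * n.im ∈ pamDecisionSet M b (qamSpacing M γ)} := by
    intro n hn
    refine ⟨⟨fun h => ?_, fun h => ?_⟩, ⟨fun h => ?_, fun h => ?_⟩⟩
    · have := key n hn (a + 1) h b hb (Or.inl (by omega))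
      rw [hΔ]
      refine mul_lt_mul_of_pos_left (upper hD ?_) hs20
      push_cast at this
      ring_nf at this ⊢
      linarith
    · obtain ⟨k, rfl⟩ : ∃ k, a = k + 1 := ⟨a - 1, by omega⟩
      have := key n hn k (by omega) b hb (Or.inl (by omega))
      rw [hΔ, ← mul_neg]
      refine mul_lt_mul_of_pos_left (lower hD ?_) hs20
      push_cast at this
      ring_nf at this ⊢
      linarith
    · have := key n hn a ha (b + 1) h (Or.inr (by omega))
      rw [hΔ]
      refine mul_lt_mul_of_pos_left (upper hD ?_) hs20
      push_cast at this
      ring_nf at this ⊢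
      linarith
    · obtain ⟨k, rfl⟩ : ∃ k, b = k + 1 := ⟨b - 1, by omega⟩
      have := key n hn a ha k (by omega) (Or.inr (by omega))
      rw [hΔ, ← mul_neg]
      refine mul_lt_mul_of_pos_left (lower hD ?_) hs20
      push_cast at this
      ring_nf at this ⊢
      linarith
  have h1 := measureReal_mono (μ := stdComplexGaussian) hsub
  rw [stdComplexGaussian_real_rectangle (measurableSet_pamDecisionSet _ _ _)
    (measurableSet_pamDecisionSet _ _ _)] at h1
  have h2 : (1 : ℝ) ≤ stdComplexGaussian.real E + stdComplexGaussian.real Eᶜ := by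
    have := measureReal_union_le (μ := stdComplexGaussian) E Eᶜ
    rwa [Set.union_compl_self, probReal_univ] at this
  linarith

/-- The symbol error rate is below one half only if the constellation is spread enough. -/
theorem le_qamSpacing_of_symbolErrorRate_lt (hM : 16 ≤ M)
    (h : symbolErrorRate (squareQAM M) γ < 1 / 2) : 2.017 ≤ qamSpacing M γ := by
  by_contra! hlt
  have hM2 : 2 ≤ M := by omega
  have hMr : (16 : ℝ) ≤ M := by exact_mod_cast hM
  have hΔ : 0 ≤ qamSpacing M γ := by
    have := qamMinDist_pos hM2
    unfold qamSpacing
    positivity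
  set g : ℕ → ℝ := fun a => (gaussianReal 0 1).real (pamDecisionSet M a (qamSpacing M γ)) with hg
  have hsum := sum_gaussianReal_real_pamDecisionSet_le (M := M) (by omega) hΔ
  have hQ := le_gaussianReal_real_Ioi (c := qamSpacing M γ / 2) (by linarith)
  -- For M ≥ 16 the mean success probability per quadrature is at most 1 - 2(15/16)(0.1563) < 0.707,
  -- and 0.707² < 1/2. So a spacing below 2.017 gives an error rate above 1/2.
  have hsum' : ∑ a ∈ Finset.range M, g a ≤ 0.707 * M := by
    refine hsum.trans ?_
    nlinarith
  have hsum0 : 0 ≤ ∑ a ∈ Finset.range M, g a := Finset.sum_nonneg fun a _ => measureReal_nonneg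
  have hle : (M : ℝ) ^ 2 - (∑ a ∈ Finset.range M, g a) ^ 2 ≤
      symbolErrorRate (squareQAM M) γ * (M : ℝ) ^ 2 := by
    have hM0 : (M : ℝ) ^ 2 ≠ 0 := by positivity
    rw [symbolErrorRate, card_squareQAM hM2, sum_squareQAM hM2]
    push_cast
    rw [div_mul_cancel₀ _ hM0]
    refine le_trans (le_of_eq ?_) (Finset.sum_le_sum fun a ha => Finset.sum_le_sum fun b hb =>
      one_sub_le_symbolError hM2 (Finset.mem_range.1 ha) (Finset.mem_range.1 hb))
    rw [sq (∑ a ∈ Finset.range M, g a), Finset.sum_mul_sum]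
    simp [hg, Finset.sum_sub_distrib, sq]
  have h3 : (∑ a ∈ Finset.range M, g a) ^ 2 ≤ (0.707 * M) ^ 2 := pow_le_pow_left₀ hsum0 hsum' 2
  nlinarith

end SymbolError

/-! ### Limits of block averages and passage from grids to all frequencies. -/

section RiemannSum

lemma tendsto_riemannSum {f : ℝ → ℝ} (hf : Continuous f) {T : ℝ} (hT : 0 < T) :
    Tendsto (fun N : ℕ => 1 / (N : ℝ) * ∑ k ∈ Finset.range N, f (T * k / N)) atTop
      (𝓝 (1 / T * ∫ x in (0 : ℝ)..T, f x)) := by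
  rw [Metric.tendsto_atTop]
  intro ε hε
  have huc := (isCompact_Icc (a := (0 : ℝ)) (b := T)).uniformContinuousOn_of_continuous
    hf.continuousOn
  obtain ⟨δ, hδ, huc⟩ := Metric.uniformContinuousOn_iff.1 huc (ε / 2) (by positivity)
  obtain ⟨N0, hN0⟩ := exists_nat_gt (T / δ)
  refine ⟨N0 + 1, fun N hN => ?_⟩
  have hNpos : (0 : ℝ) < N := by
    have : 0 < N := by omega
    exact_mod_cast this
  have hmesh : T / N < δ := by
    have h1 : (N0 : ℝ) ≤ N := by exact_mod_cast (by omega : N0 ≤ N)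
    rw [div_lt_iff₀ hδ] at hN0
    rw [div_lt_iff₀ hNpos]
    nlinarith
  set p : ℕ → ℝ := fun k => T * k / N with hp
  have hstep : ∀ k, p (k + 1) - p k = T / N := fun k => by
    simp only [hp]; push_cast; field_simp; ring
  have hpmono : ∀ k, p k ≤ p (k + 1) := fun k => by
    have := hstep k
    have : 0 < T / N := by positivity
    linarith
  have hp0 : ∀ k, 0 ≤ p k := fun k => by positivity
  have hpT : ∀ k ≤ N, p k ≤ T := fun k hk => by
    simp only [hp]
    rw [div_le_iff₀ hNpos]
    have : (k : ℝ) ≤ N := by exact_mod_cast hk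
    gcongr
  have hsum : ∑ k ∈ Finset.range N, ∫ x in p k..p (k + 1), f x = ∫ x in (0 : ℝ)..T, f x := by
    rw [intervalIntegral.sum_integral_adjacent_intervals fun k _ => hf.intervalIntegrable _ _]
    congr 1
    · simp [hp]
    · simp only [hp]; field_simp
  have hcell : ∀ k ∈ Finset.range N,
      |(∫ x in p k..p (k + 1), f x) - T / N * f (p k)| ≤ ε / 2 * (T / N) := fun k hk => by
    have hk' : k + 1 ≤ N := Finset.mem_range.1 hk
    have h1 : (∫ x in p k..p (k + 1), f x) - T / N * f (p k) =
        ∫ x in p k..p (k + 1), (f x - f (p k)) := by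
      rw [intervalIntegral.integral_sub (hf.intervalIntegrable _ _)
        intervalIntegrable_const, intervalIntegral.integral_const, hstep, smul_eq_mul]
    rw [h1, ← Real.norm_eq_abs]
    refine (intervalIntegral.norm_integral_le_of_norm_le_const fun x hx => ?_).trans_eq
      (by rw [hstep, abs_of_pos (by positivity : 0 < T / (N : ℝ))])
    rw [Set.uIoc_of_le (hpmono k)] at hx
    have hd := huc x ⟨(hp0 k).trans hx.1.le, hx.2.trans (hpT _ hk')⟩ (p k)
      ⟨hp0 k, hpT k (by omega)⟩ (by
        rw [Real.dist_eq, abs_of_pos (by linarith [hx.1])]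
        linarith [hx.2, hstep k])
    exact hd.le
  have htot : |(∫ x in (0 : ℝ)..T, f x) - T / N * ∑ k ∈ Finset.range N, f (p k)| ≤
      ε / 2 * T := by
    rw [← hsum, Finset.mul_sum, ← Finset.sum_sub_distrib]
    refine (Finset.abs_sum_le_sum_abs _ _).trans ((Finset.sum_le_sum hcell).trans_eq ?_)
    rw [Finset.sum_const, Finset.card_range, nsmul_eq_mul]
    field_simp
  rw [dist_comm, Real.dist_eq]
  have he : 1 / T * (∫ x in (0 : ℝ)..T, f x) - 1 / (N : ℝ) * ∑ k ∈ Finset.range N, f (p k) =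
      1 / T * ((∫ x in (0 : ℝ)..T, f x) - T / N * ∑ k ∈ Finset.range N, f (p k)) := by
    field_simp
  calc _ = 1 / T * |(∫ x in (0 : ℝ)..T, f x) - T / N * ∑ k ∈ Finset.range N, f (p k)| := by
        rw [← abs_of_pos (by positivity : 0 < 1 / T), ← abs_mul, abs_of_pos (by positivity :
          0 < 1 / T), ← he]
    _ ≤ 1 / T * (ε / 2 * T) := by gcongr
    _ = ε / 2 := by field_simp
    _ < ε := by linarith

/-- The average is the Riemann sum on [0, 2π] times N/(N + Ncp), which tends to 1. Periodicity moves
the interval to [-π, π]. -/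
lemma tendsto_blockAverage {f : ℝ → ℝ} (hf : Continuous f)
    (hper : Function.Periodic f (2 * Real.pi)) {Ncp : ℕ → ℕ}
    (hNcp : (fun N : ℕ => (Ncp N : ℝ)) =o[atTop] (fun N : ℕ => (N : ℝ))) :
    Tendsto (fun N : ℕ => 1 / ((N : ℝ) + Ncp N) *
      ∑ k ∈ Finset.range N, f (2 * Real.pi * k / N)) atTop
      (𝓝 (1 / (2 * Real.pi) * ∫ θ in (-Real.pi)..Real.pi, f θ)) := by
  have hI : ∫ θ in (-Real.pi)..Real.pi, f θ = ∫ θ in (0 : ℝ)..(2 * Real.pi), f θ := by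
    have := hper.intervalIntegral_add_eq (-Real.pi) 0
    rwa [zero_add, show -Real.pi + 2 * Real.pi = Real.pi by ring] at this
  have h1 := tendsto_riemannSum hf Real.two_pi_pos
  have h2 : Tendsto (fun N : ℕ => (1 + (Ncp N : ℝ) / N)⁻¹) atTop (𝓝 1) := by
    have := (hNcp.tendsto_div_nhds_zero.const_add 1).inv₀ (by norm_num)
    simpa using this
  rw [hI]
  have h3 := h2.mul h1
  rw [one_mul] at h3
  refine h3.congr' ?_
  filter_upwards [eventually_gt_atTop 0] with N hN
  have hN' : (0 : ℝ) < N := by exact_mod_cast hN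
  rw [← mul_assoc]
  congr 1
  have : (0 : ℝ) < N + Ncp N := by positivity
  field_simp

/-- A closed lower bound on arbitrarily fine grids holds everywhere. -/
lemma le_of_frequently_le_grid {f : ℝ → ℝ} (hf : Continuous f)
    (hper : Function.Periodic f (2 * Real.pi)) {c : ℝ}
    (h : ∃ᶠ N : ℕ in atTop, ∀ k < N, c ≤ f (2 * Real.pi * k / N)) (θ : ℝ) : c ≤ f θ := by
  obtain ⟨x, hx, hfx⟩ := hper.exists_mem_Ico₀ Real.two_pi_pos θ
  rw [hfx]
  have hpi := Real.two_pi_pos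
  have hx0 : 0 ≤ x / (2 * Real.pi) := div_nonneg hx.1 hpi.le
  -- Rounding down to the grid of size N approximates x from below, and x < 2π keeps the grid index
  -- below N.
  have hlim : Tendsto (fun N : ℕ => 2 * Real.pi * ⌊x / (2 * Real.pi) * N⌋₊ / N) atTop (𝓝 x) := by
    have := ((tendsto_nat_floor_mul_div_atTop hx0).comp
      (tendsto_natCast_atTop_atTop (R := ℝ))).const_mul (2 * Real.pi)
    rw [mul_div_cancel₀ x hpi.ne'] at this
    refine this.congr fun N => ?_
    simp only [Function.comp]
    ring
  refine ge_of_tendsto_of_frequently ((hf.tendsto x).comp hlim)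
    ((h.and_eventually (eventually_gt_atTop 0)).mono fun N hN => ?_)
  refine hN.1 _ ?_
  have hN' : (0 : ℝ) < N := by exact_mod_cast hN.2
  rw [Nat.floor_lt (by positivity)]
  have : x / (2 * Real.pi) < 1 := (div_lt_one hpi).2 hx.2
  nlinarith

end RiemannSum

/-! ### Jensen's inequality over the frequencies. -/

section Channel
variable {L : ℕ} (h : Fin L → ℂ)

lemma continuous_transferFunction : Continuous (transferFunction h) := by
  unfold transferFunction; fun_prop

lemma periodic_transferFunction : Function.Periodic (transferFunction h) (2 * Real.pi) := by
  intro θ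
  unfold transferFunction
  refine Finset.sum_congr rfl fun k _ => ?_
  congr 1
  refine Complex.exp_eq_exp_iff_exists_int.2 ⟨-(k : ℕ), ?_⟩
  push_cast
  ring

variable {M : ℕ}

lemma continuous_qamSpacing (M : ℕ) : Continuous (qamSpacing M) := by
  unfold qamSpacing; fun_prop

lemma continuous_scalarInformation_squareQAM (hM : 2 ≤ M) :
    Continuous (scalarInformation (squareQAM M)) := by
  rw [funext (scalarInformation_squareQAM hM)]
  exact continuous_const.mul
    ((continuous_pamInformation (by omega)).comp (continuous_qamSpacing M))

lemma qamSpacing_exp_sub_one (hM : 2 ≤ M) (t : ℝ) :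
    qamSpacing M (Real.exp t - 1) = logSpacing (12 / ((M : ℝ) ^ 2 - 1)) t := by
  have : (2 : ℝ) ≤ M := by exact_mod_cast hM
  have h6 : 0 ≤ 6 / ((M : ℝ) ^ 2 - 1) := div_nonneg (by norm_num) (by nlinarith)
  rw [qamSpacing, logSpacing, qamMinDist, ← Real.sqrt_mul (by norm_num), ← Real.sqrt_mul' _ h6]
  congr 1
  ring

lemma continuous_logSpacing (a : ℝ) : Continuous (logSpacing a) := by
  unfold logSpacing; fun_prop

/-- Jensen's inequality for the QAM information in the log-SNR variable. -/
lemma ofdmRate_le_shamaiLaroiaRate (hM : 16 ≤ M)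
    (hlow : ∀ θ, 2.017 ≤ qamSpacing M (‖transferFunction h θ‖ ^ 2)) :
    ofdmRate (squareQAM M) h ≤ shamaiLaroiaRate (squareQAM M) h := by
  have hM2 : 2 ≤ M := by omega
  have hMr : (16 : ℝ) ≤ M := by exact_mod_cast hM
  set a : ℝ := 12 / ((M : ℝ) ^ 2 - 1) with ha
  have ha0 : 0 < a := div_pos (by norm_num) (by nlinarith)
  set u : ℝ → ℝ := fun θ => Real.log (1 + ‖transferFunction h θ‖ ^ 2) with hu
  have hpos : ∀ θ, 0 < 1 + ‖transferFunction h θ‖ ^ 2 := fun θ => by positivity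
  have huc : Continuous u :=
    (continuous_const.add ((continuous_transferFunction h).norm.pow 2)).log fun θ => (hpos θ).ne'
  have hspac : ∀ θ, qamSpacing M (‖transferFunction h θ‖ ^ 2) = logSpacing a (u θ) := fun θ => by
    rw [← qamSpacing_exp_sub_one hM2, Real.exp_log (hpos θ), add_sub_cancel_left]
  -- The log-SNR at which the spacing is exactly 2.017. Beyond it concavity is available.
  set t0 : ℝ := Real.log (1 + 2.017 ^ 2 / a) with ht0
  have ht0pos : 0 < t0 := Real.log_pos (by
    have : 0 < 2.017 ^ 2 / a := by positivity
    linarith)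
  have hlt0 : (2.017 : ℝ) ≤ logSpacing a t0 := by
    rw [logSpacing, ht0, Real.exp_log (by positivity), add_sub_cancel_left,
      mul_div_cancel₀ _ ha0.ne', Real.sqrt_sq (by norm_num)]
  have hmem : ∀ θ, u θ ∈ Set.Ici t0 := fun θ => by
    have h1 := hlow θ
    have hu0 : 0 ≤ u θ := Real.log_nonneg (by have := sq_nonneg ‖transferFunction h θ‖; linarith)
    rw [hspac] at h1
    have h2 := pow_le_pow_left₀ (by norm_num) h1 2
    rw [logSpacing_sq ha0.le hu0, hu, Real.exp_log (hpos θ)] at h2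
    refine Real.log_le_log (by positivity) ?_
    rw [add_le_add_iff_left, div_le_iff₀ ha0]
    linarith
  set g : ℝ → ℝ := fun t => pamInformation M (logSpacing a t) with hg
  have hgc : Continuous g := (continuous_pamInformation (by omega)).comp (continuous_logSpacing a)
  have hconc : ConcaveOn ℝ (Set.Ici t0) g := concaveOn_pamInformation_logSpacing hM ht0pos hlt0
  have hpi : -Real.pi ≤ Real.pi := by linarith [Real.pi_pos]
  have hvol : (volume : Measure ℝ) (Set.Ioc (-Real.pi) Real.pi) ≠ 0 := by
    rw [Real.volume_Ioc]
    simpa using Real.pi_pos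
  -- Membership of the mean in the closed half-line comes with Jensen's inequality itself, so no
  -- separate bound on the SNR of the equalizer is required.
  have hjen := hconc.le_map_set_average hgc.continuousOn isClosed_Ici hvol (by simp)
    (Eventually.of_forall hmem)
    (huc.integrableOn_Icc.mono_set Set.Ioc_subset_Icc_self)
    ((hgc.comp huc).integrableOn_Icc.mono_set Set.Ioc_subset_Icc_self)
  have hav : ∀ f : ℝ → ℝ, ⨍ θ in Set.Ioc (-Real.pi) Real.pi, f θ =
      1 / (2 * Real.pi) * ∫ θ in (-Real.pi)..Real.pi, f θ := fun f => by
    rw [← Set.uIoc_of_le hpi, interval_average_eq, smul_eq_mul, one_div]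
    congr 2
    ring
  rw [hav, hav] at hjen
  have hR : ofdmRate (squareQAM M) h =
      2 * (1 / (2 * Real.pi) * ∫ θ in (-Real.pi)..Real.pi, g (u θ)) := by
    rw [ofdmRate]
    simp only [scalarInformation_squareQAM hM2, hspac]
    rw [intervalIntegral.integral_const_mul]
    ring
  have hSL : shamaiLaroiaRate (squareQAM M) h =
      2 * g (1 / (2 * Real.pi) * ∫ θ in (-Real.pi)..Real.pi, u θ) := by
    rw [shamaiLaroiaRate, snrDFE, scalarInformation_squareQAM hM2, qamSpacing_exp_sub_one hM2]
  rw [hR, hSL]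
  linarith

end Channel

/-- If for arbitrarily large block sizes `N` the uncoded symbol error rate is below 50% on every
subcarrier, then `I_OFDM`, the limit of the block rates, is at most `I_SL`. (Equivalently: for all
sufficiently large `N`, symbol error rates below 50% on all `N` subcarriers imply
`I_OFDM ≤ I_SL`.) -/
theorem mainTheorem5 (M : ℕ) (hM : 16 ≤ M) (L : ℕ) (h : Fin L → ℂ)
    (Ncp : ℕ → ℕ) (hNcp : (fun N : ℕ => (Ncp N : ℝ)) =o[atTop] (fun N : ℕ => (N : ℝ)))
    (hSER : ∃ᶠ N : ℕ in atTop, ∀ k < N,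
      symbolErrorRate (squareQAM M) (subcarrierSNR h N k) < 1 / 2) :
    Tendsto (fun N : ℕ => ofdmBlockRate (squareQAM M) h N (Ncp N)) atTop
        (𝓝 (ofdmRate (squareQAM M) h)) ∧
      ofdmRate (squareQAM M) h ≤ shamaiLaroiaRate (squareQAM M) h := by
  have hM2 : 2 ≤ M := by omega
  have hsq : Continuous fun θ => ‖transferFunction h θ‖ ^ 2 :=
    (continuous_transferFunction h).norm.pow 2
  have hper : ∀ f : ℝ → ℝ,
      Function.Periodic (fun θ => f (‖transferFunction h θ‖ ^ 2)) (2 * Real.pi) := fun f θ => by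
    simp only [periodic_transferFunction h θ]
  refine ⟨tendsto_blockAverage ((continuous_scalarInformation_squareQAM hM2).comp hsq)
    (hper _) hNcp, ofdmRate_le_shamaiLaroiaRate h hM fun θ => ?_⟩
  -- The error rate is converted into a bound on the spacing before the limit is taken: a non-strict
  -- bound on a continuous function survives it, while a strict bound on the error rate need not.
  exact le_of_frequently_le_grid ((continuous_qamSpacing M).comp hsq) (hper _)
    (hSER.mono fun N hN k hk => le_qamSpacing_of_symbolErrorRate_lt hM (hN k hk)) θ
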